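/- **Convergence rate of DIAMOND.** *Problem.* Let $m\ge 2$ agents be connected by a graph, and let $M\in\mathbb R^{m\times m}$ be symmetric and doubly stochastic (with nonnegative entries), with $M_{ij}>0$ for $i\ne j$ exactly when $i,j$ are neighbours. Write $\lambda_1(M)\ge\dots\ge\lambda_m(M)$ for its eigenvalues and assume $\lambda:=\max\{|\lambda_2(M)|,|\lambda_m(M)|\}<1$. Agent $i$ has stochastic objectives $f_i(x,y;\xi)$, $\xi\sim\pi_f$, and $g_i(x,y;\zeta)$, $\zeta\sim\pi_g$, for $(x,y)\in\mathbb R^{d_{up}}\times\mathbb R^{d_{low}}$. Put $f_i(x,y)=\mathbb E f_i(x,y;\xi)$, $g_i(x,y)=\mathbb E g_i(x,y;\zeta)$, $y_i^*(x)=\arg\min_y g_i(x,y)$, $l(x)=\frac1m\sum_i f_i(x,y_i^*(x))$ and $l^*=\inf l>-\infty$. *Assumptions.* The functions $f_i$ and $f_i(\cdot,\cdot;\xi)$ (for almost every $\xi$) are differentiable, $\nabla_xf$ and $\nabla_yf$ are Lipschitz in $(x,y)$ with constants $L_{f_x},L_{f_y}\ge0$, and $\|\nabla_yf\|\le C_{f_y}$,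 $C_{f_y}\ge 0$. The functions $g_i$ and $g_i(\cdot,\cdot;\zeta)$ (for almost every $\zeta$) are $C^2$, $\nabla_yg$ is $L_g$-Lipschitz in $(x,y)$, $g(x,\cdot)$ is $\mu_g$-strongly convex, $\nabla^2_{xy}g$ and $\nabla^2_{yy}g$ are Lipschitz with constants $L_{g_{xy}},L_{g_{yy}}\ge 0$, and $\|\nabla^2_{xy}g\|\le C_{g_{xy}}$. Here $0<\mu_g<L_g$ and $C_{g_{xy}}>0$. Define $$\bar\nabla f_i=\nabla_xf_i-\nabla^2_{xy}g_i[\nabla^2_{yy}g_i]^{-1}\nabla_yf_i ,$$ $$\hat\nabla f_i(x,y;\bar\xi)=\nabla_xf_i(x,y;\xi)-\tfrac K{L_g}\nabla^2_{xy}g_i(x,y;\zeta^0)\prod_{j=1}^{k}\Big(I-\tfrac{\nabla^2_{yy}g_i(x,y;\zeta^j)}{L_g}\Big)\nabla_yf_i(x,y;\xi),$$ where $\bar\xi=(\xi,\zeta^0,\dots,\zeta^K,k)$ has independent entries, $\xi\sim\pi_f$, $\zeta^j\sim\pi_g$, $k$ uniform on $\{0,\dots,K-1\}$. With $b_i=\mathbb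 E\hat\nabla f_i-\bar\nabla f_i$ assume, at every $(x,y)$ and for every $i$, $\mathbb E\|\hat\nabla f_i-\bar\nabla f_i-b_i\|^2\le\sigma_f^2$ and $\mathbb E\|\nabla_yg_i(x,y;\zeta)-\nabla_yg_i(x,y)\|^2\le\sigma_g^2$. *Algorithm.* All agents start at the same deterministic point $(x_0,y_0)$. With fresh samples $(\bar\xi_{i,t},\zeta_{i,t})$, independent over $t$, and with $p_{i,-1}=v_{i,-1}=u_{i,-1}=0$, $\eta_0=\gamma_0=1$, put for $t\ge 0$ $$p_{i,t}=\hat\nabla f_i(x_{i,t},y_{i,t};\bar\xi_{i,t})+(1-\eta_t)\big(p_{i,t-1}-\hat\nabla f_i(x_{i,t-1},y_{i,t-1};\bar\xi_{i,t})\big),$$ $$v_{i,t}=\nabla_yg_i(x_{i,t},y_{i,t};\zeta_{i,t})+(1-\gamma_t)\big(v_{i,t-1}-\nabla_yg_i(x_{i,t-1},y_{i,t-1};\zeta_{i,t})\big),$$ $$u_{i,t}=\sum_jM_{ij}u_{j,t-1}+p_{i,t}-p_{i,t-1},\quad x_{i,t+1}=\sum_jM_{ij}x_{j,t}-\alpha_tu_{i,t},\quad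 y_{i,t+1}=y_{i,t}-\beta_tv_{i,t}.$$ *Constants.* $L_f=L_{f_x}+\frac{L_{f_y}C_{g_{xy}}}{\mu_g}+C_{f_y}\big(\frac{L_{g_{xy}}}{\mu_g}+\frac{L_{g_{yy}}C_{g_{xy}}}{\mu_g^2}\big)$ (assumed $>0$), $L_l=L_f+\frac{L_fC_{g_{xy}}}{\mu_g}$, $L_y=\frac{C_{g_{xy}}}{\mu_g}$, $L_{\mu_g}=\frac{\mu_gL_g}{\mu_g+L_g}$, $$L_K^2=2L_{f_x}^2+\frac{6C_{g_{xy}}^2L_{f_y}^2K}{2\mu_gL_g-\mu_g^2}+\frac{6C_{f_y}^2L_{g_{xy}}^2K}{2\mu_gL_g-\mu_g^2}+\frac{6C_{g_{xy}}^2C_{f_y}^2L_{g_{yy}}^2K^3}{(L_g-\mu_g)^2(2\mu_gL_g-\mu_g^2)} .$$ For a fixed $\theta\in(0,1)$ let $$\bar c_y=\min\Big\{\sqrt{\tfrac{L_f^2}{2L_y^2m}},\sqrt{\tfrac{L_f^2}{10L_y^2m^2}}\Big\},\quad c_\beta=\frac{8L_f^2}{mL_{\mu_g}\bar c_y},\quad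 \bar c_u=\theta\min\Big\{\frac1{48L_K^2},\frac1{3\bar c_\eta}\Big\},$$ $$\bar c_\eta=\max\Big\{32L_K^2,160L_K^2m,\tfrac{24(\mu_g+L_g)L_K^2c_\beta}{\bar c_y}\Big\},\quad \bar c_\gamma=\max\Big\{32L_g^2,160L_g^2m,\tfrac{24(\mu_g+L_g)L_g^2c_\beta}{\bar c_y}\Big\},$$ $$c_\eta=\frac{6L_f\bar c_\eta+m}{3L_fm(1-3\bar c_u\bar c_\eta)},\quad c_\gamma=\frac1{3L_f}+8L_g^2c_\beta^2+\bar c_\gamma\Big(\frac{2c_\beta\bar c_y}{L_{\mu_g}}+\frac{8L_K^2c_\beta^2}{\bar c_\eta}+12L_K^2\bar c_uc_\beta^2\Big).$$ *Parameters.* For the horizon $T\ge2$ take $K=\max\{1,\lceil\frac{L_g}{\mu_g}\log\frac{C_{g_{xy}}C_{f_y}T}{\mu_g}\rceil\}$ (and $K=1$ if $C_{f_y}=0$), $\alpha_t=(\omega+t)^{-1/3}$ with $\omega\ge2$, $\beta_t=c_\beta\alpha_t$, $\eta_{t+1}=c_\eta\alpha_t^2$, $\gamma_{t+1}=c_\gamma\alpha_t^2$.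 Call $\omega$ *admissible* if, for all $t\ge 0$, $\eta_t,\gamma_t\in[0,1]$, $\beta_t\le\frac1{\mu_g+L_g}$ and $$\alpha_t\le\min\Big\{\sqrt{\tfrac m{2L_l^2}},\tfrac{\bar c_u(1-\lambda)^2}{30},\tfrac{\bar c_u(1-\lambda)L_{\mu_g}c_\beta}{40L_y^2\bar c_y},\tfrac{\bar c_u(1-\lambda)\bar c_\eta}{80L_K^2},\tfrac{\bar c_u(1-\lambda)\bar c_\gamma}{80L_g^2},\tfrac1{5L_l},\tfrac1{3L_f},\sqrt{\tfrac{(1-\lambda)^2}{120L_K^2}},\tfrac{1-\lambda}{240\bar c_uL_K^2m},\tfrac{\bar c_y(1-\lambda)}{36(\mu_g+L_g)\bar c_uL_K^2c_\beta},1-\lambda\Big\}.$$ *Conclusion.* Put $\mathfrak M_t=\|\nabla l(\bar x_t)\|^2+\sum_i\|x_{i,t}-\bar x_t\|^2+\sum_i\|y_i^*(x_{i,t})-y_{i,t}\|^2$, where bars denote averages over the agents, and $$\mathfrak B_0=l(\bar x_0)+\bar c_y\sum_i\|y_{i,0}-y_i^*(x_{i,0})\|^2+\frac6{(1-\lambda)\alpha_0}\sum_i\|x_{i,0}-\bar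 x_0\|^2+\bar c_u\sum_i\|u_{i,0}-\bar u_0\|^2 .$$ There are constants $C>0$ and $q\in\mathbb N$ that depend only on $L_{f_x},L_{f_y},C_{f_y},L_g,\mu_g,L_{g_{xy}},L_{g_{yy}},C_{g_{xy}},m,\lambda,\theta$ such that: 1. for every $T\ge2$ there is an admissible $\omega\le C(\log T)^q$; 2. for every such problem, starting point, $T\ge2$, admissible $\omega$ and $\sigma_f,\sigma_g$, the variables $\mathfrak M_t$ ($t<T$) and $\mathfrak B_0$ are integrable and $$\frac1T\sum_{t=0}^{T-1}\mathbb E\,\mathfrak M_t\le C\Big(\omega^{1/3}\frac{\mathbb E\mathfrak B_0-l^*}{T^{2/3}}+K^3\omega^{2/3}\frac{\log T\,\sigma_f^2}{T^{2/3}}+\omega^{2/3}\frac{\log T\,\sigma_g^2}{T^{2/3}}+\frac{\omega^{1/3}}{T^{5/3}}\Big);$$ 3. consequently the rate is $\tilde{\mathcal O}(T^{-2/3})$: for every problem and starting point there is $D$, depending on these and on the parameters above but not on $M,T,\omega,\sigma_f,\sigma_g$, such that always $$\frac1T\sum_{t=0}^{T-1}\mathbb E\,\mathfrak M_t\le D\,(1+\sigma_f^2+\sigma_g^2)\,\omega^{2/3}\,(\log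 T)^q\,T^{-2/3}.$$ -/

import Mathlib

open MeasureTheory ProbabilityTheory

universe u v w

noncomputable section

namespace Diamond

/-- `ℝ^d` with the Euclidean norm. -/
abbrev Vec (d : ℕ) : Type := EuclideanSpace ℝ (Fin d)

/-! ### Derivatives of a function of two vector variables -/

section Derivatives

variable {a b : ℕ}

/-- `∇_x h(x, y)`. -/
def gradX (h : Vec a → Vec b → ℝ) (x : Vec a) (y : Vec b) : Vec a :=
  gradient (fun x' => h x' y) x

/-- `∇_y h(x, y)`. -/
def gradY (h : Vec a → Vec b → ℝ) (x : Vec a) (y : Vec b) : Vec b :=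
  gradient (fun y' => h x y') y

/-- `∇²_{yy} h(x, y)`, as an operator on the `y`-space. -/
def hessYY (h : Vec a → Vec b → ℝ) (x : Vec a) (y : Vec b) : Vec b →L[ℝ] Vec b :=
  fderiv ℝ (fun y' => gradY h x y') y

/-- `∇²_{xy} h(x, y)`: the `a × b` matrix of mixed second derivatives, i.e. the transpose of the
`x`-derivative of `∇_y h`. -/
def hessXY (h : Vec a → Vec b → ℝ) (x : Vec a) (y : Vec b) : Vec b →L[ℝ] Vec a :=
  ContinuousLinearMap.adjoint (fderiv ℝ (fun x' => gradY h x' y) x)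

/-- `F` is Lipschitz with constant `L` on the Euclidean product `ℝ^a × ℝ^b`. -/
def LipXY {E : Type*} [NormedAddCommGroup E] (L : ℝ) (F : Vec a → Vec b → E) : Prop :=
  ∀ x x' y y', ‖F x y - F x' y'‖ ≤ L * √(‖x - x'‖ ^ 2 + ‖y - y'‖ ^ 2)

/-- A minimiser of `h(x, ·)`. -/
def argminY (h : Vec a → Vec b → ℝ) (x : Vec a) : Vec b :=
  Classical.epsilon fun y => IsMinOn (h x) Set.univ y

/-- The surrogate hypergradient
`∇_x f - ∇²_{xy} g [∇²_{yy} g]⁻¹ ∇_y f` at `(x, y)`. -/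
def barGrad (f g : Vec a → Vec b → ℝ) (x : Vec a) (y : Vec b) : Vec a :=
  gradX f x y - hessXY g x y ((hessYY g x y).inverse (gradY f x y))

end Derivatives

/-! ### Problem constants and regularity assumptions -/

/-- The regularity constants of the upper- and lower-level objectives. -/
structure Consts where
  Lfx : ℝ
  Lfy : ℝ
  Cfy : ℝ
  Lg : ℝ
  μg : ℝ
  Lgxy : ℝ
  Lgyy : ℝ
  Cgxy : ℝ

namespace Consts

variable (c : Consts)

/-- `L_f`. -/
def Lf : ℝ :=
  c.Lfx + c.Lfy * c.Cgxy / c.μg + c.Cfy * (c.Lgxy / c.μg + c.Lgyy * c.Cgxy / c.μg ^ 2)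

/-- `L_l`. -/
def Ll : ℝ := c.Lf + c.Lf * c.Cgxy / c.μg

/-- `L_y`. -/
def Ly : ℝ := c.Cgxy / c.μg

/-- `L_{μ_g}`. -/
def Lμ : ℝ := c.μg * c.Lg / (c.μg + c.Lg)

/-- `L_K`: the mean-square Lipschitz constant of the estimator with `K` Neumann samples. -/
def LK (K : ℕ) : ℝ :=
  √(2 * c.Lfx ^ 2
    + 6 * c.Cgxy ^ 2 * c.Lfy ^ 2 * K / (2 * c.μg * c.Lg - c.μg ^ 2)
    + 6 * c.Cfy ^ 2 * c.Lgxy ^ 2 * K / (2 * c.μg * c.Lg - c.μg ^ 2)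
    + 6 * c.Cgxy ^ 2 * c.Cfy ^ 2 * c.Lgyy ^ 2 * K ^ 3
      / ((c.Lg - c.μg) ^ 2 * (2 * c.μg * c.Lg - c.μg ^ 2)))

/-- Sign conditions, and non-degeneracy of the quantities by which the formulas below divide. -/
structure Valid : Prop where
  Lfx_nonneg : 0 ≤ c.Lfx
  Lfy_nonneg : 0 ≤ c.Lfy
  Cfy_nonneg : 0 ≤ c.Cfy
  Lgxy_nonneg : 0 ≤ c.Lgxy
  Lgyy_nonneg : 0 ≤ c.Lgyy
  Cgxy_pos : 0 < c.Cgxy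
  μg_pos : 0 < c.μg
  μg_lt_Lg : c.μg < c.Lg
  Lf_pos : 0 < c.Lf

/-- `K = (L_g/μ_g) log(C_{g_{xy}} C_{f_y} T / μ_g)`, rounded up to a positive integer. -/
def numSamples (T : ℕ) : ℕ :=
  max 1 ⌈c.Lg / c.μg * Real.log (c.Cgxy * c.Cfy * T / c.μg)⌉₊

end Consts

/-- The upper-level assumption on a function `f(x, y)`. -/
structure UpperRegular {a b : ℕ} (c : Consts) (f : Vec a → Vec b → ℝ) : Prop where
  diff : Differentiable ℝ fun z : Vec a × Vec b => f z.1 z.2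
  lip_gradX : LipXY c.Lfx (gradX f)
  lip_gradY : LipXY c.Lfy (gradY f)
  bound_gradY : ∀ x y, ‖gradY f x y‖ ≤ c.Cfy

/-- The lower-level assumption on a function `g(x, y)`. -/
structure LowerRegular {a b : ℕ} (c : Consts) (g : Vec a → Vec b → ℝ) : Prop where
  contDiff : ContDiff ℝ 2 fun z : Vec a × Vec b => g z.1 z.2
  lip_gradY : LipXY c.Lg (gradY g)
  strongConvex : ∀ x, StrongConvexOn Set.univ c.μg (g x)
  lip_hessXY : LipXY c.Lgxy (hessXY g)
  lip_hessYY : LipXY c.Lgyy (hessYY g)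
  bound_hessXY : ∀ x y, ‖hessXY g x y‖ ≤ c.Cgxy

/-! ### The stochastic bilevel problem -/

/-- `m` agents with stochastic objectives `f_i(x, y; ξ)`, `g_i(x, y; ζ)` and the laws of the
samples `ξ` and `ζ`. -/
structure Problem (m dup dlow : ℕ) (Ξ Z : Type*) [MeasurableSpace Ξ] [MeasurableSpace Z] where
  f : Fin m → Vec dup → Vec dlow → Ξ → ℝ
  g : Fin m → Vec dup → Vec dlow → Z → ℝ
  πf : Measure Ξ
  πg : Measure Z

/-- The samples `(ξ, ζ⁰, …, ζ^K, k)` of one hypergradient estimate. -/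
abbrev UpperSample (Ξ Z : Type*) (K : ℕ) : Type _ := Ξ × (Fin (K + 1) → Z) × Fin K

namespace Problem

variable {m dup dlow : ℕ} {Ξ Z : Type*} [MeasurableSpace Ξ] [MeasurableSpace Z]
  (B : Problem m dup dlow Ξ Z)

/-- `f_i(x, y) = E f_i(x, y; ξ)`. -/
def F (i : Fin m) (x : Vec dup) (y : Vec dlow) : ℝ := ∫ ξ, B.f i x y ξ ∂B.πf

/-- `g_i(x, y) = E g_i(x, y; ζ)`. -/
def G (i : Fin m) (x : Vec dup) (y : Vec dlow) : ℝ := ∫ ζ, B.g i x y ζ ∂B.πg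

/-- `y_i^*(x)`. -/
def yStar (i : Fin m) (x : Vec dup) : Vec dlow := argminY (B.G i) x

/-- `l(x) = (1/m) ∑_i f_i(x, y_i^*(x))`. -/
def l (x : Vec dup) : ℝ := (1 / (m : ℝ)) * ∑ i, B.F i x (B.yStar i x)

/-- `l^* = inf_x l(x)`. -/
def lStar : ℝ := ⨅ x, B.l x

/-- The assumptions on the population objectives and on the stochastic objectives, together with
what is needed for the expectations defining the problem and for `l^*` to make sense. -/
structure Regular (c : Consts) : Prop where
  prob_f : IsProbabilityMeasure B.πf
  prob_g : IsProbabilityMeasure B.πg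
  meas_f : ∀ i x y, Measurable (B.f i x y)
  meas_g : ∀ i x y, Measurable (B.g i x y)
  int_f : ∀ i x y, Integrable (B.f i x y) B.πf
  int_g : ∀ i x y, Integrable (B.g i x y) B.πg
  bddBelow : BddBelow (Set.range B.l)
  upper : ∀ i, UpperRegular c (B.F i)
  lower : ∀ i, LowerRegular c (B.G i)
  upper_sample : ∀ i, ∀ᵐ ξ ∂B.πf, UpperRegular c fun x y => B.f i x y ξ
  lower_sample : ∀ i, ∀ᵐ ζ ∂B.πg, LowerRegular c fun x y => B.g i x y ζ

/-- The stochastic hypergradient estimator: with `s = (ξ, ζ⁰, …, ζ^K, k)`,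
`∇_x f(·;ξ) - (K/L_g) ∇²_{xy} g(·;ζ⁰) ∏_{j=1}^{k} (I - ∇²_{yy} g(·;ζ^j)/L_g) ∇_y f(·;ξ)`. -/
def hatGrad (c : Consts) {K : ℕ} (i : Fin m) (x : Vec dup) (y : Vec dlow)
    (s : UpperSample Ξ Z K) : Vec dup :=
  gradX (fun x y => B.f i x y s.1) x y
    - ((K : ℝ) / c.Lg) • hessXY (fun x y => B.g i x y (s.2.1 0)) x y
      ((List.ofFn fun j : Fin (s.2.2 : ℕ) =>
          (1 : Vec dlow →L[ℝ] Vec dlow) - (1 / c.Lg) •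
            hessYY (fun x y => B.g i x y (s.2.1 ⟨(j : ℕ) + 1, by omega⟩)) x y).prod
        (gradY (fun x y => B.f i x y s.1) x y))

/-- The law of `(ξ, ζ⁰, …, ζ^K, k)`: independent, `ξ ∼ π_f`, `ζ^j ∼ π_g`, and `k` uniform on
`{0, …, K-1}`. -/
def upperLaw (K : ℕ) : Measure (UpperSample Ξ Z K) :=
  B.πf.prod ((Measure.pi fun _ : Fin (K + 1) => B.πg).prod (uniformOn (Set.univ : Set (Fin K))))

/-- The bias `b_i(x, y)` of the hypergradient estimator. -/
def bias (c : Consts) (K : ℕ) (i : Fin m) (x : Vec dup) (y : Vec dlow) : Vec dup :=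
  (∫ s, B.hatGrad c i x y s ∂B.upperLaw K) - barGrad (B.F i) (B.G i) x y

/-- The variance assumptions on the two gradient estimators. -/
structure Variance (c : Consts) (K : ℕ) (σf σg : ℝ) : Prop where
  σf_nonneg : 0 ≤ σf
  σg_nonneg : 0 ≤ σg
  upper : ∀ i x y,
    ∫⁻ s, ‖B.hatGrad c i x y s - barGrad (B.F i) (B.G i) x y - B.bias c K i x y‖ₑ ^ 2
      ∂B.upperLaw K ≤ ENNReal.ofReal (σf ^ 2)
  lower : ∀ i x y,
    ∫⁻ ζ, ‖gradY (fun x y => B.g i x y ζ) x y - gradY (B.G i) x y‖ₑ ^ 2 ∂B.πg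
      ≤ ENNReal.ofReal (σg ^ 2)

end Problem

/-! ### The network -/

/-- Symmetric doubly stochastic mixing matrix with the sparsity pattern of the graph `N`. -/
structure IsMixing {m : ℕ} (N : SimpleGraph (Fin m)) (M : Matrix (Fin m) (Fin m) ℝ) : Prop where
  doublyStochastic : M ∈ doublyStochastic ℝ (Fin m)
  symm : M.IsHermitian
  sparse : ∀ i j, i ≠ j → (0 < M i j ↔ N.Adj i j)

/-- `max {|λ_2(M)|, |λ_m(M)|}`, where `λ_1 ≥ … ≥ λ_m` are the eigenvalues of `M`. -/
def secondEig {m : ℕ} (hm : 2 ≤ m) {M : Matrix (Fin m) (Fin m) ℝ} (hM : M.IsHermitian) : ℝ :=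
  max |hM.eigenvalues₀ ⟨1, by rw [Fintype.card_fin]; omega⟩|
    |hM.eigenvalues₀ ⟨m - 1, by rw [Fintype.card_fin]; omega⟩|

/-! ### Algorithm parameters -/

section Parameters

/- `m` is the number of agents, `lam` the second eigenvalue, `K` the number of Neumann samples,
`θ ∈ (0,1)` the factor in the definition of `c̄_u`, `ω` the step-size offset. -/
variable (c : Consts) (m : ℕ) (lam θ : ℝ) (K : ℕ) (ω : ℝ)

/-- `α_t = (ω + t)^{-1/3}`. -/
def stepα (t : ℕ) : ℝ := (ω + t) ^ (-(1 / 3) : ℝ)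

/-- `c̄_y`. -/
def cbarY : ℝ :=
  min √(c.Lf ^ 2 / (2 * c.Ly ^ 2 * m)) √(c.Lf ^ 2 / (10 * c.Ly ^ 2 * (m : ℝ) ^ 2))

/-- `c_β`. -/
def cβ : ℝ := 8 * c.Lf ^ 2 / (m * c.Lμ * cbarY c m)

/-- `c̄_η`. -/
def cbarη : ℝ :=
  max (32 * c.LK K ^ 2) (max (160 * c.LK K ^ 2 * m)
    (24 * (c.μg + c.Lg) * c.LK K ^ 2 * cβ c m / cbarY c m))

/-- `c̄_γ`. -/
def cbarγ : ℝ :=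
  max (32 * c.Lg ^ 2) (max (160 * c.Lg ^ 2 * m)
    (24 * (c.μg + c.Lg) * c.Lg ^ 2 * cβ c m / cbarY c m))

/-- `c̄_u`. -/
def cbarU : ℝ := θ * min (1 / (48 * c.LK K ^ 2)) (1 / (3 * cbarη c m K))

/-- `c_η`. -/
def cη : ℝ :=
  (6 * c.Lf * cbarη c m K + m) / (3 * c.Lf * m * (1 - 3 * cbarU c m θ K * cbarη c m K))

/-- `c_γ`. -/
def cγ : ℝ :=
  1 / (3 * c.Lf) + 8 * c.Lg ^ 2 * cβ c m ^ 2
    + cbarγ c m * (2 * cβ c m * cbarY c m / c.Lμ + 8 * c.LK K ^ 2 * cβ c m ^ 2 / cbarη c m K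
        + 12 * c.LK K ^ 2 * cbarU c m θ K * cβ c m ^ 2)

/-- `c̄_x = 6 / ((1 - λ) α_t)`. -/
def cbarX (t : ℕ) : ℝ := 6 / ((1 - lam) * stepα ω t)

/-- `β_t = c_β α_t`. -/
def stepβ (t : ℕ) : ℝ := cβ c m * stepα ω t

/-- `η_0 = 1` and `η_{t+1} = c_η α_t²`. -/
def momη : ℕ → ℝ
  | 0 => 1
  | t + 1 => cη c m θ K * stepα ω t ^ 2

/-- `γ_0 = 1` and `γ_{t+1} = c_γ α_t²`. -/
def momγ : ℕ → ℝ
  | 0 => 1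
  | t + 1 => cγ c m θ K * stepα ω t ^ 2

/-- The conditions on the step sizes and on the momentum coefficients. -/
structure Admissible : Prop where
  two_le : 2 ≤ ω
  α_le_1 : ∀ t, stepα ω t ≤ √(m / (2 * c.Ll ^ 2))
  α_le_2 : ∀ t, stepα ω t ≤ cbarU c m θ K * (1 - lam) ^ 2 / 30
  α_le_3 : ∀ t, stepα ω t ≤
    cbarU c m θ K * (1 - lam) * c.Lμ * cβ c m / (40 * c.Ly ^ 2 * cbarY c m)
  α_le_4 : ∀ t, stepα ω t ≤ cbarU c m θ K * (1 - lam) * cbarη c m K / (80 * c.LK K ^ 2)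
  α_le_5 : ∀ t, stepα ω t ≤ cbarU c m θ K * (1 - lam) * cbarγ c m / (80 * c.Lg ^ 2)
  α_le_6 : ∀ t, stepα ω t ≤ 1 / (5 * c.Ll)
  α_le_7 : ∀ t, stepα ω t ≤ 1 / (3 * c.Lf)
  α_le_8 : ∀ t, stepα ω t ≤ √((1 - lam) ^ 2 / (120 * c.LK K ^ 2))
  α_le_9 : ∀ t, stepα ω t ≤ (1 - lam) / (240 * cbarU c m θ K * c.LK K ^ 2 * m)
  α_le_10 : ∀ t, stepα ω t ≤
    cbarY c m * (1 - lam) / (36 * (c.μg + c.Lg) * cbarU c m θ K * c.LK K ^ 2 * cβ c m)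
  α_le_11 : ∀ t, stepα ω t ≤ 1 - lam
  β_le : ∀ t, stepβ c m ω t ≤ 1 / (c.μg + c.Lg)
  η_mem : ∀ t, momη c m θ K ω t ∈ Set.Icc (0 : ℝ) 1
  γ_mem : ∀ t, momγ c m θ K ω t ∈ Set.Icc (0 : ℝ) 1

end Parameters

/-! ### The algorithm -/

/-- The variables `x_{i,t}, y_{i,t}, p_{i,t}, v_{i,t}, u_{i,t}` of all agents at one time `t`. -/
structure State (m dup dlow : ℕ) where
  x : Fin m → Vec dup
  y : Fin m → Vec dlow
  p : Fin m → Vec dup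
  v : Fin m → Vec dlow
  u : Fin m → Vec dup

section Algorithm

variable {m dup dlow : ℕ} {Ξ Z : Type*} [MeasurableSpace Ξ] [MeasurableSpace Z]

/-- The iterates of the algorithm driven by the samples `s t i = (ξ̄_{i,t}, ζ_{i,t})`.
All agents start from the same point `(x₀, y₀)`.  Since `p_{-1} = v_{-1} = u_{-1} = 0` and
`η_0 = γ_0 = 1`, the directions at `t = 0` are the plain stochastic gradients and `u_0 = p_0`.
As `M i j = 0` for agents that are not neighbours, the sums over neighbours are full sums. -/
def iterate (c : Consts) (B : Problem m dup dlow Ξ Z) (M : Matrix (Fin m) (Fin m) ℝ)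
    (θ : ℝ) (K : ℕ) (ω : ℝ) (x₀ : Vec dup) (y₀ : Vec dlow)
    (s : ℕ → Fin m → UpperSample Ξ Z K × Z) : ℕ → State m dup dlow
  | 0 =>
    { x := fun _ => x₀
      y := fun _ => y₀
      p := fun i => B.hatGrad c i x₀ y₀ (s 0 i).1
      v := fun i => gradY (fun x y => B.g i x y (s 0 i).2) x₀ y₀
      u := fun i => B.hatGrad c i x₀ y₀ (s 0 i).1 }
  | t + 1 =>
    let S := iterate c B M θ K ω x₀ y₀ s t
    let x : Fin m → Vec dup := fun i => ∑ j, M i j • S.x j - stepα ω t • S.u i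
    let y : Fin m → Vec dlow := fun i => S.y i - stepβ c m ω t • S.v i
    let p : Fin m → Vec dup := fun i =>
      B.hatGrad c i (x i) (y i) (s (t + 1) i).1
        + (1 - momη c m θ K ω (t + 1)) •
          (S.p i - B.hatGrad c i (S.x i) (S.y i) (s (t + 1) i).1)
    let v : Fin m → Vec dlow := fun i =>
      gradY (fun x y => B.g i x y (s (t + 1) i).2) (x i) (y i)
        + (1 - momγ c m θ K ω (t + 1)) •
          (S.v i - gradY (fun x y => B.g i x y (s (t + 1) i).2) (S.x i) (S.y i))
    { x := x
      y := y
      p := p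
      v := v
      u := fun i => ∑ j, M i j • S.u j + p i - S.p i }

/-- The average of the agents' vectors. -/
def avg {d : ℕ} (w : Fin m → Vec d) : Vec d := (1 / (m : ℝ)) • ∑ i, w i

/-- `‖w - 1 ⊗ w̄‖²`. -/
def consensusErr {d : ℕ} (w : Fin m → Vec d) : ℝ := ∑ i, ‖w i - avg w‖ ^ 2

/-- `‖y^* - y‖²`, with `y^*_i = y^*_i(x_i)`. -/
def lowerErr (B : Problem m dup dlow Ξ Z) (S : State m dup dlow) : ℝ :=
  ∑ i, ‖B.yStar i (S.x i) - S.y i‖ ^ 2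

/-- The convergence metric `‖∇l(x̄)‖² + ‖x - 1 ⊗ x̄‖² + ‖y^* - y‖²`. -/
def metric (B : Problem m dup dlow Ξ Z) (S : State m dup dlow) : ℝ :=
  ‖gradient B.l (avg S.x)‖ ^ 2 + consensusErr S.x + lowerErr B S

/-- `𝔅_t = l(x̄_t) + c̄_y ‖y_t - y_t^*‖² + c̄_x ‖x_t - 1 ⊗ x̄_t‖² + c̄_u ‖u_t - 1 ⊗ ū_t‖²`. -/
def potential (c : Consts) (B : Problem m dup dlow Ξ Z) (lam θ : ℝ) (K : ℕ) (ω : ℝ) (t : ℕ)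
    (S : State m dup dlow) : ℝ :=
  B.l (avg S.x) + cbarY c m * lowerErr B S + cbarX lam ω t * consensusErr S.x
    + cbarU c m θ K * consensusErr S.u

/-- `s t i` are the samples of agent `i` at time `t`: they have the right laws, and the samples
of different times are independent.  (Nothing is asked about the joint law of the samples of
different agents at the same time.) -/
structure IsSampling (B : Problem m dup dlow Ξ Z) (K : ℕ) {Ω : Type*} [MeasurableSpace Ω]
    (P : Measure Ω) (s : ℕ → Fin m → Ω → UpperSample Ξ Z K × Z) : Prop where
  meas : ∀ t i, Measurable (s t i)
  law_upper : ∀ t i, P.map (fun ω => (s t i ω).1) = B.upperLaw K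
  law_lower : ∀ t i, P.map (fun ω => (s t i ω).2) = B.πg
  indep : iIndepFun (fun t ω i => s t i ω) P

end Algorithm

end Diamond

end

/-!
The proof follows the expectation of a potential function along the iteration and sums its
decrements.

**Hypergradient.**  Since `∇_y g_i` is strongly monotone in `y`, the minimizer `y_i^*` is Lipschitz,
and with this the implicit function theorem for `∇_y g_i(x, y_i^*(x)) = 0` is an elementary
expansion (`LowerRegular.hasFDerivAt_argminY`).  Hence `l` is differentiable, its gradient is the
average of the surrogate hypergradients `∇̄f_i(x, y_i^*(x))`, and it is `L_l`-Lipschitz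
(`hasGradientAt_hyper`, `Problem.gradL_lip`).

**Estimators.**  The mean of the estimator of the hypergradient is the Neumann series of the inverse
Hessian truncated after `K` terms (`Problem.integral_hatGrad`); the chosen `K` makes the bias at
most `1/T` (`Problem.bias_bound_numSamples`).  In mean square the estimator is Lipschitz with
constant `L_K` (`Consts.avg_lipSample_le`).  These properties make it an `Oracle`, for which the
momentum recursion damps the old error and adds noise of the order of the squared movement of the
iterates plus `η² σ²` (`Oracle.error_step_le`, `Oracle.momentum_step`).  Measurability of the
iterates is not part of the hypotheses: the estimators are almost surely continuous in the point,
hence almost surely equal to jointly measurable ones (`exists_measurable_version`), and the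
iterates may be replaced by those of the latter (`exists_oracles_iterate`).

**Descent.**  A symmetric doubly stochastic matrix contracts the consensus error by the second
largest absolute eigenvalue (`IsMixing.contracts`).  Together with the descent lemma for `l` and
the contraction of strongly monotone gradient steps, all expected quantities satisfy a closed system
of inequalities (`Recursion`, `recursion_run`).  The potential `lyapunov` adds to the potential of
the statement the errors of the momentum estimators with weights `1/α_{t-1}`.  In the
increment of the potential the movement of the iterates is absorbed by the negative terms
(`lyapunov_succ_le`), except possibly for the consensus error of the tracking variables.  It enters
the consensus error of the `x_i`, and thereby the potential, with weight `6 α_t / (1 - λ)²`, which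
the step-size conditions only bound by `c̄_u / 5`, while mixing removes no more than `c̄_u (1 - λ)`.
As `α_t → 0`, this concerns finitely many steps: during the first `burnIn λ` steps the potential at
most doubles, up to noise, and once `α_t ≤ (1 - λ)²` the potential with the larger weight
`c̄_u / (1 - λ)` decreases (`sum_decrement_le`).  This costs a factor that depends on `λ` only.

**Summation.**  The step sizes satisfy `α_t⁻¹ ≤ (ωT)^(1/3)` for `t < T` and `∑ α_t³ ≤ 2 log T`, and
`c_η² / c̄_η` is of the order of `K³` while `c_γ` is bounded, which gives the three-term rate
(`exists_rate`).  The step-size conditions hold once `α_0` is at most a small multiple of `K⁻³`, and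
`K` is of the order of `log T`, so that offsets `ω` of the order of `(log T)⁹` are admissible
(`exists_offset`).
-/

noncomputable section

namespace Diamond

/-! ### Averages and the mixing matrix -/

section Mixing

variable {m d : ℕ}

/-- The spectral gap on scalar data: `M` contracts the orthogonal complement of the constant
vector by `lam`, because `lam < 1` forces the constant vector to span the top eigenline. -/
lemma sum_sq_mulVec_le (hm : 2 ≤ m) {N : SimpleGraph (Fin m)} {M : Matrix (Fin m) (Fin m) ℝ}
    (hM : IsMixing N M) {lam : ℝ} (hlam : secondEig hm hM.symm = lam) (hlt : lam < 1)
    (z : Fin m → ℝ) (hz : ∑ i, z i = 0) :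
    ∑ i, (∑ j, M i j * z j) ^ 2 ≤ lam ^ 2 * ∑ i, z i ^ 2 := by
  have hS := hM.symm
  have h0 : 0 < Fintype.card (Fin m) := by rw [Fintype.card_fin]; omega
  let b := hS.eigenvectorBasis
  let e : Fin (Fintype.card (Fin m)) ≃ Fin m := Fintype.equivOfCardEq (Fintype.card_fin _)
  let i0 : Fin m := e ⟨0, h0⟩
  -- all eigenvalues except the one at the index `i0` of the largest are at most `lam` in modulus
  have habs : ∀ i, i ≠ i0 → |hS.eigenvalues i| ≤ lam := by
    intro i hi
    have hk : e.symm i ≠ ⟨0, h0⟩ := fun h => hi ((Equiv.symm_apply_eq e).1 h)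
    have hk0 : 1 ≤ (e.symm i : ℕ) := by
      rcases Nat.eq_zero_or_pos (e.symm i : ℕ) with h | h
      · exact absurd (Fin.ext h) hk
      · exact h
    have hkm : (e.symm i : ℕ) ≤ m - 1 := by
      have := (e.symm i).2
      have h2 : Fintype.card (Fin m) = m := Fintype.card_fin m
      omega
    have hup : hS.eigenvalues i ≤ hS.eigenvalues₀ ⟨1, by rw [Fintype.card_fin]; omega⟩ :=
      hS.eigenvalues₀_antitone (Fin.mk_le_of_le_val hk0)
    have hdn : hS.eigenvalues₀ ⟨m - 1, by rw [Fintype.card_fin]; omega⟩ ≤ hS.eigenvalues i :=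
      hS.eigenvalues₀_antitone (by rw [Fin.le_def]; exact hkm)
    rw [← hlam, secondEig, abs_le]
    constructor
    · refine le_trans ?_ hdn
      rw [neg_le]
      exact (neg_le_abs _).trans (le_max_right _ _)
    · exact (hup.trans (le_abs_self _)).trans (le_max_left _ _)
  have hsymm : ∀ i j, M i j = M j i := fun i j => by
    have := congrFun (congrFun hS.eq j) i
    simpa [Matrix.conjTranspose_apply] using this
  have hin : ∀ (i : Fin m) (w : Fin m → ℝ),
      inner ℝ (b i) (WithLp.toLp 2 w) = ∑ j, b i j * w j := by
    intro i w
    rw [PiLp.inner_apply]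
    refine Finset.sum_congr rfl fun j _ => ?_
    simp [mul_comm]
  have heig : ∀ (i : Fin m) (w : Fin m → ℝ),
      ∑ k, b i k * (∑ j, M k j * w j) = hS.eigenvalues i * ∑ j, b i j * w j := by
    intro i w
    have h1 : ∀ j, ∑ k, M j k * b i k = hS.eigenvalues i * b i j := by
      intro j
      have := congrFun (hS.mulVec_eigenvectorBasis i) j
      simpa [Matrix.mulVec, dotProduct] using this
    simp_rw [Finset.mul_sum]
    rw [Finset.sum_comm]
    refine Finset.sum_congr rfl fun j _ => ?_
    rw [← mul_assoc, ← h1 j, Finset.sum_mul]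
    refine Finset.sum_congr rfl fun k _ => ?_
    rw [hsymm k j]; ring
  -- the eigenvalue `1` of the constant vector differs from these, so it is orthogonal to their
  -- eigenvectors
  have hone : ∀ i, i ≠ i0 → ∑ j, b i j * (1 : ℝ) = 0 := by
    intro i hi
    have h1 := heig i (fun _ => 1)
    simp only [mul_one, sum_row_of_mem_doublyStochastic hM.doublyStochastic] at h1
    have h2 : hS.eigenvalues i < 1 := (le_abs_self _).trans_lt ((habs i hi).trans_lt hlt)
    have h3 : (1 - hS.eigenvalues i) * ∑ j, b i j = 0 := by linear_combination h1
    rcases mul_eq_zero.1 h3 with h | h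
    · linarith
    · simpa using h
  -- Parseval in the eigenbasis
  have hexp : ∀ w w' : Fin m → ℝ,
      ∑ j, w j * w' j = ∑ i, (∑ j, b i j * w j) * (∑ j, b i j * w' j) := by
    intro w w'
    have := b.sum_inner_mul_inner (WithLp.toLp 2 w) (WithLp.toLp 2 w')
    rw [PiLp.inner_apply] at this
    have h2 : ∑ j, w j * w' j = ∑ x, inner ℝ ((WithLp.toLp 2 w).ofLp x)
        ((WithLp.toLp 2 w').ofLp x) := Finset.sum_congr rfl fun j _ => by simp [mul_comm]
    rw [h2, ← this]
    refine Finset.sum_congr rfl fun i _ => ?_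
    rw [← hin i w, ← hin i w', real_inner_comm]
  -- the constant vector is a multiple of `b i0`, and `z` is orthogonal to it
  have hi0 : ∑ j, b i0 j * z j = 0 := by
    have h1 := hexp (fun _ => 1) z
    have h2 := hexp (fun _ => 1) (fun _ => 1)
    have h3 : ∀ w : Fin m → ℝ, ∑ i, (∑ j, b i j * (1 : ℝ)) * (∑ j, b i j * w j)
        = (∑ j, b i0 j * (1 : ℝ)) * (∑ j, b i0 j * w j) := fun w =>
      Finset.sum_eq_single i0 (fun i _ hi => by rw [hone i hi, zero_mul]) (by simp)
    rw [h3] at h1 h2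
    simp only [one_mul, hz] at h1
    rcases mul_eq_zero.1 h1.symm with h | h
    · rw [h] at h2
      simp at h2
      omega
    · exact h
  have hsq : ∀ w : Fin m → ℝ, ∑ j, w j ^ 2 = ∑ i, (∑ j, b i j * w j) ^ 2 := by
    intro w
    simpa [sq] using hexp w w
  rw [hsq z, hsq (fun i => ∑ j, M i j * z j), Finset.mul_sum]
  refine Finset.sum_le_sum fun i _ => ?_
  rw [heig i z, mul_pow]
  by_cases hi : i = i0
  · rw [hi, hi0]; simp
  · refine mul_le_mul_of_nonneg_right ?_ (sq_nonneg _)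
    rw [← sq_abs (hS.eigenvalues i)]
    exact pow_le_pow_left₀ (abs_nonneg _) (habs i hi) 2

lemma sum_sub_avg (hm : 0 < m) (w : Fin m → Vec d) : ∑ i, (w i - avg w) = 0 := by
  have : (m : ℝ) ≠ 0 := by positivity
  rw [Finset.sum_sub_distrib, Finset.sum_const, Finset.card_univ, Fintype.card_fin, avg,
    ← Nat.cast_smul_eq_nsmul ℝ, smul_smul, mul_one_div_cancel this, one_smul, sub_self]

lemma avg_add (w z : Fin m → Vec d) : avg (fun i => w i + z i) = avg w + avg z := by
  simp [avg, Finset.sum_add_distrib]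

lemma avg_sub (w z : Fin m → Vec d) : avg (fun i => w i - z i) = avg w - avg z := by
  simp [avg, Finset.sum_sub_distrib, smul_sub]

lemma avg_smul (r : ℝ) (w : Fin m → Vec d) : avg (fun i => r • w i) = r • avg w := by
  simp only [avg, ← Finset.smul_sum]
  rw [smul_comm]

lemma avg_const (hm : 0 < m) (w : Vec d) : avg (fun _ : Fin m => w) = w := by
  have : (m : ℝ) ≠ 0 := by positivity
  rw [avg, Finset.sum_const, Finset.card_univ, Fintype.card_fin,
    ← Nat.cast_smul_eq_nsmul ℝ, smul_smul, one_div_mul_cancel this, one_smul]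

lemma consensusErr_nonneg (w : Fin m → Vec d) : 0 ≤ consensusErr w :=
  Finset.sum_nonneg fun _ _ => by positivity

/-- Pythagoras for the splitting of `w` into its average and the deviation from it. -/
lemma sum_norm_sq_eq (hm : 0 < m) (w : Fin m → Vec d) :
    ∑ i, ‖w i‖ ^ 2 = consensusErr w + m * ‖avg w‖ ^ 2 := by
  have h1 : ∀ i, ‖w i‖ ^ 2 = ‖w i - avg w‖ ^ 2 + 2 * inner ℝ (w i - avg w) (avg w)
      + ‖avg w‖ ^ 2 := by
    intro i
    rw [← norm_add_sq_real, sub_add_cancel]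
  simp_rw [h1]
  rw [Finset.sum_add_distrib, Finset.sum_add_distrib, ← Finset.mul_sum, ← sum_inner,
    sum_sub_avg hm, inner_zero_left]
  simp [consensusErr]

lemma consensusErr_le (hm : 0 < m) (w : Fin m → Vec d) : consensusErr w ≤ ∑ i, ‖w i‖ ^ 2 := by
  rw [sum_norm_sq_eq hm]
  nlinarith [sq_nonneg ‖avg w‖, (Nat.cast_nonneg m : (0 : ℝ) ≤ m)]

lemma norm_avg_sq_le (hm : 0 < m) (w : Fin m → Vec d) :
    ‖avg w‖ ^ 2 ≤ (1 / (m : ℝ)) * ∑ i, ‖w i‖ ^ 2 := by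
  have : (0 : ℝ) < m := by exact_mod_cast hm
  rw [sum_norm_sq_eq hm, one_div, inv_mul_eq_div, le_div_iff₀ this]
  nlinarith [consensusErr_nonneg w]

lemma consensusErr_const (hm : 0 < m) (w : Vec d) : consensusErr (fun _ : Fin m => w) = 0 := by
  simp [consensusErr, avg_const hm]

/-- The two properties of the mixing matrix that the analysis uses: it preserves averages, and
it contracts deviations from the average by the factor `lam`. -/
structure Contracts (M : Matrix (Fin m) (Fin m) ℝ) (lam : ℝ) : Prop where
  col_sum : ∀ j, ∑ i, M i j = 1
  contract : ∀ {d : ℕ} (w : Fin m → Vec d),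
    ∑ i, ‖∑ j, M i j • w j - avg w‖ ^ 2 ≤ lam ^ 2 * consensusErr w

lemma IsMixing.contracts (hm : 2 ≤ m) {N : SimpleGraph (Fin m)}
    {M : Matrix (Fin m) (Fin m) ℝ} (hM : IsMixing N M) {lam : ℝ}
    (hlam : secondEig hm hM.symm = lam) (hlt : lam < 1) : Contracts M lam where
  col_sum := sum_col_of_mem_doublyStochastic hM.doublyStochastic
  contract := by
    intro d w
    have hrow := sum_row_of_mem_doublyStochastic hM.doublyStochastic
    have h1 : ∀ i, ∑ j, M i j • w j - avg w = ∑ j, M i j • (w j - avg w) := by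
      intro i
      simp_rw [smul_sub]
      rw [Finset.sum_sub_distrib, ← Finset.sum_smul, hrow i, one_smul]
    simp_rw [h1, consensusErr, EuclideanSpace.norm_sq_eq, Real.norm_eq_abs, sq_abs]
    rw [Finset.sum_comm, Finset.sum_comm (s := Finset.univ) (t := Finset.univ)
      (f := fun i k => ((w i - avg w) k) ^ 2), Finset.mul_sum]
    refine Finset.sum_le_sum fun k _ => ?_
    have h2 := sum_sq_mulVec_le hm hM hlam hlt (fun i => (w i - avg w) k) (by
      have := congrArg (fun v : Vec d => v k) (sum_sub_avg (by omega) w)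
      simpa using this)
    simpa using h2

namespace Contracts

variable {M : Matrix (Fin m) (Fin m) ℝ} {lam : ℝ}

lemma avg_mix (hM : Contracts M lam) (w : Fin m → Vec d) :
    avg (fun i => ∑ j, M i j • w j) = avg w := by
  simp only [avg]
  congr 1
  rw [Finset.sum_comm]
  simp_rw [← Finset.sum_smul, hM.col_sum, one_smul]

/-- Consensus contraction under a perturbation, with Young's inequality tuned so that the factor
is `lam` itself. -/
lemma consensusErr_mix_add_le (hM : Contracts M lam) (h0 : 0 ≤ lam) (h1 : lam < 1)
    (w z : Fin m → Vec d) :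
    consensusErr (fun i => ∑ j, M i j • w j + z i) ≤
      lam * consensusErr w + 1 / (1 - lam) * consensusErr z := by
  have hpos : 0 < 1 - lam := by linarith
  have hdev : ∀ i, (∑ j, M i j • w j + z i) - avg (fun i => ∑ j, M i j • w j + z i)
      = (∑ j, M i j • w j - avg w) + (z i - avg z) := by
    intro i
    rw [avg_add, hM.avg_mix]; abel
  have hc := hM.contract w
  rw [consensusErr]
  simp_rw [hdev]
  set A : Fin m → Vec d := fun i => ∑ j, M i j • w j - avg w
  have hB : consensusErr z = ∑ i, ‖z i - avg z‖ ^ 2 := rfl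
  rw [hB]
  -- the ratio `1 / lam` in Young's inequality degenerates at `lam = 0`, where mixing averages
  -- exactly
  rcases h0.eq_or_lt with h | h
  · subst h
    have hA : ∀ i, A i = 0 := by
      have h2 : ∑ i, ‖A i‖ ^ 2 = 0 :=
        le_antisymm (by simpa using hc) (Finset.sum_nonneg fun _ _ => by positivity)
      intro i
      have := (Finset.sum_eq_zero_iff_of_nonneg (fun i _ => by positivity)).1 h2 i
        (Finset.mem_univ i)
      simpa using this
    have h2 : ∀ i, ∑ j, M i j • w j - avg w = 0 := hA
    simp [h2]
  · have hpt : ∀ i, ‖A i + (z i - avg z)‖ ^ 2 ≤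
        1 / lam * ‖A i‖ ^ 2 + 1 / (1 - lam) * ‖z i - avg z‖ ^ 2 := by
      intro i
      have h2 := norm_add_le (A i) (z i - avg z)
      have h3 : (‖A i‖ + ‖z i - avg z‖) ^ 2 ≤
          1 / lam * ‖A i‖ ^ 2 + 1 / (1 - lam) * ‖z i - avg z‖ ^ 2 := by
        set p := ‖A i‖
        set q := ‖z i - avg z‖
        have : 1 / lam * p ^ 2 + 1 / (1 - lam) * q ^ 2 - (p + q) ^ 2
            = ((1 - lam) * p - lam * q) ^ 2 / (lam * (1 - lam)) := by
          field_simp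
          ring
        have h4 : 0 ≤ ((1 - lam) * p - lam * q) ^ 2 / (lam * (1 - lam)) := by positivity
        linarith
      exact (pow_le_pow_left₀ (norm_nonneg _) h2 2).trans h3
    refine (Finset.sum_le_sum fun i _ => hpt i).trans ?_
    rw [Finset.sum_add_distrib, ← Finset.mul_sum, ← Finset.mul_sum]
    refine add_le_add ?_ le_rfl
    have : 1 / lam * ∑ i, ‖A i‖ ^ 2 ≤ 1 / lam * (lam ^ 2 * consensusErr w) := by gcongr
    refine this.trans (le_of_eq ?_)
    field_simp

/-- How far the upper variables move in one step. -/
lemma sum_norm_move_sq_le (hM : Contracts M lam) (hm : 0 < m) (h0 : 0 ≤ lam) (h1 : lam < 1)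
    (x u : Fin m → Vec d) (α : ℝ) :
    ∑ i, ‖(∑ j, M i j • x j - α • u i) - x i‖ ^ 2 ≤
      8 * consensusErr x + 2 * α ^ 2 * consensusErr u + m * α ^ 2 * ‖avg u‖ ^ 2 := by
  have havg : avg (fun i => (∑ j, M i j • x j - α • u i) - x i) = -(α • avg u) := by
    rw [avg_sub, avg_sub, hM.avg_mix, avg_smul]; abel
  rw [sum_norm_sq_eq hm, havg, norm_neg, norm_smul, mul_pow, Real.norm_eq_abs, sq_abs, ← mul_assoc]
  gcongr
  rw [consensusErr, havg]
  have hpt : ∀ i, ‖(∑ j, M i j • x j - α • u i) - x i - -(α • avg u)‖ ^ 2 ≤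
      4 * ‖∑ j, M i j • x j - avg x‖ ^ 2 + 4 * ‖x i - avg x‖ ^ 2
        + 2 * α ^ 2 * ‖u i - avg u‖ ^ 2 := by
    intro i
    have e : (∑ j, M i j • x j - α • u i) - x i - -(α • avg u)
        = (∑ j, M i j • x j - avg x) - (x i - avg x) - α • (u i - avg u) := by
      rw [smul_sub]; abel
    rw [e]
    have t1 := norm_sub_le ((∑ j, M i j • x j - avg x) - (x i - avg x)) (α • (u i - avg u))
    have t2 := norm_sub_le (∑ j, M i j • x j - avg x) (x i - avg x)
    rw [norm_smul, Real.norm_eq_abs] at t1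
    have t3 : ‖(∑ j, M i j • x j - avg x) - (x i - avg x) - α • (u i - avg u)‖ ^ 2 ≤
      (‖∑ j, M i j • x j - avg x‖ + ‖x i - avg x‖ + |α| * ‖u i - avg u‖) ^ 2 :=
      pow_le_pow_left₀ (norm_nonneg _) (by linarith) 2
    have t4 : (|α| * ‖u i - avg u‖) ^ 2 = α ^ 2 * ‖u i - avg u‖ ^ 2 := by
      rw [mul_pow, sq_abs]
    nlinarith [sq_nonneg (‖∑ j, M i j • x j - avg x‖ + ‖x i - avg x‖ - |α| * ‖u i - avg u‖),
      sq_nonneg (‖∑ j, M i j • x j - avg x‖ - ‖x i - avg x‖)]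
  refine (Finset.sum_le_sum fun i _ => hpt i).trans ?_
  rw [Finset.sum_add_distrib, Finset.sum_add_distrib, ← Finset.mul_sum, ← Finset.mul_sum,
    ← Finset.mul_sum]
  have hc := hM.contract x
  have hx := consensusErr_nonneg x
  have hl : lam ^ 2 * consensusErr x ≤ 1 * consensusErr x := by
    gcongr
    nlinarith
  have e1 : ∑ i, ‖x i - avg x‖ ^ 2 = consensusErr x := rfl
  have e2 : ∑ i, ‖u i - avg u‖ ^ 2 = consensusErr u := rfl
  rw [e1, e2]
  linarith

end Contracts

end Mixing

/-! ### Smooth and strongly convex functions -/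

section Convexity

variable {E : Type*} [NormedAddCommGroup E] [InnerProductSpace ℝ E]

/-- A symmetric operator is bounded in norm by its quadratic form. -/
lemma norm_apply_le_of_symmetric {S : E →L[ℝ] E} {r : ℝ} (hr : 0 < r)
    (hsymm : ∀ v w, inner ℝ (S v) w = inner ℝ v (S w))
    (hq : ∀ v, |inner ℝ (S v) v| ≤ r * ‖v‖ ^ 2) (v : E) : ‖S v‖ ≤ r * ‖v‖ := by
  -- polarization, used with `w = S v / r`
  have hpol : ∀ w, 2 * inner ℝ (S v) w ≤ r * (‖v‖ ^ 2 + ‖w‖ ^ 2) := by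
    intro w
    have h1 := (abs_le.1 (hq (v + w))).2
    have h2 := (abs_le.1 (hq (v - w))).1
    have h3 : inner ℝ (S w) v = inner ℝ (S v) w := by rw [hsymm w v, real_inner_comm]
    simp only [map_add, map_sub, inner_add_left, inner_add_right, inner_sub_left,
      inner_sub_right, h3] at h1 h2
    have h4 := parallelogram_law_with_norm ℝ v w
    nlinarith
  have h := hpol ((1 / r) • S v)
  rw [real_inner_smul_right, real_inner_self_eq_norm_sq, norm_smul, Real.norm_eq_abs,
    abs_of_pos (by positivity : 0 < 1 / r), mul_pow] at h
  have h5 : ‖S v‖ ^ 2 ≤ (r * ‖v‖) ^ 2 := by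
    have e : 2 * (1 / r * ‖S v‖ ^ 2) - r * (‖v‖ ^ 2 + (1 / r) ^ 2 * ‖S v‖ ^ 2)
        = (‖S v‖ ^ 2 - (r * ‖v‖) ^ 2) / r := by
      field_simp; ring
    have h6 : (‖S v‖ ^ 2 - (r * ‖v‖) ^ 2) / r ≤ 0 := by linarith
    rw [div_le_iff₀ hr] at h6
    linarith
  exact (pow_le_pow_iff_left₀ (norm_nonneg _) (by positivity) two_ne_zero).1 h5

variable [CompleteSpace E]

lemma hasDerivAt_line {f : E → ℝ} {v x d : E} {t : ℝ} (h : HasGradientAt f v (x + t • d)) :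
    HasDerivAt (fun s : ℝ => f (x + s • d)) (inner ℝ v d) t := by
  have h1 : HasDerivAt (fun s : ℝ => x + s • d) d t := by
    simpa using ((hasDerivAt_id t).smul_const d).const_add x
  exact h.hasFDerivAt.comp_hasDerivAt t h1

/-- First-order characterization of strong convexity. -/
lemma strongConvex_lower_bound {f : E → ℝ} {μ : ℝ} (hf : StrongConvexOn Set.univ μ f)
    {x v : E} (hv : HasGradientAt f v x) (y : E) :
    f x + inner ℝ v (y - x) + μ / 2 * ‖y - x‖ ^ 2 ≤ f y := by
  have hc := strongConvexOn_iff_convex.1 hf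
  have hc1 : ConvexOn ℝ Set.univ
      (fun t : ℝ => f (x + t • (y - x)) - μ / 2 * ‖x + t • (y - x)‖ ^ 2) := by
    have := hc.comp_affineMap (AffineMap.lineMap x y : ℝ →ᵃ[ℝ] E)
    simp only [Set.preimage_univ] at this
    refine this.congr fun t _ => ?_
    simp [AffineMap.lineMap_apply, add_comm]
  have hd : HasDerivAt (fun t : ℝ => f (x + t • (y - x)) - μ / 2 * ‖x + t • (y - x)‖ ^ 2)
      (inner ℝ v (y - x) - μ / 2 * (2 * inner ℝ x (y - x))) 0 := by
    have h1 : HasDerivAt (fun s : ℝ => f (x + s • (y - x))) (inner ℝ v (y - x)) 0 :=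
      hasDerivAt_line (by simpa using hv)
    have h2 : HasDerivAt (fun s : ℝ => x + s • (y - x)) (y - x) 0 := by
      simpa using ((hasDerivAt_id (0 : ℝ)).smul_const (y - x)).const_add x
    have h3 := h2.norm_sq
    simp only [zero_smul, add_zero] at h3
    exact h1.sub (h3.const_mul (μ / 2))
  have h := hc1.le_slope_of_hasDerivAt (Set.mem_univ 0) (Set.mem_univ 1) one_pos hd
  simp only [slope_def_field, one_smul, zero_smul, add_zero, sub_zero, div_one,
    add_sub_cancel] at h
  have e : ‖y - x‖ ^ 2 = ‖y‖ ^ 2 - ‖x‖ ^ 2 - 2 * inner ℝ x (y - x) := by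
    rw [norm_sub_sq_real, inner_sub_right, real_inner_self_eq_norm_sq, real_inner_comm]
    ring
  rw [e]
  linarith

lemma strongConvex_monotone {f : E → ℝ} {μ : ℝ} (hf : StrongConvexOn Set.univ μ f)
    {x y v w : E} (hv : HasGradientAt f v x) (hw : HasGradientAt f w y) :
    μ * ‖y - x‖ ^ 2 ≤ inner ℝ (w - v) (y - x) := by
  have h1 := strongConvex_lower_bound hf hv y
  have h2 := strongConvex_lower_bound hf hw x
  rw [← neg_sub y x, inner_neg_right, norm_neg] at h2
  rw [inner_sub_left]
  linarith

/-- The descent lemma. -/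
lemma le_of_lipschitz_gradient {f : E → ℝ} {f' : E → E} {L : ℝ}
    (hf : ∀ x, HasGradientAt f (f' x) x) (hL : ∀ x y, ‖f' x - f' y‖ ≤ L * ‖x - y‖) (x y : E) :
    f y ≤ f x + inner ℝ (f' x) (y - x) + L / 2 * ‖y - x‖ ^ 2 := by
  set d := y - x with hd
  let φ : ℝ → ℝ := fun t => f (x + t • d) - t * inner ℝ (f' x) d - L / 2 * ‖d‖ ^ 2 * t ^ 2
  have hφ : ∀ t, HasDerivAt φ
      (inner ℝ (f' (x + t • d)) d - inner ℝ (f' x) d - L / 2 * ‖d‖ ^ 2 * (2 * t)) t := by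
    intro t
    have h1 := hasDerivAt_line (hf (x + t • d))
    have h2 : HasDerivAt (fun t : ℝ => t * inner ℝ (f' x) d) (inner ℝ (f' x) d) t := by
      simpa using (hasDerivAt_id t).mul_const (inner ℝ (f' x) d)
    have h3 : HasDerivAt (fun t : ℝ => L / 2 * ‖d‖ ^ 2 * t ^ 2)
        (L / 2 * ‖d‖ ^ 2 * (2 * t)) t := by
      simpa using (hasDerivAt_pow 2 t).const_mul (L / 2 * ‖d‖ ^ 2)
    exact (h1.sub h2).sub h3
  have hanti : AntitoneOn φ (Set.Icc 0 1) := by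
    refine antitoneOn_of_deriv_nonpos (convex_Icc 0 1)
      (fun t _ => (hφ t).continuousAt.continuousWithinAt)
      (fun t _ => (hφ t).differentiableAt.differentiableWithinAt) fun t ht => ?_
    rw [interior_Icc] at ht
    rw [(hφ t).deriv, ← inner_sub_left]
    have h1 := real_inner_le_norm (f' (x + t • d) - f' x) d
    have h2 := hL (x + t • d) x
    rw [add_sub_cancel_left, norm_smul, Real.norm_eq_abs, abs_of_pos ht.1] at h2
    nlinarith [norm_nonneg d]
  have h := hanti (Set.left_mem_Icc.2 zero_le_one) (Set.right_mem_Icc.2 zero_le_one) zero_le_one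
  simp only [φ, one_smul, zero_smul, add_zero, one_mul, zero_mul, one_pow, mul_one, sub_zero,
    ne_eq, OfNat.ofNat_ne_zero, not_false_eq_true, zero_pow, mul_zero] at h
  rw [hd, add_sub_cancel] at h
  rw [hd]
  linarith

end Convexity

/-! ### Derivatives of the objectives -/

section Calculus

variable {a b : ℕ} {c : Consts}

lemma hasFDerivAt_slice_left {E F G : Type*} [NormedAddCommGroup E] [NormedSpace ℝ E]
    [NormedAddCommGroup F] [NormedSpace ℝ F] [NormedAddCommGroup G] [NormedSpace ℝ G]
    {h : E → F → G} {D : E × F →L[ℝ] G} {x : E} {y : F}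
    (hD : HasFDerivAt (fun z : E × F => h z.1 z.2) D (x, y)) :
    HasFDerivAt (fun x' => h x' y) (D.comp (ContinuousLinearMap.inl ℝ E F)) x :=
  hD.comp (f := fun x' => (x', y)) x (hasFDerivAt_prodMk_left x y)

lemma hasFDerivAt_slice_right {E F G : Type*} [NormedAddCommGroup E] [NormedSpace ℝ E]
    [NormedAddCommGroup F] [NormedSpace ℝ F] [NormedAddCommGroup G] [NormedSpace ℝ G]
    {h : E → F → G} {D : E × F →L[ℝ] G} {x : E} {y : F}
    (hD : HasFDerivAt (fun z : E × F => h z.1 z.2) D (x, y)) :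
    HasFDerivAt (fun y' => h x y') (D.comp (ContinuousLinearMap.inr ℝ E F)) y :=
  hD.comp (f := fun y' => (x, y')) y (hasFDerivAt_prodMk_right x y)

lemma sq_sqrt_add_sq (p q : ℝ) : √(p ^ 2 + q ^ 2) ^ 2 = p ^ 2 + q ^ 2 :=
  Real.sq_sqrt (by positivity)

lemma LipXY.left {E : Type*} [NormedAddCommGroup E] {L : ℝ} {F : Vec a → Vec b → E}
    (h : LipXY L F) (x x' : Vec a) (y : Vec b) : ‖F x y - F x' y‖ ≤ L * ‖x - x'‖ := by
  simpa [Real.sqrt_sq] using h x x' y y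

lemma LipXY.right {E : Type*} [NormedAddCommGroup E] {L : ℝ} {F : Vec a → Vec b → E}
    (h : LipXY L F) (x : Vec a) (y y' : Vec b) : ‖F x y - F x y'‖ ≤ L * ‖y - y'‖ := by
  simpa [Real.sqrt_sq] using h x x y y'

lemma LipXY.continuous {E : Type*} [NormedAddCommGroup E] {L : ℝ} {F : Vec a → Vec b → E}
    (h : LipXY L F) : Continuous fun z : Vec a × Vec b => F z.1 z.2 := by
  rw [continuous_iff_continuousAt]
  intro z
  rw [ContinuousAt, tendsto_iff_norm_sub_tendsto_zero]
  refine squeeze_zero (fun _ => norm_nonneg _) (fun z' => h z'.1 z.1 z'.2 z.2) ?_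
  have : Continuous fun z' : Vec a × Vec b =>
      L * √(‖z'.1 - z.1‖ ^ 2 + ‖z'.2 - z.2‖ ^ 2) := by fun_prop
  simpa using this.tendsto z

namespace UpperRegular

variable {f : Vec a → Vec b → ℝ} (hf : UpperRegular c f)

include hf

lemma hasGradientAt_x (x : Vec a) (y : Vec b) :
    HasGradientAt (fun x' => f x' y) (gradX f x y) x := by
  exact (hasFDerivAt_slice_left (hf.diff (x, y)).hasFDerivAt).differentiableAt.hasGradientAt

lemma hasGradientAt_y (x : Vec a) (y : Vec b) :
    HasGradientAt (fun y' => f x y') (gradY f x y) y := by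
  exact (hasFDerivAt_slice_right (hf.diff (x, y)).hasFDerivAt).differentiableAt.hasGradientAt

lemma fderiv_apply (x : Vec a) (y : Vec b) (v : Vec a) (w : Vec b) :
    fderiv ℝ (fun z : Vec a × Vec b => f z.1 z.2) (x, y) (v, w)
      = inner ℝ (gradX f x y) v + inner ℝ (gradY f x y) w := by
  have h := (hf.diff (x, y)).hasFDerivAt
  have h1 := hasFDerivAt_slice_left h
  have h2 := hasFDerivAt_slice_right h
  have e1 := congrArg (fun A => A v) (h1.unique (hf.hasGradientAt_x x y).hasFDerivAt)
  have e2 := congrArg (fun A => A w) (h2.unique (hf.hasGradientAt_y x y).hasFDerivAt)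
  simp only [ContinuousLinearMap.comp_apply, ContinuousLinearMap.inl_apply,
    ContinuousLinearMap.inr_apply, InnerProductSpace.toDual_apply_apply] at e1 e2
  rw [← e1, ← e2, ← map_add]
  simp

end UpperRegular

namespace LowerRegular

variable {g : Vec a → Vec b → ℝ} (hg : LowerRegular c g)

include hg

lemma differentiable : Differentiable ℝ fun z : Vec a × Vec b => g z.1 z.2 :=
  hg.contDiff.differentiable (by norm_num)

lemma hasGradientAt_y (x : Vec a) (y : Vec b) :
    HasGradientAt (fun y' => g x y') (gradY g x y) y := by
  exact (hasFDerivAt_slice_right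
    (hg.differentiable (x, y)).hasFDerivAt).differentiableAt.hasGradientAt

lemma contDiff_gradY : ContDiff ℝ 1 fun z : Vec a × Vec b => gradY g z.1 z.2 := by
  have h1 : ContDiff ℝ 1 (fderiv ℝ fun z : Vec a × Vec b => g z.1 z.2) :=
    hg.contDiff.fderiv_right (by norm_num)
  have h2 : (fun z : Vec a × Vec b => gradY g z.1 z.2) = fun z =>
      (InnerProductSpace.toDual ℝ (Vec b)).symm
        ((fderiv ℝ (fun z : Vec a × Vec b => g z.1 z.2) z).comp
          (ContinuousLinearMap.inr ℝ (Vec a) (Vec b))) := by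
    funext z
    rw [gradY, gradient, (hasFDerivAt_slice_right (hg.differentiable z).hasFDerivAt).fderiv]
  rw [h2]
  exact (InnerProductSpace.toDual ℝ (Vec b)).symm.contDiff.comp (h1.clm_comp contDiff_const)

lemma hasFDerivAt_gradY_y (x : Vec a) (y : Vec b) :
    HasFDerivAt (fun y' => gradY g x y') (hessYY g x y) y := by
  exact (hasFDerivAt_slice_right (h := gradY g) ((hg.contDiff_gradY.differentiable
    (by norm_num)) (x, y)).hasFDerivAt).differentiableAt.hasFDerivAt

lemma hasFDerivAt_gradY_x (x : Vec a) (y : Vec b) :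
    HasFDerivAt (fun x' => gradY g x' y) (ContinuousLinearMap.adjoint (hessXY g x y)) x := by
  rw [hessXY, ContinuousLinearMap.adjoint_adjoint]
  exact (hasFDerivAt_slice_left (h := gradY g) ((hg.contDiff_gradY.differentiable
    (by norm_num)) (x, y)).hasFDerivAt).differentiableAt.hasFDerivAt

/-- The total derivative of `∇_y g`. -/
lemma hasFDerivAt_gradY (x : Vec a) (y : Vec b) :
    HasFDerivAt (fun z : Vec a × Vec b => gradY g z.1 z.2)
      ((ContinuousLinearMap.adjoint (hessXY g x y)).coprod (hessYY g x y)) (x, y) := by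
  have h := ((hg.contDiff_gradY.differentiable (by norm_num)) (x, y)).hasFDerivAt
  have e1 := (hasFDerivAt_slice_left (h := gradY g) h).unique (hg.hasFDerivAt_gradY_x x y)
  have e2 := (hasFDerivAt_slice_right (h := gradY g) h).unique (hg.hasFDerivAt_gradY_y x y)
  have e : (ContinuousLinearMap.adjoint (hessXY g x y)).coprod (hessYY g x y)
      = fderiv ℝ (fun z : Vec a × Vec b => gradY g z.1 z.2) (x, y) := by
    rw [← e1, ← e2, ← ContinuousLinearMap.comp_coprod, ContinuousLinearMap.coprod_inl_inr,
      ContinuousLinearMap.comp_id]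
  rw [e]
  exact h

lemma hessYY_symm (x : Vec a) (y v w : Vec b) :
    inner ℝ (hessYY g x y v) w = inner ℝ v (hessYY g x y w) := by
  have hy : ContDiff ℝ 2 (fun y' => g x y') :=
    hg.contDiff.comp (contDiff_const.prodMk contDiff_id)
  have hs : IsSymmSndFDerivAt ℝ (fun y' => g x y') y :=
    hy.contDiffAt.isSymmSndFDerivAt (by simp)
  have h1 : fderiv ℝ (fderiv ℝ (fun y' => g x y')) y
      = ((InnerProductSpace.toDual ℝ (Vec b)).toContinuousLinearEquiv.toContinuousLinearMap).comp
        (hessYY g x y) := by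
    have h2 : fderiv ℝ (fun y' => g x y')
        = fun y' => InnerProductSpace.toDual ℝ (Vec b) (gradY g x y') := by
      funext y'
      exact (hg.hasGradientAt_y x y').hasFDerivAt.fderiv
    rw [h2]
    exact (((InnerProductSpace.toDual ℝ
      (Vec b)).toContinuousLinearEquiv.toContinuousLinearMap.hasFDerivAt).comp y
        (hg.hasFDerivAt_gradY_y x y)).fderiv
  have h3 := hs v w
  rw [h1] at h3
  rw [real_inner_comm (hessYY g x y w) v]
  exact h3

lemma gradY_monotone (x : Vec a) (y y' : Vec b) :
    c.μg * ‖y - y'‖ ^ 2 ≤ inner ℝ (gradY g x y - gradY g x y') (y - y') :=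
  strongConvex_monotone (hg.strongConvex x) (hg.hasGradientAt_y x y') (hg.hasGradientAt_y x y)

lemma hessYY_coercive (x : Vec a) (y v : Vec b) :
    c.μg * ‖v‖ ^ 2 ≤ inner ℝ (hessYY g x y v) v := by
  have h1 : HasDerivAt (fun t : ℝ => gradY g x (y + t • v)) (hessYY g x y v) 0 := by
    have h2 : HasDerivAt (fun s : ℝ => y + s • v) v 0 := by
      simpa using ((hasDerivAt_id (0 : ℝ)).smul_const v).const_add y
    have h3 : HasFDerivAt (fun y' => gradY g x y') (hessYY g x y) (y + (0 : ℝ) • v) := by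
      simpa using hg.hasFDerivAt_gradY_y x y
    exact h3.comp_hasDerivAt 0 h2
  have h2 := (hasDerivAt_iff_tendsto_slope_zero.1 h1).inner (𝕜 := ℝ)
    (tendsto_const_nhds (x := v) (f := nhdsWithin (0 : ℝ) {0}ᶜ))
  refine ge_of_tendsto h2 ?_
  filter_upwards [self_mem_nhdsWithin] with t ht
  have ht : t ≠ 0 := ht
  have h3 := hg.gradY_monotone x (y + t • v) y
  rw [add_sub_cancel_left, norm_smul, Real.norm_eq_abs, mul_pow, sq_abs,
    real_inner_smul_right] at h3
  simp only [zero_add, zero_smul, add_zero]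
  rw [real_inner_smul_left]
  have h4 : 0 < t ^ 2 := by positivity
  have h5 : t ^ 2 * (c.μg * ‖v‖ ^ 2) ≤
      t ^ 2 * (t⁻¹ * inner ℝ (gradY g x (y + t • v) - gradY g x y) v) := by
    have e : t ^ 2 * (t⁻¹ * inner ℝ (gradY g x (y + t • v) - gradY g x y) v)
        = t * inner ℝ (gradY g x (y + t • v) - gradY g x y) v := by
      field_simp
    rw [e]; linarith
  exact le_of_mul_le_mul_left h5 h4

lemma norm_hessYY_le (hc : c.Valid) (x : Vec a) (y : Vec b) : ‖hessYY g x y‖ ≤ c.Lg := by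
  have hL : 0 ≤ c.Lg := (hc.μg_pos.trans hc.μg_lt_Lg).le
  have : LipschitzWith ⟨c.Lg, hL⟩ (fun y' => gradY g x y') :=
    LipschitzWith.of_dist_le_mul fun y y' => by
      rw [dist_eq_norm, dist_eq_norm]; exact hg.lip_gradY.right x y y'
  exact (hg.hasFDerivAt_gradY_y x y).le_of_lipschitz this

lemma inner_hessYY_le (hc : c.Valid) (x : Vec a) (y v : Vec b) :
    inner ℝ (hessYY g x y v) v ≤ c.Lg * ‖v‖ ^ 2 := by
  have h1 := real_inner_le_norm (hessYY g x y v) v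
  have h2 := (hessYY g x y).le_of_opNorm_le (hg.norm_hessYY_le hc x y) v
  nlinarith [norm_nonneg v]

/-- The factors of the Neumann series for `[∇²_yy g]⁻¹` have norm at most `1 - μ_g / L_g`. -/
lemma norm_one_sub_hessYY_le (hc : c.Valid) (x : Vec a) (y : Vec b) :
    ‖(1 : Vec b →L[ℝ] Vec b) - (1 / c.Lg) • hessYY g x y‖ ≤ 1 - c.μg / c.Lg := by
  have hL : 0 < c.Lg := hc.μg_pos.trans hc.μg_lt_Lg
  have hq : 0 < 1 - c.μg / c.Lg := by
    rw [sub_pos, div_lt_one hL]; exact hc.μg_lt_Lg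
  refine ContinuousLinearMap.opNorm_le_bound _ hq.le
    (norm_apply_le_of_symmetric hq (fun v w => ?_) fun v => ?_)
  · simp [inner_sub_left, inner_sub_right, real_inner_smul_left, real_inner_smul_right,
      hg.hessYY_symm x y v w]
  · have h1 := hg.hessYY_coercive x y v
    have h2 := hg.inner_hessYY_le hc x y v
    simp only [_root_.sub_apply, one_apply_eq_self,
      _root_.smul_apply, inner_sub_left, real_inner_smul_left,
      real_inner_self_eq_norm_sq]
    set I := inner ℝ (hessYY g x y v) v
    have h3 : 1 / c.Lg * I ≤ ‖v‖ ^ 2 := by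
      rw [one_div, inv_mul_le_iff₀ hL]; exact h2
    have h4 : c.μg / c.Lg * ‖v‖ ^ 2 ≤ 1 / c.Lg * I := by
      rw [div_mul_eq_mul_div, div_le_iff₀ hL]
      field_simp
      exact h1
    rw [abs_of_nonneg (by linarith)]
    linarith

lemma norm_hessYY_sub_le (hc : c.Valid) (x : Vec a) (y : Vec b) :
    ‖hessYY g x y - ((c.Lg + c.μg) / 2) • (1 : Vec b →L[ℝ] Vec b)‖ ≤ (c.Lg - c.μg) / 2 := by
  have hq : 0 < (c.Lg - c.μg) / 2 := by linarith [hc.μg_lt_Lg]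
  refine ContinuousLinearMap.opNorm_le_bound _ hq.le
    (norm_apply_le_of_symmetric hq (fun v w => ?_) fun v => ?_)
  · simp [inner_sub_left, inner_sub_right, real_inner_smul_left, real_inner_smul_right,
      hg.hessYY_symm x y v w]
  · have h1 := hg.hessYY_coercive x y v
    have h2 := hg.inner_hessYY_le hc x y v
    simp only [_root_.sub_apply, one_apply_eq_self,
      _root_.smul_apply, inner_sub_left, real_inner_smul_left,
      real_inner_self_eq_norm_sq]
    rw [abs_le]
    constructor <;> linarith

/-- Interpolation inequality for smooth strongly convex functions: `∇_y g - (L_g + μ_g)/2` is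
Lipschitz with constant `(L_g - μ_g)/2`, by the mean value inequality. -/
lemma gradY_interpolation (hc : c.Valid) (x : Vec a) (y y' : Vec b) :
    ‖gradY g x y - gradY g x y'‖ ^ 2 + c.μg * c.Lg * ‖y - y'‖ ^ 2 ≤
      (c.μg + c.Lg) * inner ℝ (gradY g x y - gradY g x y') (y - y') := by
  have h := Convex.norm_image_sub_le_of_norm_hasFDerivWithin_le (𝕜 := ℝ) (s := Set.univ)
    (f := fun y' => gradY g x y' - ((c.Lg + c.μg) / 2) • y') (x := y') (y := y)
    (f' := fun y' => hessYY g x y' - ((c.Lg + c.μg) / 2) • (1 : Vec b →L[ℝ] Vec b))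
    (fun y'' _ => (((hg.hasFDerivAt_gradY_y x y'').sub
      ((hasFDerivAt_id y'').const_smul ((c.Lg + c.μg) / 2)))).hasFDerivWithinAt)
    (fun y'' _ => hg.norm_hessYY_sub_le hc x y'') convex_univ (Set.mem_univ _) (Set.mem_univ _)
  have e : gradY g x y - ((c.Lg + c.μg) / 2) • y - (gradY g x y' - ((c.Lg + c.μg) / 2) • y')
      = (gradY g x y - gradY g x y') - ((c.Lg + c.μg) / 2) • (y - y') := by
    rw [smul_sub]; abel
  rw [e] at h
  have h2 := pow_le_pow_left₀ (norm_nonneg _) h 2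
  rw [norm_sub_sq_real, real_inner_smul_right, norm_smul, mul_pow, Real.norm_eq_abs, sq_abs,
    mul_pow] at h2
  linarith

lemma gradY_lip_x (x x' : Vec a) (y : Vec b) :
    ‖gradY g x y - gradY g x' y‖ ≤ c.Cgxy * ‖x - x'‖ :=
  Convex.norm_image_sub_le_of_norm_hasFDerivWithin_le (𝕜 := ℝ) (s := Set.univ)
    (fun x'' _ => (hg.hasFDerivAt_gradY_x x'' y).hasFDerivWithinAt)
    (fun x'' _ => by
      rw [LinearIsometryEquiv.norm_map]; exact hg.bound_hessXY x'' y)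
    convex_univ (Set.mem_univ _) (Set.mem_univ _)

lemma mul_norm_le_norm_hessYY (x : Vec a) (y v : Vec b) :
    c.μg * ‖v‖ ≤ ‖hessYY g x y v‖ := by
  rcases (norm_nonneg v).eq_or_lt with h | h
  · rw [← h]; simp
  · have h1 := hg.hessYY_coercive x y v
    have h2 := real_inner_le_norm (hessYY g x y v) v
    refine le_of_mul_le_mul_right ?_ h
    nlinarith

lemma isUnit_hessYY (hc : c.Valid) (x : Vec a) (y : Vec b) : IsUnit (hessYY g x y) := by
  have hL : 0 < c.Lg := hc.μg_pos.trans hc.μg_lt_Lg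
  have h1 : ‖(1 : Vec b →L[ℝ] Vec b) - (1 / c.Lg) • hessYY g x y‖ < 1 :=
    (hg.norm_one_sub_hessYY_le hc x y).trans_lt (by
      have : 0 < c.μg / c.Lg := div_pos hc.μg_pos hL
      linarith)
  have h2 := isUnit_one_sub_of_norm_lt_one h1
  rw [sub_sub_cancel] at h2
  have h3 : hessYY g x y
      = algebraMap ℝ (Vec b →L[ℝ] Vec b) c.Lg * ((1 / c.Lg) • hessYY g x y) := by
    rw [← Algebra.smul_def, smul_smul, mul_one_div_cancel hL.ne', one_smul]
  rw [h3]
  exact ((isUnit_iff_ne_zero.2 hL.ne').map _).mul h2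

lemma hessYY_inverse_apply (hc : c.Valid) (x : Vec a) (y v : Vec b) :
    hessYY g x y ((hessYY g x y).inverse v) = v := by
  have := Ring.mul_inverse_cancel _ (hg.isUnit_hessYY hc x y)
  rw [ContinuousLinearMap.ringInverse_eq_inverse] at this
  exact congrArg (fun A => A v) this

lemma inverse_hessYY_apply (hc : c.Valid) (x : Vec a) (y v : Vec b) :
    (hessYY g x y).inverse (hessYY g x y v) = v := by
  have := Ring.inverse_mul_cancel _ (hg.isUnit_hessYY hc x y)
  rw [ContinuousLinearMap.ringInverse_eq_inverse] at this
  exact congrArg (fun A => A v) this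

lemma norm_inverse_hessYY_le (hc : c.Valid) (x : Vec a) (y v : Vec b) :
    ‖(hessYY g x y).inverse v‖ ≤ ‖v‖ / c.μg := by
  rw [le_div_iff₀ hc.μg_pos, mul_comm]
  simpa [hg.hessYY_inverse_apply hc] using
    hg.mul_norm_le_norm_hessYY x y ((hessYY g x y).inverse v)

lemma inverse_hessYY_symm (hc : c.Valid) (x : Vec a) (y v w : Vec b) :
    inner ℝ ((hessYY g x y).inverse v) w = inner ℝ v ((hessYY g x y).inverse w) := by
  conv_lhs => rw [← hg.hessYY_inverse_apply hc x y w]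
  rw [← hg.hessYY_symm, hg.hessYY_inverse_apply hc]

end LowerRegular

end Calculus

/-! ### The lower-level solution and the hypergradient -/

namespace Consts

variable {c : Consts}

lemma Ll_eq : c.Ll = c.Lf * (1 + c.Ly) := by rw [Ll, Ly]; ring

namespace Valid

variable (hc : c.Valid)

include hc

lemma Lg_pos : 0 < c.Lg := hc.μg_pos.trans hc.μg_lt_Lg

lemma Ly_pos : 0 < c.Ly := div_pos hc.Cgxy_pos hc.μg_pos

lemma Lμ_pos : 0 < c.Lμ :=
  div_pos (mul_pos hc.μg_pos hc.Lg_pos) (add_pos hc.μg_pos hc.Lg_pos)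

lemma Ll_pos : 0 < c.Ll := by
  rw [Ll_eq]; exact mul_pos hc.Lf_pos (by linarith [hc.Ly_pos])

end Valid

end Consts

section Hypergradient

variable {a b : ℕ} {c : Consts} {f g : Vec a → Vec b → ℝ}

namespace LowerRegular

variable (hg : LowerRegular c g)

include hg

lemma exists_isMinOn (hc : c.Valid) (x : Vec a) : ∃ y, IsMinOn (g x) Set.univ y := by
  have hcont : Continuous (g x) :=
    hg.contDiff.continuous.comp (continuous_const.prodMk continuous_id)
  have hbd : ∀ y, g x 0 + (c.μg / 2 * ‖y‖ - ‖gradY g x 0‖) * ‖y‖ ≤ g x y := by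
    intro y
    have h1 := strongConvex_lower_bound (hg.strongConvex x) (hg.hasGradientAt_y x 0) y
    have h2 := neg_le_of_abs_le (abs_real_inner_le_norm (gradY g x 0) y)
    simp only [sub_zero] at h1
    nlinarith
  have ht : Filter.Tendsto (fun y : Vec b => g x 0 + (c.μg / 2 * ‖y‖ - ‖gradY g x 0‖) * ‖y‖)
      (Filter.cocompact _) Filter.atTop := by
    have h1 := tendsto_norm_cocompact_atTop (E := Vec b)
    refine Filter.tendsto_atTop_add_const_left _ _ (Filter.Tendsto.atTop_mul_atTop₀ ?_ h1)
    exact Filter.tendsto_atTop_add_const_right _ _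
      (h1.const_mul_atTop (half_pos hc.μg_pos))
  obtain ⟨y, hy⟩ := hcont.exists_forall_le (Filter.tendsto_atTop_mono hbd ht)
  exact ⟨y, fun z _ => hy z⟩

lemma gradY_argminY (hc : c.Valid) (x : Vec a) : gradY g x (argminY g x) = 0 := by
  have h1 : IsMinOn (g x) Set.univ (argminY g x) :=
    Classical.epsilon_spec (hg.exists_isMinOn hc x)
  have h2 : IsLocalMin (g x) (argminY g x) := h1.isLocalMin Filter.univ_mem
  rw [gradY, gradient, h2.fderiv_eq_zero, map_zero]

/-- The lower-level solution is Lipschitz. -/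
lemma argminY_lip (hc : c.Valid) (x x' : Vec a) :
    ‖argminY g x - argminY g x'‖ ≤ c.Ly * ‖x - x'‖ := by
  set y := argminY g x
  set y' := argminY g x'
  have h1 := hg.gradY_monotone x y y'
  have h2 : gradY g x y = gradY g x' y' := by
    rw [hg.gradY_argminY hc, hg.gradY_argminY hc]
  rw [h2] at h1
  have h3 := real_inner_le_norm (gradY g x' y' - gradY g x y') (y - y')
  have h4 := hg.gradY_lip_x x' x y'
  rw [norm_sub_rev x' x] at h4
  rw [Consts.Ly, div_mul_eq_mul_div, le_div_iff₀ hc.μg_pos]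
  rcases (norm_nonneg (y - y')).eq_or_lt with h | h
  · rw [← h, zero_mul]
    exact mul_nonneg hc.Cgxy_pos.le (norm_nonneg _)
  · refine le_of_mul_le_mul_right ?_ h
    nlinarith

lemma continuous_argminY (hc : c.Valid) : Continuous (argminY g) := by
  have : LipschitzWith ⟨c.Ly, hc.Ly_pos.le⟩ (argminY g) :=
    LipschitzWith.of_dist_le_mul fun x y => by
      rw [dist_eq_norm, dist_eq_norm]; exact hg.argminY_lip hc x y
  exact this.continuous

/-- The implicit function theorem for `∇_y g (x, y^*(x)) = 0`, made elementary by the Lipschitz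
continuity of `y^*`. -/
lemma hasFDerivAt_argminY (hc : c.Valid) (x : Vec a) :
    HasFDerivAt (argminY g)
      (-((hessYY g x (argminY g x)).inverse.comp
        (ContinuousLinearMap.adjoint (hessXY g x (argminY g x))))) x := by
  set y := argminY g x with hy
  set H := hessYY g x y
  set J := ContinuousLinearMap.adjoint (hessXY g x y)
  have h1 := (hg.hasFDerivAt_gradY x y).isLittleO
  have hbig : (fun x' => argminY g x' - y) =O[nhds x] fun x' => x' - x :=
    Asymptotics.IsBigO.of_bound c.Ly (Filter.Eventually.of_forall fun x' => hg.argminY_lip hc x' x)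
  have hcont : Filter.Tendsto (fun x' => (x', argminY g x')) (nhds x) (nhds (x, y)) :=
    Filter.Tendsto.prodMk_nhds Filter.tendsto_id (hg.continuous_argminY hc).continuousAt
  have h2 := h1.comp_tendsto hcont
  have hpair : ((fun z : Vec a × Vec b => z - (x, y)) ∘ fun x' => (x', argminY g x'))
      =O[nhds x] fun x' => x' - x := by
    have : ((fun z : Vec a × Vec b => z - (x, y)) ∘ fun x' => (x', argminY g x'))
        = fun x' => (x' - x, argminY g x' - y) := rfl
    rw [this]
    exact (Asymptotics.isBigO_refl _ _).prod_left hbig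
  have h3 := h2.trans_isBigO hpair
  have h4 := (H.inverse.isBigO_comp _ _).trans_isLittleO h3
  refine HasFDerivAt.of_isLittleO (h4.neg_left.congr_left fun x' => ?_)
  have e1 : gradY g x' (argminY g x') = 0 := hg.gradY_argminY hc x'
  have e2 : gradY g x y = 0 := hg.gradY_argminY hc x
  simp only [Function.comp_apply, e1, e2, sub_zero, Prod.mk_sub_mk,
    ContinuousLinearMap.coprod_apply, zero_sub, map_neg, neg_neg, map_add]
  -- both gradients vanish, so that the inverse Hessian applied to the first-order remainder of
  -- `∇_y g` is the remainder of `y^*`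
  rw [hg.inverse_hessYY_apply hc x y]
  simp only [_root_.neg_apply, ContinuousLinearMap.comp_apply]
  abel

end LowerRegular

/-- The surrogate hypergradient is `L_f`-Lipschitz: applying the Hessian, which is
bounded below, to the difference of the two solutions avoids subtracting inverses. -/
lemma barGrad_lip (hc : c.Valid) (hf : UpperRegular c f) (hg : LowerRegular c g) :
    LipXY c.Lf (barGrad f g) := by
  intro x x' y y'
  set D := √(‖x - x'‖ ^ 2 + ‖y - y'‖ ^ 2)
  have hD : 0 ≤ D := Real.sqrt_nonneg _
  have hμ := hc.μg_pos
  set v := gradY f x y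
  set v' := gradY f x' y'
  set w := (hessYY g x y).inverse v with hw
  set w' := (hessYY g x' y').inverse v' with hw'
  have hv' : ‖w'‖ ≤ c.Cfy / c.μg := by
    refine (hg.norm_inverse_hessYY_le hc x' y' v').trans ?_
    gcongr
    exact hf.bound_gradY x' y'
  have hvv : ‖w‖ ≤ c.Cfy / c.μg := by
    refine (hg.norm_inverse_hessYY_le hc x y v).trans ?_
    gcongr
    exact hf.bound_gradY x y
  have h1 : ‖w - w'‖ ≤ (c.Lfy + c.Lgyy * (c.Cfy / c.μg)) * D / c.μg := by
    rw [le_div_iff₀ hμ, mul_comm]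
    refine (hg.mul_norm_le_norm_hessYY x y (w - w')).trans ?_
    have e : hessYY g x y (w - w') = (v - v') - (hessYY g x y - hessYY g x' y') w' := by
      rw [map_sub, hw, hg.hessYY_inverse_apply hc, _root_.sub_apply, hw',
        hg.hessYY_inverse_apply hc x' y']
      abel
    rw [e]
    have t1 := norm_sub_le (v - v') ((hessYY g x y - hessYY g x' y') w')
    have t2 := hf.lip_gradY x x' y y'
    have t3 := (hessYY g x y - hessYY g x' y').le_opNorm w'
    have t4 := hg.lip_hessYY x x' y y'
    have t5 : ‖hessYY g x y - hessYY g x' y'‖ * ‖w'‖ ≤ (c.Lgyy * D) * (c.Cfy / c.μg) :=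
      mul_le_mul t4 hv' (norm_nonneg _) (mul_nonneg hc.Lgyy_nonneg hD)
    calc _ ≤ _ := t1
      _ ≤ c.Lfy * D + (c.Lgyy * D) * (c.Cfy / c.μg) := add_le_add t2 (t3.trans t5)
      _ = _ := by ring
  have e : barGrad f g x y - barGrad f g x' y' = (gradX f x y - gradX f x' y')
      - ((hessXY g x y - hessXY g x' y') w + hessXY g x' y' (w - w')) := by
    simp only [barGrad, _root_.sub_apply, map_sub]
    abel
  rw [e]
  have t1 := norm_sub_le (gradX f x y - gradX f x' y')
    ((hessXY g x y - hessXY g x' y') w + hessXY g x' y' (w - w'))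
  have t2 := norm_add_le ((hessXY g x y - hessXY g x' y') w) (hessXY g x' y' (w - w'))
  have t3 := hf.lip_gradX x x' y y'
  have t4 : ‖(hessXY g x y - hessXY g x' y') w‖ ≤ (c.Lgxy * D) * (c.Cfy / c.μg) :=
    ((hessXY g x y - hessXY g x' y').le_opNorm w).trans
      (mul_le_mul (hg.lip_hessXY x x' y y') hvv (norm_nonneg _)
        (mul_nonneg hc.Lgxy_nonneg hD))
  have t5 : ‖hessXY g x' y' (w - w')‖ ≤
      c.Cgxy * ((c.Lfy + c.Lgyy * (c.Cfy / c.μg)) * D / c.μg) :=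
    ((hessXY g x' y').le_opNorm _).trans
      (mul_le_mul (hg.bound_hessXY x' y') h1 (norm_nonneg _) hc.Cgxy_pos.le)
  calc _ ≤ _ := t1
    _ ≤ c.Lfx * D + ((c.Lgxy * D) * (c.Cfy / c.μg)
        + c.Cgxy * ((c.Lfy + c.Lgyy * (c.Cfy / c.μg)) * D / c.μg)) :=
      add_le_add t3 (t2.trans (add_le_add t4 t5))
    _ = c.Lf * D := by rw [Consts.Lf]; field_simp; ring

/-- The gradient of `x ↦ f(x, y^*(x))` is the surrogate hypergradient at `(x, y^*(x))`. -/
lemma hasGradientAt_hyper (hc : c.Valid) (hf : UpperRegular c f) (hg : LowerRegular c g)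
    (x : Vec a) :
    HasGradientAt (fun x' => f x' (argminY g x')) (barGrad f g x (argminY g x)) x := by
  have h1 := (hasFDerivAt_id x).prodMk (hg.hasFDerivAt_argminY hc x)
  have h2 := (hf.diff (x, argminY g x)).hasFDerivAt.comp (f := fun x' => (x', argminY g x')) x h1
  rw [hasGradientAt_iff_hasFDerivAt]
  refine h2.congr_fderiv ?_
  ext1 v
  rw [ContinuousLinearMap.comp_apply, ContinuousLinearMap.prod_apply, hf.fderiv_apply]
  simp only [ContinuousLinearMap.id_apply, _root_.neg_apply, ContinuousLinearMap.comp_apply,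
    InnerProductSpace.toDual_apply_apply, barGrad, inner_sub_left, inner_neg_right]
  rw [← hg.inverse_hessYY_symm hc, ContinuousLinearMap.adjoint_inner_right]
  ring

lemma hyper_lip (hc : c.Valid) (hf : UpperRegular c f) (hg : LowerRegular c g) (x x' : Vec a) :
    ‖barGrad f g x (argminY g x) - barGrad f g x' (argminY g x')‖ ≤ c.Ll * ‖x - x'‖ := by
  refine (barGrad_lip hc hf hg x x' _ _).trans ?_
  rw [Consts.Ll_eq, mul_assoc]
  refine mul_le_mul_of_nonneg_left ?_ hc.Lf_pos.le
  have h := hg.argminY_lip hc x x'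
  have hy := hc.Ly_pos
  rw [Real.sqrt_le_left (by positivity)]
  nlinarith [norm_nonneg (x - x'), norm_nonneg (argminY g x - argminY g x')]

end Hypergradient

namespace Problem

variable {m dup dlow : ℕ} {Ξ : Type u} {Z : Type v} [MeasurableSpace Ξ] [MeasurableSpace Z]
  {B : Problem m dup dlow Ξ Z} {c : Consts}

/-- `∇l`, in terms of the surrogate hypergradients of the agents. -/
def gradL (B : Problem m dup dlow Ξ Z) (x : Vec dup) : Vec dup :=
  avg fun i => barGrad (B.F i) (B.G i) x (B.yStar i x)

variable (hc : c.Valid) (hB : B.Regular c)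

include hc hB

lemma hasGradientAt_l (x : Vec dup) : HasGradientAt B.l (B.gradL x) x := by
  have h : HasFDerivAt (fun x' => (1 / (m : ℝ)) * ∑ i, B.F i x' (B.yStar i x')) _ x :=
    (HasFDerivAt.fun_sum (u := Finset.univ) fun i _ =>
      (hasGradientAt_hyper hc (hB.upper i) (hB.lower i) x).hasFDerivAt).const_mul (1 / (m : ℝ))
  rw [hasGradientAt_iff_hasFDerivAt]
  refine h.congr_fderiv ?_
  simp only [gradL, avg, map_smul, map_sum]
  rfl

lemma gradient_l (x : Vec dup) : gradient B.l x = B.gradL x := (hasGradientAt_l hc hB x).gradient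

lemma norm_gradL_sub_sq_le (hm : 0 < m) (x : Vec dup) (X : Fin m → Vec dup)
    (Y : Fin m → Vec dlow) :
    ‖B.gradL x - avg fun i => barGrad (B.F i) (B.G i) (X i) (Y i)‖ ^ 2 ≤
      (1 / (m : ℝ)) * (2 * c.Ll ^ 2 * ∑ i, ‖X i - x‖ ^ 2
        + 2 * c.Lf ^ 2 * ∑ i, ‖B.yStar i (X i) - Y i‖ ^ 2) := by
  rw [gradL, ← avg_sub]
  refine (norm_avg_sq_le hm _).trans ?_
  gcongr
  rw [Finset.mul_sum, Finset.mul_sum, ← Finset.sum_add_distrib]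
  refine Finset.sum_le_sum fun i _ => ?_
  have h1 := hyper_lip hc (hB.upper i) (hB.lower i) x (X i)
  have h2 := (barGrad_lip hc (hB.upper i) (hB.lower i)).right (X i) (B.yStar i (X i)) (Y i)
  rw [norm_sub_rev x] at h1
  have h3 := norm_sub_le_norm_sub_add_norm_sub (barGrad (B.F i) (B.G i) x (B.yStar i x))
    (barGrad (B.F i) (B.G i) (X i) (B.yStar i (X i))) (barGrad (B.F i) (B.G i) (X i) (Y i))
  have h4 : ‖barGrad (B.F i) (B.G i) x (B.yStar i x) - barGrad (B.F i) (B.G i) (X i) (Y i)‖ ≤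
      c.Ll * ‖X i - x‖ + c.Lf * ‖B.yStar i (X i) - Y i‖ := h3.trans (add_le_add h1 h2)
  have h5 := pow_le_pow_left₀ (norm_nonneg _) h4 2
  nlinarith [sq_nonneg (c.Ll * ‖X i - x‖ - c.Lf * ‖B.yStar i (X i) - Y i‖)]

lemma gradL_lip (hm : 0 < m) (x x' : Vec dup) : ‖B.gradL x - B.gradL x'‖ ≤ c.Ll * ‖x - x'‖ := by
  have hm' : (0 : ℝ) < m := by exact_mod_cast hm
  rw [gradL, gradL, ← avg_sub, avg, norm_smul, Real.norm_eq_abs, abs_of_pos (by positivity),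
    one_div, inv_mul_le_iff₀ hm']
  refine (norm_sum_le _ _).trans ((Finset.sum_le_sum fun i _ =>
    hyper_lip hc (hB.upper i) (hB.lower i) x x').trans ?_)
  simp

lemma continuous_gradL (hm : 0 < m) : Continuous B.gradL := by
  have : LipschitzWith ⟨c.Ll, hc.Ll_pos.le⟩ B.gradL :=
    LipschitzWith.of_dist_le_mul fun x y => by
      rw [dist_eq_norm, dist_eq_norm]; exact gradL_lip hc hB hm x y
  exact this.continuous

lemma continuous_l : Continuous B.l :=
  continuous_iff_continuousAt.2 fun x => (hasGradientAt_l hc hB x).continuousAt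

lemma l_le (hm : 0 < m) (x y : Vec dup) :
    B.l y ≤ B.l x + inner ℝ (B.gradL x) (y - x) + c.Ll / 2 * ‖y - x‖ ^ 2 :=
  le_of_lipschitz_gradient (hasGradientAt_l hc hB) (gradL_lip hc hB hm) x y

omit hc in
lemma lStar_le (x : Vec dup) : B.lStar ≤ B.l x := ciInf_le hB.bddBelow x

/-- Descent of `l` along a step of size `α` in direction `u`. -/
lemma l_step_le (hm : 0 < m) (x u : Vec dup) (α : ℝ) :
    B.l (x - α • u) ≤ B.l x - α / 2 * ‖B.gradL x‖ ^ 2 - (α / 2 - c.Ll / 2 * α ^ 2) * ‖u‖ ^ 2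
      + α / 2 * ‖B.gradL x - u‖ ^ 2 := by
  have h := l_le hc hB hm x (x - α • u)
  rw [sub_sub_cancel_left, inner_neg_right, norm_neg, real_inner_smul_right, norm_smul, mul_pow,
    Real.norm_eq_abs, sq_abs] at h
  rw [norm_sub_sq_real]
  linarith

/-- One step of gradient descent on the lower-level problem with an inexact gradient `v`, while
the upper variable moves from `x` to `x'`. -/
lemma lower_step_le (i : Fin m) {β : ℝ} (hβ : 0 < β) (hβ' : β ≤ 1 / (c.μg + c.Lg))
    (x x' : Vec dup) (y v : Vec dlow) :
    ‖B.yStar i x' - (y - β • v)‖ ^ 2 ≤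
      (1 - 3 / 4 * (β * c.Lμ)) * ‖B.yStar i x - y‖ ^ 2
        + 2 * β / c.Lμ * ‖v - gradY (B.G i) x y‖ ^ 2
        - β / (4 * (c.μg + c.Lg)) * ‖v‖ ^ 2
        + 17 * c.Ly ^ 2 / (4 * (β * c.Lμ)) * ‖x' - x‖ ^ 2 := by
  have hg := hB.lower i
  set ys := B.yStar i x with hys
  set e := v - gradY (B.G i) x y with he
  set S := c.μg + c.Lg with hS
  have hSpos : 0 < S := add_pos hc.μg_pos hc.Lg_pos
  have hLμ := hc.Lμ_pos
  set p := β * c.Lμ with hp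
  have hp0 : 0 < p := mul_pos hβ hLμ
  have hβS : β * S ≤ 1 := by rwa [le_div_iff₀ hSpos] at hβ'
  have hLS : c.Lμ * S = c.μg * c.Lg := div_mul_cancel₀ _ hSpos.ne'
  have hLμS : c.Lμ * 4 ≤ S := by
    have : c.Lμ * 4 * S ≤ S * S := by
      rw [mul_right_comm, hLS, hS]; nlinarith [sq_nonneg (c.μg - c.Lg)]
    exact le_of_mul_le_mul_right this hSpos
  have hp1 : p ≤ 1 / 4 := by nlinarith
  -- the interpolation inequality between `y` and the minimiser
  have hint : ‖gradY (B.G i) x y‖ ^ 2 + c.μg * c.Lg * ‖ys - y‖ ^ 2 ≤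
      S * inner ℝ (gradY (B.G i) x y) (y - ys) := by
    have h := hg.gradY_interpolation hc x y ys
    have h0 : gradY (B.G i) x ys = 0 := hg.gradY_argminY hc x
    rw [h0, sub_zero, norm_sub_rev y ys] at h
    exact h
  have hv : gradY (B.G i) x y = v - e := by rw [he]; abel
  rw [hv] at hint
  -- the inexact gradient step at a fixed upper variable
  have hstep : ‖ys - (y - β • v)‖ ^ 2 ≤ (1 - p) * ‖ys - y‖ ^ 2
      + β * (1 / c.Lμ + 10 / (3 * S)) * ‖e‖ ^ 2 - β / (4 * S) * ‖v‖ ^ 2 := by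
    have e1 : ys - (y - β • v) = β • v - (y - ys) := by abel
    have e2 : ‖y - ys‖ = ‖ys - y‖ := norm_sub_rev _ _
    rw [e1, norm_sub_sq_real, e2, norm_smul, mul_pow, Real.norm_eq_abs, sq_abs,
      real_inner_smul_left]
    have i1 : 2 * β * inner ℝ v (y - ys) =
        2 * β * inner ℝ (v - e) (y - ys) + 2 * β * inner ℝ e (y - ys) := by
      rw [inner_sub_left]; ring
    have i2 : -(2 * inner ℝ e (y - ys)) ≤ c.Lμ * ‖ys - y‖ ^ 2 + 1 / c.Lμ * ‖e‖ ^ 2 := by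
      have h1 := neg_le_of_abs_le (abs_real_inner_le_norm e (y - ys))
      rw [e2] at h1
      have h2 : c.Lμ * ‖ys - y‖ ^ 2 + 1 / c.Lμ * ‖e‖ ^ 2 - 2 * (‖e‖ * ‖ys - y‖)
          = (c.Lμ * ‖ys - y‖ - ‖e‖) ^ 2 / c.Lμ := by field_simp; ring
      have h3 : 0 ≤ (c.Lμ * ‖ys - y‖ - ‖e‖) ^ 2 / c.Lμ := by positivity
      linarith
    have i3 : 5 / 8 * ‖v‖ ^ 2 - 5 / 3 * ‖e‖ ^ 2 ≤ ‖v - e‖ ^ 2 := by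
      rw [norm_sub_sq_real v e]
      have h1 := real_inner_le_norm v e
      nlinarith [sq_nonneg (3 * ‖v‖ - 8 * ‖e‖)]
    have i4 : c.Lμ * ‖ys - y‖ ^ 2 + 1 / S * ‖v - e‖ ^ 2 ≤ inner ℝ (v - e) (y - ys) := by
      have : S * (c.Lμ * ‖ys - y‖ ^ 2 + 1 / S * ‖v - e‖ ^ 2) ≤
          S * inner ℝ (v - e) (y - ys) := by
        have e3 : S * (c.Lμ * ‖ys - y‖ ^ 2 + 1 / S * ‖v - e‖ ^ 2)
            = ‖v - e‖ ^ 2 + c.Lμ * S * ‖ys - y‖ ^ 2 := by field_simp; ring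
        rw [e3, hLS]; exact hint
      exact le_of_mul_le_mul_left this hSpos
    have i5 : β ^ 2 * ‖v‖ ^ 2 ≤ β * (1 / S) * ‖v‖ ^ 2 := by
      rw [sq β]
      gcongr
    have i6 : 1 / S * (5 / 8 * ‖v‖ ^ 2 - 5 / 3 * ‖e‖ ^ 2) ≤ 1 / S * ‖v - e‖ ^ 2 := by gcongr
    have i7 := mul_le_mul_of_nonneg_left i2 hβ.le
    have i8 := mul_le_mul_of_nonneg_left (i6.trans (le_sub_iff_add_le'.2 i4))
      (by positivity : 0 ≤ 2 * β)
    have e4 : β * (1 / c.Lμ + 10 / (3 * S)) * ‖e‖ ^ 2 - β / (4 * S) * ‖v‖ ^ 2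
        = β * (1 / c.Lμ * ‖e‖ ^ 2) + β * (1 / S) * ‖v‖ ^ 2
          - 2 * β * (1 / S * (5 / 8 * ‖v‖ ^ 2 - 5 / 3 * ‖e‖ ^ 2)) := by
      field_simp; ring
    rw [hp]
    linarith
  -- transfer to the new minimiser by Young's inequality with ratio `p / 4`
  have hyoung : ‖B.yStar i x' - (y - β • v)‖ ^ 2 ≤
      (1 + p / 4) * ‖ys - (y - β • v)‖ ^ 2 + (1 + 4 / p) * (c.Ly * ‖x' - x‖) ^ 2 := by
    have h1 := hg.argminY_lip hc x' x
    have h2 := norm_sub_le_norm_sub_add_norm_sub (B.yStar i x') ys (y - β • v)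
    have h3 : ‖B.yStar i x' - (y - β • v)‖ ≤ c.Ly * ‖x' - x‖ + ‖ys - (y - β • v)‖ :=
      h2.trans (add_le_add h1 le_rfl)
    refine (pow_le_pow_left₀ (norm_nonneg _) h3 2).trans ?_
    set A := c.Ly * ‖x' - x‖
    set D := ‖ys - (y - β • v)‖
    have h4 : (1 + p / 4) * D ^ 2 + (1 + 4 / p) * A ^ 2 - (A + D) ^ 2
        = (p * D - 4 * A) ^ 2 / (4 * p) := by field_simp; ring
    have h5 : 0 ≤ (p * D - 4 * A) ^ 2 / (4 * p) := by positivity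
    linarith
  have hfirst : (1 + p / 4) * ‖ys - (y - β • v)‖ ^ 2 ≤
      (1 - 3 / 4 * p) * ‖ys - y‖ ^ 2 + 2 * β / c.Lμ * ‖e‖ ^ 2 - β / (4 * S) * ‖v‖ ^ 2 := by
    refine (mul_le_mul_of_nonneg_left hstep (by positivity)).trans ?_
    have j1 : (1 + p / 4) * (1 - p) ≤ 1 - 3 / 4 * p := by nlinarith
    have j2 : (1 + p / 4) * (β * (1 / c.Lμ + 10 / (3 * S))) ≤ 2 * β / c.Lμ := by
      have k1 : 1 / S ≤ 1 / 4 * (1 / c.Lμ) := by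
        rw [one_div_mul_one_div, mul_comm 4]
        exact one_div_le_one_div_of_le (by positivity) hLμS
      have e5 : 10 / (3 * S) = 10 / 3 * (1 / S) := by field_simp
      have e6 : 2 * β / c.Lμ = β * (2 * (1 / c.Lμ)) := by ring
      rw [e5, e6, mul_left_comm]
      refine mul_le_mul_of_nonneg_left ?_ hβ.le
      have k2 : 0 < 1 / c.Lμ := by positivity
      have k3 : 1 / c.Lμ + 10 / 3 * (1 / S) ≤ 11 / 6 * (1 / c.Lμ) := by linarith
      calc (1 + p / 4) * (1 / c.Lμ + 10 / 3 * (1 / S))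
          ≤ (1 + 1 / 16) * (11 / 6 * (1 / c.Lμ)) :=
            mul_le_mul (by linarith) k3 (by positivity) (by norm_num)
        _ ≤ 2 * (1 / c.Lμ) := by linarith
    have j3 : β / (4 * S) * ‖v‖ ^ 2 ≤ (1 + p / 4) * (β / (4 * S) * ‖v‖ ^ 2) :=
      le_mul_of_one_le_left (by positivity) (by linarith)
    have j4 := mul_le_mul_of_nonneg_right j1 (sq_nonneg ‖ys - y‖)
    have j5 := mul_le_mul_of_nonneg_right j2 (sq_nonneg ‖e‖)
    linarith
  have hlast : (1 + 4 / p) * (c.Ly * ‖x' - x‖) ^ 2 ≤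
      17 * c.Ly ^ 2 / (4 * p) * ‖x' - x‖ ^ 2 := by
    have : 1 + 4 / p ≤ 17 / (4 * p) := by
      rw [show 1 + 4 / p = (4 * p + 16) / (4 * p) by field_simp; ring]
      gcongr
      linarith
    calc _ ≤ 17 / (4 * p) * (c.Ly * ‖x' - x‖) ^ 2 := by gcongr
      _ = _ := by ring
  linarith

end Problem

/-! ### Derivatives of expectations and measurability in parameters -/

section Expectation

variable {a : ℕ} {S : Type*} [MeasurableSpace S] {ν : Measure S}
  {G : Type*} [NormedAddCommGroup G] [NormedSpace ℝ G]

lemma clm_eq_sum_smulRight (A : Vec a →L[ℝ] G) :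
    A = ∑ j, ContinuousLinearMap.smulRightL ℝ (Vec a) G (EuclideanSpace.proj j)
      (A (EuclideanSpace.single j 1)) := by
  ext v
  rw [sum_apply]
  conv_lhs => rw [← (EuclideanSpace.basisFun (Fin a) ℝ).sum_repr v]
  rw [map_sum]
  refine Finset.sum_congr rfl fun j _ => ?_
  rw [map_smul]
  simp

lemma integrable_univ_sum {H : Type*} [NormedAddCommGroup H] {n : ℕ} {B : Fin n → S → H}
    (h : ∀ j, Integrable (B j) ν) : Integrable (fun s => ∑ j, B j s) ν :=
  integrable_finsetSum _ fun j _ => h j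

lemma integrable_of_apply {A : S → Vec a →L[ℝ] G}
    (hA : ∀ v, Integrable (fun s => A s v) ν) : Integrable A ν := by
  have hmap : ∀ Λ : Fin a → G →L[ℝ] (Vec a →L[ℝ] G),
      (∀ s, A s = ∑ j, Λ j (A s (EuclideanSpace.single j 1))) → Integrable A ν := by
    intro Λ hΛ
    have h : ∀ j, Integrable (fun s => Λ j (A s (EuclideanSpace.single j 1))) ν := fun j =>
      (Λ j).integrable_comp (hA (EuclideanSpace.single j 1))
    exact (integrable_univ_sum h).congr (Filter.Eventually.of_forall fun s => (hΛ s).symm)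
  exact hmap _ fun s => clm_eq_sum_smulRight (A s)

/-- Differentiation under the expectation for functions whose derivatives are Lipschitz with a
deterministic constant.  Integrability of the derivative comes for free from that of the function,
since difference quotients approximate the derivative up to a deterministic error. -/
lemma hasFDerivAt_expectation [IsProbabilityMeasure ν] [CompleteSpace G] {h : Vec a → S → G}
    {h' : Vec a → S → Vec a →L[ℝ] G} {L : ℝ} (hL0 : 0 ≤ L) (hint : ∀ x, Integrable (h x) ν)
    (hd : ∀ᵐ s ∂ν, ∀ x, HasFDerivAt (fun x => h x s) (h' x s) x)
    (hL : ∀ᵐ s ∂ν, ∀ x x', ‖h' x s - h' x' s‖ ≤ L * ‖x - x'‖) (x : Vec a) :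
    Integrable (h' x) ν ∧ HasFDerivAt (fun x => ∫ s, h x s ∂ν) (∫ s, h' x s ∂ν) x := by
  -- directional derivatives are limits of difference quotients
  have hmeas : ∀ v, AEStronglyMeasurable (fun s => h' x s v) ν := by
    intro v
    refine aestronglyMeasurable_of_tendsto_ae Filter.atTop
      (f := fun (n : ℕ) s => (n : ℝ) • (h (x + (n : ℝ)⁻¹ • v) s - h x s)) (fun n => ?_) ?_
    · exact (((hint _).aestronglyMeasurable).sub (hint x).aestronglyMeasurable).const_smul _
    · filter_upwards [hd] with s hs
      refine (hs x).lim v ?_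
      simpa using tendsto_natCast_atTop_atTop (R := ℝ)
  have hintv : ∀ v, Integrable (fun s => h' x s v) ν := by
    intro v
    refine Integrable.mono' (((hint (x + v)).norm.add (hint x).norm).add
      (integrable_const (L * ‖v‖ * ‖v‖))) (hmeas v) ?_
    filter_upwards [hd, hL] with s hs hLs
    -- the difference quotient of unit step deviates from the derivative by at most `L ‖v‖²`
    have h1 := Convex.norm_image_sub_le_of_norm_hasFDerivWithin_le' (𝕜 := ℝ)
      (s := Metric.closedBall x ‖v‖) (f := fun x => h x s) (f' := fun x => h' x s)
      (φ := h' x s) (x := x) (y := x + v) (C := L * ‖v‖)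
      (fun z _ => (hs z).hasFDerivWithinAt)
      (fun z hz => (hLs z x).trans (mul_le_mul_of_nonneg_left
        (by rwa [mem_closedBall_iff_norm] at hz) hL0))
      (convex_closedBall _ _) (Metric.mem_closedBall_self (norm_nonneg _)) (by simp)
    rw [add_sub_cancel_left] at h1
    have e : h' x s v = h (x + v) s - h x s - (h (x + v) s - h x s - h' x s v) := by abel
    rw [e]
    refine (norm_sub_le _ _).trans (add_le_add (norm_sub_le _ _) h1)
  have hint' : Integrable (h' x) ν := integrable_of_apply hintv
  refine hasFDerivAt_integral_of_dominated_loc_of_lip (Metric.ball_mem_nhds x one_pos)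
    (Filter.Eventually.of_forall fun z => (hint z).aestronglyMeasurable) (hint x)
    hint'.aestronglyMeasurable (bound := fun s => ‖h' x s‖ + L) ?_
    (hint'.norm.add (integrable_const L)) (hd.mono fun s hs => hs x)
  filter_upwards [hd, hL] with s hs hLs
  refine LipschitzOnWith.of_dist_le_mul fun z hz z' hz' => ?_
  rw [dist_eq_norm, dist_eq_norm, Real.coe_nnabs, abs_of_nonneg (by positivity)]
  refine Convex.norm_image_sub_le_of_norm_hasFDerivWithin_le (𝕜 := ℝ) (s := Metric.ball x 1)
    (fun w _ => (hs w).hasFDerivWithinAt) (fun w hw => ?_) (convex_ball _ _) hz' hz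
  rw [mem_ball_iff_norm] at hw
  have h1 := norm_le_norm_add_norm_sub' (h' w s) (h' x s)
  have h2 := hLs w x
  nlinarith

omit [NormedSpace ℝ G] in
/-- Random functions that are almost surely continuous in a parameter have a version that is
jointly measurable in the parameter and the sample. -/
lemma exists_measurable_version {X : Type*} [TopologicalSpace X]
    [TopologicalSpace.MetrizableSpace X] [SecondCountableTopology X]
    [MeasurableSpace X] [OpensMeasurableSpace X]
    [MeasurableSpace G] [BorelSpace G] {h : X → S → G}
    (hm : ∀ x, AEStronglyMeasurable (h x) ν) (hc : ∀ᵐ s ∂ν, Continuous fun x => h x s) :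
    ∃ k : X → S → G, Measurable (Function.uncurry k) ∧ ∀ᵐ s ∂ν, ∀ x, k x s = h x s := by
  classical
  rcases isEmpty_or_nonempty X with hX | hX
  · exact ⟨fun _ _ => 0, measurable_const, Filter.Eventually.of_forall fun s x => (hX.false x).elim⟩
  let z := TopologicalSpace.denseSeq X
  have hgood : ∀ᵐ s ∂ν, (Continuous fun x => h x s) ∧
      ∀ n, h (z n) s = (hm (z n)).aemeasurable.mk _ s :=
    hc.and (ae_all_iff.2 fun n => (hm (z n)).aemeasurable.ae_eq_mk)
  -- the version vanishes outside a measurable set of full measure on which the function is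
  -- continuous in the parameter and measurable along a dense sequence
  obtain ⟨N, hN, hNm, hNp⟩ := hgood.exists_measurable_mem
  refine ⟨fun x s => if s ∈ N then h x s else 0, ?_, ?_⟩
  · refine measurable_uncurry_of_continuous_of_measurable (fun s => ?_) fun x => ?_
    · by_cases hs : s ∈ N
      · simpa [hs] using (hNp s hs).1
      · simpa [hs] using continuous_const
    · obtain ⟨w, hw, hwl⟩ := mem_closure_iff_seq_limit.1
        ((TopologicalSpace.denseRange_denseSeq X) x)
      choose n hn using hw
      refine measurable_of_tendsto_metrizable
        (f := fun k s => if s ∈ N then (hm (z (n k))).aemeasurable.mk _ s else 0)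
        (fun k => Measurable.ite hNm (hm (z (n k))).aemeasurable.measurable_mk
          measurable_const) ?_
      rw [tendsto_pi_nhds]
      intro s
      by_cases hs : s ∈ N
      · simp only [hs, if_true]
        have h1 := ((hNp s hs).1.tendsto x).comp hwl
        refine h1.congr fun k => ?_
        rw [Function.comp_apply, ← hn k, ← (hNp s hs).2 (n k)]
      · simp [hs]
  · filter_upwards [hN] with s hs x
    simp [show s ∈ N from hs]

end Expectation

/-! ### Expectations of products of independent operators -/

section Products

variable {Z : Type*} [MeasurableSpace Z] {μ : Measure Z} {S : Type*} [MeasurableSpace S]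
  {ν : Measure S} {V W : Type*} [NormedAddCommGroup V] [NormedSpace ℝ V] [NormedAddCommGroup W]
  [NormedSpace ℝ W] [CompleteSpace V] [CompleteSpace W]

/-- The expectation of an operator applied to an independent vector. -/
lemma integral_prod_clm_apply [IsProbabilityMeasure μ] [IsProbabilityMeasure ν]
    {T : Z → V →L[ℝ] W} {R : S → V} {C : ℝ} (hT : AEStronglyMeasurable T μ)
    (hC : ∀ᵐ z ∂μ, ‖T z‖ ≤ C) (hR : Integrable R ν) :
    Integrable (fun p : Z × S => T p.1 (R p.2)) (μ.prod ν) ∧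
      ∫ p, T p.1 (R p.2) ∂(μ.prod ν) = (∫ z, T z ∂μ) (∫ s, R s ∂ν) := by
  have hTi : Integrable T μ := (integrable_const C).mono' hT hC
  have hint : Integrable (fun p : Z × S => T p.1 (R p.2)) (μ.prod ν) := by
    refine Integrable.mono' ((hR.comp_snd μ).norm.const_mul C)
      ((ContinuousLinearMap.id ℝ (V →L[ℝ] W)).aestronglyMeasurable_comp₂ hT.comp_fst
        hR.aestronglyMeasurable.comp_snd) ?_
    filter_upwards [Measure.quasiMeasurePreserving_fst.ae hC] with p hp
    exact (T p.1).le_of_opNorm_le hp _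
  refine ⟨hint, ?_⟩
  rw [integral_prod _ hint]
  simp_rw [ContinuousLinearMap.integral_comp_comm _ hR]
  rw [ContinuousLinearMap.integral_apply hTi]

omit [CompleteSpace W] in
lemma integral_pi_succ [IsProbabilityMeasure μ] {n : ℕ} {φ : Z × (Fin n → Z) → W}
    (hφ : Integrable φ (μ.prod (Measure.pi fun _ => μ))) :
    Integrable (fun ζ : Fin (n + 1) → Z => φ (ζ 0, fun j => ζ j.succ))
        (Measure.pi fun _ => μ) ∧
      ∫ ζ : Fin (n + 1) → Z, φ (ζ 0, fun j => ζ j.succ) ∂(Measure.pi fun _ => μ)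
        = ∫ p, φ p ∂(μ.prod (Measure.pi fun _ => μ)) := by
  have hmp := measurePreserving_piFinSuccAbove (fun _ : Fin (n + 1) => μ) 0
  exact ⟨(hmp.integrable_comp_emb (MeasurableEquiv.measurableEmbedding _)).2 hφ,
    hmp.integral_comp' φ⟩

/-- The expectation of a product of independent copies of a random operator is the power of its
expectation. -/
lemma integral_pi_prod_apply [IsProbabilityMeasure μ] {T : Z → V →L[ℝ] V}
    (hT : AEStronglyMeasurable T μ) {C : ℝ} (hC : ∀ᵐ z ∂μ, ‖T z‖ ≤ C) :
    ∀ (k n : ℕ) (hkn : k ≤ n) (w : V),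
      Integrable (fun ζ : Fin n → Z =>
        (List.ofFn fun j : Fin k => T (ζ ⟨j, j.2.trans_le hkn⟩)).prod w)
          (Measure.pi fun _ => μ) ∧
      ∫ ζ : Fin n → Z, (List.ofFn fun j : Fin k => T (ζ ⟨j, j.2.trans_le hkn⟩)).prod w
        ∂(Measure.pi fun _ => μ) = ((∫ z, T z ∂μ) ^ k) w := by
  intro k
  induction k with
  | zero => intro n _ w; simp
  | succ k ih =>
    intro n hkn w
    obtain ⟨n, rfl⟩ : ∃ n', n = n' + 1 := ⟨n - 1, by omega⟩
    obtain ⟨h1, h2⟩ := ih n (by omega) w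
    obtain ⟨h3, h4⟩ := integral_prod_clm_apply hT hC h1
    obtain ⟨h5, h6⟩ := integral_pi_succ h3
    have e : (fun ζ : Fin (n + 1) → Z =>
        (List.ofFn fun j : Fin (k + 1) => T (ζ ⟨j, j.2.trans_le hkn⟩)).prod w)
        = fun ζ => T (ζ 0) ((List.ofFn fun j : Fin k =>
          T (ζ (Fin.succ ⟨j, j.2.trans_le (by omega)⟩))).prod w) := by
      funext ζ
      rw [List.ofFn_succ, List.prod_cons]
      rfl
    rw [e]
    refine ⟨h5, h6.trans ?_⟩
    rw [h4, h2, pow_succ']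
    rfl

omit [CompleteSpace V] in
lemma norm_prod_ofFn_le {k : ℕ} {T : Fin k → V →L[ℝ] V} {q : ℝ} (hq : ∀ j, ‖T j‖ ≤ q)
    (v : V) : ‖(List.ofFn T).prod v‖ ≤ q ^ k * ‖v‖ := by
  induction k with
  | zero => simp
  | succ k ih =>
    have h0 : 0 ≤ q := (norm_nonneg _).trans (hq 0)
    rw [List.ofFn_succ, List.prod_cons, pow_succ', mul_assoc]
    exact ((T 0).le_of_opNorm_le (hq 0) _).trans
      (mul_le_mul_of_nonneg_left (ih fun j => hq j.succ) h0)

omit [CompleteSpace V] in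
lemma norm_prod_ofFn_sub_le {k : ℕ} {T T' : Fin k → V →L[ℝ] V} {q δ : ℝ} (hq0 : 0 < q)
    (hq : ∀ j, ‖T j‖ ≤ q) (hq' : ∀ j, ‖T' j‖ ≤ q) (hδ : ∀ j, ‖T j - T' j‖ ≤ δ)
    (v : V) : ‖(List.ofFn T).prod v - (List.ofFn T').prod v‖ ≤ k * q ^ k / q * δ * ‖v‖ := by
  induction k with
  | zero => simp
  | succ k ih =>
    have hδ0 : 0 ≤ δ := (norm_nonneg _).trans (hδ 0)
    simp only [List.ofFn_succ, List.prod_cons]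
    set P := (List.ofFn fun i : Fin k => T i.succ).prod
    set P' := (List.ofFn fun i : Fin k => T' i.succ).prod
    have e : (T 0 * P) v - (T' 0 * P') v = T 0 (P v - P' v) + (T 0 - T' 0) (P' v) := by
      simp [map_sub]
    rw [e]
    have h1 := (T 0).le_of_opNorm_le (hq 0) (P v - P' v)
    have h2 := ih (fun j => hq j.succ) (fun j => hq' j.succ) (fun j => hδ j.succ)
    have h3 := (T 0 - T' 0).le_of_opNorm_le (hδ 0) (P' v)
    have h4 := norm_prod_ofFn_le (fun j => hq' j.succ) v
    calc _ ≤ q * (k * q ^ k / q * δ * ‖v‖) + δ * (q ^ k * ‖v‖) :=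
          (norm_add_le _ _).trans (add_le_add (h1.trans (mul_le_mul_of_nonneg_left h2 hq0.le))
            (h3.trans (mul_le_mul_of_nonneg_left h4 hδ0)))
      _ = _ := by
          push_cast
          field_simp
          ring

end Products

/-! ### The stochastic gradient oracles -/

section GradientExpectation

variable {a : ℕ} {S : Type*} [MeasurableSpace S] {ν : Measure S}

lemma hasGradientAt_expectation [IsProbabilityMeasure ν] {h : Vec a → S → ℝ}
    {h' : Vec a → S → Vec a} {L : ℝ} (hL0 : 0 ≤ L) (hint : ∀ x, Integrable (h x) ν)
    (hd : ∀ᵐ s ∂ν, ∀ x, HasGradientAt (fun x => h x s) (h' x s) x)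
    (hL : ∀ᵐ s ∂ν, ∀ x x', ‖h' x s - h' x' s‖ ≤ L * ‖x - x'‖) (x : Vec a) :
    Integrable (h' x) ν ∧ HasGradientAt (fun x => ∫ s, h x s ∂ν) (∫ s, h' x s ∂ν) x := by
  let e := (InnerProductSpace.toDual ℝ (Vec a)).toContinuousLinearEquiv
  have hL' : ∀ᵐ s ∂ν, ∀ x x', ‖e (h' x s) - e (h' x' s)‖ ≤ L * ‖x - x'‖ := by
    filter_upwards [hL] with s hs x x'
    rw [← map_sub]
    exact ((InnerProductSpace.toDual ℝ (Vec a)).norm_map _).trans_le (hs x x')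
  have hd' : ∀ᵐ s ∂ν, ∀ x, HasFDerivAt (fun x => h x s) (e (h' x s)) x := by
    filter_upwards [hd] with s hs x
    exact (hs x).hasFDerivAt
  obtain ⟨h1, h2⟩ := hasFDerivAt_expectation hL0 hint hd' hL' x
  have h3 : Integrable (h' x) ν := by
    have := e.symm.toContinuousLinearMap.integrable_comp h1
    simpa using this
  refine ⟨h3, ?_⟩
  rw [hasGradientAt_iff_hasFDerivAt]
  refine h2.congr_fderiv ?_
  exact e.toContinuousLinearMap.integral_comp_comm h3

lemma integral_uniformOn_univ {K : ℕ} [Nonempty (Fin K)] {G : Type*} [NormedAddCommGroup G]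
    [NormedSpace ℝ G] [CompleteSpace G] (φ : Fin K → G) :
    ∫ k, φ k ∂(uniformOn (Set.univ : Set (Fin K))) = (1 / (K : ℝ)) • ∑ k, φ k := by
  have := isProbabilityMeasure_uniformOn (s := (Set.univ : Set (Fin K))) Set.finite_univ
    Set.univ_nonempty
  rw [integral_fintype (Integrable.of_finite), Finset.smul_sum]
  refine Finset.sum_congr rfl fun k _ => ?_
  congr 1
  rw [Measure.real, uniformOn_univ]
  simp

end GradientExpectation

/-- The remainder of the truncated Neumann series of the inverse Hessian. -/
lemma LowerRegular.inverse_sub_neumann {a b : ℕ} {c : Consts} {g : Vec a → Vec b → ℝ}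
    (hg : LowerRegular c g) (hc : c.Valid) (x : Vec a) (y v : Vec b) (K : ℕ) :
    (hessYY g x y).inverse v - (1 / c.Lg) • ∑ k ∈ Finset.range K,
        (((1 : Vec b →L[ℝ] Vec b) - (1 / c.Lg) • hessYY g x y) ^ k) v
      = (((1 : Vec b →L[ℝ] Vec b) - (1 / c.Lg) • hessYY g x y) ^ K)
          ((hessYY g x y).inverse v) := by
  set T := (1 : Vec b →L[ℝ] Vec b) - (1 / c.Lg) • hessYY g x y with hT
  have h1 := geom_sum_mul_neg T K
  have h2 := congrArg (fun A => A ((hessYY g x y).inverse v)) h1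
  have h3 : (1 - T) ((hessYY g x y).inverse v) = (1 / c.Lg) • v := by
    rw [hT, sub_sub_cancel, _root_.smul_apply, hg.hessYY_inverse_apply hc]
  simp only [mul_apply_eq_comp, h3, _root_.sub_apply, one_apply_eq_self, map_smul,
    sum_apply] at h2
  rw [h2, sub_sub_cancel]

namespace Problem

variable {m dup dlow : ℕ} {Ξ : Type u} {Z : Type v} [MeasurableSpace Ξ] [MeasurableSpace Z]
  {B : Problem m dup dlow Ξ Z} {c : Consts}

section Population

variable (hc : c.Valid) (hB : B.Regular c) (i : Fin m) (x : Vec dup) (y : Vec dlow)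

include hc hB

lemma gradX_F : Integrable (fun ξ => gradX (fun x y => B.f i x y ξ) x y) B.πf ∧
    gradX (B.F i) x y = ∫ ξ, gradX (fun x y => B.f i x y ξ) x y ∂B.πf := by
  have := hB.prob_f
  obtain ⟨h1, h2⟩ := hasGradientAt_expectation (ν := B.πf) (h := fun x ξ => B.f i x y ξ)
    (h' := fun x ξ => gradX (fun x y => B.f i x y ξ) x y) hc.Lfx_nonneg
    (fun x => hB.int_f i x y)
    ((hB.upper_sample i).mono fun ξ h x => h.hasGradientAt_x x y)
    ((hB.upper_sample i).mono fun ξ h x x' => h.lip_gradX.left x x' y) x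
  exact ⟨h1, h2.gradient⟩

lemma gradY_F : Integrable (fun ξ => gradY (fun x y => B.f i x y ξ) x y) B.πf ∧
    gradY (B.F i) x y = ∫ ξ, gradY (fun x y => B.f i x y ξ) x y ∂B.πf := by
  have := hB.prob_f
  obtain ⟨h1, h2⟩ := hasGradientAt_expectation (ν := B.πf) (h := fun y ξ => B.f i x y ξ)
    (h' := fun y ξ => gradY (fun x y => B.f i x y ξ) x y) hc.Lfy_nonneg
    (fun y => hB.int_f i x y)
    ((hB.upper_sample i).mono fun ξ h y => h.hasGradientAt_y x y)
    ((hB.upper_sample i).mono fun ξ h y y' => h.lip_gradY.right x y y') y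
  exact ⟨h1, h2.gradient⟩

lemma gradY_G : Integrable (fun ζ => gradY (fun x y => B.g i x y ζ) x y) B.πg ∧
    gradY (B.G i) x y = ∫ ζ, gradY (fun x y => B.g i x y ζ) x y ∂B.πg := by
  have := hB.prob_g
  obtain ⟨h1, h2⟩ := hasGradientAt_expectation (ν := B.πg) (h := fun y ζ => B.g i x y ζ)
    (h' := fun y ζ => gradY (fun x y => B.g i x y ζ) x y) hc.Lg_pos.le
    (fun y => hB.int_g i x y)
    ((hB.lower_sample i).mono fun ζ h y => h.hasGradientAt_y x y)
    ((hB.lower_sample i).mono fun ζ h y y' => h.lip_gradY.right x y y') y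
  exact ⟨h1, h2.gradient⟩

lemma hessYY_G : Integrable (fun ζ => hessYY (fun x y => B.g i x y ζ) x y) B.πg ∧
    hessYY (B.G i) x y = ∫ ζ, hessYY (fun x y => B.g i x y ζ) x y ∂B.πg := by
  have := hB.prob_g
  obtain ⟨h1, h2⟩ := hasFDerivAt_expectation (ν := B.πg)
    (h := fun y ζ => gradY (fun x y => B.g i x y ζ) x y)
    (h' := fun y ζ => hessYY (fun x y => B.g i x y ζ) x y) hc.Lgyy_nonneg
    (fun y => (gradY_G hc hB i x y).1)
    ((hB.lower_sample i).mono fun ζ h y => h.hasFDerivAt_gradY_y x y)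
    ((hB.lower_sample i).mono fun ζ h y y' => h.lip_hessYY.right x y y') y
  refine ⟨h1, ?_⟩
  rw [← h2.fderiv, hessYY]
  congr 1
  funext y'
  exact (gradY_G hc hB i x y').2

lemma hessXY_G : Integrable (fun ζ => hessXY (fun x y => B.g i x y ζ) x y) B.πg ∧
    hessXY (B.G i) x y = ∫ ζ, hessXY (fun x y => B.g i x y ζ) x y ∂B.πg := by
  have := hB.prob_g
  obtain ⟨h1, h2⟩ := hasFDerivAt_expectation (ν := B.πg)
    (h := fun x ζ => gradY (fun x y => B.g i x y ζ) x y)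
    (h' := fun x ζ => ContinuousLinearMap.adjoint (hessXY (fun x y => B.g i x y ζ) x y))
    hc.Lgxy_nonneg (fun x => (gradY_G hc hB i x y).1)
    ((hB.lower_sample i).mono fun ζ h x => h.hasFDerivAt_gradY_x x y)
    ((hB.lower_sample i).mono fun ζ h x x' => by
      rw [← map_sub, LinearIsometryEquiv.norm_map]; exact h.lip_hessXY.left x x' y) x
  have h3 : Integrable (fun ζ => hessXY (fun x y => B.g i x y ζ) x y) B.πg := by
    have hm := (ContinuousLinearMap.adjoint (𝕜 := ℝ) (E := Vec dup)
      (F := Vec dlow)).continuous.comp_aestronglyMeasurable h1.aestronglyMeasurable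
    simp only [ContinuousLinearMap.adjoint_adjoint] at hm
    refine h1.norm.mono' hm (Filter.Eventually.of_forall fun ζ => ?_)
    rw [LinearIsometryEquiv.norm_map]
  refine ⟨h3, ?_⟩
  have h4 : fderiv ℝ (fun x' => gradY (B.G i) x' y) x
      = ∫ ζ, ContinuousLinearMap.adjoint (hessXY (fun x y => B.g i x y ζ) x y) ∂B.πg := by
    rw [← h2.fderiv]
    congr 1
    funext x'
    exact (gradY_G hc hB i x' y).2
  ext1 w
  refine ext_inner_right ℝ fun v => ?_
  rw [hessXY, h4, ContinuousLinearMap.adjoint_inner_left, ContinuousLinearMap.integral_apply h1,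
    ContinuousLinearMap.integral_apply h3, ← integral_inner (h1.apply_continuousLinearMap v),
    real_inner_comm, ← integral_inner (h3.apply_continuousLinearMap w)]
  refine integral_congr_ae (Filter.Eventually.of_forall fun ζ => ?_)
  simp only
  rw [ContinuousLinearMap.adjoint_inner_right, real_inner_comm]

end Population

/-- The random factor `I - ∇²_{yy} g_i(x, y; ζ) / L_g` of the Neumann series. -/
def neumannFactor (B : Problem m dup dlow Ξ Z) (c : Consts) (i : Fin m) (x : Vec dup)
    (y : Vec dlow) (ζ : Z) : Vec dlow →L[ℝ] Vec dlow :=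
  1 - (1 / c.Lg) • hessYY (fun x y => B.g i x y ζ) x y

/-- The samples for which all objectives that enter the hypergradient estimator are regular. -/
def GoodSample (B : Problem m dup dlow Ξ Z) (c : Consts) {K : ℕ} (i : Fin m)
    (s : UpperSample Ξ Z K) : Prop :=
  UpperRegular c (fun x y => B.f i x y s.1) ∧
    ∀ j, LowerRegular c fun x y => B.g i x y (s.2.1 j)

lemma isProbabilityMeasure_upperLaw (hB : B.Regular c) {K : ℕ} (hK : 0 < K) :
    IsProbabilityMeasure (B.upperLaw K) := by
  have := hB.prob_f
  have := hB.prob_g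
  have : Nonempty (Fin K) := ⟨⟨0, hK⟩⟩
  have := isProbabilityMeasure_uniformOn (s := (Set.univ : Set (Fin K))) Set.finite_univ
    Set.univ_nonempty
  unfold upperLaw
  infer_instance

lemma ae_goodSample (hB : B.Regular c) (K : ℕ) (i : Fin m) :
    ∀ᵐ s ∂B.upperLaw K, B.GoodSample c i s := by
  have := hB.prob_g
  refine (Measure.quasiMeasurePreserving_fst.ae (hB.upper_sample i)).and ?_
  refine Measure.quasiMeasurePreserving_snd.ae (p := fun q : (Fin (K + 1) → Z) × Fin K =>
    ∀ j, LowerRegular c fun x y => B.g i x y (q.1 j)) ?_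
  refine Measure.quasiMeasurePreserving_fst.ae (p := fun q : Fin (K + 1) → Z =>
    ∀ j, LowerRegular c fun x y => B.g i x y (q j)) ?_
  exact ae_all_iff.2 fun j =>
    (measurePreserving_eval (fun _ : Fin (K + 1) => B.πg) j).quasiMeasurePreserving.ae
      (hB.lower_sample i)

lemma norm_neumannFactor_le (hc : c.Valid) {i : Fin m} {ζ : Z}
    (h : LowerRegular c fun x y => B.g i x y ζ) (x : Vec dup) (y : Vec dlow) :
    ‖B.neumannFactor c i x y ζ‖ ≤ 1 - c.μg / c.Lg :=
  h.norm_one_sub_hessYY_le hc x y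

lemma hatGrad_eq {K : ℕ} (i : Fin m) (x : Vec dup) (y : Vec dlow) (s : UpperSample Ξ Z K) :
    B.hatGrad c i x y s = gradX (fun x y => B.f i x y s.1) x y
      - ((K : ℝ) / c.Lg) • hessXY (fun x y => B.g i x y (s.2.1 0)) x y
        ((List.ofFn fun j : Fin (s.2.2 : ℕ) =>
          B.neumannFactor c i x y (s.2.1 ⟨(j : ℕ) + 1, by omega⟩)).prod
        (gradY (fun x y => B.f i x y s.1) x y)) := rfl

section Oracle

variable (hc : c.Valid) (hB : B.Regular c)

include hc hB

lemma integral_neumannFactor (i : Fin m) (x : Vec dup) (y : Vec dlow) :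
    Integrable (B.neumannFactor c i x y) B.πg ∧
      ∫ ζ, B.neumannFactor c i x y ζ ∂B.πg = 1 - (1 / c.Lg) • hessYY (B.G i) x y := by
  have := hB.prob_g
  obtain ⟨h1, h2⟩ := hessYY_G hc hB i x y
  have h3 : Integrable (fun ζ => (1 / c.Lg) • hessYY (fun x y => B.g i x y ζ) x y) B.πg :=
    h1.smul (1 / c.Lg)
  have h4 : Integrable (fun _ : Z => (1 : Vec dlow →L[ℝ] Vec dlow)) B.πg := integrable_const _
  refine ⟨h4.sub h3, ?_⟩
  unfold neumannFactor
  rw [integral_sub h4 h3, integral_smul, ← h2]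
  simp

lemma aestronglyMeasurable_hatGrad {K : ℕ} (i : Fin m) (x : Vec dup) (y : Vec dlow) :
    AEStronglyMeasurable (fun s : UpperSample Ξ Z K => B.hatGrad c i x y s) (B.upperLaw K) := by
  classical
  have := hB.prob_f
  have := hB.prob_g
  have hfix : ∀ k : Fin K, AEStronglyMeasurable
      (fun s : UpperSample Ξ Z K => B.hatGrad c i x y (s.1, s.2.1, k)) (B.upperLaw K) := by
    intro k
    have hfst : Measure.QuasiMeasurePreserving (fun s : UpperSample Ξ Z K => s.1)
        (B.upperLaw K) B.πf := Measure.quasiMeasurePreserving_fst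
    have heval : ∀ j, Measure.QuasiMeasurePreserving (fun s : UpperSample Ξ Z K => s.2.1 j)
        (B.upperLaw K) B.πg := fun j =>
      (measurePreserving_eval (fun _ : Fin (K + 1) => B.πg) j).quasiMeasurePreserving.comp
        (Measure.quasiMeasurePreserving_fst.comp Measure.quasiMeasurePreserving_snd)
    have h1 := (gradX_F hc hB i x y).1.aestronglyMeasurable.comp_quasiMeasurePreserving hfst
    have h2 := (gradY_F hc hB i x y).1.aestronglyMeasurable.comp_quasiMeasurePreserving hfst
    have h3 := (hessXY_G hc hB i x y).1.aestronglyMeasurable.comp_quasiMeasurePreserving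
      (heval 0)
    have h4 : AEStronglyMeasurable (fun s : UpperSample Ξ Z K =>
        (List.ofFn fun j : Fin (k : ℕ) =>
          B.neumannFactor c i x y (s.2.1 ⟨(j : ℕ) + 1, by omega⟩)).prod) (B.upperLaw K) := by
      have := List.aestronglyMeasurable_fun_prod (μ := B.upperLaw K)
        (List.ofFn fun (j : Fin (k : ℕ)) (s : UpperSample Ξ Z K) =>
          B.neumannFactor c i x y (s.2.1 ⟨(j : ℕ) + 1, by omega⟩)) (by
          intro f hf
          obtain ⟨j, rfl⟩ := (List.mem_ofFn' _ _).1 hf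
          exact (integral_neumannFactor hc hB i x
            y).1.aestronglyMeasurable.comp_quasiMeasurePreserving (heval _))
      simpa [List.map_ofFn, Function.comp_def] using this
    have h5 := (ContinuousLinearMap.id ℝ (Vec dlow →L[ℝ] Vec dlow)).aestronglyMeasurable_comp₂
      h4 h2
    have h6 := (ContinuousLinearMap.id ℝ (Vec dlow →L[ℝ] Vec dup)).aestronglyMeasurable_comp₂
      h3 h5
    exact h1.sub (h6.const_smul ((K : ℝ) / c.Lg))
  have e : (fun s : UpperSample Ξ Z K => B.hatGrad c i x y s) = fun s => ∑ k : Fin K,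
      {s : UpperSample Ξ Z K | s.2.2 = k}.indicator
        (fun s => B.hatGrad c i x y (s.1, s.2.1, k)) s := by
    funext s
    rw [Finset.sum_eq_single s.2.2]
    · simp
    · intro k _ hk
      simp [Ne.symm hk]
    · simp
  rw [e]
  refine Finset.aestronglyMeasurable_fun_sum _ fun k _ => (hfix k).indicator ?_
  exact measurable_snd.snd (measurableSet_singleton k)

/-- The mean of the hypergradient estimator: the exact Hessian inverse is replaced by a truncated
Neumann series. -/
lemma integral_hatGrad {K : ℕ} (hK : 0 < K) (i : Fin m) (x : Vec dup) (y : Vec dlow)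
    (hint : Integrable (fun s : UpperSample Ξ Z K => B.hatGrad c i x y s) (B.upperLaw K)) :
    ∫ s, B.hatGrad c i x y s ∂B.upperLaw K = gradX (B.F i) x y - hessXY (B.G i) x y
      ((1 / c.Lg) • ∑ k ∈ Finset.range K,
        ((1 - (1 / c.Lg) • hessYY (B.G i) x y) ^ k) (gradY (B.F i) x y)) := by
  have := hB.prob_f
  have := hB.prob_g
  have : Nonempty (Fin K) := ⟨⟨0, hK⟩⟩
  have := isProbabilityMeasure_uniformOn (s := (Set.univ : Set (Fin K))) Set.finite_univ
    Set.univ_nonempty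
  set A := hessXY (B.G i) x y with hA
  set T := 1 - (1 / c.Lg) • hessYY (B.G i) x y with hT
  have hKL : (K : ℝ) ≠ 0 := by positivity
  -- the inner expectation over the lower-level samples, for a fixed upper-level sample
  have hinner : ∀ (k : Fin K) (w : Vec dlow),
      Integrable (fun ζ : Fin (K + 1) → Z => hessXY (fun x y => B.g i x y (ζ 0)) x y
        ((List.ofFn fun j : Fin (k : ℕ) =>
          B.neumannFactor c i x y (ζ ⟨(j : ℕ) + 1, by omega⟩)).prod w))
        (Measure.pi fun _ => B.πg) ∧
      ∫ ζ : Fin (K + 1) → Z, hessXY (fun x y => B.g i x y (ζ 0)) x y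
        ((List.ofFn fun j : Fin (k : ℕ) =>
          B.neumannFactor c i x y (ζ ⟨(j : ℕ) + 1, by omega⟩)).prod w)
        ∂(Measure.pi fun _ => B.πg) = A ((T ^ (k : ℕ)) w) := by
    intro k w
    obtain ⟨n1, n2⟩ := integral_neumannFactor hc hB i x y
    obtain ⟨a1, a2⟩ := hessXY_G hc hB i x y
    obtain ⟨p1, p2⟩ := integral_pi_prod_apply n1.aestronglyMeasurable
      ((hB.lower_sample i).mono fun ζ h => norm_neumannFactor_le hc h x y) k K k.2.le w
    obtain ⟨q1, q2⟩ := integral_prod_clm_apply a1.aestronglyMeasurable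
      ((hB.lower_sample i).mono fun ζ h => h.bound_hessXY x y) p1
    obtain ⟨r1, r2⟩ := integral_pi_succ q1
    refine ⟨r1, r2.trans ?_⟩
    rw [q2, p2, n2, ← a2]
  unfold upperLaw at hint ⊢
  rw [integral_prod _ hint]
  have hslice : ∀ᵐ ξ ∂B.πf, ∫ q, B.hatGrad c i x y (ξ, q)
      ∂((Measure.pi fun _ : Fin (K + 1) => B.πg).prod (uniformOn (Set.univ : Set (Fin K))))
      = gradX (fun x y => B.f i x y ξ) x y - A ((1 / c.Lg) • ∑ k ∈ Finset.range K,
        (T ^ k) (gradY (fun x y => B.f i x y ξ) x y)) := by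
    filter_upwards [hint.prod_right_ae] with ξ hξ
    set w := gradY (fun x y => B.f i x y ξ) x y
    set u := gradX (fun x y => B.f i x y ξ) x y
    rw [integral_prod _ hξ]
    simp_rw [integral_uniformOn_univ]
    rw [integral_smul, integral_finsetSum]
    · have h1 : ∀ k : Fin K, ∫ ζ : Fin (K + 1) → Z, B.hatGrad c i x y (ξ, ζ, k)
          ∂(Measure.pi fun _ => B.πg) = u - ((K : ℝ) / c.Lg) • A ((T ^ (k : ℕ)) w) := by
        intro k
        simp_rw [hatGrad_eq]
        rw [integral_sub (integrable_const _) ((hinner k w).1.fun_smul ((K : ℝ) / c.Lg)),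
          integral_smul, (hinner k w).2]
        simp [u]
      simp_rw [h1]
      rw [Finset.sum_sub_distrib, Finset.sum_const, Finset.card_univ, Fintype.card_fin,
        ← Finset.smul_sum, smul_sub, ← Nat.cast_smul_eq_nsmul ℝ, smul_smul, smul_smul,
        one_div_mul_cancel hKL, one_smul, map_smul, map_sum,
        Finset.sum_range (fun k => A ((T ^ k) w))]
      congr 2
      field_simp
    · intro k _
      simp_rw [hatGrad_eq]
      exact (integrable_const _).sub ((hinner k w).1.fun_smul ((K : ℝ) / c.Lg))
  rw [integral_congr_ae hslice]
  obtain ⟨x1, x2⟩ := gradX_F hc hB i x y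
  obtain ⟨y1, y2⟩ := gradY_F hc hB i x y
  let Λ : Vec dlow →L[ℝ] Vec dup := A.comp ((1 / c.Lg) • ∑ k ∈ Finset.range K, T ^ k)
  have hΛ : ∀ w, A ((1 / c.Lg) • ∑ k ∈ Finset.range K, (T ^ k) w) = Λ w := by
    intro w
    simp [Λ, sum_apply]
  simp_rw [hΛ]
  rw [integral_sub x1 (Λ.integrable_comp y1), Λ.integral_comp_comm y1, ← x2, ← y2]

lemma norm_bias_le {K : ℕ} (hK : 0 < K) (i : Fin m) (x : Vec dup) (y : Vec dlow)
    (hint : Integrable (fun s : UpperSample Ξ Z K => B.hatGrad c i x y s) (B.upperLaw K)) :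
    ‖B.bias c K i x y‖ ≤ c.Cgxy * ((1 - c.μg / c.Lg) ^ K * (c.Cfy / c.μg)) := by
  have hg := hB.lower i
  have hq : 0 ≤ 1 - c.μg / c.Lg :=
    (norm_nonneg _).trans (hg.norm_one_sub_hessYY_le hc x y)
  have e : B.bias c K i x y = hessXY (B.G i) x y
      (((1 - (1 / c.Lg) • hessYY (B.G i) x y) ^ K)
        ((hessYY (B.G i) x y).inverse (gradY (B.F i) x y))) := by
    rw [bias, integral_hatGrad hc hB hK i x y hint, barGrad, ← hg.inverse_sub_neumann hc, map_sub]
    abel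
  rw [e]
  refine ((hessXY (B.G i) x y).le_of_opNorm_le (hg.bound_hessXY x y) _).trans ?_
  refine mul_le_mul_of_nonneg_left ?_ hc.Cgxy_pos.le
  refine (ContinuousLinearMap.le_opNorm _ _).trans ?_
  refine mul_le_mul ((norm_pow_le' _ hK).trans (pow_le_pow_left₀ (norm_nonneg _)
    (hg.norm_one_sub_hessYY_le hc x y) K)) ?_ (norm_nonneg _) (pow_nonneg hq K)
  refine (hg.norm_inverse_hessYY_le hc x y _).trans ?_
  have := (hB.upper i).bound_gradY x y
  have hμ := hc.μg_pos
  gcongr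

omit hB in
/-- The number of Neumann samples is chosen so that `(1 - μ_g / L_g) ^ K ≤ exp (-K μ_g / L_g)` makes
the bias at most `1 / T`. -/
lemma bias_bound_numSamples {T : ℕ} (hT : 2 ≤ T) :
    c.Cgxy * ((1 - c.μg / c.Lg) ^ c.numSamples T * (c.Cfy / c.μg)) ≤ 1 / T := by
  have hT0 : (0 : ℝ) < T := by positivity
  have hμ := hc.μg_pos
  have hL := hc.Lg_pos
  rcases hc.Cfy_nonneg.eq_or_lt with h | h
  · rw [← h]; simp
  · set r := c.Cgxy * c.Cfy * T / c.μg with hr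
    have hr0 : 0 < r := by have := hc.Cgxy_pos; positivity
    have hK : c.Lg / c.μg * Real.log r ≤ c.numSamples T := by
      refine (Nat.le_ceil _).trans ?_
      exact_mod_cast le_max_right _ _
    have hlog : Real.log r ≤ c.μg / c.Lg * c.numSamples T := by
      have : Real.log r = c.μg / c.Lg * (c.Lg / c.μg * Real.log r) := by field_simp
      rw [this]
      gcongr
    have hpow : (1 - c.μg / c.Lg) ^ c.numSamples T ≤ 1 / r := by
      have hq0 : 0 ≤ 1 - c.μg / c.Lg := by
        rw [sub_nonneg, div_le_one hL]; exact hc.μg_lt_Lg.le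
      calc _ ≤ Real.exp (-(c.μg / c.Lg)) ^ c.numSamples T :=
            pow_le_pow_left₀ hq0 (Real.one_sub_le_exp_neg _) _
        _ = Real.exp (-(c.μg / c.Lg * c.numSamples T)) := by
            rw [← Real.exp_nat_mul]; congr 1; ring
        _ ≤ Real.exp (-Real.log r) := by gcongr
        _ = 1 / r := by rw [Real.exp_neg, Real.exp_log hr0, one_div]
    have hC := hc.Cgxy_pos
    calc _ ≤ c.Cgxy * (1 / r * (c.Cfy / c.μg)) := by gcongr
      _ = 1 / T := by rw [hr]; field_simp

end Oracle

end Problem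

/-! ### Mean-square smoothness of the hypergradient estimator -/

lemma Consts.LK_sq {c : Consts} (hc : c.Valid) (K : ℕ) : c.LK K ^ 2 = 2 * c.Lfx ^ 2
    + 6 * c.Cgxy ^ 2 * c.Lfy ^ 2 * K / (2 * c.μg * c.Lg - c.μg ^ 2)
    + 6 * c.Cfy ^ 2 * c.Lgxy ^ 2 * K / (2 * c.μg * c.Lg - c.μg ^ 2)
    + 6 * c.Cgxy ^ 2 * c.Cfy ^ 2 * c.Lgyy ^ 2 * K ^ 3
      / ((c.Lg - c.μg) ^ 2 * (2 * c.μg * c.Lg - c.μg ^ 2)) := by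
  have h : 0 < 2 * c.μg * c.Lg - c.μg ^ 2 := by
    nlinarith [hc.μg_pos, hc.μg_lt_Lg]
  rw [Consts.LK, Real.sq_sqrt (by positivity)]

/-- The squared Lipschitz constant of the estimator when the random truncation index is `k`. -/
def Consts.lipSample (c : Consts) (K k : ℕ) : ℝ :=
  2 * c.Lfx ^ 2 + 6 * ((K : ℝ) / c.Lg) ^ 2 *
    ((c.Lgxy * ((1 - c.μg / c.Lg) ^ k * c.Cfy)) ^ 2
      + (c.Cgxy * (k * (1 - c.μg / c.Lg) ^ k / (1 - c.μg / c.Lg) * (c.Lgyy / c.Lg) * c.Cfy)) ^ 2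
      + (c.Cgxy * ((1 - c.μg / c.Lg) ^ k * c.Lfy)) ^ 2)

/-- The constant `L_K²` is the average of the squared Lipschitz constants over the random truncation
index, by summation of a geometric series. -/
lemma Consts.avg_lipSample_le {c : Consts} (hc : c.Valid) {K : ℕ} (hK : 0 < K) :
    (1 / (K : ℝ)) * ∑ k : Fin K, c.lipSample K k ≤ c.LK K ^ 2 := by
  have hμ := hc.μg_pos
  have hL := hc.Lg_pos
  have hLμ : 0 < c.Lg - c.μg := by linarith [hc.μg_lt_Lg]
  have hd : 0 < 2 * c.μg * c.Lg - c.μg ^ 2 := by nlinarith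
  have hK0 : (0 : ℝ) < K := by exact_mod_cast hK
  set q := 1 - c.μg / c.Lg with hq
  have hqL : q = (c.Lg - c.μg) / c.Lg := by rw [hq]; field_simp
  have hq0 : 0 < q := by rw [hqL]; positivity
  have hq2 : 1 - q ^ 2 = (2 * c.μg * c.Lg - c.μg ^ 2) / c.Lg ^ 2 := by
    rw [hqL]; field_simp; ring
  have hgeom : ∑ k : Fin K, (q ^ (k : ℕ)) ^ 2 ≤ c.Lg ^ 2 / (2 * c.μg * c.Lg - c.μg ^ 2) := by
    have h1 : ∑ k : Fin K, (q ^ (k : ℕ)) ^ 2 = ∑ k ∈ Finset.range K, (q ^ 2) ^ k := by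
      rw [Finset.sum_range]
      exact Finset.sum_congr rfl fun k _ => by rw [← pow_mul, ← pow_mul, mul_comm]
    have h2 := mul_neg_geom_sum (q ^ 2) K
    rw [hq2] at h2
    rw [h1, le_div_iff₀ hd]
    have h3 : 0 ≤ (q ^ 2) ^ K := by positivity
    rw [div_mul_eq_mul_div, div_eq_iff (by positivity)] at h2
    nlinarith [sq_nonneg c.Lg]
  have hpt : ∀ k : Fin K, c.lipSample K k ≤ 2 * c.Lfx ^ 2 + 6 * ((K : ℝ) / c.Lg) ^ 2 *
      (c.Lgxy ^ 2 * c.Cfy ^ 2 + c.Cgxy ^ 2 * (K ^ 2 / q ^ 2 * (c.Lgyy / c.Lg) ^ 2) * c.Cfy ^ 2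
        + c.Cgxy ^ 2 * c.Lfy ^ 2) * (q ^ (k : ℕ)) ^ 2 := by
    intro k
    rw [Consts.lipSample, ← hq]
    have hk : ((k : ℕ) : ℝ) ^ 2 ≤ (K : ℝ) ^ 2 := by
      gcongr
      exact k.2.le
    have h1 : (c.Cgxy * ((k : ℕ) * q ^ (k : ℕ) / q * (c.Lgyy / c.Lg) * c.Cfy)) ^ 2
        ≤ c.Cgxy ^ 2 * (K ^ 2 / q ^ 2 * (c.Lgyy / c.Lg) ^ 2) * c.Cfy ^ 2
          * (q ^ (k : ℕ)) ^ 2 := by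
      have e : (c.Cgxy * ((k : ℕ) * q ^ (k : ℕ) / q * (c.Lgyy / c.Lg) * c.Cfy)) ^ 2
          = ((k : ℕ) : ℝ) ^ 2 * ((c.Cgxy * (q ^ (k : ℕ) / q * (c.Lgyy / c.Lg) * c.Cfy)) ^ 2) := by
        ring
      rw [e]
      refine (mul_le_mul_of_nonneg_right hk (sq_nonneg _)).trans (le_of_eq ?_)
      ring_nf
    rw [mul_assoc (6 * ((K : ℝ) / c.Lg) ^ 2)]
    gcongr
    linarith
  obtain ⟨A, hA⟩ : ∃ A, A = 6 * ((K : ℝ) / c.Lg) ^ 2 *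
      (c.Lgxy ^ 2 * c.Cfy ^ 2 + c.Cgxy ^ 2 * (K ^ 2 / q ^ 2 * (c.Lgyy / c.Lg) ^ 2) * c.Cfy ^ 2
        + c.Cgxy ^ 2 * c.Lfy ^ 2) := ⟨_, rfl⟩
  have hA0 : 0 ≤ A := by rw [hA]; positivity
  rw [← hA] at hpt
  calc _ ≤ (1 / (K : ℝ)) * ∑ k : Fin K, (2 * c.Lfx ^ 2 + A * (q ^ (k : ℕ)) ^ 2) := by
        gcongr with k _
        exact hpt k
    _ = 2 * c.Lfx ^ 2 + (1 / (K : ℝ)) * (A * ∑ k : Fin K, (q ^ (k : ℕ)) ^ 2) := by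
        rw [Finset.sum_add_distrib, ← Finset.mul_sum, Finset.sum_const, Finset.card_univ,
          Fintype.card_fin, nsmul_eq_mul]
        field_simp
        rw [Finset.mul_sum]
    _ ≤ 2 * c.Lfx ^ 2 + (1 / (K : ℝ)) * (A * (c.Lg ^ 2 / (2 * c.μg * c.Lg - c.μg ^ 2))) := by
        gcongr
    _ = c.LK K ^ 2 := by
        rw [Consts.LK_sq hc, hA, hqL]
        field_simp
        ring

lemma add_three_sq_le (p q r : ℝ) : (p + q + r) ^ 2 ≤ 3 * (p ^ 2 + q ^ 2 + r ^ 2) := by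
  nlinarith [sq_nonneg (p - q), sq_nonneg (q - r), sq_nonneg (p - r)]

namespace Problem

variable {m dup dlow : ℕ} {Ξ : Type u} {Z : Type v} [MeasurableSpace Ξ] [MeasurableSpace Z]
  {B : Problem m dup dlow Ξ Z} {c : Consts}

/-- For a sample at which all the regularity assumptions hold, the estimator is Lipschitz in
the point.  The product of the Neumann factors is compared by telescoping. -/
lemma norm_hatGrad_sub_sq_le (hc : c.Valid) {K : ℕ} {i : Fin m} {s : UpperSample Ξ Z K}
    (hs : B.GoodSample c i s) (x x' : Vec dup) (y y' : Vec dlow) :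
    ‖B.hatGrad c i x y s - B.hatGrad c i x' y' s‖ ^ 2 ≤
      c.lipSample K s.2.2 * (‖x - x'‖ ^ 2 + ‖y - y'‖ ^ 2) := by
  obtain ⟨hf, hg⟩ := hs
  have hL := hc.Lg_pos
  set D := √(‖x - x'‖ ^ 2 + ‖y - y'‖ ^ 2) with hD
  have hD0 : 0 ≤ D := Real.sqrt_nonneg _
  have hDsq : ‖x - x'‖ ^ 2 + ‖y - y'‖ ^ 2 = D ^ 2 := (sq_sqrt_add_sq _ _).symm
  set q := 1 - c.μg / c.Lg with hq
  have hq0 : 0 < q := by rw [hq, sub_pos, div_lt_one hL]; exact hc.μg_lt_Lg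
  set k : ℕ := Fin.val s.2.2 with hk
  let T : Fin k → Vec dlow →L[ℝ] Vec dlow := fun j =>
    B.neumannFactor c i x y (s.2.1 ⟨(j : ℕ) + 1, by omega⟩)
  let T' : Fin k → Vec dlow →L[ℝ] Vec dlow := fun j =>
    B.neumannFactor c i x' y' (s.2.1 ⟨(j : ℕ) + 1, by omega⟩)
  set w := gradY (fun x y => B.f i x y s.1) x y
  set w' := gradY (fun x y => B.f i x y s.1) x' y'
  set A := hessXY (fun x y => B.g i x y (s.2.1 0)) x y
  set A' := hessXY (fun x y => B.g i x y (s.2.1 0)) x' y'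
  have hT : ∀ j, ‖T j‖ ≤ q := fun j => norm_neumannFactor_le hc (hg _) x y
  have hT' : ∀ j, ‖T' j‖ ≤ q := fun j => norm_neumannFactor_le hc (hg _) x' y'
  have hTT : ∀ j, ‖T j - T' j‖ ≤ c.Lgyy / c.Lg * D := by
    intro j
    have h1 := (hg ⟨(j : ℕ) + 1, by omega⟩).lip_hessYY x x' y y'
    have e : T j - T' j = -((1 / c.Lg) •
        (hessYY (fun x y => B.g i x y (s.2.1 ⟨(j : ℕ) + 1, by omega⟩)) x y
          - hessYY (fun x y => B.g i x y (s.2.1 ⟨(j : ℕ) + 1, by omega⟩)) x' y')) := by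
      simp only [T, T', neumannFactor, smul_sub]
      abel
    rw [e, norm_neg, norm_smul, Real.norm_eq_abs, abs_of_pos (by positivity), div_mul_eq_mul_div,
      one_mul, div_le_iff₀ hL]
    refine h1.trans (le_of_eq ?_)
    rw [hD]
    field_simp
  have hw : ‖w‖ ≤ c.Cfy := hf.bound_gradY x y
  have hww : ‖w - w'‖ ≤ c.Lfy * D := hf.lip_gradY x x' y y'
  have hA' : ‖A'‖ ≤ c.Cgxy := (hg 0).bound_hessXY x' y'
  have hAA : ‖A - A'‖ ≤ c.Lgxy * D := (hg 0).lip_hessXY x x' y y'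
  set Pw := (List.ofFn T).prod w
  set P'w := (List.ofFn T').prod w
  set P'w' := (List.ofFn T').prod w'
  have t1 : ‖(A - A') Pw‖ ≤ c.Lgxy * (q ^ k * c.Cfy) * D := by
    have h1 := norm_prod_ofFn_le hT w
    calc _ ≤ ‖A - A'‖ * ‖Pw‖ := (A - A').le_opNorm _
      _ ≤ (c.Lgxy * D) * (q ^ k * c.Cfy) := by
        refine mul_le_mul hAA (h1.trans ?_) (norm_nonneg _) ((norm_nonneg _).trans hAA)
        gcongr
      _ = _ := by ring
  have t2 : ‖A' (Pw - P'w)‖ ≤ c.Cgxy * (k * q ^ k / q * (c.Lgyy / c.Lg) * c.Cfy) * D := by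
    have h1 := norm_prod_ofFn_sub_le hq0 hT hT' hTT w
    have h2 := hc.Lgyy_nonneg
    calc _ ≤ ‖A'‖ * ‖Pw - P'w‖ := A'.le_opNorm _
      _ ≤ c.Cgxy * (k * q ^ k / q * (c.Lgyy / c.Lg * D) * c.Cfy) := by
        refine mul_le_mul hA' (h1.trans ?_) (norm_nonneg _) hc.Cgxy_pos.le
        gcongr
      _ = _ := by ring
  have t3 : ‖A' (P'w - P'w')‖ ≤ c.Cgxy * (q ^ k * c.Lfy) * D := by
    have h1 := norm_prod_ofFn_le hT' (w - w')
    rw [map_sub] at h1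
    calc _ ≤ ‖A'‖ * ‖P'w - P'w'‖ := A'.le_opNorm _
      _ ≤ c.Cgxy * (q ^ k * (c.Lfy * D)) := by
        refine mul_le_mul hA' (h1.trans ?_) (norm_nonneg _) hc.Cgxy_pos.le
        gcongr
      _ = _ := by ring
  have hx := hf.lip_gradX x x' y y'
  have e : B.hatGrad c i x y s - B.hatGrad c i x' y' s
      = (gradX (fun x y => B.f i x y s.1) x y - gradX (fun x y => B.f i x y s.1) x' y')
        - ((K : ℝ) / c.Lg) • ((A - A') Pw + A' (Pw - P'w) + A' (P'w - P'w')) := by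
    have e1 : (A - A') Pw + A' (Pw - P'w) + A' (P'w - P'w') = A Pw - A' P'w' := by
      simp only [_root_.sub_apply, map_sub]
      abel
    rw [e1, smul_sub, hatGrad_eq, hatGrad_eq]
    abel
  rw [e, hDsq]
  set R := (A - A') Pw + A' (Pw - P'w) + A' (P'w - P'w')
  have hR : ‖R‖ ≤ (c.Lgxy * (q ^ k * c.Cfy)
      + c.Cgxy * (k * q ^ k / q * (c.Lgyy / c.Lg) * c.Cfy) + c.Cgxy * (q ^ k * c.Lfy)) * D := by
    refine (norm_add₃_le).trans ?_
    rw [add_mul, add_mul]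
    exact add_le_add (add_le_add t1 t2) t3
  have hR2 : ‖R‖ ^ 2 ≤ 3 * ((c.Lgxy * (q ^ k * c.Cfy)) ^ 2
      + (c.Cgxy * (k * q ^ k / q * (c.Lgyy / c.Lg) * c.Cfy)) ^ 2
      + (c.Cgxy * (q ^ k * c.Lfy)) ^ 2) * D ^ 2 := by
    refine (pow_le_pow_left₀ (norm_nonneg _) hR 2).trans ?_
    rw [mul_pow]
    exact mul_le_mul_of_nonneg_right (add_three_sq_le _ _ _) (sq_nonneg _)
  set Gd := gradX (fun x y => B.f i x y s.1) x y - gradX (fun x y => B.f i x y s.1) x' y'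
  have hG2 : ‖Gd‖ ^ 2 ≤ c.Lfx ^ 2 * D ^ 2 := by
    rw [← mul_pow]; exact pow_le_pow_left₀ (norm_nonneg _) hx 2
  have hfin : ‖Gd - ((K : ℝ) / c.Lg) • R‖ ^ 2 ≤
      2 * ‖Gd‖ ^ 2 + 2 * (((K : ℝ) / c.Lg) ^ 2 * ‖R‖ ^ 2) := by
    have h1 := pow_le_pow_left₀ (norm_nonneg _) (norm_sub_le Gd (((K : ℝ) / c.Lg) • R)) 2
    have h2 : ‖((K : ℝ) / c.Lg) • R‖ ^ 2 = ((K : ℝ) / c.Lg) ^ 2 * ‖R‖ ^ 2 := by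
      rw [norm_smul, mul_pow, Real.norm_eq_abs, sq_abs]
    nlinarith [sq_nonneg (‖Gd‖ - ‖((K : ℝ) / c.Lg) • R‖)]
  have h3 := mul_le_mul_of_nonneg_left hR2 (sq_nonneg ((K : ℝ) / c.Lg))
  rw [Consts.lipSample, ← hq]
  nlinarith

end Problem

/-! ### Variance reduction -/

/-- A stochastic oracle `h` for the vector field `H` driven by samples of law `ν`: it is unbiased,
has variance at most `σ²`, and is Lipschitz in mean square with constant `L`. -/
structure Oracle {a b d : ℕ} {S : Type*} [MeasurableSpace S] (ν : Measure S)
    (h : Vec a → Vec b → S → Vec d) (H : Vec a → Vec b → Vec d) (L σ : ℝ) : Prop where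
  meas : Measurable fun q : (Vec a × Vec b) × S => h q.1.1 q.1.2 q.2
  memLp : ∀ x y, MemLp (h x y) 2 ν
  mean : ∀ x y, ∫ s, h x y s ∂ν = H x y
  var : ∀ x y, ∫ s, ‖h x y s - H x y‖ ^ 2 ∂ν ≤ σ ^ 2
  lip : ∀ x x' y y', ∫ s, ‖h x y s - h x' y' s‖ ^ 2 ∂ν ≤ L ^ 2 * (‖x - x'‖ ^ 2 + ‖y - y'‖ ^ 2)

section SquareIntegrable

variable {S : Type*} [MeasurableSpace S] {ν : Measure S} {d : ℕ}

lemma integrable_norm_sq {N : S → Vec d} (hN : MemLp N 2 ν) :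
    Integrable (fun s => ‖N s‖ ^ 2) ν :=
  (memLp_two_iff_integrable_sq_norm hN.aestronglyMeasurable).1 hN

/-- Second moment of a centred random vector plus a constant. -/
lemma integral_norm_add_sq [IsProbabilityMeasure ν] {N : S → Vec d} (hN : MemLp N 2 ν)
    (h0 : ∫ s, N s ∂ν = 0) (v : Vec d) :
    ∫ s, ‖v + N s‖ ^ 2 ∂ν = ‖v‖ ^ 2 + ∫ s, ‖N s‖ ^ 2 ∂ν := by
  have hNi : Integrable N ν := hN.integrable (by norm_num)
  have h1 : ∀ s, ‖v + N s‖ ^ 2 = ‖v‖ ^ 2 + 2 * inner ℝ v (N s) + ‖N s‖ ^ 2 := fun s =>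
    norm_add_sq_real _ _
  have h2 : Integrable (fun s => inner ℝ v (N s)) ν := hNi.const_inner v
  have h3 : Integrable (fun s => ‖v‖ ^ 2 + 2 * inner ℝ v (N s)) ν :=
    (integrable_const _).add (h2.const_mul 2)
  simp_rw [h1]
  rw [integral_add h3 (integrable_norm_sq hN),
    integral_add (integrable_const _) (h2.const_mul 2), integral_const_mul, integral_inner hNi, h0]
  simp

lemma integral_norm_sub_mean_sq_add [IsProbabilityMeasure ν] {N : S → Vec d} (hN : MemLp N 2 ν) :
    ∫ s, ‖N s - ∫ s', N s' ∂ν‖ ^ 2 ∂ν + ‖∫ s, N s ∂ν‖ ^ 2 = ∫ s, ‖N s‖ ^ 2 ∂ν := by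
  have hNi : Integrable N ν := hN.integrable (by norm_num)
  set v := ∫ s', N s' ∂ν with hv
  have hc : MemLp (fun s => N s - v) 2 ν := hN.sub (memLp_const v)
  have h := integral_norm_add_sq hc (by
    rw [integral_sub hNi (integrable_const _)]; simp [hv]) v
  simp only [add_sub_cancel] at h
  rw [h]; ring

/-- A damped constant plus centred noise with a damped and an undamped part. -/
lemma integral_norm_damped_sq_le [IsProbabilityMeasure ν] {A E : S → Vec d} (hA : MemLp A 2 ν)
    (hE : MemLp E 2 ν) (hA0 : ∫ s, A s ∂ν = 0) (hE0 : ∫ s, E s ∂ν = 0) {η : ℝ} (h0 : 0 ≤ η)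
    (h1 : η ≤ 1) (v : Vec d) :
    Integrable (fun s => ‖(1 - η) • v + ((1 - η) • A s + η • E s)‖ ^ 2) ν ∧
    ∫ s, ‖(1 - η) • v + ((1 - η) • A s + η • E s)‖ ^ 2 ∂ν ≤
      (1 - η) * ‖v‖ ^ 2 + (2 * ∫ s, ‖A s‖ ^ 2 ∂ν + 2 * η ^ 2 * ∫ s, ‖E s‖ ^ 2 ∂ν) := by
  have hA' : MemLp (fun s => (1 - η) • A s) 2 ν := hA.const_smul (1 - η)
  have hE' : MemLp (fun s => η • E s) 2 ν := hE.const_smul η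
  have hN : MemLp (fun s => (1 - η) • A s + η • E s) 2 ν := hA'.add hE'
  have hN0 : ∫ s, ((1 - η) • A s + η • E s) ∂ν = 0 := by
    have i1 : Integrable (fun s => (1 - η) • A s) ν := hA'.integrable (by norm_num)
    have i2 : Integrable (fun s => η • E s) ν := hE'.integrable (by norm_num)
    rw [integral_add i1 i2, integral_smul, integral_smul, hA0, hE0, smul_zero, smul_zero, add_zero]
  refine ⟨integrable_norm_sq ((memLp_const ((1 - η) • v)).add hN), ?_⟩
  rw [integral_norm_add_sq hN hN0, norm_smul, mul_pow, Real.norm_eq_abs, sq_abs]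
  have hfirst : (1 - η) ^ 2 * ‖v‖ ^ 2 ≤ (1 - η) * ‖v‖ ^ 2 := by
    gcongr; nlinarith
  refine add_le_add hfirst ?_
  have hNle : ∀ s, ‖(1 - η) • A s + η • E s‖ ^ 2 ≤ 2 * ‖A s‖ ^ 2 + 2 * η ^ 2 * ‖E s‖ ^ 2 := by
    intro s
    have t1 : ‖(1 - η) • A s + η • E s‖ ≤ ‖A s‖ + η * ‖E s‖ := by
      refine (norm_add_le _ _).trans (add_le_add ?_ ?_)
      · rw [norm_smul, Real.norm_eq_abs, abs_of_nonneg (by linarith)]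
        exact mul_le_of_le_one_left (norm_nonneg _) (by linarith)
      · rw [norm_smul, Real.norm_eq_abs, abs_of_nonneg h0]
    have t2 := pow_le_pow_left₀ (norm_nonneg _) t1 2
    nlinarith [sq_nonneg (‖A s‖ - η * ‖E s‖)]
  have hAi := integrable_norm_sq hA
  have hEi := integrable_norm_sq hE
  have hAi' : Integrable (fun s => 2 * ‖A s‖ ^ 2) ν := hAi.const_mul 2
  have hEi' : Integrable (fun s => 2 * η ^ 2 * ‖E s‖ ^ 2) ν := hEi.const_mul (2 * η ^ 2)
  rw [← integral_const_mul, ← integral_const_mul, ← integral_add hAi' hEi']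
  exact integral_mono (integrable_norm_sq hN) (hAi'.add hEi') hNle

end SquareIntegrable

namespace Oracle

variable {a b d : ℕ} {S : Type*} [MeasurableSpace S] {ν : Measure S} [IsProbabilityMeasure ν]
  {h : Vec a → Vec b → S → Vec d} {H : Vec a → Vec b → Vec d} {L σ : ℝ}

lemma mean_lip (hO : Oracle ν h H L σ) (x x' : Vec a) (y y' : Vec b) :
    ‖H x y - H x' y'‖ ^ 2 ≤ L ^ 2 * (‖x - x'‖ ^ 2 + ‖y - y'‖ ^ 2) := by
  have h1 := integral_norm_sub_mean_sq_add ((hO.memLp x y).sub (hO.memLp x' y'))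
  simp only [Pi.sub_apply] at h1
  rw [integral_sub ((hO.memLp x y).integrable (by norm_num))
    ((hO.memLp x' y').integrable (by norm_num)), hO.mean, hO.mean] at h1
  have h2 := hO.lip x x' y y'
  have h3 : 0 ≤ ∫ s, ‖h x y s - h x' y' s - (H x y - H x' y')‖ ^ 2 ∂ν :=
    integral_nonneg fun _ => by positivity
  linarith

lemma mean_lipXY (hO : Oracle ν h H L σ) : LipXY |L| H := by
  intro x x' y y'
  refine (pow_le_pow_iff_left₀ (norm_nonneg _) (by positivity) two_ne_zero).1 ?_
  rw [mul_pow, sq_abs, sq_sqrt_add_sq]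
  exact hO.mean_lip x x' y y'

/-- One step of the momentum estimator for fixed iterates: the old error is damped and the fresh
noise has a second moment of the order of the squared movement plus `η² σ²`. -/
lemma error_step_le (hO : Oracle ν h H L σ) {η : ℝ} (h0 : 0 ≤ η) (h1 : η ≤ 1) (x x' : Vec a)
    (y y' : Vec b) (p : Vec d) :
    Integrable (fun s => ‖h x' y' s + (1 - η) • (p - h x y s) - H x' y'‖ ^ 2) ν ∧
    ∫ s, ‖h x' y' s + (1 - η) • (p - h x y s) - H x' y'‖ ^ 2 ∂ν ≤
      (1 - η) * ‖p - H x y‖ ^ 2 + 2 * L ^ 2 * (‖x' - x‖ ^ 2 + ‖y' - y‖ ^ 2)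
        + 2 * η ^ 2 * σ ^ 2 := by
  have hi := fun x y => (hO.memLp x y).integrable (q := 2) (by norm_num)
  have hΔ : MemLp (fun s => h x' y' s - h x y s) 2 ν := (hO.memLp x' y').sub (hO.memLp x y)
  have hΔmean : ∫ s, (h x' y' s - h x y s) ∂ν = H x' y' - H x y := by
    rw [integral_sub (hi x' y') (hi x y), hO.mean, hO.mean]
  have hA : MemLp (fun s => h x' y' s - h x y s - (H x' y' - H x y)) 2 ν :=
    hΔ.sub (memLp_const _)
  have hE : MemLp (fun s => h x' y' s - H x' y') 2 ν := (hO.memLp x' y').sub (memLp_const _)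
  have hA0 : ∫ s, (h x' y' s - h x y s - (H x' y' - H x y)) ∂ν = 0 := by
    rw [integral_sub (hΔ.integrable (by norm_num)) (integrable_const _), hΔmean]; simp
  have hE0 : ∫ s, (h x' y' s - H x' y') ∂ν = 0 := by
    rw [integral_sub (hi x' y') (integrable_const _), hO.mean]; simp
  obtain ⟨j1, j2⟩ := integral_norm_damped_sq_le hA hE hA0 hE0 h0 h1 (p - H x y)
  -- old error damped, plus centred increment damped, plus fresh noise
  have e : ∀ s, h x' y' s + (1 - η) • (p - h x y s) - H x' y'
      = (1 - η) • (p - H x y) + ((1 - η) • (h x' y' s - h x y s - (H x' y' - H x y))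
        + η • (h x' y' s - H x' y')) := by
    intro s
    module
  simp_rw [e]
  refine ⟨j1, j2.trans ?_⟩
  have hvar := integral_norm_sub_mean_sq_add hΔ
  rw [hΔmean] at hvar
  have hlip := hO.lip x' x y' y
  have hη2 := mul_le_mul_of_nonneg_left (hO.var x' y') (by positivity : 0 ≤ 2 * η ^ 2)
  have h3 := sq_nonneg ‖H x' y' - H x y‖
  linarith

/-- The change of the momentum estimator in one step, for fixed iterates. -/
lemma change_step_le (hO : Oracle ν h H L σ) {η : ℝ} (x x' : Vec a)
    (y y' : Vec b) (p : Vec d) :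
    Integrable (fun s => ‖h x' y' s + (1 - η) • (p - h x y s) - p‖ ^ 2) ν ∧
    ∫ s, ‖h x' y' s + (1 - η) • (p - h x y s) - p‖ ^ 2 ∂ν ≤
      3 * (L ^ 2 * (‖x' - x‖ ^ 2 + ‖y' - y‖ ^ 2) + η ^ 2 * ‖p - H x y‖ ^ 2 + η ^ 2 * σ ^ 2) := by
  have hΔ : MemLp (fun s => h x' y' s - h x y s) 2 ν := (hO.memLp x' y').sub (hO.memLp x y)
  have hB : MemLp (fun s => h x y s - H x y) 2 ν := (hO.memLp x y).sub (memLp_const _)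
  have e : ∀ s, h x' y' s + (1 - η) • (p - h x y s) - p
      = (h x' y' s - h x y s) + η • (h x y s - H x y) + η • (H x y - p) := by
    intro s
    simp only [smul_sub, sub_smul, one_smul]
    abel
  simp_rw [e]
  have hi : MemLp (fun s => (h x' y' s - h x y s) + η • (h x y s - H x y) + η • (H x y - p)) 2 ν :=
    (hΔ.add (hB.const_smul η)).add (memLp_const _)
  refine ⟨integrable_norm_sq hi, ?_⟩
  have hle : ∀ s, ‖(h x' y' s - h x y s) + η • (h x y s - H x y) + η • (H x y - p)‖ ^ 2 ≤
      3 * ‖h x' y' s - h x y s‖ ^ 2 + 3 * η ^ 2 * ‖h x y s - H x y‖ ^ 2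
        + 3 * η ^ 2 * ‖p - H x y‖ ^ 2 := by
    intro s
    have t1 := pow_le_pow_left₀ (norm_nonneg _) (norm_add₃_le (a := h x' y' s - h x y s)
      (b := η • (h x y s - H x y)) (c := η • (H x y - p))) 2
    refine t1.trans ((add_three_sq_le _ _ _).trans (le_of_eq ?_))
    rw [norm_smul, norm_smul, mul_pow, mul_pow, Real.norm_eq_abs, sq_abs, norm_sub_rev _ p]
    ring
  have i1 := integrable_norm_sq hΔ
  have i2 := integrable_norm_sq hB
  have i3 : Integrable (fun s => 3 * ‖h x' y' s - h x y s‖ ^ 2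
      + 3 * η ^ 2 * ‖h x y s - H x y‖ ^ 2) ν := (i1.const_mul 3).add (i2.const_mul (3 * η ^ 2))
  refine (integral_mono (integrable_norm_sq hi)
    (i3.add (integrable_const _)) hle).trans ?_
  simp only [Pi.add_apply]
  rw [integral_add i3 (integrable_const _),
    integral_add (i1.const_mul 3) (i2.const_mul (3 * η ^ 2)), integral_const_mul,
    integral_const_mul, integral_const]
  have h1 := hO.lip x' x y' y
  have h2 := mul_le_mul_of_nonneg_left (hO.var x y) (by positivity : 0 ≤ 3 * η ^ 2)
  simp only [probReal_univ, one_smul]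
  linarith

end Oracle

/-! ### The gradient estimators as measurable oracles -/

/-- The second-moment bound in the form of a lower integral yields square integrability and the
same bound for the Bochner integral. -/
lemma memLp_two_of_lintegral_le {S E : Type*} [MeasurableSpace S] [NormedAddCommGroup E]
    {ν : Measure S} {f : S → E} (hf : AEStronglyMeasurable f ν) {r : ℝ} (hr : 0 ≤ r)
    (h : ∫⁻ s, ‖f s‖ₑ ^ 2 ∂ν ≤ ENNReal.ofReal r) :
    MemLp f 2 ν ∧ ∫ s, ‖f s‖ ^ 2 ∂ν ≤ r := by
  have e : ∀ s, ‖f s‖ₑ ^ 2 = ENNReal.ofReal (‖f s‖ ^ 2) := fun s => by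
    rw [ENNReal.ofReal_pow (norm_nonneg _), ofReal_norm]
  have hfin : ∫⁻ s, ‖f s‖ₑ ^ 2 ∂ν < ⊤ := h.trans_lt ENNReal.ofReal_lt_top
  have hint : Integrable (fun s => ‖f s‖ ^ 2) ν := by
    refine ⟨hf.norm.pow 2, ?_⟩
    rw [hasFiniteIntegral_iff_ofReal (Filter.Eventually.of_forall fun s => by positivity)]
    simpa only [e] using hfin
  refine ⟨(memLp_two_iff_integrable_sq_norm hf).2 hint, ?_⟩
  rw [integral_eq_lintegral_of_nonneg_ae (Filter.Eventually.of_forall fun s => by positivity)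
    hint.aestronglyMeasurable]
  simp only [e] at h
  exact ENNReal.toReal_le_of_le_ofReal hr h

lemma continuous_of_sq_le {a b d : ℕ} {H : Vec a × Vec b → Vec d} {L : ℝ}
    (h : ∀ z z', ‖H z - H z'‖ ^ 2 ≤ L * (‖z.1 - z'.1‖ ^ 2 + ‖z.2 - z'.2‖ ^ 2)) :
    Continuous H := by
  refine continuous_iff_continuousAt.2 fun z => ?_
  rw [ContinuousAt, tendsto_iff_norm_sub_tendsto_zero]
  have h1 : Filter.Tendsto (fun w : Vec a × Vec b =>
      √(L * (‖w.1 - z.1‖ ^ 2 + ‖w.2 - z.2‖ ^ 2))) (nhds z) (nhds 0) := by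
    have : Continuous fun w : Vec a × Vec b => √(L * (‖w.1 - z.1‖ ^ 2 + ‖w.2 - z.2‖ ^ 2)) := by
      fun_prop
    simpa using this.tendsto z
  refine squeeze_zero (fun _ => norm_nonneg _) (fun w => ?_) h1
  exact Real.le_sqrt_of_sq_le (h w z)

namespace Problem

variable {m dup dlow : ℕ} {Ξ : Type u} {Z : Type v} [MeasurableSpace Ξ] [MeasurableSpace Z]
  {B : Problem m dup dlow Ξ Z} {c : Consts}

/-- The mean of the hypergradient estimator. -/
def meanHat (B : Problem m dup dlow Ξ Z) (c : Consts) (K : ℕ) (i : Fin m) (x : Vec dup)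
    (y : Vec dlow) : Vec dup := ∫ s, B.hatGrad c i x y s ∂B.upperLaw K

lemma integral_lipSample_le (hc : c.Valid) (hB : B.Regular c) {K : ℕ} (hK : 0 < K) :
    Integrable (fun s : UpperSample Ξ Z K => c.lipSample K s.2.2) (B.upperLaw K) ∧
      ∫ s : UpperSample Ξ Z K, c.lipSample K s.2.2 ∂B.upperLaw K ≤ c.LK K ^ 2 := by
  have := hB.prob_f
  have := hB.prob_g
  have : Nonempty (Fin K) := ⟨⟨0, hK⟩⟩
  have := isProbabilityMeasure_uniformOn (s := (Set.univ : Set (Fin K))) Set.finite_univ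
    Set.univ_nonempty
  have hi : Integrable (fun k : Fin K => c.lipSample K k) (uniformOn Set.univ) :=
    Integrable.of_finite
  have hi2 := hi.comp_snd (Measure.pi fun _ : Fin (K + 1) => B.πg)
  refine ⟨hi2.comp_snd B.πf, ?_⟩
  rw [upperLaw, integral_fun_snd (f := fun q : (Fin (K + 1) → Z) × Fin K => c.lipSample K q.2),
    integral_fun_snd (f := fun k : Fin K => c.lipSample K k), integral_uniformOn_univ]
  simpa using Consts.avg_lipSample_le hc hK

/-- The hypergradient estimator is an oracle for its mean, after a modification on a null set
that makes it jointly measurable. -/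
lemma exists_upperOracle (hc : c.Valid) (hB : B.Regular c) {K : ℕ} (hK : 0 < K) {σf σg : ℝ}
    (hV : B.Variance c K σf σg) (i : Fin m) :
    ∃ h : Vec dup → Vec dlow → UpperSample Ξ Z K → Vec dup,
      Oracle (B.upperLaw K) h (B.meanHat c K i) (c.LK K) σf ∧
      ∀ᵐ s ∂B.upperLaw K, ∀ x y, B.hatGrad c i x y s = h x y s := by
  have := isProbabilityMeasure_upperLaw hB hK
  have hmeas := fun x y => aestronglyMeasurable_hatGrad hc hB (K := K) i x y
  obtain ⟨k, hk1, hk2⟩ := exists_measurable_version (ν := B.upperLaw K)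
    (h := fun (z : Vec dup × Vec dlow) s => B.hatGrad c i z.1 z.2 s) (fun z => hmeas z.1 z.2) (by
      filter_upwards [ae_goodSample hB K i] with s hs
      exact continuous_of_sq_le fun z z' => norm_hatGrad_sub_sq_le hc hs z.1 z'.1 z.2 z'.2)
  have hae : ∀ x y, (fun s => B.hatGrad c i x y s) =ᵐ[B.upperLaw K] fun s => k (x, y) s :=
    fun x y => by filter_upwards [hk2] with s hs using (hs (x, y)).symm
  have hcentre : ∀ x y, MemLp (fun s => B.hatGrad c i x y s - B.meanHat c K i x y) 2
      (B.upperLaw K) ∧ ∫ s, ‖B.hatGrad c i x y s - B.meanHat c K i x y‖ ^ 2 ∂B.upperLaw K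
        ≤ σf ^ 2 := by
    intro x y
    have h1 := hV.upper i x y
    have e : ∀ s : UpperSample Ξ Z K, B.hatGrad c i x y s - barGrad (B.F i) (B.G i) x y
        - B.bias c K i x y = B.hatGrad c i x y s - B.meanHat c K i x y := fun s => by
      rw [bias, meanHat]; abel
    simp_rw [e] at h1
    exact memLp_two_of_lintegral_le ((hmeas x y).sub aestronglyMeasurable_const)
      (sq_nonneg _) h1
  have hmem : ∀ x y, MemLp (fun s => B.hatGrad c i x y s) 2 (B.upperLaw K) := fun x y => by
    have := (hcentre x y).1.add (memLp_const (B.meanHat c K i x y))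
    refine this.congr_norm (hmeas x y) (Filter.Eventually.of_forall fun s => ?_)
    simp
  have hmemk : ∀ x y, MemLp (k (x, y)) 2 (B.upperLaw K) := fun x y =>
    (memLp_congr_ae (hae x y)).1 (hmem x y)
  refine ⟨fun x y s => k (x, y) s, ⟨hk1, hmemk, fun x y => ?_, fun x y => ?_,
    fun x x' y y' => ?_⟩, ?_⟩
  · exact (integral_congr_ae (hae x y)).symm
  · refine le_trans (le_of_eq (integral_congr_ae ?_)) (hcentre x y).2
    filter_upwards [hae x y] with s hs
    rw [hs]
  · obtain ⟨j1, j2⟩ := integral_lipSample_le hc hB hK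
    calc _ ≤ ∫ s : UpperSample Ξ Z K,
          c.lipSample K s.2.2 * (‖x - x'‖ ^ 2 + ‖y - y'‖ ^ 2) ∂B.upperLaw K := by
          refine integral_mono_ae (integrable_norm_sq ((hmemk x y).sub (hmemk x' y')))
            (j1.mul_const _) ?_
          filter_upwards [hk2, ae_goodSample hB K i] with s hs hg
          simp only [hs]
          exact norm_hatGrad_sub_sq_le hc hg x x' y y'
      _ ≤ _ := by
          rw [integral_mul_const]
          gcongr
  · filter_upwards [hk2] with s hs x y using (hs (x, y)).symm

/-- The lower-level stochastic gradient is an oracle for the population gradient, after a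
modification on a null set. -/
lemma exists_lowerOracle (hc : c.Valid) (hB : B.Regular c) {K : ℕ} {σf σg : ℝ}
    (hV : B.Variance c K σf σg) (i : Fin m) :
    ∃ h : Vec dup → Vec dlow → Z → Vec dlow,
      Oracle B.πg h (gradY (B.G i)) c.Lg σg ∧
      ∀ᵐ ζ ∂B.πg, ∀ x y, gradY (fun x y => B.g i x y ζ) x y = h x y ζ := by
  have := hB.prob_g
  have hL : ∀ {ζ}, (LowerRegular c fun x y => B.g i x y ζ) → ∀ z z' : Vec dup × Vec dlow,
      ‖gradY (fun x y => B.g i x y ζ) z.1 z.2 - gradY (fun x y => B.g i x y ζ) z'.1 z'.2‖ ^ 2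
        ≤ c.Lg ^ 2 * (‖z.1 - z'.1‖ ^ 2 + ‖z.2 - z'.2‖ ^ 2) := by
    intro ζ hζ z z'
    have := pow_le_pow_left₀ (norm_nonneg _) (hζ.lip_gradY z.1 z'.1 z.2 z'.2) 2
    rwa [mul_pow, sq_sqrt_add_sq] at this
  have hint := fun x y => gradY_G hc hB i x y
  have hmeas := fun x y => (hint x y).1.aestronglyMeasurable
  obtain ⟨k, hk1, hk2⟩ := exists_measurable_version (ν := B.πg)
    (h := fun (z : Vec dup × Vec dlow) ζ => gradY (fun x y => B.g i x y ζ) z.1 z.2)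
    (fun z => hmeas z.1 z.2) (by
      filter_upwards [hB.lower_sample i] with ζ hζ
      exact continuous_of_sq_le (hL hζ))
  have hae : ∀ x y, (fun ζ => gradY (fun x y => B.g i x y ζ) x y) =ᵐ[B.πg]
      fun ζ => k (x, y) ζ :=
    fun x y => by filter_upwards [hk2] with s hs using (hs (x, y)).symm
  have hcentre := fun x y => memLp_two_of_lintegral_le
    ((hmeas x y).sub aestronglyMeasurable_const) (sq_nonneg _) (hV.lower i x y)
  have hmem : ∀ x y, MemLp (fun ζ => gradY (fun x y => B.g i x y ζ) x y) 2 B.πg := fun x y => by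
    have := (hcentre x y).1.add (memLp_const (gradY (B.G i) x y))
    refine this.congr_norm (hmeas x y) (Filter.Eventually.of_forall fun s => ?_)
    simp
  have hmemk : ∀ x y, MemLp (k (x, y)) 2 B.πg := fun x y =>
    (memLp_congr_ae (hae x y)).1 (hmem x y)
  refine ⟨fun x y ζ => k (x, y) ζ, ⟨hk1, hmemk, fun x y => ?_, fun x y => ?_,
    fun x x' y y' => ?_⟩, ?_⟩
  · rw [(hint x y).2]
    exact (integral_congr_ae (hae x y)).symm
  · refine le_trans (le_of_eq (integral_congr_ae ?_)) (hcentre x y).2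
    filter_upwards [hae x y] with s hs
    simp only [Pi.sub_apply, hs]
  · calc _ ≤ ∫ _ : Z, c.Lg ^ 2 * (‖x - x'‖ ^ 2 + ‖y - y'‖ ^ 2) ∂B.πg := by
          refine integral_mono_ae (integrable_norm_sq ((hmemk x y).sub (hmemk x' y')))
            (integrable_const _) ?_
          filter_upwards [hk2, hB.lower_sample i] with s hs hg
          simp only [hs]
          exact hL hg (x, y) (x', y')
      _ = _ := by simp
  · filter_upwards [hk2] with s hs x y using (hs (x, y)).symm

/-- The mean of the hypergradient estimator is the surrogate hypergradient up to an exponentially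
small bias. -/
lemma norm_meanHat_sub_le (hc : c.Valid) (hB : B.Regular c) {K : ℕ} (hK : 0 < K) {σf σg : ℝ}
    (hV : B.Variance c K σf σg) (i : Fin m) (x : Vec dup) (y : Vec dlow) :
    ‖B.meanHat c K i x y - barGrad (B.F i) (B.G i) x y‖ ≤
      c.Cgxy * ((1 - c.μg / c.Lg) ^ K * (c.Cfy / c.μg)) := by
  have := isProbabilityMeasure_upperLaw hB hK
  obtain ⟨h, hO, he⟩ := exists_upperOracle hc hB hK hV i
  refine norm_bias_le hc hB hK i x y ?_
  refine ((hO.memLp x y).integrable (by norm_num)).congr ?_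
  filter_upwards [he] with s hs using (hs x y).symm

end Problem

/-! ### Momentum estimators driven by fresh samples -/

section Fresh

variable {Ω : Type*} [MeasurableSpace Ω] {P : Measure Ω} [IsProbabilityMeasure P]

/-- A conditional bound for fixed `w` integrates to a bound for a random `W` that is independent
of the fresh sample. -/
lemma integral_le_of_indepFun {E S : Type*} [MeasurableSpace E] [MeasurableSpace S]
    {ν : Measure S} [IsProbabilityMeasure ν] {W : Ω → E} {s : Ω → S} (hW : Measurable W)
    (hs : Measurable s) (hind : IndepFun W s P) (hν : P.map s = ν) {φ : E → S → ℝ}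
    (hφ : Measurable (Function.uncurry φ)) (h0 : ∀ w s, 0 ≤ φ w s) {ψ : E → ℝ}
    (hψ : Measurable ψ)
    (hψi : Integrable (fun o => ψ (W o)) P)
    (h : ∀ w, Integrable (φ w) ν ∧ ∫ s, φ w s ∂ν ≤ ψ w) :
    Integrable (fun o => φ (W o) (s o)) P ∧ ∫ o, φ (W o) (s o) ∂P ≤ ∫ o, ψ (W o) ∂P := by
  have hmap : P.map (fun o => (W o, s o)) = (P.map W).prod ν := by
    rw [(indepFun_iff_map_prod_eq_prod_map_map hW.aemeasurable hs.aemeasurable).1 hind, hν]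
  have := Measure.isProbabilityMeasure_map (μ := P) hW.aemeasurable
  have hψW : Integrable ψ (P.map W) :=
    (integrable_map_measure hψ.aestronglyMeasurable hW.aemeasurable).2 hψi
  have hint : Integrable (fun w => ∫ s, φ w s ∂ν) (P.map W) := by
    refine hψW.mono' (hφ.stronglyMeasurable.integral_prod_right).aestronglyMeasurable
      (Filter.Eventually.of_forall fun w => ?_)
    rw [Real.norm_eq_abs, abs_of_nonneg (integral_nonneg (h0 w))]
    exact (h w).2
  have hprod : Integrable (Function.uncurry φ) ((P.map W).prod ν) := by
    refine (integrable_prod_iff hφ.aestronglyMeasurable).2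
      ⟨Filter.Eventually.of_forall fun w => (h w).1, ?_⟩
    simpa [Function.uncurry, abs_of_nonneg (h0 _ _)] using hint
  have hpair : Measurable fun o => (W o, s o) := hW.prodMk hs
  have hi : Integrable (fun o => φ (W o) (s o)) P := by
    have := (integrable_map_measure hφ.aestronglyMeasurable hpair.aemeasurable (μ := P)).1
      (by rw [hmap]; exact hprod)
    exact this
  refine ⟨hi, ?_⟩
  have e : ∫ o, φ (W o) (s o) ∂P = ∫ w, ∫ s, φ w s ∂ν ∂(P.map W) := by
    have h1 := integral_map (μ := P) hpair.aemeasurable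
      (f := Function.uncurry φ) hφ.aestronglyMeasurable
    rw [hmap, integral_prod _ hprod] at h1
    exact h1.symm
  rw [e, ← integral_map (μ := P) hW.aemeasurable hψ.aestronglyMeasurable]
  exact integral_mono hint hψW fun w => (h w).2

variable {a b d : ℕ}

lemma LipXY.memLp {L : ℝ} {H : Vec a → Vec b → Vec d} (hH : LipXY L H) {X : Ω → Vec a}
    {Y : Ω → Vec b} (hX : MemLp X 2 P) (hY : MemLp Y 2 P) :
    MemLp (fun o => H (X o) (Y o)) 2 P := by
  have hm : AEStronglyMeasurable (fun o => H (X o) (Y o)) P :=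
    hH.continuous.comp_aestronglyMeasurable (hX.aestronglyMeasurable.prodMk
      hY.aestronglyMeasurable)
  -- linear growth
  have hdom : MemLp (fun o => ‖H 0 0‖ + |L| * (‖X o‖ + ‖Y o‖)) 2 P :=
    (memLp_const ‖H 0 0‖).add ((hX.norm.add hY.norm).const_mul |L|)
  refine hdom.mono hm (Filter.Eventually.of_forall fun o => ?_)
  have h1 := hH (X o) 0 (Y o) 0
  rw [sub_zero, sub_zero] at h1
  have h2 : √(‖X o‖ ^ 2 + ‖Y o‖ ^ 2) ≤ ‖X o‖ + ‖Y o‖ := by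
    refine Real.sqrt_le_iff.2 ⟨by positivity, ?_⟩
    nlinarith [norm_nonneg (X o), norm_nonneg (Y o)]
  have h3 : L * √(‖X o‖ ^ 2 + ‖Y o‖ ^ 2) ≤ |L| * (‖X o‖ + ‖Y o‖) :=
    mul_le_mul (le_abs_self L) h2 (Real.sqrt_nonneg _) (abs_nonneg L)
  have h4 := norm_le_norm_add_norm_sub' (H (X o) (Y o)) (H 0 0)
  rw [Real.norm_eq_abs]
  exact (h4.trans (by linarith)).trans (le_abs_self _)

variable {S : Type*} [MeasurableSpace S] {ν : Measure S} [IsProbabilityMeasure ν]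
  {h : Vec a → Vec b → S → Vec d} {H : Vec a → Vec b → Vec d} {L σ : ℝ}

omit [IsProbabilityMeasure P] [IsProbabilityMeasure ν] in
/-- The initial estimator, computed from one sample at a deterministic point. -/
lemma Oracle.init (hO : Oracle ν h H L σ) {s : Ω → S} (hs : Measurable s) (hν : P.map s = ν)
    (x : Vec a) (y : Vec b) :
    MemLp (fun o => h x y (s o)) 2 P ∧ ∫ o, ‖h x y (s o) - H x y‖ ^ 2 ∂P ≤ σ ^ 2 := by
  have hmp : MeasurePreserving s P ν := ⟨hs, hν⟩
  have h1 : Measurable (h x y) := hO.meas.comp (f := fun s => ((x, y), s)) (by fun_prop)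
  refine ⟨(hO.memLp x y).comp_measurePreserving hmp, ?_⟩
  have h2 := integral_map (μ := P) hs.aemeasurable (f := fun s => ‖h x y s - H x y‖ ^ 2)
    (by fun_prop)
  rw [hν] at h2
  rw [← h2]
  exact hO.var x y

/-- One step of the momentum estimator along random iterates that are independent of the fresh
sample. -/
lemma Oracle.momentum_step (hO : Oracle ν h H L σ) {s : Ω → S} (hs : Measurable s)
    (hν : P.map s = ν) {X X' : Ω → Vec a} {Y Y' : Ω → Vec b} {p : Ω → Vec d}
    (hm : Measurable fun o => (((X o, Y o), (X' o, Y' o)), p o))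
    (hind : IndepFun (fun o => (((X o, Y o), (X' o, Y' o)), p o)) s P)
    (hX : MemLp X 2 P) (hX' : MemLp X' 2 P) (hY : MemLp Y 2 P) (hY' : MemLp Y' 2 P)
    (hp : MemLp p 2 P) {η : ℝ} (h0 : 0 ≤ η) (h1 : η ≤ 1) {p' : Ω → Vec d}
    (hp' : ∀ o, p' o = h (X' o) (Y' o) (s o) + (1 - η) • (p o - h (X o) (Y o) (s o))) :
    MemLp p' 2 P ∧
    ∫ o, ‖p' o - H (X' o) (Y' o)‖ ^ 2 ∂P ≤ (1 - η) * ∫ o, ‖p o - H (X o) (Y o)‖ ^ 2 ∂P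
      + 2 * L ^ 2 * (∫ o, ‖X' o - X o‖ ^ 2 ∂P + ∫ o, ‖Y' o - Y o‖ ^ 2 ∂P) + 2 * η ^ 2 * σ ^ 2 ∧
    ∫ o, ‖p' o - p o‖ ^ 2 ∂P ≤ 3 * (L ^ 2 * (∫ o, ‖X' o - X o‖ ^ 2 ∂P
      + ∫ o, ‖Y' o - Y o‖ ^ 2 ∂P) + η ^ 2 * ∫ o, ‖p o - H (X o) (Y o)‖ ^ 2 ∂P
      + η ^ 2 * σ ^ 2) := by
  have iX : Integrable (fun o => ‖X' o - X o‖ ^ 2) P := integrable_norm_sq (hX'.sub hX)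
  have iY : Integrable (fun o => ‖Y' o - Y o‖ ^ 2) P := integrable_norm_sq (hY'.sub hY)
  have ie : Integrable (fun o => ‖p o - H (X o) (Y o)‖ ^ 2) P :=
    integrable_norm_sq (hp.sub (hO.mean_lipXY.memLp hX hY))
  have iD : Integrable (fun o => ‖X' o - X o‖ ^ 2 + ‖Y' o - Y o‖ ^ 2) P := iX.add iY
  have hHm : Measurable fun z : Vec a × Vec b => H z.1 z.2 :=
    hO.mean_lipXY.continuous.measurable
  have hmh := hO.meas
  -- the new estimator as a function of the old variables and of the sample
  have hcur : Measurable fun q : (((Vec a × Vec b) × (Vec a × Vec b)) × Vec d) × S =>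
      h q.1.1.1.1 q.1.1.1.2 q.2 :=
    hmh.comp (g := fun q : (Vec a × Vec b) × S => h q.1.1 q.1.2 q.2)
      (f := fun q : (((Vec a × Vec b) × (Vec a × Vec b)) × Vec d) × S => (q.1.1.1, q.2))
      (by fun_prop)
  have hnew : Measurable fun q : (((Vec a × Vec b) × (Vec a × Vec b)) × Vec d) × S =>
      h q.1.1.2.1 q.1.1.2.2 q.2 :=
    hmh.comp (g := fun q : (Vec a × Vec b) × S => h q.1.1 q.1.2 q.2)
      (f := fun q : (((Vec a × Vec b) × (Vec a × Vec b)) × Vec d) × S => (q.1.1.2, q.2))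
      (by fun_prop)
  have hstep : Measurable fun q : (((Vec a × Vec b) × (Vec a × Vec b)) × Vec d) × S =>
      h q.1.1.2.1 q.1.1.2.2 q.2 + (1 - η) • (q.1.2 - h q.1.1.1.1 q.1.1.1.2 q.2) :=
    hnew.add (((measurable_snd.comp measurable_fst).sub hcur).const_smul (1 - η))
  have hHnew : Measurable fun q : ((Vec a × Vec b) × (Vec a × Vec b)) × Vec d =>
      H q.1.2.1 q.1.2.2 :=
    hHm.comp (f := fun q : ((Vec a × Vec b) × (Vec a × Vec b)) × Vec d => q.1.2) (by fun_prop)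
  have hHcur : Measurable fun q : ((Vec a × Vec b) × (Vec a × Vec b)) × Vec d =>
      H q.1.1.1 q.1.1.2 :=
    hHm.comp (f := fun q : ((Vec a × Vec b) × (Vec a × Vec b)) × Vec d => q.1.1) (by fun_prop)
  obtain ⟨i1, b1⟩ := integral_le_of_indepFun hm hs hind hν
    (φ := fun q s => ‖h q.1.2.1 q.1.2.2 s + (1 - η) • (q.2 - h q.1.1.1 q.1.1.2 s)
      - H q.1.2.1 q.1.2.2‖ ^ 2)
    (ψ := fun q => (1 - η) * ‖q.2 - H q.1.1.1 q.1.1.2‖ ^ 2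
      + 2 * L ^ 2 * (‖q.1.2.1 - q.1.1.1‖ ^ 2 + ‖q.1.2.2 - q.1.1.2‖ ^ 2) + 2 * η ^ 2 * σ ^ 2)
    (((hstep.sub (hHnew.comp measurable_fst)).norm.pow_const 2)) (fun _ _ => by positivity)
    (by fun_prop)
    (((ie.const_mul _).add (iD.const_mul _)).add (integrable_const _))
    (fun q => hO.error_step_le h0 h1 q.1.1.1 q.1.2.1 q.1.1.2 q.1.2.2 q.2)
  obtain ⟨i2, b2⟩ := integral_le_of_indepFun hm hs hind hν
    (φ := fun q s => ‖h q.1.2.1 q.1.2.2 s + (1 - η) • (q.2 - h q.1.1.1 q.1.1.2 s)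
      - q.2‖ ^ 2)
    (ψ := fun q => 3 * (L ^ 2 * (‖q.1.2.1 - q.1.1.1‖ ^ 2 + ‖q.1.2.2 - q.1.1.2‖ ^ 2)
      + η ^ 2 * ‖q.2 - H q.1.1.1 q.1.1.2‖ ^ 2 + η ^ 2 * σ ^ 2))
    (((hstep.sub (measurable_snd.comp measurable_fst)).norm.pow_const 2))
    (fun _ _ => by positivity) (by fun_prop)
    ((((iD.const_mul _).add (ie.const_mul _)).add (integrable_const _)).const_mul 3)
    (fun q => hO.change_step_le q.1.1.1 q.1.2.1 q.1.1.2 q.1.2.2 q.2)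
  simp only [← hp'] at i1 b1 i2 b2
  have hp'm : Measurable p' := by
    have : p' = fun o => h (X' o) (Y' o) (s o) + (1 - η) • (p o - h (X o) (Y o) (s o)) :=
      funext hp'
    rw [this]
    exact hstep.comp (hm.prodMk hs)
  have hdiff : MemLp (fun o => p' o - p o) 2 P :=
    (memLp_two_iff_integrable_sq_norm
      (hp'm.sub hm.snd).aestronglyMeasurable).2 i2
  refine ⟨?_, b1.trans (le_of_eq ?_), b2.trans (le_of_eq ?_)⟩
  · have := hdiff.add hp
    refine this.congr_norm hp'm.aestronglyMeasurable (Filter.Eventually.of_forall fun o => ?_)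
    simp
  · have j1 : Integrable (fun o => (1 - η) * ‖p o - H (X o) (Y o)‖ ^ 2) P := ie.const_mul _
    have j2 : Integrable (fun o => 2 * L ^ 2 * (‖X' o - X o‖ ^ 2 + ‖Y' o - Y o‖ ^ 2)) P :=
      iD.const_mul _
    have j3 : Integrable (fun o => (1 - η) * ‖p o - H (X o) (Y o)‖ ^ 2
      + 2 * L ^ 2 * (‖X' o - X o‖ ^ 2 + ‖Y' o - Y o‖ ^ 2)) P := j1.add j2
    rw [integral_add j3 (integrable_const _), integral_add j1 j2, integral_const_mul,
      integral_const_mul, integral_add iX iY]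
    simp
  · have j1 : Integrable (fun o => η ^ 2 * ‖p o - H (X o) (Y o)‖ ^ 2) P := ie.const_mul _
    have j2 : Integrable (fun o => L ^ 2 * (‖X' o - X o‖ ^ 2 + ‖Y' o - Y o‖ ^ 2)) P :=
      iD.const_mul _
    have j3 : Integrable (fun o => L ^ 2 * (‖X' o - X o‖ ^ 2 + ‖Y' o - Y o‖ ^ 2)
      + η ^ 2 * ‖p o - H (X o) (Y o)‖ ^ 2) P := j2.add j1
    rw [integral_const_mul, integral_add j3 (integrable_const _), integral_add j2 j1,
      integral_const_mul, integral_const_mul, integral_add iX iY]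
    simp

end Fresh

/-! ### The iterates as random variables -/

section Run

variable {m dup dlow : ℕ} {A Z : Type*}

/-- The iteration with general estimators `h`, `k` of the two gradients, mixing matrix `M` and
step sizes and momentum coefficients `α, β, η, γ`. -/
def run (h : Fin m → Vec dup → Vec dlow → A → Vec dup)
    (k : Fin m → Vec dup → Vec dlow → Z → Vec dlow)
    (M : Matrix (Fin m) (Fin m) ℝ) (α β η γ : ℕ → ℝ) (x₀ : Vec dup) (y₀ : Vec dlow)
    (s : ℕ → Fin m → A × Z) : ℕ → State m dup dlow
  | 0 =>
    { x := fun _ => x₀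
      y := fun _ => y₀
      p := fun i => h i x₀ y₀ (s 0 i).1
      v := fun i => k i x₀ y₀ (s 0 i).2
      u := fun i => h i x₀ y₀ (s 0 i).1 }
  | t + 1 =>
    let S := run h k M α β η γ x₀ y₀ s t
    let x : Fin m → Vec dup := fun i => ∑ j, M i j • S.x j - α t • S.u i
    let y : Fin m → Vec dlow := fun i => S.y i - β t • S.v i
    let p : Fin m → Vec dup := fun i =>
      h i (x i) (y i) (s (t + 1) i).1
        + (1 - η (t + 1)) • (S.p i - h i (S.x i) (S.y i) (s (t + 1) i).1)
    let v : Fin m → Vec dlow := fun i =>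
      k i (x i) (y i) (s (t + 1) i).2
        + (1 - γ (t + 1)) • (S.v i - k i (S.x i) (S.y i) (s (t + 1) i).2)
    { x := x
      y := y
      p := p
      v := v
      u := fun i => ∑ j, M i j • S.u j + p i - S.p i }

lemma iterate_eq_run {Ξ Z : Type*} [MeasurableSpace Ξ] [MeasurableSpace Z] (c : Consts)
    (B : Problem m dup dlow Ξ Z) (M : Matrix (Fin m) (Fin m) ℝ) (θ : ℝ) (K : ℕ) (ω : ℝ)
    (x₀ : Vec dup) (y₀ : Vec dlow) (s : ℕ → Fin m → UpperSample Ξ Z K × Z) (t : ℕ) :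
    iterate c B M θ K ω x₀ y₀ s t = run (fun i => B.hatGrad c i)
      (fun i x y ζ => gradY (fun x y => B.g i x y ζ) x y) M (stepα ω) (stepβ c m ω)
      (momη c m θ K ω) (momγ c m θ K ω) x₀ y₀ s t := by
  induction t with
  | zero => rfl
  | succ t ih => simp only [iterate, run, ih]

variable {h h' : Fin m → Vec dup → Vec dlow → A → Vec dup}
  {k k' : Fin m → Vec dup → Vec dlow → Z → Vec dlow} {M : Matrix (Fin m) (Fin m) ℝ}
  {α β η γ : ℕ → ℝ} {x₀ : Vec dup} {y₀ : Vec dlow}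

lemma run_congr {s : ℕ → Fin m → A × Z} (hh : ∀ t i x y, h i x y (s t i).1 = h' i x y (s t i).1)
    (hk : ∀ t i x y, k i x y (s t i).2 = k' i x y (s t i).2) (t : ℕ) :
    run h k M α β η γ x₀ y₀ s t = run h' k' M α β η γ x₀ y₀ s t := by
  induction t with
  | zero => simp only [run, hh, hk]
  | succ t ih => simp only [run, ih, hh, hk]

/-- The average of the tracking variables is the average of the momentum estimators. -/
lemma avg_u_run {lam : ℝ} (hM : Contracts M lam) (s : ℕ → Fin m → A × Z) (t : ℕ) :
    avg (run h k M α β η γ x₀ y₀ s t).u = avg (run h k M α β η γ x₀ y₀ s t).p := by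
  induction t with
  | zero => rfl
  | succ t ih =>
    have e : (run h k M α β η γ x₀ y₀ s (t + 1)).u = fun i =>
        (∑ j, M i j • (run h k M α β η γ x₀ y₀ s t).u j
          + (run h k M α β η γ x₀ y₀ s (t + 1)).p i) - (run h k M α β η γ x₀ y₀ s t).p i := rfl
    rw [e, avg_sub, avg_add, hM.avg_mix, ih]
    abel

/-- All components of a random state are measurable. -/
structure State.Meas {Ω : Type*} [MeasurableSpace Ω] (S : Ω → State m dup dlow) : Prop where
  x : ∀ i, Measurable fun o => (S o).x i
  y : ∀ i, Measurable fun o => (S o).y i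
  p : ∀ i, Measurable fun o => (S o).p i
  v : ∀ i, Measurable fun o => (S o).v i
  u : ∀ i, Measurable fun o => (S o).u i

/-- All components of a random state are square integrable. -/
structure State.SqInt {Ω : Type*} [MeasurableSpace Ω] (P : Measure Ω)
    (S : Ω → State m dup dlow) : Prop where
  x : ∀ i, MemLp (fun o => (S o).x i) 2 P
  y : ∀ i, MemLp (fun o => (S o).y i) 2 P
  p : ∀ i, MemLp (fun o => (S o).p i) 2 P
  v : ∀ i, MemLp (fun o => (S o).v i) 2 P
  u : ∀ i, MemLp (fun o => (S o).u i) 2 P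

variable [MeasurableSpace A] [MeasurableSpace Z]

/-- Only the samples up to time `t` have to be measurable, so that this applies also with the
σ-algebra which they generate. -/
lemma measurable_run {Ω : Type*} [MeasurableSpace Ω]
    (hh : ∀ i, Measurable fun q : (Vec dup × Vec dlow) × A => h i q.1.1 q.1.2 q.2)
    (hk : ∀ i, Measurable fun q : (Vec dup × Vec dlow) × Z => k i q.1.1 q.1.2 q.2)
    {s : ℕ → Fin m → Ω → A × Z} (t : ℕ) (hs : ∀ j ≤ t, ∀ i, Measurable (s j i)) :
    State.Meas fun o => run h k M α β η γ x₀ y₀ (fun j i => s j i o) t := by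
  have hh' : ∀ (i) {X : Ω → Vec dup} {Y : Ω → Vec dlow} {a : Ω → A}, Measurable X →
      Measurable Y → Measurable a → Measurable fun o => h i (X o) (Y o) (a o) :=
    fun i X Y a hX hY ha => (hh i).comp ((hX.prodMk hY).prodMk ha)
  have hk' : ∀ (i) {X : Ω → Vec dup} {Y : Ω → Vec dlow} {a : Ω → Z}, Measurable X →
      Measurable Y → Measurable a → Measurable fun o => k i (X o) (Y o) (a o) :=
    fun i X Y a hX hY ha => (hk i).comp ((hX.prodMk hY).prodMk ha)
  induction t with
  | zero =>
    have h0 := hs 0 le_rfl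
    exact ⟨fun _ => measurable_const, fun _ => measurable_const,
      fun i => hh' i measurable_const measurable_const (h0 i).fst,
      fun i => hk' i measurable_const measurable_const (h0 i).snd,
      fun i => hh' i measurable_const measurable_const (h0 i).fst⟩
  | succ t ih =>
    have ih := ih fun j hj => hs j (hj.trans (Nat.le_succ t))
    have h1 := hs (t + 1) le_rfl
    have hmix : ∀ {w : Ω → Fin m → Vec dup}, (∀ i, Measurable fun o => w o i) → ∀ i,
        Measurable fun o => ∑ j, M i j • w o j := fun hw i =>
      Finset.measurable_sum _ fun j _ => (hw j).const_smul (M i j)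
    have hx : ∀ i, Measurable fun o =>
        (run h k M α β η γ x₀ y₀ (fun j i => s j i o) (t + 1)).x i := fun i =>
      (hmix ih.x i).sub ((ih.u i).const_smul (α t))
    have hy : ∀ i, Measurable fun o =>
        (run h k M α β η γ x₀ y₀ (fun j i => s j i o) (t + 1)).y i := fun i =>
      (ih.y i).sub ((ih.v i).const_smul (β t))
    have hp : ∀ i, Measurable fun o =>
        (run h k M α β η γ x₀ y₀ (fun j i => s j i o) (t + 1)).p i := fun i =>
      (hh' i (hx i) (hy i) (h1 i).fst).add
        (((ih.p i).sub (hh' i (ih.x i) (ih.y i) (h1 i).fst)).const_smul (1 - η (t + 1)))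
    have hv : ∀ i, Measurable fun o =>
        (run h k M α β η γ x₀ y₀ (fun j i => s j i o) (t + 1)).v i := fun i =>
      (hk' i (hx i) (hy i) (h1 i).snd).add
        (((ih.v i).sub (hk' i (ih.x i) (ih.y i) (h1 i).snd)).const_smul (1 - γ (t + 1)))
    exact ⟨hx, hy, hp, hv, fun i => ((hmix ih.u i).add (hp i)).sub (ih.p i)⟩

/-- The variables that enter the estimators at time `t + 1` are independent of the samples of
that time. -/
lemma indepFun_run {Ω : Type*} [MeasurableSpace Ω] {P : Measure Ω}
    (hh : ∀ i, Measurable fun q : (Vec dup × Vec dlow) × A => h i q.1.1 q.1.2 q.2)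
    (hk : ∀ i, Measurable fun q : (Vec dup × Vec dlow) × Z => k i q.1.1 q.1.2 q.2)
    {s : ℕ → Fin m → Ω → A × Z} (hs : ∀ j i, Measurable (s j i))
    (hind : iIndepFun (fun t o i => s t i o) P) (t : ℕ) (i : Fin m) {E : Type*}
    [MeasurableSpace E] {g : State m dup dlow → State m dup dlow → E}
    (hg : ∀ [MeasurableSpace Ω] (S S' : Ω → State m dup dlow), State.Meas S →
      (∀ i, Measurable fun o => (S' o).x i) → (∀ i, Measurable fun o => (S' o).y i) →
      Measurable fun o => g (S o) (S' o)) :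
    IndepFun (fun o => g (run h k M α β η γ x₀ y₀ (fun j i => s j i o) t)
      (run h k M α β η γ x₀ y₀ (fun j i => s j i o) (t + 1))) (s (t + 1) i) P := by
  have hle : ∀ j, MeasurableSpace.comap (fun o i => s j i o) inferInstance
      ≤ (inferInstance : MeasurableSpace Ω) := fun j =>
    (measurable_pi_lambda _ fun i => hs j i).comap_le
  have h1 := indep_iSup_of_disjoint hle ((iIndepFun_iff_iIndep _ _ _).1 hind)
    (S := Set.Iic t) (T := {t + 1}) (by simp)
  rw [IndepFun_iff_Indep]
  refine indep_of_indep_of_le_left (indep_of_indep_of_le_right h1 ?_) ?_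
  · simp only [Set.mem_singleton_iff, iSup_iSup_eq_left]
    rw [← measurable_iff_comap_le]
    exact (measurable_pi_apply i).comp
      (comap_measurable (fun o i => s (t + 1) i o))
  · rw [← measurable_iff_comap_le]
    have hs' : ∀ j ≤ t, ∀ i, Measurable[⨆ j ∈ Set.Iic t,
        MeasurableSpace.comap (fun o i => s j i o) inferInstance] (s j i) := by
      intro j hj i
      have h2 : Measurable[MeasurableSpace.comap (fun o i => s j i o) inferInstance] (s j i) :=
        (measurable_pi_apply i).comp (comap_measurable (fun o i => s j i o))
      refine h2.mono (le_iSup₂_of_le j hj le_rfl) le_rfl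
    -- from here on measurability is meant with respect to the samples up to time `t`
    let _ : MeasurableSpace Ω := ⨆ j ∈ Set.Iic t,
        MeasurableSpace.comap (fun o i => s j i o) inferInstance
    have h3 := measurable_run (M := M) (α := α) (β := β) (η := η) (γ := γ) (x₀ := x₀)
      (y₀ := y₀) hh hk t hs'
    refine hg _ _ h3 (fun i => ?_) fun i => (h3.y i).sub ((h3.v i).const_smul (β t))
    exact (Finset.measurable_sum _ fun j _ => (h3.x j).const_smul (M i j)).sub
      ((h3.u i).const_smul (α t))

end Run

/-! ### One step of the algorithm -/

lemma consensusErr_smul {m d : ℕ} (r : ℝ) (w : Fin m → Vec d) :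
    consensusErr (fun i => r • w i) = r ^ 2 * consensusErr w := by
  simp only [consensusErr, avg_smul, ← smul_sub, norm_smul, mul_pow, Real.norm_eq_abs, sq_abs,
    Finset.mul_sum]

lemma norm_add_three_sq_le {E : Type*} [NormedAddCommGroup E] (x y z : E) :
    ‖x + y + z‖ ^ 2 ≤ 3 * (‖x‖ ^ 2 + ‖y‖ ^ 2 + ‖z‖ ^ 2) :=
  (pow_le_pow_left₀ (norm_nonneg _) norm_add₃_le 2).trans (add_three_sq_le _ _ _)

section Deterministic

variable {m d : ℕ} {M : Matrix (Fin m) (Fin m) ℝ} {lam : ℝ}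

lemma Contracts.avg_step (hM : Contracts M lam) (x u : Fin m → Vec d) (α : ℝ) :
    avg (fun i => ∑ j, M i j • x j - α • u i) = avg x - α • avg u := by
  rw [avg_sub, hM.avg_mix, avg_smul]

/-- Consensus error of the upper variables. -/
lemma Contracts.consensusErr_step_le (hM : Contracts M lam) (h0 : 0 ≤ lam) (h1 : lam < 1)
    (x u : Fin m → Vec d) (α : ℝ) :
    consensusErr (fun i => ∑ j, M i j • x j - α • u i) ≤
      lam * consensusErr x + 1 / (1 - lam) * (α ^ 2 * consensusErr u) := by
  have h := hM.consensusErr_mix_add_le h0 h1 x fun i => (-α) • u i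
  rw [consensusErr_smul, neg_sq] at h
  simpa only [neg_smul, ← sub_eq_add_neg] using h

/-- Consensus error of the tracking variables, driven by the increments of the estimators. -/
lemma Contracts.consensusErr_track_le (hM : Contracts M lam) (hm : 0 < m) (h0 : 0 ≤ lam)
    (h1 : lam < 1) (u p p' : Fin m → Vec d) :
    consensusErr (fun i => ∑ j, M i j • u j + p' i - p i) ≤
      lam * consensusErr u + 1 / (1 - lam) * ∑ i, ‖p' i - p i‖ ^ 2 := by
  have h := hM.consensusErr_mix_add_le h0 h1 u fun i => p' i - p i
  simp only [← add_sub_assoc] at h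
  have h2 : 0 ≤ 1 / (1 - lam) := by
    have : 0 < 1 - lam := by linarith
    positivity
  exact h.trans (add_le_add le_rfl (mul_le_mul_of_nonneg_left (consensusErr_le hm _) h2))

end Deterministic

namespace Problem

variable {m dup dlow : ℕ} {Ξ : Type u} {Z : Type v} [MeasurableSpace Ξ] [MeasurableSpace Z]
  {B : Problem m dup dlow Ξ Z} {c : Consts}

/-- `∑_i ‖p_i - E p̂_i‖²`, the error of the upper-level momentum estimators. -/
def upperMomErr (B : Problem m dup dlow Ξ Z) (c : Consts) (K : ℕ) (S : State m dup dlow) : ℝ :=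
  ∑ i, ‖S.p i - B.meanHat c K i (S.x i) (S.y i)‖ ^ 2

/-- `∑_i ‖v_i - ∇_y g_i‖²`, the error of the lower-level momentum estimators. -/
def lowerMomErr (B : Problem m dup dlow Ξ Z) (S : State m dup dlow) : ℝ :=
  ∑ i, ‖S.v i - gradY (B.G i) (S.x i) (S.y i)‖ ^ 2

variable (hc : c.Valid) (hB : B.Regular c)

include hc hB

/-- The averaged direction as an approximation of the hypergradient of `l`. -/
lemma norm_gradL_sub_avg_p_sq_le (hm : 0 < m) {K : ℕ} {δ : ℝ}
    (hδ : ∀ i x y, ‖B.meanHat c K i x y - barGrad (B.F i) (B.G i) x y‖ ≤ δ)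
    (S : State m dup dlow) :
    ‖B.gradL (avg S.x) - avg S.p‖ ^ 2 ≤ 3 * ((1 / (m : ℝ)) * (2 * c.Ll ^ 2 * consensusErr S.x
      + 2 * c.Lf ^ 2 * lowerErr B S) + (1 / (m : ℝ)) * B.upperMomErr c K S + δ ^ 2) := by
  have hm' : (0 : ℝ) < m := by exact_mod_cast hm
  set bg : Fin m → Vec dup := fun i => barGrad (B.F i) (B.G i) (S.x i) (S.y i)
  set H : Fin m → Vec dup := fun i => B.meanHat c K i (S.x i) (S.y i)
  have e : B.gradL (avg S.x) - avg S.p = (B.gradL (avg S.x) - avg bg)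
      + avg (fun i => bg i - H i) + avg (fun i => H i - S.p i) := by
    rw [avg_sub, avg_sub]; abel
  have h1 : ‖B.gradL (avg S.x) - avg bg‖ ^ 2 ≤ (1 / (m : ℝ)) * (2 * c.Ll ^ 2 * consensusErr S.x
      + 2 * c.Lf ^ 2 * lowerErr B S) := norm_gradL_sub_sq_le hc hB hm (avg S.x) S.x S.y
  have h2 : ‖avg (fun i => bg i - H i)‖ ^ 2 ≤ δ ^ 2 := by
    refine (norm_avg_sq_le hm _).trans ?_
    calc (1 / (m : ℝ)) * ∑ i, ‖bg i - H i‖ ^ 2 ≤ (1 / (m : ℝ)) * ∑ _i : Fin m, δ ^ 2 := by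
          gcongr with i _
          rw [norm_sub_rev]
          exact hδ i _ _
      _ = δ ^ 2 := by
          rw [Finset.sum_const, Finset.card_univ, Fintype.card_fin, nsmul_eq_mul]
          field_simp
  have h3 : ‖avg (fun i => H i - S.p i)‖ ^ 2 ≤ (1 / (m : ℝ)) * B.upperMomErr c K S := by
    refine (norm_avg_sq_le hm _).trans (le_of_eq ?_)
    simp only [upperMomErr, norm_sub_rev (S.p _), H]
  rw [e]
  have := norm_add_three_sq_le (B.gradL (avg S.x) - avg bg) (avg fun i => bg i - H i)
    (avg fun i => H i - S.p i)
  linarith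

/-- Descent of `l` at the average of the upper-level iterates. -/
lemma l_avg_step_le (hm : 0 < m) {K : ℕ} {δ : ℝ}
    (hδ : ∀ i x y, ‖B.meanHat c K i x y - barGrad (B.F i) (B.G i) x y‖ ≤ δ)
    (S : State m dup dlow) (hu : avg S.u = avg S.p) {α : ℝ} (hα : 0 ≤ α)
    (hα' : α * c.Ll ≤ 1 / 5) :
    B.l (avg S.x - α • avg S.u) ≤ B.l (avg S.x) - α / 2 * ‖B.gradL (avg S.x)‖ ^ 2
      - 2 / 5 * α * ‖avg S.u‖ ^ 2 + 3 * α * c.Ll ^ 2 / m * consensusErr S.x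
      + 3 * α * c.Lf ^ 2 / m * lowerErr B S + 3 * α / (2 * m) * B.upperMomErr c K S
      + 3 / 2 * α * δ ^ 2 := by
  have h1 := l_step_le hc hB hm (avg S.x) (avg S.u) α
  have h2 := norm_gradL_sub_avg_p_sq_le hc hB hm hδ S
  rw [← hu] at h2
  have h3 := mul_le_mul_of_nonneg_left h2 (by positivity : 0 ≤ α / 2)
  have h4 : (2 / 5 * α) * ‖avg S.u‖ ^ 2 ≤ (α / 2 - c.Ll / 2 * α ^ 2) * ‖avg S.u‖ ^ 2 := by
    refine mul_le_mul_of_nonneg_right ?_ (sq_nonneg _)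
    nlinarith
  have e : α / 2 * (3 * ((1 / (m : ℝ)) * (2 * c.Ll ^ 2 * consensusErr S.x
      + 2 * c.Lf ^ 2 * lowerErr B S) + (1 / (m : ℝ)) * B.upperMomErr c K S + δ ^ 2))
      = 3 * α * c.Ll ^ 2 / m * consensusErr S.x
      + 3 * α * c.Lf ^ 2 / m * lowerErr B S + 3 * α / (2 * m) * B.upperMomErr c K S
      + 3 / 2 * α * δ ^ 2 := by
    field_simp
  linarith

/-- The lower-level error contracts up to the error of the momentum estimators and the drift of the
minimizers caused by the movement of the upper variables. -/
lemma lowerErr_step_le {β : ℝ} (hβ : 0 < β) (hβ' : β ≤ 1 / (c.μg + c.Lg))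
    (S S' : State m dup dlow) (hy : ∀ i, S'.y i = S.y i - β • S.v i) :
    lowerErr B S' ≤ (1 - 3 / 4 * (β * c.Lμ)) * lowerErr B S
      + 2 * β / c.Lμ * B.lowerMomErr S - β / (4 * (c.μg + c.Lg)) * ∑ i, ‖S.v i‖ ^ 2
      + 17 * c.Ly ^ 2 / (4 * (β * c.Lμ)) * ∑ i, ‖S'.x i - S.x i‖ ^ 2 := by
  simp only [lowerErr, lowerMomErr, Finset.mul_sum, ← Finset.sum_add_distrib,
    ← Finset.sum_sub_distrib]
  refine Finset.sum_le_sum fun i _ => ?_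
  rw [hy i]
  exact lower_step_le hc hB i hβ hβ' (S.x i) (S'.x i) (S.y i) (S.v i)

end Problem

/-! ### Expected one-step inequalities -/

section Integrability

variable {Ω : Type*} [MeasurableSpace Ω] {P : Measure Ω} {m d : ℕ}

lemma memLp_avg {w : Ω → Fin m → Vec d} (hw : ∀ i, MemLp (fun o => w o i) 2 P) :
    MemLp (fun o => avg (w o)) 2 P := by
  have h1 : MemLp (fun o => ∑ i, w o i) 2 P := memLp_finsetSum _ fun i _ => hw i
  exact h1.const_smul (1 / (m : ℝ))

lemma memLp_mix {w : Ω → Fin m → Vec d} (hw : ∀ i, MemLp (fun o => w o i) 2 P)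
    (M : Matrix (Fin m) (Fin m) ℝ) (i : Fin m) : MemLp (fun o => ∑ j, M i j • w o j) 2 P :=
  memLp_finsetSum _ fun j _ => (hw j).const_smul (M i j)

lemma integrable_sum_norm_sq {w : Ω → Fin m → Vec d} (hw : ∀ i, MemLp (fun o => w o i) 2 P) :
    Integrable (fun o => ∑ i, ‖w o i‖ ^ 2) P :=
  integrable_finsetSum _ fun i _ => integrable_norm_sq (hw i)

lemma integrable_consensusErr {w : Ω → Fin m → Vec d} (hw : ∀ i, MemLp (fun o => w o i) 2 P) :
    Integrable (fun o => consensusErr (w o)) P :=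
  integrable_sum_norm_sq (w := fun o i => w o i - avg (w o)) fun i => (hw i).sub (memLp_avg hw)

end Integrability

namespace Problem

variable {m dup dlow : ℕ} {Ξ : Type u} {Z : Type v} [MeasurableSpace Ξ] [MeasurableSpace Z]
  {B : Problem m dup dlow Ξ Z} {c : Consts}

section Integrability

variable (hc : c.Valid) (hB : B.Regular c) {Ω : Type*} [MeasurableSpace Ω] {P : Measure Ω}
  [IsProbabilityMeasure P] {S : Ω → State m dup dlow} (hS : State.SqInt P S)

include hc hB hS

lemma memLp_gradL (hm : 0 < m) : MemLp (fun o => B.gradL (avg (S o).x)) 2 P := by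
  have hx := memLp_avg hS.x
  have hm' : AEStronglyMeasurable (fun o => B.gradL (avg (S o).x)) P :=
    (continuous_gradL hc hB hm).comp_aestronglyMeasurable hx.aestronglyMeasurable
  have hdom : MemLp (fun o => ‖B.gradL 0‖ + c.Ll * ‖avg (S o).x‖) 2 P :=
    (memLp_const ‖B.gradL 0‖).add (hx.norm.const_mul c.Ll)
  refine hdom.mono hm' (Filter.Eventually.of_forall fun o => ?_)
  have h1 := gradL_lip hc hB hm (avg (S o).x) 0
  rw [sub_zero] at h1
  have h2 := norm_le_norm_add_norm_sub' (B.gradL (avg (S o).x)) (B.gradL 0)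
  rw [Real.norm_eq_abs]
  exact (h2.trans (by linarith)).trans (le_abs_self _)

lemma integrable_l (hm : 0 < m) : Integrable (fun o => B.l (avg (S o).x)) P := by
  have hx := memLp_avg hS.x
  have hm' : AEStronglyMeasurable (fun o => B.l (avg (S o).x)) P :=
    (continuous_l hc hB).comp_aestronglyMeasurable hx.aestronglyMeasurable
  have h1 : Integrable (fun o => ‖B.gradL 0‖ * ‖avg (S o).x‖) P :=
    (hx.integrable (by norm_num)).norm.const_mul _
  have h2 : Integrable (fun o => c.Ll / 2 * ‖avg (S o).x‖ ^ 2) P :=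
    (integrable_norm_sq hx).const_mul _
  have h3 : Integrable (fun o => (|B.l 0| + |B.lStar|) + (‖B.gradL 0‖ * ‖avg (S o).x‖
      + c.Ll / 2 * ‖avg (S o).x‖ ^ 2)) P := (integrable_const _).add (h1.add h2)
  refine h3.mono' hm' (Filter.Eventually.of_forall fun o => ?_)
  have h4 := l_le hc hB hm 0 (avg (S o).x)
  rw [sub_zero] at h4
  have h5 := lStar_le hB (avg (S o).x)
  have h6 := real_inner_le_norm (B.gradL 0) (avg (S o).x)
  have h7 := le_abs_self (B.l 0)
  have h8 := neg_abs_le B.lStar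
  have h9 := abs_nonneg (B.l 0)
  have h10 := abs_nonneg B.lStar
  have h11 : 0 ≤ ‖B.gradL 0‖ * ‖avg (S o).x‖ + c.Ll / 2 * ‖avg (S o).x‖ ^ 2 := by
    have := hc.Ll_pos
    positivity
  rw [Real.norm_eq_abs, abs_le]
  constructor <;> linarith

lemma integrable_lowerErr : Integrable (fun o => lowerErr B (S o)) P := by
  refine integrable_sum_norm_sq (w := fun o i => B.yStar i ((S o).x i) - (S o).y i) fun i => ?_
  have hL : LipXY c.Ly (fun (x : Vec dup) (_ : Vec dlow) => B.yStar i x) := by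
    intro x x' y y'
    refine ((hB.lower i).argminY_lip hc x x').trans ?_
    refine mul_le_mul_of_nonneg_left ?_ hc.Ly_pos.le
    exact Real.le_sqrt_of_sq_le (by nlinarith [sq_nonneg ‖y - y'‖])
  exact (hL.memLp (hS.x i) (hS.y i)).sub (hS.y i)

lemma integrable_metric (hm : 0 < m) : Integrable (fun o => metric B (S o)) P := by
  unfold metric
  simp only [gradient_l hc hB]
  exact ((integrable_norm_sq (memLp_gradL hc hB hS hm)).add (integrable_consensusErr hS.x)).add
    (integrable_lowerErr hc hB hS)

lemma integrable_potential (hm : 0 < m) (lam θ : ℝ) (K : ℕ) (ω : ℝ) (t : ℕ) :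
    Integrable (fun o => potential c B lam θ K ω t (S o)) P :=
  (((integrable_l hc hB hS hm).add ((integrable_lowerErr hc hB hS).const_mul _)).add
    ((integrable_consensusErr hS.x).const_mul _)).add
    ((integrable_consensusErr hS.u).const_mul _)

end Integrability

end Problem

/-- The second moments of one run of the algorithm, as real sequences: expectations of the
objective `l`, the squared gradient `G`, the consensus errors `X`, `U`, the squared average
direction `Ub`, the lower-level error `Y`, the errors `Pe`, `Ve` of the two momentum estimators,
the squared lower-level directions `W`, and the squared movement `D` of the upper variables; with
the inequalities that link two consecutive times. -/
structure Recursion (c : Consts) (m : ℕ) (lam L σf σg δ : ℝ) (α β η γ : ℕ → ℝ)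
    (l G X U Ub Y Pe Ve W D : ℕ → ℝ) : Prop where
  G_nonneg : ∀ t, 0 ≤ G t
  X_nonneg : ∀ t, 0 ≤ X t
  U_nonneg : ∀ t, 0 ≤ U t
  Ub_nonneg : ∀ t, 0 ≤ Ub t
  Y_nonneg : ∀ t, 0 ≤ Y t
  Pe_nonneg : ∀ t, 0 ≤ Pe t
  Ve_nonneg : ∀ t, 0 ≤ Ve t
  W_nonneg : ∀ t, 0 ≤ W t
  X_zero : X 0 = 0
  Pe_zero : Pe 0 ≤ m * σf ^ 2
  Ve_zero : Ve 0 ≤ m * σg ^ 2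
  objective : ∀ t, l (t + 1) ≤ l t - α t / 2 * G t - 2 / 5 * α t * Ub t
    + 3 * α t * c.Ll ^ 2 / m * X t + 3 * α t * c.Lf ^ 2 / m * Y t
    + 3 * α t / (2 * m) * Pe t + 3 / 2 * α t * δ ^ 2
  lower : ∀ t, Y (t + 1) ≤ (1 - 3 / 4 * (β t * c.Lμ)) * Y t + 2 * β t / c.Lμ * Ve t
    - β t / (4 * (c.μg + c.Lg)) * W t + 17 * c.Ly ^ 2 / (4 * (β t * c.Lμ)) * D t
  consensus : ∀ t, X (t + 1) ≤ lam * X t + 1 / (1 - lam) * (α t ^ 2 * U t)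
  tracking : ∀ t, U (t + 1) ≤ lam * U t + 1 / (1 - lam) * (3 * (L ^ 2 * (D t + β t ^ 2 * W t)
    + η (t + 1) ^ 2 * Pe t + η (t + 1) ^ 2 * (m * σf ^ 2)))
  upperMomentum : ∀ t, Pe (t + 1) ≤ (1 - η (t + 1)) * Pe t
    + 2 * L ^ 2 * (D t + β t ^ 2 * W t) + 2 * η (t + 1) ^ 2 * (m * σf ^ 2)
  lowerMomentum : ∀ t, Ve (t + 1) ≤ (1 - γ (t + 1)) * Ve t
    + 2 * c.Lg ^ 2 * (D t + β t ^ 2 * W t) + 2 * γ (t + 1) ^ 2 * (m * σg ^ 2)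
  movement : ∀ t, D t ≤ 8 * X t + 2 * α t ^ 2 * U t + m * α t ^ 2 * Ub t

section ExpectedSteps

variable {m dup dlow : ℕ} {Ξ : Type u} {Z : Type v} [MeasurableSpace Ξ] [MeasurableSpace Z]
  {B : Problem m dup dlow Ξ Z} {c : Consts} {K : ℕ} {σf σg : ℝ}
  {h : Fin m → Vec dup → Vec dlow → UpperSample Ξ Z K → Vec dup}
  {k : Fin m → Vec dup → Vec dlow → Z → Vec dlow}
  (hO : ∀ i, Oracle (B.upperLaw K) (h i) (B.meanHat c K i) (c.LK K) σf)
  (hOg : ∀ i, Oracle B.πg (k i) (gradY (B.G i)) c.Lg σg)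
  {M : Matrix (Fin m) (Fin m) ℝ} {α β η γ : ℕ → ℝ} {x₀ : Vec dup} {y₀ : Vec dlow}
  {Ω : Type*} [MeasurableSpace Ω] {P : Measure Ω} [IsProbabilityMeasure P]
  {s : ℕ → Fin m → Ω → UpperSample Ξ Z K × Z} (hs : IsSampling B K P s)
  {S : ℕ → Ω → State m dup dlow}
  (hS : S = fun t o => run h k M α β η γ x₀ y₀ (fun j i => s j i o) t)

include hO hOg hs hS

lemma run_zero_bounds : State.SqInt P (S 0) ∧
    (∀ i, ∫ o, ‖(S 0 o).p i - B.meanHat c K i ((S 0 o).x i) ((S 0 o).y i)‖ ^ 2 ∂P ≤ σf ^ 2) ∧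
    ∀ i, ∫ o, ‖(S 0 o).v i - gradY (B.G i) ((S 0 o).x i) ((S 0 o).y i)‖ ^ 2 ∂P ≤ σg ^ 2 := by
  subst hS
  have hp := fun i => (hO i).init (hs.meas 0 i).fst (hs.law_upper 0 i) x₀ y₀
  have hv := fun i => (hOg i).init (hs.meas 0 i).snd (hs.law_lower 0 i) x₀ y₀
  exact ⟨⟨fun i => memLp_const x₀, fun i => memLp_const y₀, fun i => (hp i).1,
    fun i => (hv i).1, fun i => (hp i).1⟩, fun i => (hp i).2, fun i => (hv i).2⟩

variable [IsProbabilityMeasure (B.upperLaw K)] [IsProbabilityMeasure B.πg]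

/-- The momentum recursion of both estimators along a run, agent by agent. -/
lemma run_succ_bounds {t : ℕ} (hη : η (t + 1) ∈ Set.Icc (0 : ℝ) 1)
    (hγ : γ (t + 1) ∈ Set.Icc (0 : ℝ) 1) (ht : State.SqInt P (S t)) :
    State.SqInt P (S (t + 1)) ∧
    (∀ i, ∫ o, ‖(S (t + 1) o).p i
        - B.meanHat c K i ((S (t + 1) o).x i) ((S (t + 1) o).y i)‖ ^ 2 ∂P ≤
      (1 - η (t + 1)) * ∫ o, ‖(S t o).p i - B.meanHat c K i ((S t o).x i) ((S t o).y i)‖ ^ 2 ∂P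
      + 2 * c.LK K ^ 2 * (∫ o, ‖(S (t + 1) o).x i - (S t o).x i‖ ^ 2 ∂P
        + ∫ o, ‖(S (t + 1) o).y i - (S t o).y i‖ ^ 2 ∂P) + 2 * η (t + 1) ^ 2 * σf ^ 2) ∧
    (∀ i, ∫ o, ‖(S (t + 1) o).p i - (S t o).p i‖ ^ 2 ∂P ≤
      3 * (c.LK K ^ 2 * (∫ o, ‖(S (t + 1) o).x i - (S t o).x i‖ ^ 2 ∂P
        + ∫ o, ‖(S (t + 1) o).y i - (S t o).y i‖ ^ 2 ∂P) + η (t + 1) ^ 2 *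
        ∫ o, ‖(S t o).p i - B.meanHat c K i ((S t o).x i) ((S t o).y i)‖ ^ 2 ∂P
        + η (t + 1) ^ 2 * σf ^ 2)) ∧
    (∀ i, ∫ o, ‖(S (t + 1) o).v i
        - gradY (B.G i) ((S (t + 1) o).x i) ((S (t + 1) o).y i)‖ ^ 2 ∂P ≤
      (1 - γ (t + 1)) * ∫ o, ‖(S t o).v i - gradY (B.G i) ((S t o).x i) ((S t o).y i)‖ ^ 2 ∂P
      + 2 * c.Lg ^ 2 * (∫ o, ‖(S (t + 1) o).x i - (S t o).x i‖ ^ 2 ∂P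
        + ∫ o, ‖(S (t + 1) o).y i - (S t o).y i‖ ^ 2 ∂P) + 2 * γ (t + 1) ^ 2 * σg ^ 2) := by
  have hhm := fun i => (hO i).meas
  have hkm := fun i => (hOg i).meas
  have hmeas : ∀ t, State.Meas (S t) := fun t => by
    rw [hS]; exact measurable_run hhm hkm t fun j _ i => hs.meas j i
  have hx : ∀ i, MemLp (fun o => (S (t + 1) o).x i) 2 P := fun i => by
    have h1 := (memLp_mix ht.x M i).sub ((ht.u i).const_smul (α t))
    subst hS
    exact h1
  have hy : ∀ i, MemLp (fun o => (S (t + 1) o).y i) 2 P := fun i => by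
    have h1 := (ht.y i).sub ((ht.v i).const_smul (β t))
    subst hS
    exact h1
  have hp := fun i => (hO i).momentum_step (P := P) (s := fun o => (s (t + 1) i o).1)
    (X := fun o => (S t o).x i) (X' := fun o => (S (t + 1) o).x i)
    (Y := fun o => (S t o).y i) (Y' := fun o => (S (t + 1) o).y i) (p := fun o => (S t o).p i)
    (p' := fun o => (S (t + 1) o).p i) (η := η (t + 1)) (hs.meas (t + 1) i).fst
    (hs.law_upper (t + 1) i)
    (((((hmeas t).x i).prodMk ((hmeas t).y i)).prodMk
      (((hmeas (t + 1)).x i).prodMk ((hmeas (t + 1)).y i))).prodMk ((hmeas t).p i)) (by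
      have h1 := indepFun_run (M := M) (α := α) (β := β) (η := η) (γ := γ) (x₀ := x₀) (y₀ := y₀)
        hhm hkm hs.meas hs.indep t i
        (g := fun S S' => (((S.x i, S.y i), (S'.x i, S'.y i)), S.p i))
        (fun S S' h1 h2 h3 => (((h1.x i).prodMk (h1.y i)).prodMk
          ((h2 i).prodMk (h3 i))).prodMk (h1.p i))
      subst hS
      exact h1.comp measurable_id measurable_fst) (ht.x i) (hx i) (ht.y i) (hy i)
    (ht.p i) hη.1 hη.2 (by subst hS; exact fun o => rfl)
  have hv := fun i => (hOg i).momentum_step (P := P) (s := fun o => (s (t + 1) i o).2)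
    (X := fun o => (S t o).x i) (X' := fun o => (S (t + 1) o).x i)
    (Y := fun o => (S t o).y i) (Y' := fun o => (S (t + 1) o).y i) (p := fun o => (S t o).v i)
    (p' := fun o => (S (t + 1) o).v i) (η := γ (t + 1)) (hs.meas (t + 1) i).snd
    (hs.law_lower (t + 1) i)
    (((((hmeas t).x i).prodMk ((hmeas t).y i)).prodMk
      (((hmeas (t + 1)).x i).prodMk ((hmeas (t + 1)).y i))).prodMk ((hmeas t).v i)) (by
      have h1 := indepFun_run (M := M) (α := α) (β := β) (η := η) (γ := γ) (x₀ := x₀) (y₀ := y₀)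
        hhm hkm hs.meas hs.indep t i
        (g := fun S S' => (((S.x i, S.y i), (S'.x i, S'.y i)), S.v i))
        (fun S S' h1 h2 h3 => (((h1.x i).prodMk (h1.y i)).prodMk
          ((h2 i).prodMk (h3 i))).prodMk (h1.v i))
      subst hS
      exact h1.comp measurable_id measurable_snd) (ht.x i) (hx i) (ht.y i) (hy i)
    (ht.v i) hγ.1 hγ.2 (by subst hS; exact fun o => rfl)
  refine ⟨⟨hx, hy, fun i => (hp i).1, fun i => (hv i).1, fun i => ?_⟩, fun i => (hp i).2.1,
    fun i => (hp i).2.2, fun i => (hv i).2.1⟩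
  have h1 := ((memLp_mix ht.u M i).add (hp i).1).sub (ht.p i)
  subst hS
  exact h1

lemma sqInt_run (hη : ∀ t, η t ∈ Set.Icc (0 : ℝ) 1) (hγ : ∀ t, γ t ∈ Set.Icc (0 : ℝ) 1) (t : ℕ) :
    State.SqInt P (S t) := by
  induction t with
  | zero => exact (run_zero_bounds hO hOg hs hS).1
  | succ t ih => exact (run_succ_bounds hO hOg hs hS (hη _) (hγ _) ih).1

end ExpectedSteps

section ExpectedRecursion

variable {m dup dlow : ℕ} {Ξ : Type u} {Z : Type v} [MeasurableSpace Ξ] [MeasurableSpace Z]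
  {B : Problem m dup dlow Ξ Z} {c : Consts} {K : ℕ} {σf σg : ℝ}
  {h : Fin m → Vec dup → Vec dlow → UpperSample Ξ Z K → Vec dup}
  {k : Fin m → Vec dup → Vec dlow → Z → Vec dlow}
  {M : Matrix (Fin m) (Fin m) ℝ} {α β η γ : ℕ → ℝ} {x₀ : Vec dup} {y₀ : Vec dlow}
  {Ω : Type*} [MeasurableSpace Ω] {P : Measure Ω} [IsProbabilityMeasure P]
  {s : ℕ → Fin m → Ω → UpperSample Ξ Z K × Z} {S : ℕ → Ω → State m dup dlow} {lam δ : ℝ}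

/-- The expected one-step inequalities hold along every run. -/
lemma recursion_run (hc : c.Valid) (hB : B.Regular c) (hm : 0 < m)
    (hO : ∀ i, Oracle (B.upperLaw K) (h i) (B.meanHat c K i) (c.LK K) σf)
    (hOg : ∀ i, Oracle B.πg (k i) (gradY (B.G i)) c.Lg σg)
    (hs : IsSampling B K P s)
    (hS : S = fun t o => run h k M α β η γ x₀ y₀ (fun j i => s j i o) t)
    (hM : Contracts M lam) (h0 : 0 ≤ lam) (h1 : lam < 1)
    (hδ : ∀ i x y, ‖B.meanHat c K i x y - barGrad (B.F i) (B.G i) x y‖ ≤ δ)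
    (hα : ∀ t, 0 ≤ α t) (hα' : ∀ t, α t * c.Ll ≤ 1 / 5) (hβ : ∀ t, 0 < β t)
    (hβ' : ∀ t, β t ≤ 1 / (c.μg + c.Lg)) (hη : ∀ t, η t ∈ Set.Icc (0 : ℝ) 1)
    (hγ : ∀ t, γ t ∈ Set.Icc (0 : ℝ) 1)
    [IsProbabilityMeasure (B.upperLaw K)] [IsProbabilityMeasure B.πg] :
    Recursion c m lam (c.LK K) σf σg δ α β η γ (fun t => ∫ o, B.l (avg (S t o).x) ∂P)
      (fun t => ∫ o, ‖B.gradL (avg (S t o).x)‖ ^ 2 ∂P) (fun t => ∫ o, consensusErr (S t o).x ∂P)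
      (fun t => ∫ o, consensusErr (S t o).u ∂P) (fun t => ∫ o, ‖avg (S t o).u‖ ^ 2 ∂P)
      (fun t => ∫ o, lowerErr B (S t o) ∂P) (fun t => ∫ o, B.upperMomErr c K (S t o) ∂P)
      (fun t => ∫ o, B.lowerMomErr (S t o) ∂P) (fun t => ∫ o, ∑ i, ‖(S t o).v i‖ ^ 2 ∂P)
      (fun t => ∫ o, ∑ i, ‖(S (t + 1) o).x i - (S t o).x i‖ ^ 2 ∂P) := by
  have hsq := sqInt_run hO hOg hs hS hη hγ
  have hx : ∀ t o i, (S (t + 1) o).x i = ∑ j, M i j • (S t o).x j - α t • (S t o).u i := by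
    subst hS; exact fun t o i => rfl
  have hy : ∀ t o i, (S (t + 1) o).y i = (S t o).y i - β t • (S t o).v i := by
    subst hS; exact fun t o i => rfl
  have hu : ∀ t o i, (S (t + 1) o).u i
      = ∑ j, M i j • (S t o).u j + (S (t + 1) o).p i - (S t o).p i := by
    subst hS; exact fun t o i => rfl
  have hup : ∀ t o, avg (S t o).u = avg (S t o).p := by
    subst hS; exact fun t o => avg_u_run hM _ t
  have hx0 : ∀ o, (S 0 o).x = fun _ => x₀ := by
    subst hS; exact fun o => rfl
  have hlam : 0 ≤ 1 / (1 - lam) := by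
    have : 0 < 1 - lam := by linarith
    positivity
  -- integrability of all the quantities that occur
  have il := fun t => B.integrable_l hc hB (hsq t) hm
  have iG := fun t => integrable_norm_sq (B.memLp_gradL hc hB (hsq t) hm)
  have iX := fun t => integrable_consensusErr (hsq t).x
  have iU := fun t => integrable_consensusErr (hsq t).u
  have iUb := fun t => integrable_norm_sq (memLp_avg (hsq t).u)
  have iY := fun t => B.integrable_lowerErr hc hB (hsq t)
  have iPi : ∀ t i, Integrable (fun o => ‖(S t o).p i
      - B.meanHat c K i ((S t o).x i) ((S t o).y i)‖ ^ 2) P := fun t i =>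
    integrable_norm_sq (((hsq t).p i).sub ((hO i).mean_lipXY.memLp ((hsq t).x i) ((hsq t).y i)))
  have iVi : ∀ t i, Integrable (fun o => ‖(S t o).v i
      - gradY (B.G i) ((S t o).x i) ((S t o).y i)‖ ^ 2) P := fun t i =>
    integrable_norm_sq (((hsq t).v i).sub ((hOg i).mean_lipXY.memLp ((hsq t).x i) ((hsq t).y i)))
  have iP : ∀ t, Integrable (fun o => B.upperMomErr c K (S t o)) P := fun t =>
    integrable_finsetSum _ fun i _ => iPi t i
  have iV : ∀ t, Integrable (fun o => B.lowerMomErr (S t o)) P := fun t =>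
    integrable_finsetSum _ fun i _ => iVi t i
  have iW := fun t => integrable_sum_norm_sq (hsq t).v
  have iDi : ∀ t i, Integrable (fun o => ‖(S (t + 1) o).x i - (S t o).x i‖ ^ 2) P := fun t i =>
    integrable_norm_sq (((hsq (t + 1)).x i).sub ((hsq t).x i))
  have iD : ∀ t, Integrable (fun o => ∑ i, ‖(S (t + 1) o).x i - (S t o).x i‖ ^ 2) P := fun t =>
    integrable_finsetSum _ fun i _ => iDi t i
  have iEi : ∀ t i, Integrable (fun o => ‖(S (t + 1) o).p i - (S t o).p i‖ ^ 2) P := fun t i =>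
    integrable_norm_sq (((hsq (t + 1)).p i).sub ((hsq t).p i))
  have iE : ∀ t, Integrable (fun o => ∑ i, ‖(S (t + 1) o).p i - (S t o).p i‖ ^ 2) P := fun t =>
    integrable_finsetSum _ fun i _ => iEi t i
  have eD : ∀ t, ∫ o, ∑ i, ‖(S (t + 1) o).x i - (S t o).x i‖ ^ 2 ∂P
      = ∑ i, ∫ o, ‖(S (t + 1) o).x i - (S t o).x i‖ ^ 2 ∂P := fun t =>
    integral_finsetSum _ fun i _ => iDi t i
  have eP : ∀ t, ∫ o, B.upperMomErr c K (S t o) ∂P = ∑ i, ∫ o, ‖(S t o).p i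
      - B.meanHat c K i ((S t o).x i) ((S t o).y i)‖ ^ 2 ∂P := fun t =>
    integral_finsetSum _ fun i _ => iPi t i
  have eV : ∀ t, ∫ o, B.lowerMomErr (S t o) ∂P = ∑ i, ∫ o, ‖(S t o).v i
      - gradY (B.G i) ((S t o).x i) ((S t o).y i)‖ ^ 2 ∂P := fun t =>
    integral_finsetSum _ fun i _ => iVi t i
  -- the lower variables move by `β v`
  have eW : ∀ t, ∑ i, ∫ o, ‖(S (t + 1) o).y i - (S t o).y i‖ ^ 2 ∂P
      = β t ^ 2 * ∫ o, ∑ i, ‖(S t o).v i‖ ^ 2 ∂P := by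
    intro t
    rw [integral_finsetSum _ fun i _ => integrable_norm_sq ((hsq t).v i), Finset.mul_sum]
    refine Finset.sum_congr rfl fun i _ => ?_
    rw [← integral_const_mul]
    refine integral_congr_ae (Filter.Eventually.of_forall fun o => ?_)
    simp only
    rw [hy, sub_sub_cancel_left, norm_neg, norm_smul, mul_pow, Real.norm_eq_abs, sq_abs]
  have hz := run_zero_bounds hO hOg hs hS
  have hstep := fun t => run_succ_bounds hO hOg hs hS (hη (t + 1)) (hγ (t + 1)) (hsq t)
  have hcard : ∀ r : ℝ, ∑ _i : Fin m, r = m * r := fun r => by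
    rw [Finset.sum_const, Finset.card_univ, Fintype.card_fin, nsmul_eq_mul]
  refine
    { G_nonneg := fun t => integral_nonneg fun o => by positivity
      X_nonneg := fun t => integral_nonneg fun o => consensusErr_nonneg _
      U_nonneg := fun t => integral_nonneg fun o => consensusErr_nonneg _
      Ub_nonneg := fun t => integral_nonneg fun o => by positivity
      Y_nonneg := fun t => integral_nonneg fun o => Finset.sum_nonneg fun i _ => by positivity
      Pe_nonneg := fun t => integral_nonneg fun o => Finset.sum_nonneg fun i _ => by positivity
      Ve_nonneg := fun t => integral_nonneg fun o => Finset.sum_nonneg fun i _ => by positivity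
      W_nonneg := fun t => integral_nonneg fun o => Finset.sum_nonneg fun i _ => by positivity
      X_zero := ?_
      Pe_zero := ?_
      Ve_zero := ?_
      objective := fun t => ?_
      lower := fun t => ?_
      consensus := fun t => ?_
      tracking := fun t => ?_
      upperMomentum := fun t => ?_
      lowerMomentum := fun t => ?_
      movement := fun t => ?_ }
  · simp only [hx0, consensusErr_const hm, integral_zero]
  · rw [eP, ← hcard]
    exact Finset.sum_le_sum fun i _ => hz.2.1 i
  · rw [eV, ← hcard]
    exact Finset.sum_le_sum fun i _ => hz.2.2 i
  · have hpt : ∀ o, B.l (avg (S (t + 1) o).x) ≤ B.l (avg (S t o).x)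
        - α t / 2 * ‖B.gradL (avg (S t o).x)‖ ^ 2
        - 2 / 5 * α t * ‖avg (S t o).u‖ ^ 2 + 3 * α t * c.Ll ^ 2 / m * consensusErr (S t o).x
        + 3 * α t * c.Lf ^ 2 / m * lowerErr B (S t o)
        + 3 * α t / (2 * m) * B.upperMomErr c K (S t o) + 3 / 2 * α t * δ ^ 2 := by
      intro o
      have e : avg (S (t + 1) o).x = avg (S t o).x - α t • avg (S t o).u := by
        rw [← hM.avg_step]; exact congrArg avg (funext (hx t o))
      rw [e]
      exact B.l_avg_step_le hc hB hm hδ (S t o) (hup t o) (hα t) (hα' t)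
    have j1 := (iG t).const_mul (α t / 2)
    have j2 := (iUb t).const_mul (2 / 5 * α t)
    have j3 := (iX t).const_mul (3 * α t * c.Ll ^ 2 / m)
    have j4 := (iY t).const_mul (3 * α t * c.Lf ^ 2 / m)
    have j5 := (iP t).const_mul (3 * α t / (2 * m))
    have a1 := (il t).sub j1
    have a2 := a1.sub j2
    have a3 := a2.add j3
    have a4 := a3.add j4
    have a5 := a4.add j5
    have hle := integral_mono (il (t + 1)) (a5.add (integrable_const (3 / 2 * α t * δ ^ 2))) hpt
    rw [integral_add' a5 (integrable_const _), integral_add' a4 j5, integral_add' a3 j4,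
      integral_add' a2 j3, integral_sub' a1 j2, integral_sub' (il t) j1] at hle
    simpa only [integral_const_mul, integral_const, probReal_univ, one_smul] using hle
  · have hpt : ∀ o, lowerErr B (S (t + 1) o) ≤ (1 - 3 / 4 * (β t * c.Lμ)) * lowerErr B (S t o)
        + 2 * β t / c.Lμ * B.lowerMomErr (S t o)
        - β t / (4 * (c.μg + c.Lg)) * ∑ i, ‖(S t o).v i‖ ^ 2
        + 17 * c.Ly ^ 2 / (4 * (β t * c.Lμ)) * ∑ i, ‖(S (t + 1) o).x i - (S t o).x i‖ ^ 2 :=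
      fun o => B.lowerErr_step_le hc hB (hβ t) (hβ' t) (S t o) (S (t + 1) o) (hy t o)
    have j1 := (iY t).const_mul (1 - 3 / 4 * (β t * c.Lμ))
    have j2 := (iV t).const_mul (2 * β t / c.Lμ)
    have j3 := (iW t).const_mul (β t / (4 * (c.μg + c.Lg)))
    have j4 := (iD t).const_mul (17 * c.Ly ^ 2 / (4 * (β t * c.Lμ)))
    have a2 := j1.add j2
    have a3 := a2.sub j3
    have hle := integral_mono (iY (t + 1)) (a3.add j4) hpt
    rw [integral_add' a3 j4, integral_sub' a2 j3, integral_add' j1 j2] at hle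
    simpa only [integral_const_mul] using hle
  · have hpt : ∀ o, consensusErr (S (t + 1) o).x ≤ lam * consensusErr (S t o).x
        + 1 / (1 - lam) * (α t ^ 2 * consensusErr (S t o).u) := by
      intro o
      rw [show (S (t + 1) o).x = _ from funext (hx t o)]
      exact hM.consensusErr_step_le h0 h1 _ _ _
    have j1 := (iX t).const_mul lam
    have j2 := ((iU t).const_mul (α t ^ 2)).const_mul (1 / (1 - lam))
    have hle := integral_mono (iX (t + 1)) (j1.add j2) hpt
    rw [integral_add' j1 j2] at hle
    simpa only [integral_const_mul] using hle
  · have hpt : ∀ o, consensusErr (S (t + 1) o).u ≤ lam * consensusErr (S t o).u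
        + 1 / (1 - lam) * ∑ i, ‖(S (t + 1) o).p i - (S t o).p i‖ ^ 2 := by
      intro o
      rw [show (S (t + 1) o).u = _ from funext (hu t o)]
      exact hM.consensusErr_track_le hm h0 h1 _ _ _
    have j1 := (iU t).const_mul lam
    have j2 := (iE t).const_mul (1 / (1 - lam))
    have hle := integral_mono (iU (t + 1)) (j1.add j2) hpt
    rw [integral_add' j1 j2] at hle
    simp only [integral_const_mul] at hle
    refine hle.trans (add_le_add le_rfl (mul_le_mul_of_nonneg_left ?_ hlam))
    rw [integral_finsetSum _ fun i _ => iEi t i]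
    refine (Finset.sum_le_sum fun i _ => (hstep t).2.2.1 i).trans (le_of_eq ?_)
    rw [← eW, eD, eP, ← hcard, ← Finset.mul_sum]
    simp only [Finset.mul_sum, Finset.sum_add_distrib, mul_add]
  · rw [eP, eP, eD, ← eW, ← hcard]
    refine (Finset.sum_le_sum fun i _ => (hstep t).2.1 i).trans (le_of_eq ?_)
    simp only [Finset.mul_sum, Finset.sum_add_distrib, mul_add]
  · rw [eV, eV, eD, ← eW, ← hcard]
    refine (Finset.sum_le_sum fun i _ => (hstep t).2.2.2 i).trans (le_of_eq ?_)
    simp only [Finset.mul_sum, Finset.sum_add_distrib, mul_add]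
  · have hpt : ∀ o, ∑ i, ‖(S (t + 1) o).x i - (S t o).x i‖ ^ 2 ≤ 8 * consensusErr (S t o).x
        + 2 * α t ^ 2 * consensusErr (S t o).u + m * α t ^ 2 * ‖avg (S t o).u‖ ^ 2 := by
      intro o
      simp only [hx]
      exact hM.sum_norm_move_sq_le hm h0 h1 _ _ _
    have j1 := (iX t).const_mul 8
    have j2 := (iU t).const_mul (2 * α t ^ 2)
    have j3 := (iUb t).const_mul (m * α t ^ 2)
    have a2 := j1.add j2
    have hle := integral_mono (iD t) (a2.add j3) hpt
    rw [integral_add' a2 j3, integral_add' j1 j2] at hle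
    simpa only [integral_const_mul] using hle

end ExpectedRecursion

/-! ### Step sizes and constants -/

section StepSize

variable {ω : ℝ} (hω : 0 < ω)

include hω

lemma stepα_pos (t : ℕ) : 0 < stepα ω t := Real.rpow_pos_of_pos (by positivity) _

lemma inv_stepα (t : ℕ) : (stepα ω t)⁻¹ = (ω + t) ^ (1 / 3 : ℝ) := by
  rw [stepα, Real.rpow_neg (by positivity), inv_inv]

lemma inv_stepα_cube (t : ℕ) : ((stepα ω t)⁻¹) ^ 3 = ω + t := by
  rw [inv_stepα hω, ← Real.rpow_natCast, ← Real.rpow_mul (by positivity)]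
  norm_num

lemma stepα_cube (t : ℕ) : stepα ω t ^ 3 = 1 / (ω + t) := by
  rw [← inv_stepα_cube hω, inv_pow, one_div, inv_inv]

omit hω in
lemma stepα_sub_one_succ (t : ℕ) : stepα (ω - 1) (t + 1) = stepα ω t := by
  rw [stepα, stepα]; push_cast; ring_nf

/-- The increments of `1/α_t` are of the order `α_t²`. -/
lemma inv_stepα_succ_le (t : ℕ) :
    (stepα ω (t + 1))⁻¹ ≤ (stepα ω t)⁻¹ + stepα ω t ^ 2 / 3 := by
  have h1 := inv_stepα_cube hω t
  have h2 := inv_stepα_cube hω (t + 1)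
  have ha := stepα_pos hω t
  have hr : 0 < (stepα ω t)⁻¹ := inv_pos.2 ha
  have hr' : 0 < (stepα ω (t + 1))⁻¹ := inv_pos.2 (stepα_pos hω _)
  have e : stepα ω t ^ 2 = 1 / ((stepα ω t)⁻¹) ^ 2 := by rw [inv_pow, one_div, inv_inv]
  rw [e]
  set r := (stepα ω t)⁻¹
  set r' := (stepα ω (t + 1))⁻¹
  push_cast at h2
  have hle : r ≤ r' := by
    refine le_of_pow_le_pow_left₀ (n := 3) (by norm_num) hr'.le ?_
    rw [h1, h2]; linarith
  have h3 : (r' - r) * (3 * r ^ 2) ≤ 1 := by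
    have : (r' - r) * (r' ^ 2 + r' * r + r ^ 2) = 1 := by linear_combination h2 - h1
    rw [← this]
    refine mul_le_mul_of_nonneg_left ?_ (by linarith)
    nlinarith
  rw [div_div, mul_comm, ← sub_le_iff_le_add', le_div_iff₀ (by positivity)]
  linarith

end StepSize

/-- The weight `1/α_t` exceeds `1/α_{t-1}`, the step size of the offset `ω - 1`, by at most
`α_t²`. -/
lemma inv_stepα_le_pred {ω : ℝ} (hω : 1 < ω) (t : ℕ) :
    (stepα ω t)⁻¹ ≤ (stepα (ω - 1) t)⁻¹ + stepα ω t ^ 2 := by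
  have hω0 : 0 < ω := by linarith
  have hω1 : 0 < ω - 1 := by linarith
  have h1 := inv_stepα_cube hω1 t
  have h2 := inv_stepα_cube hω0 t
  have hr' : 0 < (stepα ω t)⁻¹ := inv_pos.2 (stepα_pos hω0 t)
  have hr : 0 < (stepα (ω - 1) t)⁻¹ := inv_pos.2 (stepα_pos hω1 _)
  have e : stepα ω t ^ 2 = 1 / ((stepα ω t)⁻¹) ^ 2 := by rw [inv_pow, one_div, inv_inv]
  rw [e]
  set r := (stepα (ω - 1) t)⁻¹
  set r' := (stepα ω t)⁻¹
  have hle : r ≤ r' := by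
    refine le_of_pow_le_pow_left₀ (n := 3) (by norm_num) hr'.le ?_
    rw [h1, h2]; linarith
  have h3 : (r' - r) * r' ^ 2 ≤ 1 := by
    have : (r' - r) * (r' ^ 2 + r' * r + r ^ 2) = 1 := by linear_combination h2 - h1
    rw [← this]
    refine mul_le_mul_of_nonneg_left ?_ (by linarith)
    nlinarith
  rw [← sub_le_iff_le_add', le_div_iff₀ (by positivity)]
  linarith

section Constants

variable {c : Consts} {m K : ℕ} {θ : ℝ}

lemma LK_pos (hc : c.Valid) (hK : 0 < K) : 0 < c.LK K := by
  have hd : 0 < 2 * c.μg * c.Lg - c.μg ^ 2 := by nlinarith [hc.μg_pos, hc.μg_lt_Lg]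
  have hd2 : 0 < c.Lg - c.μg := by linarith [hc.μg_lt_Lg]
  have hK0 : (0 : ℝ) < K := by exact_mod_cast hK
  have h0 : 0 ≤ c.LK K := Real.sqrt_nonneg _
  refine h0.lt_of_ne fun h => ?_
  have hsq := Consts.LK_sq hc K
  rw [← h] at hsq
  have hC := hc.Cgxy_pos
  have t1 : 0 ≤ 2 * c.Lfx ^ 2 := by positivity
  have t2 : 0 ≤ 6 * c.Cgxy ^ 2 * c.Lfy ^ 2 * K / (2 * c.μg * c.Lg - c.μg ^ 2) := by positivity
  have t3 : 0 ≤ 6 * c.Cfy ^ 2 * c.Lgxy ^ 2 * K / (2 * c.μg * c.Lg - c.μg ^ 2) := by positivity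
  have t4 : 0 ≤ 6 * c.Cgxy ^ 2 * c.Cfy ^ 2 * c.Lgyy ^ 2 * K ^ 3
      / ((c.Lg - c.μg) ^ 2 * (2 * c.μg * c.Lg - c.μg ^ 2)) := by positivity
  have e1 : c.Lfx = 0 := by
    have : 2 * c.Lfx ^ 2 = 0 := by linarith
    simpa using this
  have e2 : c.Lfy = 0 := by
    have : 6 * c.Cgxy ^ 2 * c.Lfy ^ 2 * K / (2 * c.μg * c.Lg - c.μg ^ 2) = 0 := by linarith
    simpa [hC.ne', hK0.ne', hd.ne', hK.ne'] using this
  have e3 : c.Cfy = 0 ∨ c.Lgxy = 0 := by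
    have : 6 * c.Cfy ^ 2 * c.Lgxy ^ 2 * K / (2 * c.μg * c.Lg - c.μg ^ 2) = 0 := by linarith
    simpa [hC.ne', hK0.ne', hd.ne', hK.ne'] using this
  have e4 : c.Cfy = 0 ∨ c.Lgyy = 0 := by
    have : 6 * c.Cgxy ^ 2 * c.Cfy ^ 2 * c.Lgyy ^ 2 * K ^ 3
      / ((c.Lg - c.μg) ^ 2 * (2 * c.μg * c.Lg - c.μg ^ 2)) = 0 := by linarith
    simpa [hC.ne', hK0.ne', hd.ne', hK.ne', hd2.ne'] using this
  have := hc.Lf_pos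
  rw [Consts.Lf, e1, e2] at this
  rcases e3 with e3 | e3
  · simp [e3] at this
  · rcases e4 with e4 | e4
    · simp [e4] at this
    · simp [e3, e4] at this

variable (hc : c.Valid) (hm : 0 < m)

include hc hm

lemma cbarY_pos : 0 < cbarY c m := by
  have := hc.Lf_pos
  have := hc.Ly_pos
  have : (0 : ℝ) < m := by exact_mod_cast hm
  exact lt_min (Real.sqrt_pos.2 (by positivity)) (Real.sqrt_pos.2 (by positivity))

lemma cbarY_sq_le_left : 2 * c.Ly ^ 2 * m * cbarY c m ^ 2 ≤ c.Lf ^ 2 := by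
  have := hc.Lf_pos
  have := hc.Ly_pos
  have : (0 : ℝ) < m := by exact_mod_cast hm
  have h := pow_le_pow_left₀ (cbarY_pos hc hm).le (min_le_left _ _ : cbarY c m ≤ _) 2
  rw [Real.sq_sqrt (by positivity), le_div_iff₀ (by positivity)] at h
  linarith

lemma cbarY_sq_le_right : 10 * c.Ly ^ 2 * m ^ 2 * cbarY c m ^ 2 ≤ c.Lf ^ 2 := by
  have := hc.Lf_pos
  have := hc.Ly_pos
  have : (0 : ℝ) < m := by exact_mod_cast hm
  have h := pow_le_pow_left₀ (cbarY_pos hc hm).le (min_le_right _ _ : cbarY c m ≤ _) 2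
  rw [Real.sq_sqrt (by positivity), le_div_iff₀ (by positivity)] at h
  linarith

lemma cβ_pos : 0 < cβ c m := by
  have := hc.Lf_pos
  have := hc.Lμ_pos
  have := cbarY_pos hc hm
  have : (0 : ℝ) < m := by exact_mod_cast hm
  unfold cβ; positivity

lemma cβ_mul : cβ c m * c.Lμ * (m * cbarY c m) = 8 * c.Lf ^ 2 := by
  have := hc.Lμ_pos
  have := cbarY_pos hc hm
  have : (0 : ℝ) < m := by exact_mod_cast hm
  unfold cβ; field_simp

omit hm in
lemma cbarη_pos (hK : 0 < K) : 0 < cbarη c m K := by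
  have := LK_pos hc hK
  exact lt_max_of_lt_left (by positivity)

omit hm in
lemma cbarγ_pos : 0 < cbarγ c m := by
  have := hc.Lg_pos
  exact lt_max_of_lt_left (by positivity)

lemma cβ_mul_le_cbarη : 24 * (c.μg + c.Lg) * c.LK K ^ 2 * cβ c m ≤ cbarη c m K * cbarY c m := by
  rw [← div_le_iff₀ (cbarY_pos hc hm)]
  exact (le_max_right _ _).trans (le_max_right _ _)

lemma cβ_mul_le_cbarγ : 24 * (c.μg + c.Lg) * c.Lg ^ 2 * cβ c m ≤ cbarγ c m * cbarY c m := by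
  rw [← div_le_iff₀ (cbarY_pos hc hm)]
  exact (le_max_right _ _).trans (le_max_right _ _)

omit hm in
lemma cbarU_pos (hK : 0 < K) (hθ : 0 < θ) : 0 < cbarU c m θ K := by
  have := LK_pos hc hK
  have := cbarη_pos (m := m) hc hK
  unfold cbarU; positivity

omit hm in
lemma cbarU_le_left (hK : 0 < K) (hθ : θ < 1) :
    48 * c.LK K ^ 2 * cbarU c m θ K ≤ 1 := by
  have := LK_pos hc hK
  have := cbarη_pos (m := m) hc hK
  have h : cbarU c m θ K ≤ 1 / (48 * c.LK K ^ 2) := by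
    unfold cbarU
    have h1 : 0 ≤ min (1 / (48 * c.LK K ^ 2)) (1 / (3 * cbarη c m K)) := by positivity
    nlinarith [min_le_left (1 / (48 * c.LK K ^ 2)) (1 / (3 * cbarη c m K))]
  rw [le_div_iff₀ (by positivity)] at h
  linarith

omit hm in
/-- This keeps the denominator of `c_η` away from zero. -/
lemma cbarU_le_right (hK : 0 < K) (hθ0 : 0 < θ) :
    3 * cbarU c m θ K * cbarη c m K ≤ θ := by
  have := LK_pos hc hK
  have := cbarη_pos (m := m) hc hK
  have h : cbarU c m θ K ≤ θ * (1 / (3 * cbarη c m K)) :=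
    mul_le_mul_of_nonneg_left (min_le_right _ _) hθ0.le
  rw [mul_one_div, le_div_iff₀ (by positivity)] at h
  linarith

lemma cη_mul (hK : 0 < K) (hθ0 : 0 < θ) (hθ : θ < 1) :
    cη c m θ K * (1 - 3 * cbarU c m θ K * cbarη c m K)
      = 2 * cbarη c m K / m + 1 / (3 * c.Lf) := by
  have h1 := cbarU_le_right (m := m) hc hK hθ0
  have h2 : 0 < 1 - 3 * cbarU c m θ K * cbarη c m K := by linarith
  have := hc.Lf_pos
  have : (0 : ℝ) < m := by exact_mod_cast hm
  rw [cη, div_mul_eq_mul_div, div_eq_iff (by positivity)]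
  field_simp
  ring

lemma cη_pos (hK : 0 < K) (hθ0 : 0 < θ) (hθ : θ < 1) : 0 < cη c m θ K := by
  have h1 := cbarU_le_right (m := m) hc hK hθ0
  have h2 : 0 < 1 - 3 * cbarU c m θ K * cbarη c m K := by linarith
  have := hc.Lf_pos
  have := cbarη_pos (m := m) hc hK
  have : (0 : ℝ) < m := by exact_mod_cast hm
  unfold cη
  positivity

omit hm in
lemma le_cγ (hK : 0 < K) (hθ0 : 0 < θ) :
    1 / (3 * c.Lf) + cbarγ c m * (2 * cβ c m * cbarY c m / c.Lμ) ≤ cγ c m θ K := by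
  have := cbarη_pos (m := m) hc hK
  have := cbarγ_pos (m := m) hc
  have := cbarU_pos (m := m) hc hK hθ0
  have h1 : 0 ≤ 8 * c.Lg ^ 2 * cβ c m ^ 2 := by positivity
  have h2 : 0 ≤ cbarγ c m * (8 * c.LK K ^ 2 * cβ c m ^ 2 / cbarη c m K) := by positivity
  have h3 : 0 ≤ cbarγ c m * (12 * c.LK K ^ 2 * cbarU c m θ K * cβ c m ^ 2) := by positivity
  unfold cγ
  linarith

lemma cγ_pos (hK : 0 < K) (hθ0 : 0 < θ) : 0 < cγ c m θ K := by
  have := hc.Lf_pos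
  have := hc.Lμ_pos
  have := cbarγ_pos (m := m) hc
  have := cβ_pos hc hm
  have := cbarY_pos hc hm
  exact lt_of_lt_of_le (by positivity) (le_cγ (m := m) hc hK hθ0)

end Constants

/-! ### Descent of the potential -/

/-- The bookkeeping of one step: a weighted sum of the one-step inequalities in which the
movement `D` is eliminated. -/
lemma weighted_sum_le {l l' G X X' U U' Ub Y Y' Pe Pe' Ve Ve' W D : ℝ}
    {g q e₁ e₂ e₃ y₁ y₂ y₃ y₄ lam x₁ u₁ u₂ b η γ p₁ v₁ A B n₁ n₂ n₃ n₄ : ℝ}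
    {wY wX wX' wU wP wP' wV wV' : ℝ}
    (hX : 0 ≤ X) (hU : 0 ≤ U) (hUb : 0 ≤ Ub) (hY : 0 ≤ Y) (hP : 0 ≤ Pe) (hV : 0 ≤ Ve)
    (hW : 0 ≤ W) (hwY : 0 ≤ wY) (hwX' : 0 ≤ wX') (hwU : 0 ≤ wU) (hwP' : 0 ≤ wP')
    (hwV' : 0 ≤ wV') (hy₄ : 0 ≤ y₄) (hu₁ : 0 ≤ u₁) (hp₁ : 0 ≤ p₁) (hv₁ : 0 ≤ v₁)
    (h1 : l' ≤ l - g * G - q * Ub + e₁ * X + e₂ * Y + e₃ * Pe + n₁)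
    (h2 : Y' ≤ (1 - y₁) * Y + y₂ * Ve - y₃ * W + y₄ * D)
    (h3 : X' ≤ lam * X + x₁ * U)
    (h4 : U' ≤ lam * U + u₁ * (D + b * W) + u₂ * Pe + n₂)
    (h5 : Pe' ≤ (1 - η) * Pe + p₁ * (D + b * W) + n₃)
    (h6 : Ve' ≤ (1 - γ) * Ve + v₁ * (D + b * W) + n₄)
    (h7 : D ≤ 8 * X + 2 * A * U + B * Ub)
    {rX rU rY : ℝ}
    (cX : e₁ + wX' * lam + 8 * (wY * y₄ + (wU * u₁ + wP' * p₁ + wV' * v₁)) ≤ wX - rX)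
    (cU : wX' * x₁ + wU * lam + 2 * A * (wY * y₄ + (wU * u₁ + wP' * p₁ + wV' * v₁)) ≤ wU + rU)
    (cUb : B * (wY * y₄ + (wU * u₁ + wP' * p₁ + wV' * v₁)) ≤ q)
    (cY : e₂ + rY ≤ wY * y₁)
    (cP : e₃ + wU * u₂ + wP' * (1 - η) ≤ wP)
    (cV : wY * y₂ + wV' * (1 - γ) ≤ wV)
    (cW : b * (wU * u₁ + wP' * p₁ + wV' * v₁) ≤ wY * y₃) :
    l' + wY * Y' + wX' * X' + wU * U' + wP' * Pe' + wV' * Ve' ≤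
      l + wY * Y + wX * X + wU * U + wP * Pe + wV * Ve - g * G - rX * X - rY * Y + rU * U
        + (n₁ + wU * n₂ + wP' * n₃ + wV' * n₄) := by
  set d := wU * u₁ + wP' * p₁ + wV' * v₁ with hd
  have hd0 : 0 ≤ wY * y₄ + d := by positivity
  have k2 := mul_le_mul_of_nonneg_left h2 hwY
  have k3 := mul_le_mul_of_nonneg_left h3 hwX'
  have k4 := mul_le_mul_of_nonneg_left h4 hwU
  have k5 := mul_le_mul_of_nonneg_left h5 hwP'
  have k6 := mul_le_mul_of_nonneg_left h6 hwV'
  have k7 := mul_le_mul_of_nonneg_left h7 hd0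
  have m1 := mul_le_mul_of_nonneg_right cX hX
  have m2 := mul_le_mul_of_nonneg_right cU hU
  have m3 := mul_le_mul_of_nonneg_right cUb hUb
  have m4 := mul_le_mul_of_nonneg_right cY hY
  have m5 := mul_le_mul_of_nonneg_right cP hP
  have m6 := mul_le_mul_of_nonneg_right cV hV
  have m7 := mul_le_mul_of_nonneg_right cW hW
  have eD : d * D = wU * u₁ * D + wP' * p₁ * D + wV' * v₁ * D := by rw [hd]; ring
  have eW : b * d * W = wU * u₁ * (b * W) + wP' * p₁ * (b * W) + wV' * v₁ * (b * W) := by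
    rw [hd]; ring
  linarith

/-- The potential of the convergence analysis, with weight `κ` on the consensus error of the
tracking variables.  The errors of the momentum estimators are weighted by the reciprocal of the
step size of the previous time. -/
def lyapunov (c : Consts) (m : ℕ) (lam : ℝ) (K : ℕ) (ω κ : ℝ) (l X U Y Pe Ve : ℕ → ℝ)
    (t : ℕ) : ℝ :=
  l t + cbarY c m * Y t + cbarX lam ω t * X t + κ * U t
    + (cbarη c m K)⁻¹ * (stepα (ω - 1) t)⁻¹ * Pe t + (cbarγ c m)⁻¹ * (stepα (ω - 1) t)⁻¹ * Ve t

section Charges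

variable (c : Consts) (m : ℕ) (θ : ℝ) (K : ℕ)

/-- `α_t` times the total weight with which the movement of the iterates enters the potential
through the two momentum estimators and the tracking variables. -/
def moveCharge : ℝ :=
  3 * (cbarU c m θ K * c.LK K ^ 2) + 2 * (c.LK K ^ 2 * (cbarη c m K)⁻¹)
    + 2 * (c.Lg ^ 2 * (cbarγ c m)⁻¹)

/-- `α_t` times the weight with which the movement of the upper variables enters the potential
through the lower-level error. -/
def lowerCharge : ℝ := 17 * cbarY c m * c.Ly ^ 2 / (4 * (cβ c m * c.Lμ))

variable {c m θ K} (hc : c.Valid) (hm : 0 < m) (hK : 0 < K) (hθ0 : 0 < θ) (hθ : θ < 1)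

include hc hm in
/-- The two bounds on `c̄_y` in its definition. -/
lemma lowerCharge_le : 8 * lowerCharge c m ≤ 17 / 8 ∧ m * lowerCharge c m ≤ 17 / 320 := by
  have hcy := cbarY_pos hc hm
  have hcb := cβ_pos hc hm
  have hLμ := hc.Lμ_pos
  have hm' : (0 : ℝ) < m := by exact_mod_cast hm
  have cy1 := cbarY_sq_le_left hc hm
  have cy2 := cbarY_sq_le_right hc hm
  have cbm := cβ_mul hc hm
  have hLf2 : 0 < c.Lf ^ 2 := by have := hc.Lf_pos; positivity
  set w := lowerCharge c m with hw
  have hw' : w * (32 * c.Lf ^ 2) = 17 * (c.Ly ^ 2 * m * cbarY c m ^ 2) := by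
    rw [hw, lowerCharge, show 32 * c.Lf ^ 2 = 4 * (cβ c m * c.Lμ * (m * cbarY c m)) by
      rw [cbm]; ring]
    field_simp
  refine ⟨?_, ?_⟩
  · have : 8 * w * (4 * c.Lf ^ 2) ≤ 17 / 8 * (4 * c.Lf ^ 2) := by linarith
    exact le_of_mul_le_mul_right this (by positivity)
  · have e : m * (w * (32 * c.Lf ^ 2)) = m * (17 * (c.Ly ^ 2 * m * cbarY c m ^ 2)) := by rw [hw']
    have : m * w * (32 * c.Lf ^ 2) ≤ 17 / 320 * (32 * c.Lf ^ 2) := by linarith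
    exact le_of_mul_le_mul_right this (by positivity)

include hc hK hθ0 hθ in
/-- The bounds on `c̄_u`, `c̄_η` and `c̄_γ` in their definitions, in the form in which they are
needed to absorb the movement of the iterates. -/
lemma moveCharge_le (hm : 0 < m) : 8 * moveCharge c m θ K ≤ 3 / 2 ∧
    m * moveCharge c m θ K ≤ 1 / 32 ∧
    cβ c m * moveCharge c m θ K ≤ cbarY c m / (4 * (c.μg + c.Lg)) ∧
    3 * cbarU c m θ K ≤ (cbarη c m K)⁻¹ := by
  have hL := LK_pos hc hK
  have hcy := cbarY_pos hc hm
  have hcb := cβ_pos hc hm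
  have hce := cbarη_pos (m := m) hc hK
  have hcg := cbarγ_pos (m := m) hc
  have hLg := hc.Lg_pos
  have hμ := hc.μg_pos
  have ce1 : 32 * c.LK K ^ 2 ≤ cbarη c m K := le_max_left _ _
  have ce2 : 160 * c.LK K ^ 2 * m ≤ cbarη c m K := (le_max_left _ _).trans (le_max_right _ _)
  have ce3 := cβ_mul_le_cbarη hc hm (K := K)
  have cg1 : 32 * c.Lg ^ 2 ≤ cbarγ c m := le_max_left _ _
  have cg2 : 160 * c.Lg ^ 2 * m ≤ cbarγ c m := (le_max_left _ _).trans (le_max_right _ _)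
  have cg3 := cβ_mul_le_cbarγ hc hm
  have cu1 := cbarU_le_left (m := m) hc hK hθ
  have cu2 := cbarU_le_right (m := m) hc hK hθ0
  have hS : 0 < c.μg + c.Lg := by linarith
  set cy := cbarY c m
  set cb := cβ c m
  set ce := cbarη c m K
  set cg := cbarγ c m
  set cu := cbarU c m θ K
  set L := c.LK K
  have hL2 : L ^ 2 * ce⁻¹ ≤ 1 / 32 := by
    rw [← div_eq_mul_inv, div_le_iff₀ hce]; linarith only [ce1]
  have hL2m : L ^ 2 * ce⁻¹ * m ≤ 1 / 160 := by
    rw [mul_right_comm, ← div_eq_mul_inv, div_le_iff₀ hce]; linarith only [ce2]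
  have hg2 : c.Lg ^ 2 * cg⁻¹ ≤ 1 / 32 := by
    rw [← div_eq_mul_inv, div_le_iff₀ hcg]; linarith only [cg1]
  have hg2m : c.Lg ^ 2 * cg⁻¹ * m ≤ 1 / 160 := by
    rw [mul_right_comm, ← div_eq_mul_inv, div_le_iff₀ hcg]; linarith only [cg2]
  have hcu3 : 3 * cu ≤ ce⁻¹ := by
    rw [← one_div, le_div_iff₀ hce]; linarith only [cu2, hθ]
  have hcuL : cu * L ^ 2 ≤ 1 / 48 := by linarith only [cu1]
  have hL2b : L ^ 2 * ce⁻¹ * cb ≤ cy / (24 * (c.μg + c.Lg)) := by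
    rw [le_div_iff₀ (by positivity), mul_right_comm (L ^ 2), ← div_eq_mul_inv, div_mul_eq_mul_div,
      div_le_iff₀ hce]
    linarith only [ce3]
  have hg2b : c.Lg ^ 2 * cg⁻¹ * cb ≤ cy / (24 * (c.μg + c.Lg)) := by
    rw [le_div_iff₀ (by positivity), mul_right_comm (c.Lg ^ 2), ← div_eq_mul_inv,
      div_mul_eq_mul_div, div_le_iff₀ hcg]
    linarith only [cg3]
  have hcuLL : 3 * cu * L ^ 2 ≤ ce⁻¹ * L ^ 2 := by gcongr
  refine ⟨?_, ?_, ?_, hcu3⟩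
  · rw [moveCharge]
    linarith only [hL2, hg2, hcuL]
  · have := mul_le_mul_of_nonneg_right hcuLL (by positivity : (0 : ℝ) ≤ m)
    rw [moveCharge]
    linarith only [hL2m, hg2m, this]
  · have := mul_le_mul_of_nonneg_right hcuLL hcb.le
    have e : cy / (4 * (c.μg + c.Lg)) = 6 * (cy / (24 * (c.μg + c.Lg))) := by field_simp; norm_num
    have h0 : 0 < cy / (24 * (c.μg + c.Lg)) := by positivity
    rw [moveCharge, e]
    linarith only [hL2b, hg2b, this, h0]

end Charges

section Descent

variable {c : Consts} {m K : ℕ} {lam θ ω κ σf σg δ : ℝ}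
  {l G X U Ub Y Pe Ve W D : ℕ → ℝ}

/-- One step of the algorithm decreases the potential up to noise, as long as the weight `κ` is at
most `c̄_u (1 - lam) / α_t`, except for a multiple of the tracking error that is harmless only if
`κ (1 - lam) ≥ 3 c̄_u / 5`. -/
lemma lyapunov_succ_le (hc : c.Valid) (hm : 2 ≤ m) (hK : 0 < K) (h0 : 0 ≤ lam) (h1 : lam < 1)
    (hθ0 : 0 < θ) (hθ : θ < 1) (hA : Admissible c m lam θ K ω)
    (hR : Recursion c m lam (c.LK K) σf σg δ (stepα ω) (stepβ c m ω) (momη c m θ K ω)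
      (momγ c m θ K ω) l G X U Ub Y Pe Ve W D) (t : ℕ) (hκ0 : 0 ≤ κ)
    (hκ : κ * stepα ω t ≤ cbarU c m θ K * (1 - lam)) :
    lyapunov c m lam K ω κ l X U Y Pe Ve (t + 1) ≤ lyapunov c m lam K ω κ l X U Y Pe Ve t
      - stepα ω t / 2 * G t - (stepα ω t)⁻¹ * X t - 3 * stepα ω t * c.Lf ^ 2 / m * Y t
      + (3 / 5 * cbarU c m θ K - κ * (1 - lam)) * U t
      + (3 / 2 * stepα ω t * δ ^ 2
        + 3 * (cbarη c m K)⁻¹ * (stepα ω t)⁻¹ * momη c m θ K ω (t + 1) ^ 2 * (m * σf ^ 2)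
        + 2 * (cbarγ c m)⁻¹ * (stepα ω t)⁻¹ * momγ c m θ K ω (t + 1) ^ 2 * (m * σg ^ 2)) := by
  have hm0 : 0 < m := by omega
  have hω0 : 0 < ω := by linarith [hA.two_le]
  have hm2 : (2 : ℝ) ≤ m := by exact_mod_cast hm
  -- positivity of all the constants
  have hL := LK_pos hc hK
  have hcy := cbarY_pos hc hm0
  have hcb := cβ_pos hc hm0
  have hce := cbarη_pos (m := m) hc hK
  have hcg := cbarγ_pos hc (m := m)
  have hcu := cbarU_pos (m := m) hc hK hθ0
  have hη := cη_pos hc hm0 hK hθ0 hθ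
  have hγ := cγ_pos hc hm0 hK hθ0
  have hLμ := hc.Lμ_pos
  have hLy := hc.Ly_pos
  have hLf := hc.Lf_pos
  have hLl := hc.Ll_pos
  have hLg := hc.Lg_pos
  have hμ := hc.μg_pos
  have hh : 0 < 1 - lam := by linarith
  -- relations between the constants
  have cbm := cβ_mul hc hm0
  have cu1 := cbarU_le_left (m := m) hc hK hθ
  have eη := cη_mul hc hm0 hK hθ0 hθ
  have eγ := le_cγ (m := m) hc hK hθ0 (θ := θ)
  obtain ⟨hs8, hsm, hsb, hcu3⟩ := moveCharge_le hc hK hθ0 hθ hm0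
  obtain ⟨hw8, hwm⟩ := lowerCharge_le hc hm0
  -- step sizes
  have ha := stepα_pos hω0 t
  have hr' := inv_stepα_succ_le hω0 t
  have hrp := inv_stepα_le_pred (by linarith [hA.two_le] : 1 < ω) t
  have hcube := stepα_cube hω0 t
  have A2 := hA.α_le_2 t
  have A3 := hA.α_le_3 t
  have A4 := hA.α_le_4 t
  have A5 := hA.α_le_5 t
  have A6 := hA.α_le_6 t
  have A7 := hA.α_le_7 t
  have A11 := hA.α_le_11 t
  have hη1 := (hA.η_mem (t + 1)).2
  have hγ1 := (hA.γ_mem (t + 1)).2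
  have eη' : momη c m θ K ω (t + 1) = cη c m θ K * stepα ω t ^ 2 := rfl
  have eγ' : momγ c m θ K ω (t + 1) = cγ c m θ K * stepα ω t ^ 2 := rfl
  have eβ : stepβ c m ω t = cβ c m * stepα ω t := rfl
  have R1 := hR.objective t
  have R2 := hR.lower t
  have R3 := hR.consensus t
  have R4 := hR.tracking t
  have R5 := hR.upperMomentum t
  have R6 := hR.lowerMomentum t
  have R7 := hR.movement t
  have hω2 := hA.two_le
  rw [eβ] at R2 R4 R5 R6
  rw [eη'] at R4 R5 hη1
  rw [eγ'] at R6 hγ1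
  rw [eη', eγ']
  simp only [lyapunov, cbarX, stepα_sub_one_succ]
  set a := stepα ω t with ha_def
  set a' := stepα ω (t + 1)
  set ap := stepα (ω - 1) t
  set cy := cbarY c m
  set cb := cβ c m
  set ce := cbarη c m K
  set cg := cbarγ c m
  set cu := cbarU c m θ K
  set ηc := cη c m θ K
  set γc := cγ c m θ K
  set L := c.LK K
  set h := 1 - lam with hh_def
  have hapos' : 0 < a' := stepα_pos hω0 _
  have hap : 0 < ap := stepα_pos (by linarith) _
  set r := a⁻¹ with hr_def
  have hr : 0 < r := inv_pos.2 ha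
  have har : a * r = 1 := mul_inv_cancel₀ ha.ne'
  have ha' : a'⁻¹ ≤ r + a ^ 2 / 3 := hr'
  have ha3 : a ^ 3 ≤ 1 / 2 := by
    rw [hcube]
    exact one_div_le_one_div_of_le (by norm_num) (by
      have : (0 : ℝ) ≤ t := Nat.cast_nonneg t
      linarith)
  have ha_le : a ≤ 4 / 5 := by
    by_contra hcon
    have hpow := pow_le_pow_left₀ (by norm_num) (not_le.1 hcon).le 3
    norm_num at hpow
    linarith only [hpow, ha3]
  have ha_r : a ≤ 0.64 * r := by
    have : a * a ≤ 0.64 := by nlinarith only [ha, ha_le]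
    calc a = (a * a) * r := by rw [mul_assoc, har, mul_one]
      _ ≤ 0.64 * r := by gcongr
  -- the weight `κ` turns the tracking constants into multiples of `1 / a`
  have hκh : κ * (1 / h) ≤ cu * r := by
    rw [mul_one_div, div_le_iff₀ hh]
    calc κ = κ * a * r := by rw [mul_assoc, har, mul_one]
      _ ≤ cu * h * r := by gcongr
      _ = cu * r * h := by ring
  have hs : moveCharge c m θ K
    = 3 * (cu * L ^ 2) + 2 * (L ^ 2 * ce⁻¹) + 2 * (c.Lg ^ 2 * cg⁻¹) := rfl
  have hw : lowerCharge c m = 17 * cy * c.Ly ^ 2 / (4 * (cb * c.Lμ)) := rfl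
  set s := moveCharge c m θ K
  set w := lowerCharge c m
  have hcuL : cu * L ^ 2 ≤ 1 / 48 := by linarith only [cu1]
  have hd : κ * (1 / h * (3 * L ^ 2)) + ce⁻¹ * r * (2 * L ^ 2) + cg⁻¹ * r * (2 * c.Lg ^ 2)
      ≤ r * s := by
    have := mul_le_mul_of_nonneg_right hκh (by positivity : 0 ≤ 3 * L ^ 2)
    rw [hs]
    linarith only [this]
  have hyw : cy * (17 * c.Ly ^ 2 / (4 * (cb * a * c.Lμ))) = r * w := by
    rw [hw, hr_def]; field_simp
  have hwU : a * w ≤ 17 / 160 * (cu * h) := by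
    rw [le_div_iff₀ (by positivity)] at A3
    rw [hw, ← mul_div_assoc, div_le_iff₀ (by positivity)]
    linarith only [A3]
  have hsU : 2 * a * s ≤ cu * h ^ 2 / 240 + cu * h / 20 + cu * h / 20 := by
    rw [le_div_iff₀ (by positivity)] at A4 A5
    have k1 : a * (L ^ 2 * ce⁻¹) ≤ cu * h / 80 := by
      rw [← mul_assoc, ← div_eq_mul_inv, div_le_iff₀ hce]; linarith only [A4]
    have k2 : a * (c.Lg ^ 2 * cg⁻¹) ≤ cu * h / 80 := by
      rw [← mul_assoc, ← div_eq_mul_inv, div_le_iff₀ hcg]; linarith only [A5]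
    have k3 := mul_le_mul_of_nonneg_left hcuL ha.le
    rw [hs]
    linarith only [k1, k2, k3, A2]
  have hX' : 6 / (h * a') * lam ≤ 6 / (h * a) * lam + 2 * a := by
    have e1 : 6 / (h * a') * lam = 6 * lam / h * a'⁻¹ := by field_simp
    have e2 : 6 / (h * a) * lam = 6 * lam / h * r := by rw [hr_def]; field_simp
    have k := mul_le_mul_of_nonneg_left ha' (by positivity : 0 ≤ 6 * lam / h)
    have k2 : 6 * lam / h * (a ^ 2 / 3) ≤ 2 * a := by
      rw [div_mul_eq_mul_div, div_le_iff₀ hh]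
      have k3 : lam * a ^ 2 ≤ 1 * (a * h) := by
        refine mul_le_mul h1.le ?_ (sq_nonneg a) zero_le_one
        rw [sq]; gcongr
      linarith only [k3]
    rw [e1, e2]
    linarith only [k, k2]
  have hXX : 6 / (h * a) = 6 / (h * a) * lam + 6 * r := by
    have e : lam = 1 - h := by rw [hh_def]; ring
    rw [hr_def, e]; field_simp; ring
  have hLl2 : 3 * a * c.Ll ^ 2 / m ≤ 0.06 * r := by
    rw [le_div_iff₀ (by positivity)] at A6
    have k1 : a * c.Ll ≤ 1 / 5 := by linarith only [A6]
    have k2 : (a * c.Ll) ^ 2 ≤ (1 / 5) ^ 2 := pow_le_pow_left₀ (by positivity) k1 2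
    have k3 : 3 * a * c.Ll ^ 2 = 3 * (a * c.Ll) ^ 2 * r := by
      rw [show 3 * (a * c.Ll) ^ 2 * r = 3 * a * c.Ll ^ 2 * (a * r) by ring, har, mul_one]
    rw [div_le_iff₀ (by positivity), k3]
    have k4 : 3 * (a * c.Ll) ^ 2 * r ≤ 0.12 * r := by gcongr; linarith only [k2]
    have k5 : 0.06 * r * 2 ≤ 0.06 * r * m := by gcongr
    linarith only [k4, k5]
  have hU1 : 6 / (h * a') * (1 / h * a ^ 2) ≤ 7 / 30 * cu := by
    have e1 : 6 / (h * a') * (1 / h * a ^ 2) = 6 * a ^ 2 / h ^ 2 * a'⁻¹ := by field_simp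
    have k := mul_le_mul_of_nonneg_left ha' (by positivity : 0 ≤ 6 * a ^ 2 / h ^ 2)
    refine e1.le.trans (k.trans ?_)
    rw [div_mul_eq_mul_div, div_le_iff₀ (by positivity)]
    have e2 : 6 * a ^ 2 * (r + a ^ 2 / 3) = 6 * a * (a * r) + 2 * a * a ^ 3 := by ring
    rw [e2, har]
    have k2 : 2 * a * a ^ 3 ≤ 2 * a * (1 / 2) := by gcongr
    linarith only [k2, A2]
  have hη0 : 0 < ηc * a ^ 2 := by positivity
  have hrη : r * (ηc * a ^ 2) = ηc * a := by
    rw [show r * (ηc * a ^ 2) = ηc * a * (a * r) by ring, har, mul_one]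
  have hrγ : r * (γc * a ^ 2) = γc * a := by
    rw [show r * (γc * a ^ 2) = γc * a * (a * r) by ring, har, mul_one]
  have haLf : a ^ 2 ≤ a * (1 / (3 * c.Lf)) := by rw [sq]; gcongr
  have hdiff : r - ap⁻¹ ≤ a * (1 / (3 * c.Lf)) := by linarith only [haLf, hrp]
  have hκη : κ * (1 / h * (3 * (ηc * a ^ 2) ^ 2)) ≤ 3 * cu * (ηc * a) := by
    have k1 := mul_le_mul_of_nonneg_right hκh (by positivity : 0 ≤ 3 * (ηc * a ^ 2) ^ 2)
    have k2 : (ηc * a ^ 2) ^ 2 ≤ ηc * a ^ 2 := by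
      rw [sq]; exact mul_le_of_le_one_left hη0.le hη1
    have k3 : cu * r * (3 * (ηc * a ^ 2) ^ 2) ≤ cu * r * (3 * (ηc * a ^ 2)) := by gcongr
    have k4 : cu * r * (3 * (ηc * a ^ 2)) = 3 * cu * (ηc * a) := by rw [← hrη]; ring
    linarith only [k1, k3, k4]
  have hmain := weighted_sum_le (l := l t) (l' := l (t + 1)) (G := G t) (X := X t)
    (X' := X (t + 1)) (U := U t) (U' := U (t + 1)) (Ub := Ub t) (Y := Y t) (Y' := Y (t + 1))
    (Pe := Pe t) (Pe' := Pe (t + 1)) (Ve := Ve t) (Ve' := Ve (t + 1)) (W := W t) (D := D t)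
    (wY := cy) (wX := 6 / (h * a)) (wX' := 6 / (h * a')) (wU := κ) (wP := ce⁻¹ * ap⁻¹)
    (wP' := ce⁻¹ * r) (wV := cg⁻¹ * ap⁻¹) (wV' := cg⁻¹ * r) (x₁ := 1 / h * a ^ 2)
    (u₁ := 1 / h * (3 * L ^ 2)) (u₂ := 1 / h * (3 * (ηc * a ^ 2) ^ 2))
    (n₂ := 1 / h * (3 * (ηc * a ^ 2) ^ 2 * (m * σf ^ 2))) (rX := r)
    (rU := 3 / 5 * cu - κ * h) (rY := 3 * a * c.Lf ^ 2 / m) (A := a ^ 2) (B := m * a ^ 2)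
    (hR.X_nonneg t) (hR.U_nonneg t) (hR.Ub_nonneg t) (hR.Y_nonneg t) (hR.Pe_nonneg t)
    (hR.Ve_nonneg t) (hR.W_nonneg t) hcy.le (by positivity) hκ0 (by positivity) (by positivity)
    (by positivity) (by positivity) (by positivity) (by positivity) R1 R2
    (R3.trans (le_of_eq (by ring))) (R4.trans (le_of_eq (by ring))) R5 R6 R7
    (by
      rw [hyw]
      have k1 : r * (8 * w) ≤ r * (17 / 8) := by gcongr
      have k2 : r * (8 * s) ≤ r * (3 / 2) := by gcongr
      linarith only [k1, k2, hd, hX', hXX, hLl2, ha_r, hr])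
    (by
      rw [hyw]
      have k1 := mul_le_mul_of_nonneg_left hd (by positivity : 0 ≤ 2 * a ^ 2)
      have e1 : 2 * a ^ 2 * (r * s) = 2 * a * s := by
        rw [show 2 * a ^ 2 * (r * s) = 2 * a * s * (a * r) by ring, har, mul_one]
      have e2 : 2 * a ^ 2 * (r * w) = 2 * (a * w) := by
        rw [show 2 * a ^ 2 * (r * w) = 2 * (a * w) * (a * r) by ring, har, mul_one]
      have e3 : κ * lam = κ - κ * h := by rw [hh_def]; ring
      have hh1 : h ≤ 1 := by linarith
      have k2 : cu * h ≤ cu * 1 := by gcongr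
      have k3 : cu * h ^ 2 ≤ cu * 1 := by gcongr; exact pow_le_one₀ hh.le hh1
      linarith only [k1, e1, e2, e3, k2, k3, hU1, hwU, hsU, hcu])
    (by
      rw [hyw]
      have k1 := mul_le_mul_of_nonneg_left hd (by positivity : 0 ≤ m * a ^ 2)
      have e1 : m * a ^ 2 * (r * s) = a * (m * s) := by
        rw [show m * a ^ 2 * (r * s) = a * (m * s) * (a * r) by ring, har, mul_one]
      have e2 : m * a ^ 2 * (r * w) = a * (m * w) := by
        rw [show m * a ^ 2 * (r * w) = a * (m * w) * (a * r) by ring, har, mul_one]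
      have k2 := mul_le_mul_of_nonneg_left hsm ha.le
      have k3 := mul_le_mul_of_nonneg_left hwm ha.le
      linarith only [k1, k2, k3, e1, e2, ha])
    (by
      have e : cy * (3 / 4 * (cb * a * c.Lμ)) = 6 * a * c.Lf ^ 2 / m := by
        rw [eq_div_iff (by positivity)]
        linear_combination 3 / 4 * a * cbm
      rw [e]
      refine le_of_eq ?_
      ring)
    (by
      have k1 : 3 * a / (2 * m) = ce⁻¹ * (a * (3 / 2 * (ce / m))) := by field_simp
      have k2 : 2 * ce / m = 2 * (ce / m) := by ring
      rw [k2] at eη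
      have k3 : 0 ≤ ce / m := by positivity
      have k4 : ce⁻¹ * (a * (3 / 2 * (ce / m)) + (3 * cu * ce * (ηc * a) - ηc * a)
          + (r - ap⁻¹)) ≤ 0 := by
        refine mul_nonpos_of_nonneg_of_nonpos (by positivity) ?_
        have k5 : 3 * cu * ce * (ηc * a) - ηc * a = -(a * (2 * (ce / m) + 1 / (3 * c.Lf))) := by
          rw [← eη]; ring
        rw [k5]
        have k6 := mul_nonneg ha.le k3
        linarith only [k6, hdiff]
      have k7 : ce⁻¹ * (3 * cu * ce * (ηc * a)) = 3 * cu * (ηc * a) := by field_simp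
      have k8 : ce⁻¹ * r * (1 - ηc * a ^ 2) = ce⁻¹ * r - ce⁻¹ * (ηc * a) := by rw [← hrη]; ring
      rw [k8, k1]
      linarith only [k4, k7, hκη])
    (by
      have k4 : cg⁻¹ * (cg * (2 * cb * cy / c.Lμ) * a - γc * a + (r - ap⁻¹)) ≤ 0 := by
        refine mul_nonpos_of_nonneg_of_nonpos (by positivity) ?_
        have k5 := mul_le_mul_of_nonneg_right eγ ha.le
        linarith only [k5, hdiff]
      have k7 : cg⁻¹ * (cg * (2 * cb * cy / c.Lμ) * a) = cy * (2 * (cb * a) / c.Lμ) := by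
        field_simp
      have k8 : cg⁻¹ * r * (1 - γc * a ^ 2) = cg⁻¹ * r - cg⁻¹ * (γc * a) := by rw [← hrγ]; ring
      rw [k8]
      linarith only [k4, k7])
    (by
      have k1 := mul_le_mul_of_nonneg_left hd (by positivity : 0 ≤ (cb * a) ^ 2)
      have e1 : (cb * a) ^ 2 * (r * s) = cb * a * (cb * s) := by
        rw [show (cb * a) ^ 2 * (r * s) = cb * a * (cb * s) * (a * r) by ring, har, mul_one]
      have e2 : cy * (cb * a / (4 * (c.μg + c.Lg))) = cb * a * (cy / (4 * (c.μg + c.Lg))) := by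
        ring
      have k2 := mul_le_mul_of_nonneg_left hsb (by positivity : 0 ≤ cb * a)
      linarith only [k1, k2, e1, e2])
  have hn : κ * (1 / h * (3 * (ηc * a ^ 2) ^ 2 * (m * σf ^ 2))) ≤
      ce⁻¹ * r * ((ηc * a ^ 2) ^ 2 * (m * σf ^ 2)) := by
    have k1 := mul_le_mul_of_nonneg_right hκh
      (by positivity : 0 ≤ 3 * (ηc * a ^ 2) ^ 2 * (m * σf ^ 2))
    have k2 := mul_le_mul_of_nonneg_right hcu3
      (by positivity : 0 ≤ r * ((ηc * a ^ 2) ^ 2 * (m * σf ^ 2)))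
    linarith only [k1, k2]
  linarith only [hmain, hn]

end Descent

/-! ### Summation over time -/

/-- A potential `Φ` that may double in every step, and a potential `Ψ ≤ H Φ` that decreases from
time `t₀` on: then the decrements are summable with a constant that only depends on `t₀` and
`H`. -/
lemma sum_le_of_growth {Φ Ψ M N : ℕ → ℝ} {H : ℝ} {t₀ : ℕ} (hΦ : ∀ t, 0 ≤ Φ t)
    (hΨ : ∀ t, 0 ≤ Ψ t) (hM : ∀ t, 0 ≤ M t) (hN : ∀ t, 0 ≤ N t) (hH : 1 ≤ H)
    (hΨΦ : ∀ t, Ψ t ≤ H * Φ t) (h1 : ∀ t, Φ (t + 1) + M t ≤ 2 * Φ t + N t)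
    (h2 : ∀ t, t₀ ≤ t → Ψ (t + 1) + M t ≤ Ψ t + N t) (n : ℕ) :
    ∑ t ∈ Finset.range n, M t ≤ 2 ^ t₀ * H * (Φ 0 + ∑ t ∈ Finset.range n, N t) := by
  have hsN : ∀ n, 0 ≤ ∑ t ∈ Finset.range n, N t := fun n => Finset.sum_nonneg fun t _ => hN t
  have hsM : ∀ n, 0 ≤ ∑ t ∈ Finset.range n, M t := fun n => Finset.sum_nonneg fun t _ => hM t
  -- up to time `t₀`
  have first : ∀ n, Φ n + ∑ t ∈ Finset.range n, M t ≤
      2 ^ n * (Φ 0 + ∑ t ∈ Finset.range n, N t) := by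
    intro n
    induction n with
    | zero => simp
    | succ n ih =>
      rw [Finset.sum_range_succ, Finset.sum_range_succ, pow_succ]
      have h3 : N n ≤ 2 ^ n * 2 * N n := by
        have : (1 : ℝ) ≤ 2 ^ n := one_le_pow₀ (by norm_num)
        nlinarith [hN n]
      have := h1 n
      have := hsM n
      linarith
  have hpow : ∀ {n}, n ≤ t₀ → (2 : ℝ) ^ n ≤ 2 ^ t₀ := fun h => pow_le_pow_right₀ (by norm_num) h
  rcases le_total n t₀ with hn | hn
  · have h3 := first n
    have h4 : (2 : ℝ) ^ n * (Φ 0 + ∑ t ∈ Finset.range n, N t) ≤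
        2 ^ t₀ * H * (Φ 0 + ∑ t ∈ Finset.range n, N t) := by
      refine mul_le_mul_of_nonneg_right ?_ (add_nonneg (hΦ 0) (hsN n))
      exact (hpow hn).trans (le_mul_of_one_le_right (by positivity) hH)
    have := hΦ n
    linarith
  -- after time `t₀`
  · have second : Ψ n + ∑ t ∈ Finset.range n, M t ≤
        2 ^ t₀ * H * (Φ 0 + ∑ t ∈ Finset.range n, N t) := by
      induction n, hn using Nat.le_induction with
      | base =>
        have h3 := mul_le_mul_of_nonneg_left (first t₀) (by linarith : 0 ≤ H)
        have h4 := hΨΦ t₀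
        have h5 : ∑ t ∈ Finset.range t₀, M t ≤ H * ∑ t ∈ Finset.range t₀, M t :=
          le_mul_of_one_le_left (hsM t₀) hH
        linarith
      | succ n hn ih =>
        rw [Finset.sum_range_succ, Finset.sum_range_succ]
        have h3 : N n ≤ 2 ^ t₀ * H * N n := by
          refine le_mul_of_one_le_left (hN n) ?_
          exact hH.trans (le_mul_of_one_le_left (by linarith) (one_le_pow₀ (by norm_num)))
        have := h2 n hn
        linarith
    have := hΨ n
    linarith

section Summation

variable {c : Consts} {m K : ℕ} {lam θ ω κ σf σg δ : ℝ}
  {l G X U Ub Y Pe Ve W D : ℕ → ℝ}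

/-- The number of initial steps in which the potential may grow: afterwards
`α_t ≤ (1 - lam)²`. -/
def burnIn (lam : ℝ) : ℕ := ⌈((1 - lam) ^ 6)⁻¹⌉₊

lemma stepα_le_of_burnIn_le (h1 : lam < 1) (hω : 0 < ω) {t : ℕ} (ht : burnIn lam ≤ t) :
    stepα ω t ≤ (1 - lam) ^ 2 := by
  have hh : 0 < 1 - lam := by linarith
  refine le_of_pow_le_pow_left₀ (n := 3) (by norm_num) (by positivity) ?_
  rw [stepα_cube hω, ← pow_mul]
  have h2 : ((1 - lam) ^ 6)⁻¹ ≤ (t : ℝ) := (Nat.le_ceil _).trans (Nat.cast_le.2 ht)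
  rw [one_div]
  have h3 : ((1 - lam) ^ 6)⁻¹ ≤ ω + t := h2.trans (by linarith)
  exact inv_le_of_inv_le₀ (by positivity) h3

/-- The noise that enters the potential in step `t`. -/
def stepNoise (c : Consts) (m : ℕ) (θ : ℝ) (K : ℕ) (ω σf σg δ : ℝ) (t : ℕ) : ℝ :=
  3 / 2 * stepα ω t * δ ^ 2
    + 3 * (cbarη c m K)⁻¹ * (stepα ω t)⁻¹ * momη c m θ K ω (t + 1) ^ 2 * (m * σf ^ 2)
    + 2 * (cbarγ c m)⁻¹ * (stepα ω t)⁻¹ * momγ c m θ K ω (t + 1) ^ 2 * (m * σg ^ 2)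

/-- Summed descent.  When `1 - lam` is small, the step sizes of the first `burnIn lam` steps may
be too large for the potential to decrease, but it at most doubles in each of them.  From then
on the potential with the larger weight `c̄_u / (1 - lam)` on the tracking error decreases. -/
lemma sum_decrement_le (hc : c.Valid) (hm : 2 ≤ m) (hK : 0 < K) (h0 : 0 ≤ lam) (h1 : lam < 1)
    (hθ0 : 0 < θ) (hθ : θ < 1) (hA : Admissible c m lam θ K ω)
    (hR : Recursion c m lam (c.LK K) σf σg δ (stepα ω) (stepβ c m ω) (momη c m θ K ω)
      (momγ c m θ K ω) l G X U Ub Y Pe Ve W D) {lS : ℝ} (hl : ∀ t, lS ≤ l t) (n : ℕ) :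
    ∑ t ∈ Finset.range n, (stepα ω t / 2 * G t + (stepα ω t)⁻¹ * X t
        + 3 * stepα ω t * c.Lf ^ 2 / m * Y t) ≤
      2 ^ burnIn lam * (1 - lam)⁻¹ *
        (lyapunov c m lam K ω (cbarU c m θ K) l X U Y Pe Ve 0 - lS
          + ∑ t ∈ Finset.range n, stepNoise c m θ K ω σf σg δ t) := by
  have hm0 : 0 < m := by omega
  have hω2 := hA.two_le
  have hω0 : 0 < ω := by linarith
  have hh : 0 < 1 - lam := by linarith
  have hcy := cbarY_pos hc hm0
  have hce := cbarη_pos (m := m) hc hK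
  have hcg := cbarγ_pos (m := m) hc
  have hcu := cbarU_pos (m := m) hc hK hθ0
  have ha := fun t => stepα_pos hω0 t
  have hap := fun t => stepα_pos (by linarith : 0 < ω - 1) t
  have hHinv : 1 ≤ (1 - lam)⁻¹ := (one_le_inv₀ hh).2 (by linarith)
  -- the potential without the tracking error
  obtain ⟨E, hE⟩ : ∃ E : ℕ → ℝ, E = fun t => l t - lS + cbarY c m * Y t + cbarX lam ω t * X t
    + (cbarη c m K)⁻¹ * (stepα (ω - 1) t)⁻¹ * Pe t
    + (cbarγ c m)⁻¹ * (stepα (ω - 1) t)⁻¹ * Ve t := ⟨_, rfl⟩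
  have hE0 : ∀ t, 0 ≤ E t := by
    intro t
    have := hl t
    have := mul_nonneg hcy.le (hR.Y_nonneg t)
    have := mul_nonneg (by have := ha t; unfold cbarX; positivity : 0 ≤ cbarX lam ω t)
      (hR.X_nonneg t)
    have := mul_nonneg (by have := hap t; positivity :
      0 ≤ (cbarη c m K)⁻¹ * (stepα (ω - 1) t)⁻¹) (hR.Pe_nonneg t)
    have := mul_nonneg (by have := hap t; positivity :
      0 ≤ (cbarγ c m)⁻¹ * (stepα (ω - 1) t)⁻¹) (hR.Ve_nonneg t)
    rw [hE]
    simp only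
    linarith
  have hΦ : ∀ κ t, lyapunov c m lam K ω κ l X U Y Pe Ve t - lS = E t + κ * U t := by
    intro κ t
    rw [hE, lyapunov]
    ring
  have hcuU : ∀ t, 0 ≤ cbarU c m θ K * U t := fun t => mul_nonneg hcu.le (hR.U_nonneg t)
  have e : ∀ t, cbarU c m θ K * (1 - lam)⁻¹ * U t = (1 - lam)⁻¹ * (cbarU c m θ K * U t) :=
    fun t => by ring
  rw [hΦ]
  refine sum_le_of_growth (Φ := fun t => E t + cbarU c m θ K * U t)
    (Ψ := fun t => E t + cbarU c m θ K * (1 - lam)⁻¹ * U t)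
    (fun t => add_nonneg (hE0 t) (hcuU t))
    (fun t => ?_) (fun t => ?_) (fun t => ?_) hHinv (fun t => ?_) (fun t => ?_) (fun t ht => ?_) n
  · rw [e]
    exact add_nonneg (hE0 t) (mul_nonneg (by positivity) (hcuU t))
  · have := ha t
    have := hR.G_nonneg t
    have := hR.X_nonneg t
    have := hR.Y_nonneg t
    positivity
  · have := ha t
    unfold stepNoise
    positivity
  · rw [e, mul_add]
    exact add_le_add (le_mul_of_one_le_left (hE0 t) hHinv) le_rfl
  · have h2 := lyapunov_succ_le hc hm hK h0 h1 hθ0 hθ hA hR t hcu.le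
      (mul_le_mul_of_nonneg_left (hA.α_le_11 t) hcu.le)
    have e1 := hΦ (cbarU c m θ K) t
    have e2 := hΦ (cbarU c m θ K) (t + 1)
    have h3 := hcuU t
    have h4 := hE0 t
    have h5 : 0 ≤ cbarU c m θ K * (1 - lam) * U t := by
      have := hR.U_nonneg t
      positivity
    unfold stepNoise
    linarith
  · have h2 := lyapunov_succ_le (κ := cbarU c m θ K * (1 - lam)⁻¹) hc hm hK h0 h1 hθ0 hθ hA hR t
      (by positivity) (by
        rw [mul_assoc]
        refine mul_le_mul_of_nonneg_left ?_ hcu.le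
        rw [inv_mul_le_iff₀ hh, ← sq]
        exact stepα_le_of_burnIn_le h1 hω0 ht)
    have e1 := hΦ (cbarU c m θ K * (1 - lam)⁻¹) t
    have e2 := hΦ (cbarU c m θ K * (1 - lam)⁻¹) (t + 1)
    rw [inv_mul_cancel_right₀ hh.ne'] at h2
    have h3 := hcuU t
    unfold stepNoise
    linarith

end Summation

/-! ### Dependence of the constants on the number of Neumann samples -/

section Growth

variable {c : Consts} {m K : ℕ} {θ lam : ℝ}

lemma LK_one_sq_le (hc : c.Valid) (hK : 0 < K) : c.LK 1 ^ 2 ≤ c.LK K ^ 2 := by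
  have hd : 0 < 2 * c.μg * c.Lg - c.μg ^ 2 := by nlinarith [hc.μg_pos, hc.μg_lt_Lg]
  have hd2 : 0 < c.Lg - c.μg := by linarith [hc.μg_lt_Lg]
  have hK1 : (1 : ℝ) ≤ K := by exact_mod_cast hK
  have hC := hc.Cgxy_pos
  rw [Consts.LK_sq hc, Consts.LK_sq hc]
  push_cast
  gcongr

lemma LK_sq_le (hc : c.Valid) (hK : 0 < K) : c.LK K ^ 2 ≤ K ^ 3 * c.LK 1 ^ 2 := by
  have hd : 0 < 2 * c.μg * c.Lg - c.μg ^ 2 := by nlinarith [hc.μg_pos, hc.μg_lt_Lg]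
  have hd2 : 0 < c.Lg - c.μg := by linarith [hc.μg_lt_Lg]
  have hK1 : (1 : ℝ) ≤ K := by exact_mod_cast hK
  have hK3 : (1 : ℝ) ≤ K ^ 3 := one_le_pow₀ hK1
  have hKK : (K : ℝ) ≤ K ^ 3 := le_self_pow₀ hK1 (by norm_num)
  have hC := hc.Cgxy_pos
  rw [Consts.LK_sq hc, Consts.LK_sq hc]
  push_cast
  have t1 : 2 * c.Lfx ^ 2 ≤ K ^ 3 * (2 * c.Lfx ^ 2) := le_mul_of_one_le_left (by positivity) hK3
  have t2 : 6 * c.Cgxy ^ 2 * c.Lfy ^ 2 * K / (2 * c.μg * c.Lg - c.μg ^ 2) ≤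
      6 * c.Cgxy ^ 2 * c.Lfy ^ 2 * K ^ 3 / (2 * c.μg * c.Lg - c.μg ^ 2) := by gcongr
  have t3 : 6 * c.Cfy ^ 2 * c.Lgxy ^ 2 * K / (2 * c.μg * c.Lg - c.μg ^ 2) ≤
      6 * c.Cfy ^ 2 * c.Lgxy ^ 2 * K ^ 3 / (2 * c.μg * c.Lg - c.μg ^ 2) := by gcongr
  refine (add_le_add (add_le_add (add_le_add t1 t2) t3) le_rfl).trans (le_of_eq ?_)
  ring

/-- The factor between `L_K²` and an upper bound of `c̄_η`. -/
def ratioη (c : Consts) (m : ℕ) : ℝ :=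
  32 + 160 * m + 24 * (c.μg + c.Lg) * cβ c m / cbarY c m

variable (hc : c.Valid) (hm : 0 < m)

include hc hm

lemma ratioη_pos : 0 < ratioη c m := by
  have := hc.μg_pos
  have := hc.Lg_pos
  have := cβ_pos hc hm
  have := cbarY_pos hc hm
  unfold ratioη
  positivity

lemma cbarη_le : cbarη c m K ≤ ratioη c m * c.LK K ^ 2 := by
  have := hc.μg_pos
  have := hc.Lg_pos
  have := cβ_pos hc hm
  have := cbarY_pos hc hm
  have h2 : 0 ≤ 24 * (c.μg + c.Lg) * cβ c m / cbarY c m * c.LK K ^ 2 := by positivity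
  have h3 : 0 ≤ 160 * (m : ℝ) * c.LK K ^ 2 := by positivity
  have h4 : 0 ≤ c.LK K ^ 2 := by positivity
  have e : 24 * (c.μg + c.Lg) * c.LK K ^ 2 * cβ c m / cbarY c m =
    24 * (c.μg + c.Lg) * cβ c m / cbarY c m * c.LK K ^ 2 := by ring
  unfold cbarη ratioη
  rw [e]
  refine max_le (by linarith) (max_le (by linarith) (by linarith))

omit hm in
lemma inv_cbarη_le (hK : 0 < K) : (cbarη c m K)⁻¹ ≤ (32 * c.LK 1 ^ 2)⁻¹ := by
  have h1 := LK_one_sq_le hc hK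
  have h2 : 32 * c.LK K ^ 2 ≤ cbarη c m K := le_max_left _ _
  have h3 := LK_pos hc one_pos
  exact inv_anti₀ (by positivity) (by linarith)

omit hm in
lemma cbarU_mul_sq_le (hK : 0 < K) (hθ : θ < 1) : cbarU c m θ K * c.LK K ^ 2 ≤ 1 / 48 := by
  have := cbarU_le_left (m := m) hc hK hθ
  linarith

lemma le_cbarU (hK : 0 < K) (hθ0 : 0 < θ) :
    θ / ((48 + 3 * ratioη c m) * c.LK 1 ^ 2) / K ^ 3 ≤ cbarU c m θ K := by
  have hL := LK_pos hc hK
  have hL1 := LK_pos hc one_pos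
  have hr := ratioη_pos hc hm
  have hce := cbarη_pos (m := m) hc hK
  have h1 := LK_sq_le hc hK
  have h2 := cbarη_le (K := K) hc hm
  have hK0 : (0 : ℝ) < K := by exact_mod_cast hK
  have h3 := mul_le_mul_of_nonneg_left h1 hr.le
  have h5 : 0 < K ^ 3 * c.LK 1 ^ 2 := by positivity
  have h6 := mul_pos hr h5
  have e : θ / ((48 + 3 * ratioη c m) * c.LK 1 ^ 2) / K ^ 3
      = θ * (1 / ((48 + 3 * ratioη c m) * (K ^ 3 * c.LK 1 ^ 2))) := by field_simp
  rw [e, cbarU]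
  refine mul_le_mul_of_nonneg_left (le_min ?_ ?_) hθ0.le
  · exact one_div_le_one_div_of_le (by positivity) (by linarith)
  · exact one_div_le_one_div_of_le (by positivity) (by linarith)

/-- A bound of `c_η / c̄_η` that does not depend on `K`. -/
lemma cη_le (hK : 0 < K) (hθ0 : 0 < θ) (hθ : θ < 1) : cη c m θ K ≤
    (2 / m + 1 / (96 * c.Lf * c.LK 1 ^ 2)) / (1 - θ) * cbarη c m K := by
  have hL1 := LK_pos hc one_pos
  have hLf := hc.Lf_pos
  have hce := cbarη_pos (m := m) hc hK
  have h1 := cη_mul hc hm hK hθ0 hθ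
  have h2 := cbarU_le_right (m := m) hc hK hθ0
  have h3 := cη_pos hc hm hK hθ0 hθ
  have hθ' : 0 < 1 - θ := by linarith
  have hm' : (0 : ℝ) < m := by exact_mod_cast hm
  have h4 : cη c m θ K * (1 - θ) ≤ 2 * cbarη c m K / m + 1 / (3 * c.Lf) := by
    rw [← h1]
    exact mul_le_mul_of_nonneg_left (by linarith) h3.le
  have h5 : 1 ≤ cbarη c m K * (32 * c.LK 1 ^ 2)⁻¹ := by
    have := mul_le_mul_of_nonneg_left (inv_cbarη_le (m := m) hc hK) hce.le
    rwa [mul_inv_cancel₀ hce.ne'] at this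
  have h6 : 1 / (3 * c.Lf) ≤ 1 / (96 * c.Lf * c.LK 1 ^ 2) * cbarη c m K := by
    have := mul_le_mul_of_nonneg_left h5 (by positivity : 0 ≤ 1 / (3 * c.Lf))
    rw [mul_one] at this
    refine this.trans (le_of_eq ?_)
    field_simp
    norm_num
  rw [div_mul_eq_mul_div, le_div_iff₀ hθ']
  refine h4.trans ((add_le_add le_rfl h6).trans (le_of_eq ?_))
  ring

omit hm in
/-- A bound of `c_γ` that does not depend on `K`. -/
lemma cγ_le (hK : 0 < K) (hθ : θ < 1) : cγ c m θ K ≤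
    1 / (3 * c.Lf) + 8 * c.Lg ^ 2 * cβ c m ^ 2
      + cbarγ c m * (2 * cβ c m * cbarY c m / c.Lμ + cβ c m ^ 2 / 2) := by
  have hce := cbarη_pos (m := m) hc hK
  have hcg := cbarγ_pos (m := m) hc
  have h1 := cbarU_mul_sq_le (m := m) hc hK hθ
  have h2 : 32 * c.LK K ^ 2 ≤ cbarη c m K := le_max_left _ _
  have h3 : 8 * c.LK K ^ 2 * cβ c m ^ 2 / cbarη c m K ≤ cβ c m ^ 2 / 4 := by
    rw [div_le_iff₀ hce]
    have := mul_le_mul_of_nonneg_left h2 (sq_nonneg (cβ c m))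
    linarith
  have h4 : 12 * c.LK K ^ 2 * cbarU c m θ K * cβ c m ^ 2 ≤ cβ c m ^ 2 / 4 := by
    have := mul_le_mul_of_nonneg_left h1 (sq_nonneg (cβ c m))
    linarith
  unfold cγ
  have h5 := mul_le_mul_of_nonneg_left (add_le_add h3 h4) hcg.le
  linarith

/-- The step-size conditions hold as soon as all step sizes are at most a constant multiple of
`K⁻³`. -/
lemma exists_admissible (h1 : lam < 1) (hθ0 : 0 < θ) (hθ : θ < 1) :
    ∃ ε : ℝ, 0 < ε ∧ ∀ (K : ℕ) (ω : ℝ), 0 < K → 2 ≤ ω → (∀ t, stepα ω t ≤ ε / K ^ 3) →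
      Admissible c m lam θ K ω := by
  have hLf := hc.Lf_pos
  have hLl := hc.Ll_pos
  have hLy := hc.Ly_pos
  have hLμ := hc.Lμ_pos
  have hLg := hc.Lg_pos
  have hμ := hc.μg_pos
  have hcy := cbarY_pos hc hm
  have hcb := cβ_pos hc hm
  have hcg := cbarγ_pos (m := m) hc
  have hr := ratioη_pos hc hm
  have hL1 := LK_pos hc one_pos
  have hh : 0 < 1 - lam := by linarith
  have hθ' : 0 < 1 - θ := by linarith
  have hm' : (0 : ℝ) < m := by exact_mod_cast hm
  obtain ⟨u, hu⟩ : ∃ u, u = θ / ((48 + 3 * ratioη c m) * c.LK 1 ^ 2) := ⟨_, rfl⟩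
  have hu0 : 0 < u := by rw [hu]; positivity
  obtain ⟨A, hA⟩ : ∃ A, A = (2 / m + 1 / (96 * c.Lf * c.LK 1 ^ 2)) / (1 - θ) := ⟨_, rfl⟩
  have hA0 : 0 < A := by rw [hA]; positivity
  obtain ⟨Γ, hΓ⟩ : ∃ Γ, Γ = 1 / (3 * c.Lf) + 8 * c.Lg ^ 2 * cβ c m ^ 2
      + cbarγ c m * (2 * cβ c m * cbarY c m / c.Lμ + cβ c m ^ 2 / 2) := ⟨_, rfl⟩
  have hΓ0 : 0 < Γ := by rw [hΓ]; positivity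
  have ev : ∀ {C : ℝ}, 0 < C → ∀ᶠ ε in nhdsWithin (0 : ℝ) (Set.Ioi 0), ε ≤ C := fun hC =>
    nhdsWithin_le_nhds (eventually_le_nhds hC)
  obtain ⟨ε, hε0, e0, e1, e2, e3, e4, e5, e6, e7, e8, e9, e10, e11, e12, e13, e14⟩ :=
    ((eventually_mem_nhdsWithin (a := (0 : ℝ)) (s := Set.Ioi 0)).and
    ((ev one_pos).and
    ((ev (C := √(m / (2 * c.Ll ^ 2))) (by positivity)).and
    ((ev (C := u * (1 - lam) ^ 2 / 30) (by positivity)).and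
    ((ev (C := u * (1 - lam) * c.Lμ * cβ c m / (40 * c.Ly ^ 2 * cbarY c m)) (by positivity)).and
    ((ev (C := u * (1 - lam) * (2 / 5)) (by positivity)).and
    ((ev (C := u * (1 - lam) * cbarγ c m / (80 * c.Lg ^ 2)) (by positivity)).and
    ((ev (C := 1 / (5 * c.Ll)) (by positivity)).and
    ((ev (C := 1 / (3 * c.Lf)) (by positivity)).and
    ((ev (C := (1 - lam) / (11 * c.LK 1)) (by positivity)).and
    ((ev (C := (1 - lam) / (5 * m)) (by positivity)).and
    ((ev (C := cbarY c m * (1 - lam) / ((c.μg + c.Lg) * cβ c m)) (by positivity)).and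
    ((ev (C := 1 - lam) hh).and
    ((ev (C := 1 / ((c.μg + c.Lg) * cβ c m)) (by positivity)).and
    ((ev (C := 1 / (A * ratioη c m * c.LK 1 ^ 2)) (by positivity)).and
    (ev (C := 1 / Γ) (by positivity))))))))))))))))).exists
  have hε0 : 0 < ε := hε0
  refine ⟨ε, hε0, fun K ω hK hω hα => ?_⟩
  have hω0 : 0 < ω := by linarith
  have hK1 : (1 : ℝ) ≤ K := by exact_mod_cast hK
  have hK3 : (1 : ℝ) ≤ K ^ 3 := one_le_pow₀ hK1
  have hK0 : (0 : ℝ) < K ^ 3 := by linarith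
  have ha := fun t => stepα_pos hω0 t
  have hL := LK_pos hc hK
  have hce := cbarη_pos (m := m) hc hK
  have hcu := cbarU_pos (m := m) hc hK hθ0
  have hcu' : u / K ^ 3 ≤ cbarU c m θ K := by rw [hu]; exact le_cbarU hc hm hK hθ0
  have hcuL := cbarU_mul_sq_le (m := m) hc hK hθ
  -- conditions with a bound independent of `K`, and with a bound of the order of `c̄_u`
  have weak : ∀ {C : ℝ} (t : ℕ), ε ≤ C → stepα ω t ≤ C := fun t h =>
    ((hα t).trans (div_le_self hε0.le hK3)).trans h
  have strong : ∀ {C : ℝ} (t : ℕ), 0 ≤ C → ε ≤ u * C → stepα ω t ≤ cbarU c m θ K * C := by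
    intro C t hC h
    calc stepα ω t ≤ ε / K ^ 3 := hα t
      _ ≤ u * C / K ^ 3 := by gcongr
      _ = u / K ^ 3 * C := by ring
      _ ≤ cbarU c m θ K * C := by gcongr
  refine ⟨hω, fun t => weak t e1, fun t => ?_, fun t => ?_, fun t => ?_, fun t => ?_,
    fun t => weak t e6, fun t => weak t e7, fun t => ?_, fun t => ?_, fun t => ?_,
    fun t => weak t e11, fun t => ?_, fun t => ?_, fun t => ?_⟩
  · rw [mul_div_assoc] at e2 ⊢
    exact strong t (by positivity) e2
  · simp only [mul_assoc, mul_div_assoc] at e3 ⊢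
    exact strong t (by positivity) e3
  · have h2 : 32 * c.LK K ^ 2 ≤ cbarη c m K := le_max_left _ _
    rw [mul_assoc u] at e4
    refine (strong t (by positivity) e4).trans ?_
    rw [le_div_iff₀ (by positivity)]
    have := mul_le_mul_of_nonneg_left h2 (by positivity : 0 ≤ cbarU c m θ K * (1 - lam))
    linarith
  · simp only [mul_assoc, mul_div_assoc] at e5 ⊢
    exact strong t (by positivity) e5
  · refine Real.le_sqrt_of_sq_le ?_
    have h2 := LK_sq_le hc hK
    have h3 : stepα ω t * (11 * c.LK 1) * K ^ 3 ≤ 1 - lam := by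
      rw [le_div_iff₀ (by positivity)] at e8
      have := hα t
      rw [le_div_iff₀ hK0] at this
      calc _ = stepα ω t * K ^ 3 * (11 * c.LK 1) := by ring
        _ ≤ ε * (11 * c.LK 1) := by gcongr
        _ ≤ _ := e8
    have h4 := pow_le_pow_left₀ (by have := ha t; positivity) h3 2
    rw [le_div_iff₀ (by positivity)]
    calc stepα ω t ^ 2 * (120 * c.LK K ^ 2)
        ≤ stepα ω t ^ 2 * (120 * (K ^ 3 * c.LK 1 ^ 2)) := by gcongr
      _ ≤ stepα ω t ^ 2 * (121 * ((K ^ 3) ^ 2 * c.LK 1 ^ 2)) := by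
          have h5 : (K : ℝ) ^ 3 ≤ (K ^ 3) ^ 2 := le_self_pow₀ hK3 (by norm_num)
          gcongr
          norm_num
      _ = (stepα ω t * (11 * c.LK 1) * K ^ 3) ^ 2 := by ring
      _ ≤ _ := h4
  · refine (weak t e9).trans ?_
    refine div_le_div_of_nonneg_left hh.le (by positivity) ?_
    have := mul_le_mul_of_nonneg_right hcuL hm'.le
    linarith
  · refine (weak t e10).trans ?_
    refine div_le_div_of_nonneg_left (by positivity) (by positivity) ?_
    have := mul_le_mul_of_nonneg_right hcuL (by positivity : 0 ≤ (c.μg + c.Lg) * cβ c m)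
    have h3 : 0 < (c.μg + c.Lg) * cβ c m := by positivity
    linarith
  · have h2 := weak t e12
    rw [le_div_iff₀ (by positivity)] at h2
    rw [stepβ, le_div_iff₀ (by positivity)]
    linarith
  · cases t with
    | zero => exact ⟨zero_le_one, le_rfl⟩
    | succ t =>
      have h2 := cη_pos hc hm hK hθ0 hθ
      have h3 : cη c m θ K ≤ A * cbarη c m K := by rw [hA]; exact cη_le hc hm hK hθ0 hθ
      have h4 := cbarη_le (K := K) hc hm
      have h5 := LK_sq_le hc hK
      have h6 : stepα ω t ≤ 1 := weak t e0
      have h7 := hα t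
      rw [le_div_iff₀ hK0] at h7
      rw [le_div_iff₀ (by positivity)] at e13
      refine ⟨mul_nonneg h2.le (sq_nonneg _), ?_⟩
      calc cη c m θ K * stepα ω t ^ 2
          ≤ (A * (ratioη c m * (K ^ 3 * c.LK 1 ^ 2))) * (stepα ω t * 1) := by
            rw [sq]
            have := (ha t).le
            gcongr
            exact h3.trans (mul_le_mul_of_nonneg_left
              (h4.trans (mul_le_mul_of_nonneg_left h5 hr.le)) hA0.le)
        _ = stepα ω t * K ^ 3 * (A * ratioη c m * c.LK 1 ^ 2) := by ring
        _ ≤ ε * (A * ratioη c m * c.LK 1 ^ 2) := by gcongr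
        _ ≤ 1 := e13
  · cases t with
    | zero => exact ⟨zero_le_one, le_rfl⟩
    | succ t =>
      have h2 := cγ_pos hc hm hK hθ0
      have h3 : cγ c m θ K ≤ Γ := by rw [hΓ]; exact cγ_le hc hK hθ
      have h6 : stepα ω t ≤ 1 := weak t e0
      have h7 := weak t e14
      rw [le_div_iff₀ hΓ0] at h7
      refine ⟨mul_nonneg h2.le (sq_nonneg _), ?_⟩
      calc cγ c m θ K * stepα ω t ^ 2 ≤ Γ * (stepα ω t * 1) := by
            rw [sq]
            have := (ha t).le
            gcongr
        _ ≤ 1 := by linarith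

end Growth

/-! ### Existence of admissible offsets -/

section Offset

variable {c : Consts} {m : ℕ} {θ lam : ℝ}

lemma numSamples_pos (c : Consts) (T : ℕ) : 0 < c.numSamples T :=
  lt_max_of_lt_left one_pos

/-- The number of Neumann samples is of logarithmic order. -/
lemma exists_numSamples_le (hc : c.Valid) :
    ∃ C : ℝ, 0 < C ∧ ∀ T : ℕ, 2 ≤ T → (c.numSamples T : ℝ) ≤ C * Real.log T := by
  have ha : 0 < c.Lg / c.μg := div_pos hc.Lg_pos hc.μg_pos
  have h2 : 0 < Real.log 2 := Real.log_pos one_lt_two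
  obtain ⟨r, hr⟩ : ∃ r, r = c.Cgxy * c.Cfy / c.μg := ⟨_, rfl⟩
  refine ⟨(1 + c.Lg / c.μg * |Real.log r|) / Real.log 2 + c.Lg / c.μg, by positivity,
    fun T hT => ?_⟩
  have hT' : (2 : ℝ) ≤ T := by exact_mod_cast hT
  have hlog : Real.log 2 ≤ Real.log T := Real.log_le_log two_pos hT'
  have hle : Real.log (c.Cgxy * c.Cfy * T / c.μg) ≤ |Real.log r| + Real.log T := by
    rw [mul_div_right_comm, ← hr]
    by_cases hr0 : r = 0
    -- without dependence on `∇_y f` the logarithm has the junk value `log 0 = 0`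
    · have := abs_nonneg (Real.log r)
      rw [hr0, zero_mul, Real.log_zero] at *
      linarith
    · rw [Real.log_mul hr0 (by positivity)]
      have := le_abs_self (Real.log r)
      linarith
  have h0 : 0 ≤ c.Lg / c.μg * (|Real.log r| + Real.log T) := by
    have := abs_nonneg (Real.log r)
    have : 0 ≤ Real.log T := by linarith
    positivity
  have h3 : (c.numSamples T : ℝ) ≤ c.Lg / c.μg * (|Real.log r| + Real.log T) + 1 := by
    have h4 := Nat.ceil_mono (mul_le_mul_of_nonneg_left hle ha.le)
    have h5 := Nat.ceil_lt_add_one h0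
    unfold Consts.numSamples
    push_cast
    refine max_le (by linarith) ?_
    have : ((⌈c.Lg / c.μg * Real.log (c.Cgxy * c.Cfy * T / c.μg)⌉₊ : ℕ) : ℝ)
        ≤ (⌈c.Lg / c.μg * (|Real.log r| + Real.log T)⌉₊ : ℕ) := by exact_mod_cast h4
    linarith
  have h6 : 1 + c.Lg / c.μg * |Real.log r| ≤
      (1 + c.Lg / c.μg * |Real.log r|) / Real.log 2 * Real.log T := by
    refine (le_mul_of_one_le_right (by positivity) ((one_le_div h2).2 hlog)).trans (le_of_eq ?_)
    ring
  linarith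

/-- Admissible offsets of polylogarithmic size.  The exponent is `9 = 3 · 3`: the step sizes have to
be at most a multiple of `K⁻³`, that is `ω ≥ (K³ / ε)³`, and `K` is of the order of `log T`. -/
lemma exists_offset (hc : c.Valid) (hm : 0 < m) (h1 : lam < 1) (hθ0 : 0 < θ) (hθ : θ < 1) :
    ∃ C : ℝ, 0 < C ∧ ∀ T : ℕ, 2 ≤ T → ∃ ω : ℝ, ω ≤ C * Real.log T ^ 9 ∧
      Admissible c m lam θ (c.numSamples T) ω := by
  obtain ⟨ε, hε, had⟩ := exists_admissible hc hm h1 hθ0 hθ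
  obtain ⟨C, hC, hK⟩ := exists_numSamples_le hc
  have h2 : 0 < Real.log 2 := Real.log_pos one_lt_two
  refine ⟨2 / Real.log 2 ^ 9 + C ^ 9 / ε ^ 3, by positivity, fun T hT => ?_⟩
  have hT' : (2 : ℝ) ≤ T := by exact_mod_cast hT
  have hlog : Real.log 2 ≤ Real.log T := Real.log_le_log two_pos hT'
  have hK0 : (0 : ℝ) < c.numSamples T := by exact_mod_cast numSamples_pos c T
  refine ⟨2 + (c.numSamples T ^ 3 / ε) ^ 3, ?_, had _ _ (numSamples_pos c T)
    (le_add_of_nonneg_right (by positivity)) fun t => ?_⟩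
  · have h3 : (2 : ℝ) ≤ 2 / Real.log 2 ^ 9 * Real.log T ^ 9 := by
      rw [div_mul_eq_mul_div, le_div_iff₀ (by positivity)]
      gcongr
    have h4 : ((c.numSamples T : ℝ) ^ 3 / ε) ^ 3 ≤ C ^ 9 / ε ^ 3 * Real.log T ^ 9 := by
      have h5 := pow_le_pow_left₀ hK0.le (hK T hT) 9
      calc ((c.numSamples T : ℝ) ^ 3 / ε) ^ 3 = (c.numSamples T : ℝ) ^ 9 / ε ^ 3 := by
            rw [div_pow, ← pow_mul]
        _ ≤ (C * Real.log T) ^ 9 / ε ^ 3 := by gcongr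
        _ = _ := by rw [mul_pow, mul_div_right_comm]
    rw [add_mul]
    exact add_le_add h3 h4
  · have hω : 0 < 2 + ((c.numSamples T : ℝ) ^ 3 / ε) ^ 3 := by positivity
    have h3 : stepα (2 + ((c.numSamples T : ℝ) ^ 3 / ε) ^ 3) t ^ 3 ≤
        (ε / (c.numSamples T : ℝ) ^ 3) ^ 3 := by
      rw [stepα_cube hω, one_div, ← inv_div ((c.numSamples T : ℝ) ^ 3) ε, inv_pow]
      refine inv_anti₀ (by positivity) ?_
      have : (0 : ℝ) ≤ t := Nat.cast_nonneg t
      linarith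
    exact le_of_pow_le_pow_left₀ (by norm_num) (by positivity) h3

end Offset

/-! ### The rate -/

section Rate

variable {c : Consts} {m K : ℕ} {θ lam ω : ℝ}

/-- The fractional powers that occur in the rate, in terms of the cube root. -/
lemma exists_cube_root {x : ℝ} (hx : 0 ≤ x) : ∃ s : ℝ, 0 ≤ s ∧ x = s ^ 3 ∧
    x ^ (1 / 3 : ℝ) = s ∧ x ^ (2 / 3 : ℝ) = s ^ 2 ∧ x ^ (5 / 3 : ℝ) = s ^ 5 := by
  refine ⟨x ^ (1 / 3 : ℝ), by positivity, ?_, rfl, ?_, ?_⟩ <;>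
    rw [← Real.rpow_natCast, ← Real.rpow_mul hx] <;> norm_num

lemma sum_one_div_le (hω : 2 ≤ ω) (n : ℕ) :
    ∑ t ∈ Finset.range n, 1 / (ω + t) ≤ Real.log (n + 1) := by
  induction n with
  | zero => simp
  | succ n ih =>
    have hn : (0 : ℝ) ≤ n := Nat.cast_nonneg n
    have h1 := Real.one_sub_inv_le_log_of_pos (x := (n + 2 : ℝ) / (n + 1)) (by positivity)
    rw [Real.log_div (by positivity) (by positivity)] at h1
    have h2 : 1 - ((n + 2 : ℝ) / (n + 1))⁻¹ = 1 / (2 + n) := by field_simp; ring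
    have h3 : 1 / (ω + n) ≤ 1 / (2 + n) := by gcongr
    rw [Finset.sum_range_succ]
    push_cast
    rw [show (n : ℝ) + 1 + 1 = n + 2 by ring]
    linarith

lemma sum_stepα_cube_le (hω : 2 ≤ ω) {T : ℕ} (hT : 2 ≤ T) :
    ∑ t ∈ Finset.range T, stepα ω t ^ 3 ≤ 2 * Real.log T := by
  have hT' : (2 : ℝ) ≤ T := by exact_mod_cast hT
  simp only [stepα_cube (by linarith : 0 < ω)]
  refine (sum_one_div_le hω T).trans ?_
  have h := Real.log_le_log (by positivity) (by nlinarith : (T : ℝ) + 1 ≤ T ^ 2)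
  rwa [Real.log_pow, Nat.cast_two] at h

/-- The accumulated noise is of logarithmic order, since `∑ α_t³` is. -/
lemma exists_sum_stepNoise_le (hc : c.Valid) (hm : 0 < m) (hθ0 : 0 < θ) (hθ : θ < 1) :
    ∃ a b : ℝ, 0 ≤ a ∧ 0 ≤ b ∧ ∀ (K : ℕ) (ω σf σg : ℝ) (T : ℕ), 0 < K → 2 ≤ ω → 2 ≤ T →
      (∀ t, stepα ω t ≤ 1) → ∑ t ∈ Finset.range T, stepNoise c m θ K ω σf σg (1 / T) t ≤
        3 / 2 * (1 / T) + a * (K ^ 3 * (Real.log T * σf ^ 2)) + b * (Real.log T * σg ^ 2) := by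
  have hcg := cbarγ_pos (m := m) hc
  have hr := ratioη_pos hc hm
  have hL1 := LK_pos hc one_pos
  have hLf := hc.Lf_pos
  have hLμ := hc.Lμ_pos
  have hcb := cβ_pos hc hm
  have hcy := cbarY_pos hc hm
  have hθ' : 0 < 1 - θ := by linarith
  have hm' : (0 : ℝ) < m := by exact_mod_cast hm
  obtain ⟨A, hA⟩ : ∃ A, A = (2 / m + 1 / (96 * c.Lf * c.LK 1 ^ 2)) / (1 - θ) := ⟨_, rfl⟩
  have hA0 : 0 < A := by rw [hA]; positivity
  obtain ⟨Γ, hΓ⟩ : ∃ Γ, Γ = 1 / (3 * c.Lf) + 8 * c.Lg ^ 2 * cβ c m ^ 2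
      + cbarγ c m * (2 * cβ c m * cbarY c m / c.Lμ + cβ c m ^ 2 / 2) := ⟨_, rfl⟩
  refine ⟨3 * (A ^ 2 * (ratioη c m * c.LK 1 ^ 2)) * m * 2, 2 * ((cbarγ c m)⁻¹ * Γ ^ 2) * m * 2,
    by positivity, by positivity, fun K ω σf σg T hK hω hT hα => ?_⟩
  have hω0 : 0 < ω := by linarith
  have hT0 : (0 : ℝ) < T := by positivity
  have hce := cbarη_pos (m := m) hc hK
  have hcη := cη_pos hc hm hK hθ0 hθ
  have hcγ := cγ_pos hc hm hK hθ0
  have hA1 : (cbarη c m K)⁻¹ * cη c m θ K ^ 2 ≤ A ^ 2 * (ratioη c m * (K ^ 3 * c.LK 1 ^ 2)) := by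
    have h3 : cη c m θ K ≤ A * cbarη c m K := by rw [hA]; exact cη_le hc hm hK hθ0 hθ
    have h4 := (cbarη_le (K := K) hc hm).trans
      (mul_le_mul_of_nonneg_left (LK_sq_le hc hK) hr.le)
    calc (cbarη c m K)⁻¹ * cη c m θ K ^ 2 ≤ (cbarη c m K)⁻¹ * (A * cbarη c m K) ^ 2 := by gcongr
      _ = A ^ 2 * cbarη c m K := by field_simp
      _ ≤ _ := by gcongr
  have hΓ1 : (cbarγ c m)⁻¹ * cγ c m θ K ^ 2 ≤ (cbarγ c m)⁻¹ * Γ ^ 2 := by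
    have h3 : cγ c m θ K ≤ Γ := by rw [hΓ]; exact cγ_le hc hK hθ
    gcongr
  have hstep : ∀ t, stepNoise c m θ K ω σf σg (1 / T) t ≤ 3 / 2 * (1 / T) ^ 2
      + (3 * (A ^ 2 * (ratioη c m * (K ^ 3 * c.LK 1 ^ 2))) * (m * σf ^ 2)
        + 2 * ((cbarγ c m)⁻¹ * Γ ^ 2) * (m * σg ^ 2)) * stepα ω t ^ 3 := by
    intro t
    have ha := stepα_pos hω0 t
    have h5 : 3 / 2 * stepα ω t * (1 / (T : ℝ)) ^ 2 ≤ 3 / 2 * 1 * (1 / T) ^ 2 := by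
      gcongr
      exact hα t
    have e1 : 3 * (cbarη c m K)⁻¹ * (stepα ω t)⁻¹ * momη c m θ K ω (t + 1) ^ 2 * (m * σf ^ 2)
        = 3 * ((cbarη c m K)⁻¹ * cη c m θ K ^ 2) * (m * σf ^ 2) * stepα ω t ^ 3 := by
      simp only [momη]
      field_simp
    have e2 : 2 * (cbarγ c m)⁻¹ * (stepα ω t)⁻¹ * momγ c m θ K ω (t + 1) ^ 2 * (m * σg ^ 2)
        = 2 * ((cbarγ c m)⁻¹ * cγ c m θ K ^ 2) * (m * σg ^ 2) * stepα ω t ^ 3 := by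
      simp only [momγ]
      field_simp
    have h6 : 3 * ((cbarη c m K)⁻¹ * cη c m θ K ^ 2) * (m * σf ^ 2) * stepα ω t ^ 3 ≤
        3 * (A ^ 2 * (ratioη c m * (K ^ 3 * c.LK 1 ^ 2))) * (m * σf ^ 2) * stepα ω t ^ 3 := by
      gcongr
    have h7 : 2 * ((cbarγ c m)⁻¹ * cγ c m θ K ^ 2) * (m * σg ^ 2) * stepα ω t ^ 3 ≤
        2 * ((cbarγ c m)⁻¹ * Γ ^ 2) * (m * σg ^ 2) * stepα ω t ^ 3 := by gcongr
    unfold stepNoise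
    rw [e1, e2, add_mul]
    linarith only [h5, h6, h7]
  refine (Finset.sum_le_sum fun t _ => hstep t).trans ?_
  rw [Finset.sum_add_distrib, Finset.sum_const, Finset.card_range, nsmul_eq_mul, ← Finset.mul_sum]
  have h8 := mul_le_mul_of_nonneg_left (sum_stepα_cube_le hω hT)
    (by positivity : 0 ≤ 3 * (A ^ 2 * (ratioη c m * (K ^ 3 * c.LK 1 ^ 2))) * (m * σf ^ 2)
        + 2 * ((cbarγ c m)⁻¹ * Γ ^ 2) * (m * σg ^ 2))
  have e3 : (T : ℝ) * (3 / 2 * (1 / T) ^ 2) = 3 / 2 * (1 / T) := by field_simp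
  rw [e3]
  linarith only [h8]

/-- The decrements of the potential control the metric, as `α_t⁻¹ ≤ (ωT)^(1/3)` for `t < T`. -/
lemma sum_metric_le {σf σg δ d L : ℝ} {β η γ l G X U Ub Y Pe Ve W D : ℕ → ℝ} {T : ℕ} (hω : 2 ≤ ω)
    (hT : 2 ≤ T) (hα1 : ∀ t, stepα ω t ≤ 1)
    (hR : Recursion c m lam L σf σg δ (stepα ω) β η γ l G X U Ub Y Pe Ve W D)
    (hd1 : d ≤ 1 / 2) (hd2 : d ≤ 3 * c.Lf ^ 2 / m) :
    d * (ω ^ (1 / 3 : ℝ) * (T : ℝ) ^ (1 / 3 : ℝ))⁻¹ * ∑ t ∈ Finset.range T, (G t + X t + Y t) ≤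
      ∑ t ∈ Finset.range T, (stepα ω t / 2 * G t + (stepα ω t)⁻¹ * X t
        + 3 * stepα ω t * c.Lf ^ 2 / m * Y t) := by
  have hω0 : 0 < ω := by linarith
  have hT' : (2 : ℝ) ≤ T := by exact_mod_cast hT
  have hT0 : (0 : ℝ) < T := by linarith
  have hinv : ∀ t < T, (ω ^ (1 / 3 : ℝ) * (T : ℝ) ^ (1 / 3 : ℝ))⁻¹ ≤ stepα ω t := by
    intro t ht
    rw [inv_le_comm₀ (by positivity) (stepα_pos hω0 t), inv_stepα hω0,
      ← Real.mul_rpow hω0.le hT0.le]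
    have ht' : (t : ℝ) ≤ T := by exact_mod_cast ht.le
    exact Real.rpow_le_rpow (by positivity) (by nlinarith) (by norm_num)
  rw [Finset.mul_sum]
  refine Finset.sum_le_sum fun t ht => ?_
  have h2 := hinv t (Finset.mem_range.1 ht)
  have hat := stepα_pos hω0 t
  have h3 : d * (ω ^ (1 / 3 : ℝ) * (T : ℝ) ^ (1 / 3 : ℝ))⁻¹ ≤ stepα ω t / 2 :=
    (mul_le_mul hd1 h2 (by positivity) (by norm_num)).trans (le_of_eq (by ring))
  have h4 : d * (ω ^ (1 / 3 : ℝ) * (T : ℝ) ^ (1 / 3 : ℝ))⁻¹ ≤ (stepα ω t)⁻¹ := by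
    have := (one_le_inv₀ hat).2 (hα1 t)
    have := hα1 t
    linarith
  have h5 : d * (ω ^ (1 / 3 : ℝ) * (T : ℝ) ^ (1 / 3 : ℝ))⁻¹ ≤ 3 * stepα ω t * c.Lf ^ 2 / m :=
    (mul_le_mul hd2 h2 (by positivity) (by positivity)).trans (le_of_eq (by ring))
  rw [mul_add, mul_add]
  exact add_le_add (add_le_add (mul_le_mul_of_nonneg_right h3 (hR.G_nonneg t))
    (mul_le_mul_of_nonneg_right h4 (hR.X_nonneg t)))
    (mul_le_mul_of_nonneg_right h5 (hR.Y_nonneg t))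

/-- The summed descent divided by `T`, in terms of `w = ω^(1/3)` and `s = T^(1/3)`. -/
lemma rate_of_weighted_le {d w s T S F R E k p q : ℝ} (hd : 0 < d) (hw : 0 < w) (hs : 0 < s)
    (hT : T = s ^ 3)
    (h : d * (w * s)⁻¹ * S ≤ F * (R * (E + w * (k * p) + w * q + 1 / T))) :
    1 / T * S ≤ F / d * R * (w * E / s ^ 2 + k * w ^ 2 * p / s ^ 2 + w ^ 2 * q / s ^ 2
      + w / s ^ 5) := by
  have key : 1 / T * S = w / (d * s ^ 2) * (d * (w * s)⁻¹ * S) := by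
    rw [hT]
    field_simp
  rw [key]
  refine (mul_le_mul_of_nonneg_left h (by positivity)).trans (le_of_eq ?_)
  rw [hT]
  field_simp

/-- The three-term rate for sequences that satisfy the expected one-step inequalities. -/
lemma exists_rate (hc : c.Valid) (hm : 2 ≤ m) (h0 : 0 ≤ lam) (h1 : lam < 1) (hθ0 : 0 < θ)
    (hθ : θ < 1) : ∃ R : ℝ, 0 < R ∧ ∀ (T K : ℕ) (ω σf σg : ℝ) (l G X U Ub Y Pe Ve W D : ℕ → ℝ)
      (lS : ℝ), 2 ≤ T → 0 < K → Admissible c m lam θ K ω →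
      Recursion c m lam (c.LK K) σf σg (1 / T) (stepα ω) (stepβ c m ω) (momη c m θ K ω)
        (momγ c m θ K ω) l G X U Ub Y Pe Ve W D → (∀ t, lS ≤ l t) →
      (1 / (T : ℝ)) * ∑ t ∈ Finset.range T, (G t + X t + Y t) ≤
        R * (ω ^ (1 / 3 : ℝ) * (l 0 + cbarY c m * Y 0 + cbarX lam ω 0 * X 0
              + cbarU c m θ K * U 0 - lS) / (T : ℝ) ^ (2 / 3 : ℝ)
            + (K : ℝ) ^ 3 * ω ^ (2 / 3 : ℝ) * (Real.log T * σf ^ 2) / (T : ℝ) ^ (2 / 3 : ℝ)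
            + ω ^ (2 / 3 : ℝ) * (Real.log T * σg ^ 2) / (T : ℝ) ^ (2 / 3 : ℝ)
            + ω ^ (1 / 3 : ℝ) / (T : ℝ) ^ (5 / 3 : ℝ)) := by
  have hm0 : 0 < m := by omega
  have hm' : (0 : ℝ) < m := by exact_mod_cast hm0
  have hLf := hc.Lf_pos
  have hL1 := LK_pos hc one_pos
  have hcg := cbarγ_pos (m := m) hc
  have hcy := cbarY_pos hc hm0
  have hh : 0 < 1 - lam := by linarith
  have hl2 : 0 < Real.log 2 := Real.log_pos one_lt_two
  obtain ⟨a, b, ha0, hb0, hnoise⟩ := exists_sum_stepNoise_le hc hm0 hθ0 hθ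
  obtain ⟨d, hd⟩ : ∃ d, d = min (1 / 2) (3 * c.Lf ^ 2 / m) := ⟨_, rfl⟩
  have hd0 : 0 < d := by rw [hd]; exact lt_min (by norm_num) (by positivity)
  have hd1 : d ≤ 1 / 2 := hd ▸ min_le_left _ _
  have hd2 : d ≤ 3 * c.Lf ^ 2 / m := hd ▸ min_le_right _ _
  obtain ⟨F, hF⟩ : ∃ F, F = 2 ^ burnIn lam * (1 - lam)⁻¹ := ⟨_, rfl⟩
  have hF0 : 0 < F := by rw [hF]; positivity
  obtain ⟨a', ha'⟩ : ∃ a', a' = (32 * c.LK 1 ^ 2)⁻¹ * m / Real.log 2 := ⟨_, rfl⟩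
  have ha'0 : 0 ≤ a' := by rw [ha']; positivity
  obtain ⟨b', hb'⟩ : ∃ b', b' = (cbarγ c m)⁻¹ * m / Real.log 2 := ⟨_, rfl⟩
  have hb'0 : 0 ≤ b' := by rw [hb']; positivity
  refine ⟨F / d * (3 / 2 + a + b + a' + b'), by positivity, ?_⟩
  intro T K ω σf σg l G X U Ub Y Pe Ve W D lS hT hK hA hR hl
  have hω := hA.two_le
  have hω0 : 0 < ω := by linarith
  have hT' : (2 : ℝ) ≤ T := by exact_mod_cast hT
  have hK1 : (1 : ℝ) ≤ K := by exact_mod_cast hK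
  have hK3 : (1 : ℝ) ≤ K ^ 3 := one_le_pow₀ hK1
  have hce := cbarη_pos (m := m) hc hK
  have hcu := cbarU_pos (m := m) hc hK hθ0
  have hα := fun t => stepα_pos hω0 t
  have hα1 : ∀ t, stepα ω t ≤ 1 := fun t => (hA.α_le_11 t).trans (by linarith)
  have hlog : Real.log 2 ≤ Real.log T := Real.log_le_log two_pos hT'
  obtain ⟨w, hw0, hw3, hw1, hw2, -⟩ := exists_cube_root hω0.le
  obtain ⟨s, hs0, hs3, hs1, hs2, hs5⟩ := exists_cube_root (by linarith : (0 : ℝ) ≤ T)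
  have hw : 1 ≤ w := by rw [← hw1]; exact Real.one_le_rpow (by linarith) (by norm_num)
  have hs : 1 ≤ s := by rw [← hs1]; exact Real.one_le_rpow (by linarith) (by norm_num)
  obtain ⟨E, hE⟩ : ∃ E, E = l 0 + cbarY c m * Y 0 + cbarX lam ω 0 * X 0
    + cbarU c m θ K * U 0 - lS := ⟨_, rfl⟩
  have hE0 : 0 ≤ E := by
    have := hl 0
    have := mul_nonneg hcy.le (hR.Y_nonneg 0)
    have := mul_nonneg hcu.le (hR.U_nonneg 0)
    rw [hE, hR.X_zero]
    linarith
  have hdec := sum_metric_le hω hT hα1 hR hd1 hd2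
  rw [hw1, hs1] at hdec
  have hsum := sum_decrement_le hc hm hK h0 h1 hθ0 hθ hA hR hl T
  rw [← hF] at hsum
  have hN := hnoise K ω σf σg T hK hω hT hα1
  -- the initial errors of the momentum estimators
  have hpred : (stepα (ω - 1) 0)⁻¹ ≤ w := by
    rw [inv_stepα (by linarith : 0 < ω - 1), ← hw1]
    exact Real.rpow_le_rpow (by simp; linarith) (by simp) (by norm_num)
  have hpred0 := stepα_pos (by linarith : 0 < ω - 1) 0
  have hlog1 : 1 ≤ Real.log T / Real.log 2 := (one_le_div hl2).2 hlog
  have hP : (cbarη c m K)⁻¹ * (stepα (ω - 1) 0)⁻¹ * Pe 0 ≤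
      a' * w * (K ^ 3 * (Real.log T * σf ^ 2)) := by
    calc (cbarη c m K)⁻¹ * (stepα (ω - 1) 0)⁻¹ * Pe 0
        ≤ (32 * c.LK 1 ^ 2)⁻¹ * w * (m * σf ^ 2) := by
          have := inv_cbarη_le (m := m) hc hK
          have := hR.Pe_zero
          have := hR.Pe_nonneg 0
          gcongr
      _ ≤ (32 * c.LK 1 ^ 2)⁻¹ * w * (m * σf ^ 2) * (K ^ 3 * (Real.log T / Real.log 2)) :=
          le_mul_of_one_le_right (by positivity) (one_le_mul_of_one_le_of_one_le hK3 hlog1)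
      _ = _ := by rw [ha']; ring
  have hV : (cbarγ c m)⁻¹ * (stepα (ω - 1) 0)⁻¹ * Ve 0 ≤ b' * w * (Real.log T * σg ^ 2) := by
    calc (cbarγ c m)⁻¹ * (stepα (ω - 1) 0)⁻¹ * Ve 0 ≤ (cbarγ c m)⁻¹ * w * (m * σg ^ 2) := by
          have := hR.Ve_zero
          have := hR.Ve_nonneg 0
          gcongr
      _ ≤ (cbarγ c m)⁻¹ * w * (m * σg ^ 2) * (Real.log T / Real.log 2) :=
          le_mul_of_one_le_right (by positivity) hlog1
      _ = _ := by rw [hb']; ring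
  have hΦ : lyapunov c m lam K ω (cbarU c m θ K) l X U Y Pe Ve 0 - lS ≤
      E + a' * w * (K ^ 3 * (Real.log T * σf ^ 2)) + b' * w * (Real.log T * σg ^ 2) := by
    rw [lyapunov, hE]
    linarith only [hP, hV]
  have hlogT : 0 ≤ Real.log T := by linarith
  obtain ⟨Q, hQ⟩ : ∃ Q, Q = K ^ 3 * (Real.log T * σf ^ 2) := ⟨_, rfl⟩
  have hQ0 : 0 ≤ Q := by rw [hQ]; positivity
  obtain ⟨V, hVd⟩ : ∃ V, V = Real.log T * σg ^ 2 := ⟨_, rfl⟩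
  have hV0 : 0 ≤ V := by rw [hVd]; positivity
  rw [← hQ, ← hVd] at hΦ hN
  -- collect the terms
  have hcol : E + a' * w * Q + b' * w * V + (3 / 2 * (1 / T) + a * Q + b * V) ≤
      (3 / 2 + a + b + a' + b') * (E + w * Q + w * V + 1 / T) := by
    have hT0 : 0 ≤ 1 / (T : ℝ) := by positivity
    have hQw : Q ≤ w * Q := le_mul_of_one_le_left hQ0 hw
    have hVw : V ≤ w * V := le_mul_of_one_le_left hV0 hw
    have p1 : a * Q ≤ a * (w * Q) := mul_le_mul_of_nonneg_left hQw ha0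
    have p2 : b * V ≤ b * (w * V) := mul_le_mul_of_nonneg_left hVw hb0
    have p3 : 0 ≤ (1 / 2 + a + b + a' + b') * E := by positivity
    have p4 : 0 ≤ (3 / 2 + b + b') * (w * Q) := mul_nonneg (by positivity) (by linarith)
    have p5 : 0 ≤ (3 / 2 + a + a') * (w * V) := mul_nonneg (by positivity) (by linarith)
    have p6 : 0 ≤ (a + b + a' + b') * (1 / T) := by positivity
    linarith only [p1, p2, p3, p4, p5, p6]
  have htot : d * (w * s)⁻¹ * ∑ t ∈ Finset.range T, (G t + X t + Y t) ≤
      F * ((3 / 2 + a + b + a' + b') * (E + w * Q + w * V + 1 / T)) :=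
    hdec.trans (hsum.trans (mul_le_mul_of_nonneg_left
      ((add_le_add hΦ hN).trans hcol) hF0.le))
  rw [← hE, hw1, hw2, hs2, hs5]
  rw [hQ, hVd] at htot
  exact rate_of_weighted_le hd0 (by linarith) (by linarith) hs3 htot

end Rate

/-! ### The convergence theorem -/

section Convergence

/-- The three-term rate is of order `T^(-2/3)` up to logarithms.  Here `w = ω^(1/3)`,
`s = T^(1/3)`, `L = log T` and `ℓ = log 2`. -/
lemma three_term_le {C C₁ E₀ E w s K σf σg L ℓ : ℝ} (hC : 0 ≤ C) (hC₁ : 0 ≤ C₁) (hE₀ : 0 ≤ E₀)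
    (hE : E ≤ E₀ * (1 + σf ^ 2)) (hw : 1 ≤ w) (hs : 1 ≤ s) (hK0 : 0 ≤ K) (hK : K ≤ C₁ * L)
    (hℓ : 0 < ℓ) (hL : ℓ ≤ L) :
    C * (w * E / s ^ 2 + K ^ 3 * w ^ 2 * (L * σf ^ 2) / s ^ 2 + w ^ 2 * (L * σg ^ 2) / s ^ 2
        + w / s ^ 5) ≤
      C * (E₀ / ℓ ^ 9 + C₁ ^ 3 / ℓ ^ 5 + 1 / ℓ ^ 8 + 1 / ℓ ^ 9) * (1 + σf ^ 2 + σg ^ 2) * w ^ 2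
        * L ^ 9 / s ^ 2 := by
  have hL0 : 0 < L := hℓ.trans_le hL
  have hww : w ≤ w ^ 2 := le_self_pow₀ hw two_ne_zero
  have hss : s ^ 2 ≤ s ^ 5 := pow_le_pow_right₀ hs (by norm_num)
  have hs0 : 0 < s := by linarith
  have hp : ∀ k, 1 ≤ L ^ k / ℓ ^ k := fun k => by
    rw [← div_pow]
    exact one_le_pow₀ ((one_le_div hℓ).2 hL)
  obtain ⟨σ, hσ⟩ : ∃ σ, σ = 1 + σf ^ 2 + σg ^ 2 := ⟨_, rfl⟩
  have hσ1 : 1 ≤ σ := by rw [hσ]; linarith [sq_nonneg σf, sq_nonneg σg]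
  have hσf : σf ^ 2 ≤ σ := by rw [hσ]; linarith [sq_nonneg σg]
  have hσf1 : 1 + σf ^ 2 ≤ σ := by rw [hσ]; linarith [sq_nonneg σg]
  have hσg : σg ^ 2 ≤ σ := by rw [hσ]; linarith [sq_nonneg σf]
  have t1 : w * E / s ^ 2 ≤ E₀ / ℓ ^ 9 * σ * w ^ 2 * L ^ 9 / s ^ 2 := by
    have h1 : w * E ≤ w ^ 2 * (E₀ * σ) := by
      calc w * E ≤ w * (E₀ * (1 + σf ^ 2)) := by gcongr
        _ ≤ w ^ 2 * (E₀ * σ) := by gcongr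
    calc w * E / s ^ 2 ≤ w ^ 2 * (E₀ * σ) / s ^ 2 := by gcongr
      _ ≤ w ^ 2 * (E₀ * σ) / s ^ 2 * (L ^ 9 / ℓ ^ 9) :=
        le_mul_of_one_le_right (by positivity) (hp 9)
      _ = _ := by ring
  have t2 : K ^ 3 * w ^ 2 * (L * σf ^ 2) / s ^ 2 ≤
      C₁ ^ 3 / ℓ ^ 5 * σ * w ^ 2 * L ^ 9 / s ^ 2 := by
    calc K ^ 3 * w ^ 2 * (L * σf ^ 2) / s ^ 2 ≤ (C₁ * L) ^ 3 * w ^ 2 * (L * σ) / s ^ 2 := by gcongr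
      _ ≤ (C₁ * L) ^ 3 * w ^ 2 * (L * σ) / s ^ 2 * (L ^ 5 / ℓ ^ 5) :=
        le_mul_of_one_le_right (by positivity) (hp 5)
      _ = _ := by ring
  have t3 : w ^ 2 * (L * σg ^ 2) / s ^ 2 ≤ 1 / ℓ ^ 8 * σ * w ^ 2 * L ^ 9 / s ^ 2 := by
    calc w ^ 2 * (L * σg ^ 2) / s ^ 2 ≤ w ^ 2 * (L * σ) / s ^ 2 := by gcongr
      _ ≤ w ^ 2 * (L * σ) / s ^ 2 * (L ^ 8 / ℓ ^ 8) :=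
        le_mul_of_one_le_right (by positivity) (hp 8)
      _ = _ := by ring
  have t4 : w / s ^ 5 ≤ 1 / ℓ ^ 9 * σ * w ^ 2 * L ^ 9 / s ^ 2 := by
    calc w / s ^ 5 ≤ w ^ 2 / s ^ 2 := by gcongr
      _ ≤ w ^ 2 / s ^ 2 * σ := le_mul_of_one_le_right (by positivity) hσ1
      _ ≤ w ^ 2 / s ^ 2 * σ * (L ^ 9 / ℓ ^ 9) :=
        le_mul_of_one_le_right (by positivity) (hp 9)
      _ = _ := by ring
  rw [← hσ]
  refine (mul_le_mul_of_nonneg_left (add_le_add (add_le_add (add_le_add t1 t2) t3) t4) hC).trans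
    (le_of_eq ?_)
  ring

variable {m dup dlow : ℕ} {Ξ : Type u} {Z : Type v} [MeasurableSpace Ξ] [MeasurableSpace Z]
  {B : Problem m dup dlow Ξ Z} {c : Consts} {K : ℕ} {σf σg : ℝ}
  {M : Matrix (Fin m) (Fin m) ℝ} {θ ω lam : ℝ} {x₀ : Vec dup} {y₀ : Vec dlow}
  {Ω : Type*} [MeasurableSpace Ω] {P : Measure Ω}
  {s : ℕ → Fin m → Ω → UpperSample Ξ Z K × Z}

/-- Almost surely, the iterates are a run of the algorithm with oracles that are jointly
measurable in the point and the sample. -/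
lemma exists_oracles_iterate (hc : c.Valid) (hB : B.Regular c) (hK : 0 < K)
    (hV : B.Variance c K σf σg) (hs : IsSampling B K P s) :
    ∃ (h : Fin m → Vec dup → Vec dlow → UpperSample Ξ Z K → Vec dup)
      (k : Fin m → Vec dup → Vec dlow → Z → Vec dlow),
      (∀ i, Oracle (B.upperLaw K) (h i) (B.meanHat c K i) (c.LK K) σf) ∧
      (∀ i, Oracle B.πg (k i) (gradY (B.G i)) c.Lg σg) ∧
      ∀ᵐ o ∂P, ∀ t, iterate c B M θ K ω x₀ y₀ (fun j i => s j i o) t =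
        run h k M (stepα ω) (stepβ c m ω) (momη c m θ K ω) (momγ c m θ K ω) x₀ y₀
          (fun j i => s j i o) t := by
  choose h hO he using fun i => B.exists_upperOracle hc hB hK hV i
  choose k hOg hek using fun i => B.exists_lowerOracle hc hB hV i
  refine ⟨h, k, hO, hOg, ?_⟩
  have h1 : ∀ᵐ o ∂P, ∀ t i x y, B.hatGrad c i x y (s t i o).1 = h i x y (s t i o).1 := by
    refine ae_all_iff.2 fun t => ae_all_iff.2 fun i => ?_
    exact ae_of_ae_map (hs.meas t i).fst.aemeasurable (by rw [hs.law_upper t i]; exact he i)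
  have h2 : ∀ᵐ o ∂P, ∀ t i x y,
      gradY (fun x y => B.g i x y (s t i o).2) x y = k i x y (s t i o).2 := by
    refine ae_all_iff.2 fun t => ae_all_iff.2 fun i => ?_
    exact ae_of_ae_map (hs.meas t i).snd.aemeasurable (by rw [hs.law_lower t i]; exact hek i)
  filter_upwards [h1, h2] with o ho1 ho2 t
  rw [iterate_eq_run]
  exact run_congr ho1 ho2 t

variable [IsProbabilityMeasure P] {S : ℕ → Ω → State m dup dlow}

lemma integral_potential (hc : c.Valid) (hB : B.Regular c) (hm : 0 < m) {S : Ω → State m dup dlow}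
    (hS : State.SqInt P S) (t : ℕ) : ∫ o, potential c B lam θ K ω t (S o) ∂P =
      ∫ o, B.l (avg (S o).x) ∂P + cbarY c m * ∫ o, lowerErr B (S o) ∂P
        + cbarX lam ω t * ∫ o, consensusErr (S o).x ∂P
        + cbarU c m θ K * ∫ o, consensusErr (S o).u ∂P := by
  have h1 := B.integrable_l hc hB hS hm
  have h2 := (B.integrable_lowerErr hc hB hS).const_mul (cbarY c m)
  have h3 := (integrable_consensusErr hS.x).const_mul (cbarX lam ω t)
  have h4 := (integrable_consensusErr hS.u).const_mul (cbarU c m θ K)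
  unfold potential
  refine (integral_add ((h1.add h2).add h3) h4).trans ?_
  rw [integral_add' (h1.add h2) h3, integral_add' h1 h2, integral_const_mul, integral_const_mul,
    integral_const_mul]

lemma integral_metric (hc : c.Valid) (hB : B.Regular c) (hm : 0 < m) {S : Ω → State m dup dlow}
    (hS : State.SqInt P S) : ∫ o, metric B (S o) ∂P =
      ∫ o, ‖B.gradL (avg (S o).x)‖ ^ 2 ∂P + ∫ o, consensusErr (S o).x ∂P
        + ∫ o, lowerErr B (S o) ∂P := by
  have h1 := integrable_norm_sq (B.memLp_gradL hc hB hS hm)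
  have h2 := integrable_consensusErr hS.x
  have h3 := B.integrable_lowerErr hc hB hS
  unfold metric
  simp only [B.gradient_l hc hB]
  refine (integral_add (h1.add h2) h3).trans ?_
  rw [integral_add' h1 h2]

/-- The excess of the initial potential is bounded in terms of the problem, the starting point
and the variance of the gradient estimators. -/
lemma integral_potential_zero_le (hc : c.Valid) (hB : B.Regular c) (hm : 0 < m) (hK : 0 < K)
    (hθ0 : 0 < θ) (hθ : θ < 1)
    {h : Fin m → Vec dup → Vec dlow → UpperSample Ξ Z K → Vec dup}
    {k : Fin m → Vec dup → Vec dlow → Z → Vec dlow}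
    (hO : ∀ i, Oracle (B.upperLaw K) (h i) (B.meanHat c K i) (c.LK K) σf)
    (hOg : ∀ i, Oracle B.πg (k i) (gradY (B.G i)) c.Lg σg) (hs : IsSampling B K P s)
    {α β η γ : ℕ → ℝ} (hS : S = fun t o => run h k M α β η γ x₀ y₀ (fun j i => s j i o) t)
    (hδ : ∀ i x y, ‖B.meanHat c K i x y - barGrad (B.F i) (B.G i) x y‖ ≤ 1) :
    ∫ o, potential c B lam θ K ω 0 (S 0 o) ∂P - B.lStar ≤
      (B.l x₀ - B.lStar + cbarY c m * ∑ i, ‖B.yStar i x₀ - y₀‖ ^ 2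
        + 1 / (48 * c.LK 1 ^ 2) * (2 * (m + ∑ i, (‖barGrad (B.F i) (B.G i) x₀ y₀‖ + 1) ^ 2)))
      * (1 + σf ^ 2) := by
  obtain ⟨hsq, hp, -⟩ := run_zero_bounds hO hOg hs hS
  have hx : ∀ o, (S 0 o).x = fun _ => x₀ := by subst hS; exact fun o => rfl
  have hy : ∀ o, (S 0 o).y = fun _ => y₀ := by subst hS; exact fun o => rfl
  have hu : ∀ o, (S 0 o).u = (S 0 o).p := by subst hS; exact fun o => rfl
  have hcy := cbarY_pos hc hm
  have hcu := cbarU_pos (m := m) hc hK hθ0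
  have hL1 := LK_pos hc one_pos
  -- `K` depends on `T`, so the weight of the tracking error is bounded uniformly in `K`
  have hcu' : cbarU c m θ K ≤ 1 / (48 * c.LK 1 ^ 2) := by
    have h1 := cbarU_mul_sq_le (m := m) hc hK hθ
    have h2 := mul_le_mul_of_nonneg_left (LK_one_sq_le hc hK) hcu.le
    rw [le_div_iff₀ (by positivity)]
    linarith
  obtain ⟨b, hb⟩ : ∃ b, b = ∑ i, (‖barGrad (B.F i) (B.G i) x₀ y₀‖ + 1) ^ 2 := ⟨_, rfl⟩
  have hb0 : 0 ≤ b := hb ▸ Finset.sum_nonneg fun i _ => sq_nonneg _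
  have hmean : ∀ i, ‖B.meanHat c K i x₀ y₀‖ ≤ ‖barGrad (B.F i) (B.G i) x₀ y₀‖ + 1 := by
    intro i
    have h1 := hδ i x₀ y₀
    have h2 := norm_sub_norm_le (B.meanHat c K i x₀ y₀) (barGrad (B.F i) (B.G i) x₀ y₀)
    linarith
  have hint : ∀ i, Integrable (fun o => ‖(S 0 o).p i - B.meanHat c K i x₀ y₀‖ ^ 2) P := fun i =>
    integrable_norm_sq ((hsq.p i).sub (memLp_const _))
  have hint' : ∀ i, Integrable (fun o => 2 * ‖(S 0 o).p i - B.meanHat c K i x₀ y₀‖ ^ 2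
      + 2 * (‖barGrad (B.F i) (B.G i) x₀ y₀‖ + 1) ^ 2) P := fun i =>
    ((hint i).const_mul 2).add (integrable_const _)
  have hU : ∫ o, consensusErr (S 0 o).u ∂P ≤ 2 * (m * σf ^ 2 + b) := by
    calc ∫ o, consensusErr (S 0 o).u ∂P
        ≤ ∫ o, ∑ i, (2 * ‖(S 0 o).p i - B.meanHat c K i x₀ y₀‖ ^ 2
            + 2 * (‖barGrad (B.F i) (B.G i) x₀ y₀‖ + 1) ^ 2) ∂P := by
          refine integral_mono (integrable_consensusErr hsq.u)
            (integrable_finsetSum _ fun i _ => hint' i) fun o => ?_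
          refine (consensusErr_le hm _).trans (Finset.sum_le_sum fun i _ => ?_)
          have h1 := norm_add_le ((S 0 o).p i - B.meanHat c K i x₀ y₀) (B.meanHat c K i x₀ y₀)
          rw [sub_add_cancel] at h1
          rw [hu]
          have h2 := hmean i
          have h3 := pow_le_pow_left₀ (norm_nonneg _) (h1.trans (add_le_add le_rfl h2)) 2
          have h4 := sq_nonneg (‖(S 0 o).p i - B.meanHat c K i x₀ y₀‖
            - (‖barGrad (B.F i) (B.G i) x₀ y₀‖ + 1))
          linarith
      _ = ∑ i, (2 * ∫ o, ‖(S 0 o).p i - B.meanHat c K i x₀ y₀‖ ^ 2 ∂P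
            + 2 * (‖barGrad (B.F i) (B.G i) x₀ y₀‖ + 1) ^ 2) := by
          rw [integral_finsetSum _ fun i _ => hint' i]
          refine Finset.sum_congr rfl fun i _ => ?_
          rw [integral_add ((hint i).const_mul 2) (integrable_const _), integral_const_mul]
          simp
      _ ≤ ∑ i : Fin m, (2 * σf ^ 2 + 2 * (‖barGrad (B.F i) (B.G i) x₀ y₀‖ + 1) ^ 2) := by
          refine Finset.sum_le_sum fun i _ => ?_
          have h1 := hp i
          simp only [hx, hy] at h1
          linarith
      _ = _ := by
          rw [Finset.sum_add_distrib, ← Finset.mul_sum _ _ (2 : ℝ), ← Finset.mul_sum, ← hb]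
          simp
          ring
  rw [integral_potential hc hB hm hsq]
  simp only [lowerErr, hx, hy, avg_const hm, consensusErr_const hm]
  rw [← hb]
  simp only [integral_const, probReal_univ, one_smul, mul_zero, add_zero]
  have hl := B.lStar_le hB x₀
  have hy0 : 0 ≤ cbarY c m * ∑ i, ‖B.yStar i x₀ - y₀‖ ^ 2 :=
    mul_nonneg hcy.le (Finset.sum_nonneg fun i _ => sq_nonneg _)
  have h5 : cbarU c m θ K * ∫ o, consensusErr (S 0 o).u ∂P ≤
      1 / (48 * c.LK 1 ^ 2) * (2 * (m * σf ^ 2 + b)) :=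
    mul_le_mul hcu' hU (integral_nonneg fun o => consensusErr_nonneg _) (by positivity)
  have hσ := sq_nonneg σf
  have h6 : 0 ≤ (B.l x₀ - B.lStar + cbarY c m * ∑ i, ‖B.yStar i x₀ - y₀‖ ^ 2
      + 1 / (48 * c.LK 1 ^ 2) * (2 * b)) * σf ^ 2 := by
    have : 0 ≤ B.l x₀ - B.lStar := by linarith
    positivity
  have h7 : 0 ≤ 1 / (48 * c.LK 1 ^ 2) * (2 * (m : ℝ)) := by positivity
  linarith only [h5, h6, h7]

end Convergence

end Diamond

end

theorem theorem1 (c : Diamond.Consts) (hc : c.Valid) (m : ℕ) (hm : 2 ≤ m)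
    (lam : ℝ) (hlam₀ : 0 ≤ lam) (hlam₁ : lam < 1) (θ : ℝ) (hθ₀ : 0 < θ) (hθ₁ : θ < 1) :
    ∃ (C : ℝ) (q : ℕ), 0 < C ∧
      -- offsets that satisfy all step-size conditions exist, of polylogarithmic size
      (∀ T : ℕ, 2 ≤ T → ∃ ω : ℝ, ω ≤ C * Real.log T ^ q ∧
        Diamond.Admissible c m lam θ (c.numSamples T) ω) ∧
      ∀ (dup dlow : ℕ) (Ξ : Type u) (Z : Type v) [MeasurableSpace Ξ] [MeasurableSpace Z]
        (B : Diamond.Problem m dup dlow Ξ Z) (_ : B.Regular c)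
        (x₀ : Diamond.Vec dup) (y₀ : Diamond.Vec dlow),
        ∃ D : ℝ,
          ∀ (N : SimpleGraph (Fin m)) (M : Matrix (Fin m) (Fin m) ℝ)
            (hM : Diamond.IsMixing N M) (_ : Diamond.secondEig hm hM.symm = lam)
            (T : ℕ) (_ : 2 ≤ T) (K : ℕ) (_ : K = c.numSamples T)
            (ω : ℝ) (_ : Diamond.Admissible c m lam θ K ω)
            (σf σg : ℝ) (_ : B.Variance c K σf σg)
            (Ω : Type w) [MeasurableSpace Ω] (P : Measure Ω) [IsProbabilityMeasure P]
            (s : ℕ → Fin m → Ω → Diamond.UpperSample Ξ Z K × Z)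
            (_ : Diamond.IsSampling B K P s)
            (S : ℕ → Ω → Diamond.State m dup dlow)
            (_ : S = fun t o =>
              Diamond.iterate c B M θ K ω x₀ y₀ (fun t' i => s t' i o) t),
            (∀ t < T, Integrable (fun o => Diamond.metric B (S t o)) P) ∧
            Integrable (fun o => Diamond.potential c B lam θ K ω 0 (S 0 o)) P ∧
            -- the three-term rate
            (1 / (T : ℝ)) * ∑ t ∈ Finset.range T, ∫ o, Diamond.metric B (S t o) ∂P ≤
              C * (ω ^ (1 / 3 : ℝ) *
                    ((∫ o, Diamond.potential c B lam θ K ω 0 (S 0 o) ∂P) - B.lStar)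
                      / (T : ℝ) ^ (2 / 3 : ℝ)
                + (K : ℝ) ^ 3 * ω ^ (2 / 3 : ℝ) * (Real.log T * σf ^ 2) / (T : ℝ) ^ (2 / 3 : ℝ)
                + ω ^ (2 / 3 : ℝ) * (Real.log T * σg ^ 2) / (T : ℝ) ^ (2 / 3 : ℝ)
                + ω ^ (1 / 3 : ℝ) / (T : ℝ) ^ (5 / 3 : ℝ)) ∧
            -- for a fixed problem and starting point this is `T ^ (-2/3)` up to logarithms
            (1 / (T : ℝ)) * ∑ t ∈ Finset.range T, ∫ o, Diamond.metric B (S t o) ∂P ≤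
              D * (1 + σf ^ 2 + σg ^ 2) * ω ^ (2 / 3 : ℝ) * Real.log T ^ q
                / (T : ℝ) ^ (2 / 3 : ℝ) := by
  have hm0 : 0 < m := by omega
  obtain ⟨C₀, hC₀, hoffset⟩ := Diamond.exists_offset hc hm0 hlam₁ hθ₀ hθ₁
  obtain ⟨R, hR, hrate⟩ := Diamond.exists_rate hc hm hlam₀ hlam₁ hθ₀ hθ₁
  obtain ⟨C₁, hC₁, hsamples⟩ := Diamond.exists_numSamples_le hc
  refine ⟨max C₀ R, 9, lt_max_of_lt_left hC₀, fun T hT => ?_, ?_⟩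
  · obtain ⟨ω, hω, had⟩ := hoffset T hT
    have : 0 ≤ Real.log T := Real.log_natCast_nonneg T
    exact ⟨ω, hω.trans (by gcongr; exact le_max_left _ _), had⟩
  intro dup dlow Ξ Z _ _ B hB x₀ y₀
  obtain ⟨E₀, hE₀⟩ : ∃ E₀, E₀ = B.l x₀ - B.lStar
      + Diamond.cbarY c m * ∑ i, ‖B.yStar i x₀ - y₀‖ ^ 2
      + 1 / (48 * c.LK 1 ^ 2) *
        (2 * (m + ∑ i, (‖Diamond.barGrad (B.F i) (B.G i) x₀ y₀‖ + 1) ^ 2)) := ⟨_, rfl⟩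
  have hE₀0 : 0 ≤ E₀ := by
    have := B.lStar_le hB x₀
    have : 0 ≤ B.l x₀ - B.lStar := by linarith
    have := Diamond.cbarY_pos hc hm0
    rw [hE₀]
    positivity
  refine ⟨max C₀ R * (E₀ / Real.log 2 ^ 9 + C₁ ^ 3 / Real.log 2 ^ 5 + 1 / Real.log 2 ^ 8
    + 1 / Real.log 2 ^ 9), ?_⟩
  intro N M hM hlam T hT K hKT ω hA σf σg hV Ω _ P _ s hs S hS
  have hK : 0 < K := hKT ▸ Diamond.numSamples_pos c T
  have hω := hA.two_le
  have hω0 : 0 < ω := by linarith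
  have hT' : (2 : ℝ) ≤ T := by exact_mod_cast hT
  have := Diamond.Problem.isProbabilityMeasure_upperLaw hB hK
  have := hB.prob_g
  have hδ : ∀ i x y, ‖B.meanHat c K i x y - Diamond.barGrad (B.F i) (B.G i) x y‖ ≤ 1 / (T : ℝ) := by
    intro i x y
    refine (B.norm_meanHat_sub_le hc hB hK hV i x y).trans ?_
    rw [hKT]
    exact Diamond.Problem.bias_bound_numSamples hc hT
  obtain ⟨h, k, hO, hOg, hae⟩ := Diamond.exists_oracles_iterate (M := M) (θ := θ) (ω := ω)
    (x₀ := x₀) (y₀ := y₀) hc hB hK hV hs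
  obtain ⟨S', hS'⟩ : ∃ S' : ℕ → Ω → Diamond.State m dup dlow, S' = fun t o =>
    Diamond.run h k M (Diamond.stepα ω) (Diamond.stepβ c m ω) (Diamond.momη c m θ K ω)
      (Diamond.momγ c m θ K ω) x₀ y₀ (fun j i => s j i o) t := ⟨_, rfl⟩
  have hSS : ∀ᵐ o ∂P, ∀ t, S t o = S' t o := by
    subst hS hS'
    exact hae
  have hsq := Diamond.sqInt_run hO hOg hs hS' hA.η_mem hA.γ_mem
  have hrec := Diamond.recursion_run hc hB hm0 hO hOg hs hS' (hM.contracts hm hlam hlam₁) hlam₀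
    hlam₁ hδ (fun t => (Diamond.stepα_pos hω0 t).le)
    (fun t => by
      have := hA.α_le_6 t
      have hLl := hc.Ll_pos
      rw [le_div_iff₀ (by positivity)] at this
      linarith)
    (fun t => mul_pos (Diamond.cβ_pos hc hm0) (Diamond.stepα_pos hω0 t)) hA.β_le hA.η_mem hA.γ_mem
  have hlS : ∀ t, B.lStar ≤ ∫ o, B.l (Diamond.avg (S' t o).x) ∂P := by
    intro t
    have := integral_mono (integrable_const B.lStar) (B.integrable_l hc hB (hsq t) hm0)
      fun o => B.lStar_le hB (Diamond.avg (S' t o).x)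
    simpa using this
  have hmain := hrate T K ω σf σg _ _ _ _ _ _ _ _ _ _ B.lStar hT hK hA hrec hlS
  simp only [← Diamond.integral_potential hc hB hm0 (hsq 0),
    ← Diamond.integral_metric hc hB hm0 (hsq _)] at hmain
  have hE := Diamond.integral_potential_zero_le (θ := θ) (ω := ω) (lam := lam) hc hB hm0 hK hθ₀ hθ₁
    hO hOg hs hS' fun i x y => (hδ i x y).trans
      ((div_le_one (by linarith)).2 (by linarith))
  rw [← hE₀] at hE
  have emet : ∀ t, (fun o => Diamond.metric B (S' t o)) =ᵐ[P] fun o => Diamond.metric B (S t o) :=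
    fun t => by filter_upwards [hSS] with o ho; rw [ho]
  have epot : (fun o => Diamond.potential c B lam θ K ω 0 (S' 0 o)) =ᵐ[P]
      fun o => Diamond.potential c B lam θ K ω 0 (S 0 o) := by
    filter_upwards [hSS] with o ho
    rw [ho]
  simp only [integral_congr_ae (emet _)] at hmain
  rw [integral_congr_ae epot] at hmain hE
  have hpot : B.lStar ≤ ∫ o, Diamond.potential c B lam θ K ω 0 (S 0 o) ∂P := by
    rw [← integral_congr_ae epot, Diamond.integral_potential hc hB hm0 (hsq 0), hrec.X_zero]
    have := hlS 0
    have := mul_nonneg (Diamond.cbarY_pos hc hm0).le (hrec.Y_nonneg 0)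
    have := mul_nonneg (Diamond.cbarU_pos (m := m) hc hK hθ₀).le (hrec.U_nonneg 0)
    linarith
  have hlog : 0 ≤ Real.log T := Real.log_natCast_nonneg T
  have hthree := hmain.trans (mul_le_mul_of_nonneg_right (le_max_right C₀ R) (by
    have : 0 ≤ ∫ o, Diamond.potential c B lam θ K ω 0 (S 0 o) ∂P - B.lStar := by linarith
    positivity))
  refine ⟨fun t _ => (B.integrable_metric hc hB (hsq t) hm0).congr (emet t),
    (B.integrable_potential hc hB (hsq 0) hm0 lam θ K ω 0).congr epot, hthree, hthree.trans ?_⟩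
  obtain ⟨w, -, -, hw1, hw2, -⟩ := Diamond.exists_cube_root hω0.le
  obtain ⟨r, -, -, hr1, hr2, hr5⟩ := Diamond.exists_cube_root (by linarith : (0 : ℝ) ≤ T)
  have hw : 1 ≤ w := by rw [← hw1]; exact Real.one_le_rpow (by linarith) (by norm_num)
  have hr : 1 ≤ r := by rw [← hr1]; exact Real.one_le_rpow (by linarith) (by norm_num)
  rw [hw1, hw2, hr2, hr5]
  exact Diamond.three_term_le (hC₀.le.trans (le_max_left _ _)) hC₁.le hE₀0 hE hw hr
    (Nat.cast_nonneg K) (hKT ▸ hsamples T hT) (Real.log_pos one_lt_two)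
    (Real.log_le_log two_pos hT')
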